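/- **Conventions.** Let $k$ be a field, $B$ and $\mathcal L$ unital associative $k$-algebras. A left $B$-bialgebroid structure on $\mathcal L$ consists of an algebra map $s:B\to\mathcal L$ and an anti-algebra map $t:B\to\mathcal L$ with commuting images (write $bX=s(b)X$, $Xb=Xs(b)$, $\bar bX=t(b)X$, $X\bar b=Xt(b)$) and of a coassociative counital coproduct $\Delta(X)=X_{(1)}\otimes X_{(2)}$ and counit $\varepsilon:\mathcal L\to B$, both $B$-bilinear for $a.X.b=a\bar bX$, such that $\Delta$ is an algebra map into the Takeuchi product $\mathcal L\times_B\mathcal L\subseteq\mathcal L\diamond_B\mathcal L$, $\varepsilon(1)=1$ and $\varepsilon(XY)=\varepsilon(X\varepsilon(Y))=\varepsilon(X\overline{\varepsilon(Y)})$. Here, for a left $B$-module $M$, $\mathcal L\diamond_BM=\mathcal L\otimes M/\langle\bar bX\otimes m-X\otimes bm\rangle$, and for a $B$-bimodule $M$, $\mathcal L\times_BM$ is the set of $\sum_iX_i\otimes m_i\in\mathcal L\diamond_BM$ with $\sum_iX_i\bar b\otimes m_i=\sum_iX_i\otimes m_ib$ for all $b\in B$. It is a left Hopf algebroid if $$\lambda:\mathcal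 L\otimes_{\bar B}\mathcal L=\mathcal L\otimes\mathcal L/\langle X\bar b\otimes Y-X\otimes\bar bY\rangle\to\mathcal L\diamond_B\mathcal L,\qquad X\otimes Y\mapsto X_{(1)}\otimes X_{(2)}Y$$ is bijective; then $X_+\otimes X_-:=\lambda^{-1}(X\otimes1)$. A left $\mathcal L$-comodule is a $B$-bimodule $M$ with a coassociative counital map $\delta:M\to\mathcal L\times_BM$, $\delta(m)=m_{(-1)}\otimes m_{(0)}$, such that $\delta(bmb')=b\,m_{(-1)}b'\otimes m_{(0)}$. Morphisms are $B$-bilinear colinear maps. The category ${}^{\mathcal L}\mathcal M$ of left comodules is monoidal with tensor product $M\otimes_BN$, codiagonal coaction $m\otimes n\mapsto m_{(-1)}n_{(-1)}\otimes(m_{(0)}\otimes n_{(0)})$, unit object $B$ with coaction $b\mapsto s(b)\otimes1$, and the usual constraints. A left 2-cocycle on $\mathcal L$ is a linear map $\Gamma:\mathcal L\otimes_{\bar B}\mathcal L\to B$ with $\Gamma(\bar bX,Y)=\Gamma(X,Y)b$ and $$\Gamma(X,\Gamma(Y_{(1)},Z_{(1)})Y_{(2)}Z_{(2)})=\Gamma(\Gamma(X_{(1)},Y_{(1)})X_{(2)}Y_{(2)},Z),\qquad\Gamma(1,X)=\varepsilon(X)=\Gamma(X,1).$$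 For a left comodule $M$, $a\in B$ and $m\in M$ put $a\cdot_\Gamma m=\Gamma(s(a),m_{(-1)})m_{(0)}$ and $m\cdot_\Gamma a=\Gamma(m_{(-1)},s(a))m_{(0)}$. For left comodules $M,N$ let $M\otimes_{B^\Gamma}N=M\otimes N/\langle m\cdot_\Gamma b\otimes n-m\otimes b\cdot_\Gamma n\rangle$ and $$\Gamma^\#_{M,N}:M\otimes_{B^\Gamma}N\to M\otimes_BN,\qquad m\otimes n\mapsto\Gamma(m_{(-1)},n_{(-1)})m_{(0)}\otimes n_{(0)}.$$ $\Gamma$ is invertible if $\Gamma^\#_{M,N}$ is bijective for all left $\mathcal L$-comodules $M,N$. **Statement.** Let $\mathcal L$ be a left Hopf algebroid over $B$ and $\Gamma$ an invertible left 2-cocycle on $\mathcal L$. (a) There are a $k$-algebra $B^\Gamma$ with underlying vector space $B$ and a left Hopf algebroid $\mathcal L^\Gamma$ over $B^\Gamma$ with underlying vector space $\mathcal L$, with the same units, source map $s$ and target map $t$ as $B$ and $\mathcal L$, and with the products, coproduct and counit $$a\cdot_\Gamma b=\Gamma(s(a),s(b)),\qquad X\cdot_\Gamma Y=\Gamma(X_{(1)},Y_{(1)})\,X_{(2)+}Y_{(2)+}\,\overline{\Gamma(Y_{(2)-},X_{(2)-})},$$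 $$\Gamma^\#(\Delta^\Gamma(X))=\Delta(X),\qquad\varepsilon^\Gamma(X)=\Gamma(X_+,X_-),$$ where, for a left $\mathcal L$-comodule $M$, $\Gamma^\#:\mathcal L^\Gamma\diamond_{B^\Gamma}M\to\mathcal L\diamond_BM$ is the map $X\otimes m\mapsto X_+\overline{\Gamma(X_-,m_{(-1)})}\otimes m_{(0)}$ (for $\Delta^\Gamma$ take $M=\mathcal L$ with coaction $\Delta$). (b) The monoidal categories $({}^{\mathcal L}\mathcal M,\otimes_B)$ and $({}^{\mathcal L^\Gamma}\mathcal M,\otimes_{B^\Gamma})$ are equivalent. More precisely, there is a monoidal functor (with invertible structure maps) that is an equivalence of categories, that sends a left $\mathcal L$-comodule $M$ to the vector space $M$ with the $B^\Gamma$-actions $b\cdot_\Gamma m$ and $m\cdot_\Gamma b$ and the coaction $\delta^\Gamma$ with $\Gamma^\#\circ\delta^\Gamma=\delta$ (that is, $\delta^\Gamma=\Gamma^{\#-1}\circ\delta$), that leaves the underlying linear map of each morphism unchanged, and whose coherence maps are $\Gamma^\#_{M,N}:M\otimes_{B^\Gamma}N\to M\otimes_BN$ and, on unit objects, the identity map $B^\Gamma\to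 B$. -/

import Mathlib

open scoped TensorProduct
open CategoryTheory MulOpposite

universe u v

/-! ## Balanced tensor products -/

namespace BalTensor

variable {k : Type*} [CommRing k] {S M N : Type*} [AddCommGroup M] [Module k M]
  [AddCommGroup N] [Module k N]

/-- The relations `f b m ⊗ n - m ⊗ g b n`, where `f` and `g` are the actions of `S` on `M` and `N`
over which the tensor product is to be balanced. -/
def rel (f : S → Module.End k M) (g : S → Module.End k N) : Submodule k (M ⊗[k] N) :=
  Submodule.span k {x | ∃ b m n, x = f b m ⊗ₜ[k] n - m ⊗ₜ[k] g b n}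

end BalTensor

/-- The balanced tensor product `M ⊗ N / ⟨f b m ⊗ n - m ⊗ g b n⟩`. -/
def BalTensor {k : Type*} [CommRing k] {S M N : Type*} [AddCommGroup M] [Module k M]
    [AddCommGroup N] [Module k N] (f : S → Module.End k M) (g : S → Module.End k N) : Type _ :=
  (M ⊗[k] N) ⧸ BalTensor.rel f g

namespace BalTensor

variable {k : Type*} [CommRing k] {S M N M' N' W : Type*} [AddCommGroup M] [Module k M]
  [AddCommGroup N] [Module k N] [AddCommGroup M'] [Module k M'] [AddCommGroup N'] [Module k N']
  [AddCommGroup W] [Module k W]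

instance (f : S → Module.End k M) (g : S → Module.End k N) : AddCommGroup (BalTensor f g) :=
  inferInstanceAs (AddCommGroup ((M ⊗[k] N) ⧸ rel f g))

instance (f : S → Module.End k M) (g : S → Module.End k N) : Module k (BalTensor f g) :=
  inferInstanceAs (Module k ((M ⊗[k] N) ⧸ rel f g))

/-- The projection `M ⊗ N → M ⊗ N / ⟨f b m ⊗ n - m ⊗ g b n⟩`. -/
def proj (f : S → Module.End k M) (g : S → Module.End k N) : M ⊗[k] N →ₗ[k] BalTensor f g :=
  Submodule.mkQ (rel f g)

theorem proj_surjective (f : S → Module.End k M) (g : S → Module.End k N) :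
    Function.Surjective (proj f g) := Submodule.mkQ_surjective _

/-- The class of `m ⊗ n`. -/
def tmul (f : S → Module.End k M) (g : S → Module.End k N) : M →ₗ[k] N →ₗ[k] BalTensor f g :=
  (TensorProduct.mk k M N).compr₂ (proj f g)

theorem proj_tmul (f : S → Module.End k M) (g : S → Module.End k N) (m : M) (n : N) :
    proj f g (m ⊗ₜ n) = tmul f g m n := rfl

theorem tmul_bal (f : S → Module.End k M) (g : S → Module.End k N) (b : S) (m : M) (n : N) :
    tmul f g (f b m) n = tmul f g m (g b n) := by
  refine (Submodule.Quotient.eq (rel f g)).2 (Submodule.subset_span ⟨b, m, n, rfl⟩)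

variable {f : S → Module.End k M} {g : S → Module.End k N}
  {f' : S → Module.End k M'} {g' : S → Module.End k N'}

theorem hom_ext {φ ψ : BalTensor f g →ₗ[k] W} (h : ∀ m n, φ (tmul f g m n) = ψ (tmul f g m n)) :
    φ = ψ := by
  refine Submodule.linearMap_qext _ (TensorProduct.ext' fun m n => h m n)

theorem hom_ext_apply {φ ψ : BalTensor f g →ₗ[k] W}
    (h : ∀ m n, φ (tmul f g m n) = ψ (tmul f g m n)) (x : BalTensor f g) : φ x = ψ x := by
  rw [hom_ext h]

/-- The universal property of the balanced tensor product. -/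
def lift (φ : M →ₗ[k] N →ₗ[k] W) (h : ∀ b m n, φ (f b m) n = φ m (g b n)) :
    BalTensor f g →ₗ[k] W :=
  Submodule.liftQ (rel f g) (TensorProduct.lift φ) (by
    rw [rel, Submodule.span_le]
    rintro _ ⟨b, m, n, rfl⟩
    simp [h b m n])

@[simp] theorem lift_tmul (φ : M →ₗ[k] N →ₗ[k] W) (h : ∀ b m n, φ (f b m) n = φ m (g b n))
    (m : M) (n : N) : lift φ h (tmul f g m n) = φ m n := by
  change Submodule.liftQ _ _ _ (Submodule.Quotient.mk _) = _
  rw [Submodule.liftQ_apply]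
  exact TensorProduct.lift.tmul m n

/-- The map `φ ⊗ ψ` of balanced tensor products. -/
def map (φ : M →ₗ[k] M') (ψ : N →ₗ[k] N') (hφ : ∀ b m, φ (f b m) = f' b (φ m))
    (hψ : ∀ b n, ψ (g b n) = g' b (ψ n)) : BalTensor f g →ₗ[k] BalTensor f' g' :=
  lift ((tmul f' g').compl₁₂ φ ψ) (fun b m n => by simp [hφ, hψ, tmul_bal])

@[simp] theorem map_tmul (φ : M →ₗ[k] M') (ψ : N →ₗ[k] N') (hφ : ∀ b m, φ (f b m) = f' b (φ m))
    (hψ : ∀ b n, ψ (g b n) = g' b (ψ n)) (m : M) (n : N) :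
    map (f := f) (g := g) (f' := f') (g' := g') φ ψ hφ hψ (tmul f g m n)
      = tmul f' g' (φ m) (ψ n) := by
  simp [map]

end BalTensor

/-! ## Left bialgebroids and left Hopf algebroids -/

/-- A `B ⊗ Bᵒᵖ`-ring: an algebra `L` with an algebra map `s : B → L` (the source) and an
anti-algebra map `t : B → L` (the target) whose images commute. -/
structure EnvRing (k : Type v) (B L : Type u) [CommRing k] [Ring B] [Algebra k B] [Ring L]
    [Algebra k L] where
  source : B →ₐ[k] L
  target : Bᵐᵒᵖ →ₐ[k] L
  source_target : ∀ a b, source a * target b = target b * source a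

namespace EnvRing

variable {k : Type v} {B L : Type u} [CommRing k] [Ring B] [Algebra k B] [Ring L] [Algebra k L]
  (R : EnvRing k B L)

/-- The source map `b ↦ b`. -/
def s : B →ₗ[k] L := R.source.toLinearMap

/-- The target map `b ↦ b̄`. -/
def t : B →ₗ[k] L := R.target.toLinearMap ∘ₗ (opLinearEquiv k (M := B)).toLinearMap

theorem s_one : R.s 1 = 1 := map_one R.source
theorem t_one : R.t 1 = 1 := map_one R.target
theorem s_mul (a b : B) : R.s (a * b) = R.s a * R.s b := map_mul R.source a b
theorem t_mul (a b : B) : R.t (a * b) = R.t b * R.t a := map_mul R.target (op b) (op a)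
theorem s_t (a b : B) : R.s a * R.t b = R.t b * R.s a := R.source_target a (op b)

/-- `X ↦ b X`. -/
def sL : B →ₐ[k] Module.End k L := (Algebra.lmul k L).comp R.source
/-- `X ↦ X b`. -/
def sR (b : B) : Module.End k L := LinearMap.mulRight k (R.s b)
/-- `X ↦ b̄ X`. -/
def tL (b : B) : Module.End k L := LinearMap.mulLeft k (R.t b)
/-- `X ↦ X b̄`. -/
def tR (b : B) : Module.End k L := LinearMap.mulRight k (R.t b)

@[simp] theorem sL_apply (b : B) (X : L) : R.sL b X = R.s b * X := rfl
@[simp] theorem sR_apply (b : B) (X : L) : R.sR b X = X * R.s b := rfl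
@[simp] theorem tL_apply (b : B) (X : L) : R.tL b X = R.t b * X := rfl
@[simp] theorem tR_apply (b : B) (X : L) : R.tR b X = X * R.t b := rfl

theorem sL_tL (b c : B) (X : L) : R.sL b (R.tL c X) = R.tL c (R.sL b X) := by
  simp [← mul_assoc, R.s_t]
theorem tL_sL (b c : B) (X : L) : R.tL b (R.sL c X) = R.sL c (R.tL b X) := (R.sL_tL c b X).symm
theorem sR_sL (b c : B) (X : L) : R.sR b (R.sL c X) = R.sL c (R.sR b X) := by simp [mul_assoc]
theorem sR_tL (b c : B) (X : L) : R.sR b (R.tL c X) = R.tL c (R.sR b X) := by simp [mul_assoc]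
theorem tR_tL (b c : B) (X : L) : R.tR b (R.tL c X) = R.tL c (R.tR b X) := by simp [mul_assoc]

variable {M N P : Type*} [AddCommGroup M] [Module k M] [AddCommGroup N] [Module k N]
  [AddCommGroup P] [Module k P]

/-- `L ⋄_B M = L ⊗ M / ⟨b̄ X ⊗ m - X ⊗ b m⟩`, for a left action `l` of `B` on `M`. -/
abbrev Diam (l : B → Module.End k M) : Type _ := BalTensor R.tL l

/-- The class of `X ⊗ m` in `L ⋄_B M`. -/
abbrev dmul (l : B → Module.End k M) : L →ₗ[k] M →ₗ[k] R.Diam l := BalTensor.tmul R.tL l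

theorem dmul_bal (l : B → Module.End k M) (b : B) (X : L) (m : M) :
    R.dmul l (R.t b * X) m = R.dmul l X (l b m) := BalTensor.tmul_bal R.tL l b X m

/-- `X ⊗ m ↦ b X ⊗ m` on `L ⋄_B M`. -/
def diamSL (l : B → Module.End k M) (b : B) : Module.End k (R.Diam l) :=
  BalTensor.map (R.sL b) LinearMap.id (R.sL_tL b) (fun _ _ => rfl)

/-- `X ⊗ m ↦ X b ⊗ m` on `L ⋄_B M`. -/
def diamSR (l : B → Module.End k M) (b : B) : Module.End k (R.Diam l) :=
  BalTensor.map (R.sR b) LinearMap.id (R.sR_tL b) (fun _ _ => rfl)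

/-- `X ⊗ m ↦ X b̄ ⊗ m` on `L ⋄_B M`. -/
def diamTR (l : B → Module.End k M) (b : B) : Module.End k (R.Diam l) :=
  BalTensor.map (R.tR b) LinearMap.id (R.tR_tL b) (fun _ _ => rfl)

/-- `id ⋄ φ : L ⋄_B M → L ⋄_B N`, for a left `B`-linear map `φ`. -/
def diamMap {l : B → Module.End k M} {l' : B → Module.End k N} (φ : M →ₗ[k] N)
    (h : ∀ b m, φ (l b m) = l' b (φ m)) : R.Diam l →ₗ[k] R.Diam l' :=
  BalTensor.map LinearMap.id φ (fun _ _ => rfl) h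

@[simp] theorem diamSL_dmul (l : B → Module.End k M) (b : B) (X : L) (m : M) :
    R.diamSL l b (R.dmul l X m) = R.dmul l (R.s b * X) m := by simp [diamSL]
@[simp] theorem diamSR_dmul (l : B → Module.End k M) (b : B) (X : L) (m : M) :
    R.diamSR l b (R.dmul l X m) = R.dmul l (X * R.s b) m := by simp [diamSR]
@[simp] theorem diamTR_dmul (l : B → Module.End k M) (b : B) (X : L) (m : M) :
    R.diamTR l b (R.dmul l X m) = R.dmul l (X * R.t b) m := by simp [diamTR]
@[simp] theorem diamMap_dmul {l : B → Module.End k M} {l' : B → Module.End k N} (φ : M →ₗ[k] N)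
    (h : ∀ b m, φ (l b m) = l' b (φ m)) (X : L) (m : M) :
    R.diamMap φ h (R.dmul l X m) = R.dmul l' X (φ m) := by simp [diamMap]

theorem dmul_flip_sL (l : B → Module.End k M) (m : M) (b : B) (X : L) :
    (R.dmul l).flip m (R.sL b X) = R.diamSL l b ((R.dmul l).flip m X) := by simp

/-- `X ⋄ Y ↦ X ⋄ (Y ⋄ m)` as a map `L ⋄_B L → L ⋄_B (L ⋄_B M)`. -/
def diamInsert (l : B → Module.End k M) :
    M →ₗ[k] R.Diam R.sL →ₗ[k] R.Diam (R.diamSL l) :=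
  LinearMap.mk₂ k (fun m => R.diamMap ((R.dmul l).flip m) (R.dmul_flip_sL l m))
    (fun m m' x => by
      refine BalTensor.hom_ext_apply (ψ := _ + _) (fun X Y => ?_) x; simp)
    (fun c m x => by
      refine BalTensor.hom_ext_apply (ψ := c • _) (fun X Y => ?_) x; simp)
    (fun m x y => map_add _ x y) (fun c m x => map_smul _ c x)

@[simp] theorem diamInsert_dmul (l : B → Module.End k M) (m : M) (X Y : L) :
    R.diamInsert l m (R.dmul R.sL X Y) = R.dmul (R.diamSL l) X (R.dmul l Y m) := by
  simp [diamInsert, LinearMap.mk₂_apply]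


/-- `Δ ⋄ id : L ⋄_B M → L ⋄_B (L ⋄_B M)`, for a coproduct `Δ`. -/
def comulDiam (Δ : L →ₗ[k] R.Diam R.sL)
    (hΔ : ∀ b X, Δ (R.t b * X) = R.diamMap (R.tL b) (R.tL_sL b) (Δ X))
    (l : B → Module.End k M) : R.Diam l →ₗ[k] R.Diam (R.diamSL l) :=
  BalTensor.lift ((R.diamInsert l).flip ∘ₗ Δ) (fun b X m => by
    simp only [LinearMap.comp_apply, tL_apply, hΔ, LinearMap.flip_apply]
    generalize Δ X = x
    refine BalTensor.hom_ext_apply (φ := (R.diamInsert l m) ∘ₗ (R.diamMap (R.tL b) (R.tL_sL b)))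
      (fun X Y => ?_) x
    simp [dmul_bal])

@[simp] theorem comulDiam_dmul (Δ : L →ₗ[k] R.Diam R.sL)
    (hΔ : ∀ b X, Δ (R.t b * X) = R.diamMap (R.tL b) (R.tL_sL b) (Δ X))
    (l : B → Module.End k M) (X : L) (m : M) :
    R.comulDiam Δ hΔ l (R.dmul l X m) = R.diamInsert l m (Δ X) := by
  simp [comulDiam]

/-- `ε ⋄ id : L ⋄_B M → M`, `X ⋄ m ↦ ε(X) m`, for a counit `ε`. -/
def counitDiam (ε : L →ₗ[k] B) (hε : ∀ b X, ε (R.t b * X) = ε X * b)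
    (l : B →ₐ[k] Module.End k M) : R.Diam l →ₗ[k] M :=
  BalTensor.lift (l.toLinearMap ∘ₗ ε) (fun b X m => by simp [hε])

@[simp] theorem counitDiam_dmul (ε : L →ₗ[k] B) (hε : ∀ b X, ε (R.t b * X) = ε X * b)
    (l : B →ₐ[k] Module.End k M) (X : L) (m : M) :
    R.counitDiam ε hε l (R.dmul l X m) = l (ε X) m :=
  BalTensor.lift_tmul (f := R.tL) (g := ⇑l) _ _ X m

/-- `id ⋄ ε : L ⋄_B L → L`, `X ⋄ Y ↦ ε(Y)‾ X`, for a counit `ε`. -/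
def counitRight (ε : L →ₗ[k] B) (hε : ∀ b X, ε (R.s b * X) = b * ε X) : R.Diam R.sL →ₗ[k] L :=
  BalTensor.lift ((LinearMap.mul k L ∘ₗ R.t ∘ₗ ε).flip)
    (fun b X Y => by simp [hε, R.t_mul, mul_assoc])

end EnvRing

/-- A left `B`-bialgebroid. -/
structure LeftBialgebroid (k : Type v) (B L : Type u) [CommRing k] [Ring B] [Algebra k B] [Ring L]
    [Algebra k L] extends EnvRing k B L where
  comul : L →ₗ[k] toEnvRing.Diam toEnvRing.sL
  counit : L →ₗ[k] B
  /-- `Δ` and `ε` are maps of `B`-bimodules, where `a.X.b = a b̄ X`. -/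
  comul_source : ∀ b X, comul (toEnvRing.s b * X) = toEnvRing.diamSL toEnvRing.sL b (comul X)
  comul_target : ∀ b X, comul (toEnvRing.t b * X)
    = toEnvRing.diamMap (toEnvRing.tL b) (toEnvRing.tL_sL b) (comul X)
  counit_source : ∀ b X, counit (toEnvRing.s b * X) = b * counit X
  counit_target : ∀ b X, counit (toEnvRing.t b * X) = counit X * b
  /-- Coassociativity. -/
  coassoc : ∀ X, toEnvRing.diamMap comul comul_source (comul X)
    = toEnvRing.comulDiam comul comul_target toEnvRing.sL (comul X)
  /-- The two counit axioms. -/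
  counit_comul : ∀ X, toEnvRing.counitDiam counit counit_target toEnvRing.sL (comul X) = X
  comul_counit : ∀ X, toEnvRing.counitRight counit counit_source (comul X) = X
  /-- The image of `Δ` is in the Takeuchi product `L ×_B L`. -/
  comul_takeuchi : ∀ b X, toEnvRing.diamTR toEnvRing.sL b (comul X)
    = toEnvRing.diamMap (toEnvRing.sR b) (toEnvRing.sR_sL b) (comul X)
  /-- `Δ : L → L ×_B L` is an algebra map. The product of two elements of `L ×_B L` is computed on
  any representatives in `L ⊗ L`. -/
  comul_one : comul 1 = toEnvRing.dmul toEnvRing.sL 1 1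
  comul_mul : ∀ (X Y : L) (x y : L ⊗[k] L),
    BalTensor.proj toEnvRing.tL toEnvRing.sL x = comul X →
    BalTensor.proj toEnvRing.tL toEnvRing.sL y = comul Y →
    comul (X * Y) = BalTensor.proj toEnvRing.tL toEnvRing.sL (x * y)
  /-- `ε` is a left character. -/
  counit_one : counit 1 = 1
  counit_mul_source : ∀ X Y, counit (X * toEnvRing.s (counit Y)) = counit (X * Y)
  counit_mul_target : ∀ X Y, counit (X * toEnvRing.t (counit Y)) = counit (X * Y)

namespace LeftBialgebroid

variable {k : Type v} {B L : Type u} [CommRing k] [Ring B] [Algebra k B] [Ring L] [Algebra k L]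
  (H : LeftBialgebroid k B L)

theorem comul_s (b : B) : H.comul (H.s b) = H.dmul H.sL (H.s b) 1 := by
  have := H.comul_source b 1
  rw [mul_one, H.comul_one] at this
  simpa using this

theorem comul_t (b : B) : H.comul (H.t b) = H.dmul H.sL 1 (H.t b) := by
  have := H.comul_target b 1
  rw [mul_one, H.comul_one] at this
  simpa using this

theorem comul_mul_s (b : B) (X : L) : H.comul (X * H.s b) = H.diamSR H.sL b (H.comul X) := by
  obtain ⟨x, hx⟩ := BalTensor.proj_surjective H.tL H.sL (H.comul X)
  rw [H.comul_mul X (H.s b) x (H.s b ⊗ₜ 1) hx (H.comul_s b).symm, ← hx]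
  have : BalTensor.proj H.tL H.sL ∘ₗ LinearMap.mulRight k (H.s b ⊗ₜ[k] (1 : L))
      = H.diamSR H.sL b ∘ₗ BalTensor.proj H.tL H.sL := by
    refine TensorProduct.ext' fun X Y => ?_
    simp [BalTensor.proj_tmul]
  exact LinearMap.congr_fun this x

theorem tR_sL (b c : B) (X : L) : H.tR b (H.sL c X) = H.sL c (H.tR b X) := by simp [mul_assoc]

theorem comul_mul_t (b : B) (X : L) :
    H.comul (X * H.t b) = H.diamMap (H.tR b) (H.tR_sL b) (H.comul X) := by
  obtain ⟨x, hx⟩ := BalTensor.proj_surjective H.tL H.sL (H.comul X)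
  rw [H.comul_mul X (H.t b) x (1 ⊗ₜ H.t b) hx (H.comul_t b).symm, ← hx]
  have : BalTensor.proj H.tL H.sL ∘ₗ LinearMap.mulRight k ((1 : L) ⊗ₜ[k] H.t b)
      = H.diamMap (H.tR b) (H.tR_sL b) ∘ₗ BalTensor.proj H.tL H.sL := by
    refine TensorProduct.ext' fun X Y => ?_
    simp [BalTensor.proj_tmul]
  exact LinearMap.congr_fun this x

theorem mulRight_sL (Y : L) (b : B) (X : L) :
    LinearMap.mulRight k Y (H.sL b X) = H.sL b (LinearMap.mulRight k Y X) := by simp [mul_assoc]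

/-- `X₁ ⋄ X₂ ↦ X₁ ⋄ X₂ Y`, as a function of `X₁ ⋄ X₂` and `Y`. -/
def diamMulRight : H.Diam H.sL →ₗ[k] L →ₗ[k] H.Diam H.sL :=
  (LinearMap.mk₂ k (fun Y => H.diamMap (LinearMap.mulRight k Y) (H.mulRight_sL Y))
    (fun Y Y' x => by
      refine BalTensor.hom_ext_apply (ψ := _ + _) (fun X Z => ?_) x; simp [mul_add])
    (fun c Y x => by
      refine BalTensor.hom_ext_apply (ψ := c • _) (fun X Z => ?_) x; simp)
    (fun Y x y => map_add _ x y) (fun c Y x => map_smul _ c x)).flip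

@[simp] theorem diamMulRight_dmul (X Y Z : L) :
    H.diamMulRight (H.dmul H.sL X Y) Z = H.dmul H.sL X (Y * Z) := by
  simp [diamMulRight, LinearMap.mk₂_apply]

/-- `L ⊗_{B̄} L = L ⊗ L / ⟨X b̄ ⊗ Y - X ⊗ b̄ Y⟩`. -/
abbrev OpTensor : Type _ := BalTensor H.tR H.tL

/-- The class of `X ⊗ Y` in `L ⊗_{B̄} L`. -/
abbrev omul : L →ₗ[k] L →ₗ[k] H.OpTensor := BalTensor.tmul H.tR H.tL

theorem omul_bal (b : B) (X Y : L) : H.omul (X * H.t b) Y = H.omul X (H.t b * Y) :=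
  BalTensor.tmul_bal H.tR H.tL b X Y

/-- The Galois map `λ : L ⊗_{B̄} L → L ⋄_B L`, `X ⊗ Y ↦ X₁ ⋄ X₂ Y`. -/
def galois : H.OpTensor →ₗ[k] H.Diam H.sL :=
  BalTensor.lift (H.diamMulRight ∘ₗ H.comul) (fun b X Y => by
    simp only [LinearMap.comp_apply, EnvRing.tR_apply, EnvRing.tL_apply, H.comul_mul_t]
    generalize H.comul X = x
    refine BalTensor.hom_ext_apply (φ := H.diamMulRight.flip Y ∘ₗ
      H.diamMap (H.tR b) (H.tR_sL b)) (ψ := H.diamMulRight.flip (H.t b * Y)) (fun X Y => ?_) x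
    simp [mul_assoc])

@[simp] theorem galois_omul (X Y : L) :
    H.galois (H.omul X Y) = H.diamMulRight (H.comul X) Y := by simp [galois]

/-- A left bialgebroid is a left Hopf algebroid if its Galois map `λ` is bijective. -/
def IsLeftHopf : Prop := Function.Bijective H.galois

/-- The translation map `X ↦ X₊ ⊗ X₋ = λ⁻¹(X ⋄ 1)` of a left Hopf algebroid. -/
noncomputable def transl (hH : H.IsLeftHopf) : L →ₗ[k] H.OpTensor :=
  (LinearEquiv.ofBijective H.galois hH).symm.toLinearMap ∘ₗ (H.dmul H.sL).flip 1

theorem galois_transl (hH : H.IsLeftHopf) (X : L) :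
    H.galois (H.transl hH X) = H.dmul H.sL X 1 :=
  (LinearEquiv.ofBijective H.galois hH).apply_symm_apply _

theorem eq_transl (hH : H.IsLeftHopf) {X : L} {x : H.OpTensor}
    (h : H.galois x = H.dmul H.sL X 1) : H.transl hH X = x :=
  hH.1 ((H.galois_transl hH X).trans h.symm)

theorem sL_tR (b c : B) (X : L) : H.sL b (H.tR c X) = H.tR c (H.sL b X) := by simp [mul_assoc]
theorem sR_tR (b c : B) (X : L) : H.sR b (H.tR c X) = H.tR c (H.sR b X) := by
  simp [mul_assoc, H.s_t]
theorem tL_tR (b c : B) (X : L) : H.tL b (H.tR c X) = H.tR c (H.tL b X) := by simp [mul_assoc]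
theorem tR_tL' (b c : B) (X : L) : H.tR b (H.tL c X) = H.tL c (H.tR b X) := by simp [mul_assoc]

/-- The map `φ ⊗ ψ` on `L ⊗_{B̄} L`. -/
abbrev omap (φ ψ : Module.End k L) (hφ : ∀ b X, φ (H.tR b X) = H.tR b (φ X))
    (hψ : ∀ b X, ψ (H.tL b X) = H.tL b (ψ X)) : Module.End k H.OpTensor :=
  BalTensor.map φ ψ hφ hψ

theorem transl_s_mul (hH : H.IsLeftHopf) (b : B) (X : L) :
    H.transl hH (H.s b * X)
      = H.omap (H.sL b) LinearMap.id (H.sL_tR b) (fun _ _ => rfl) (H.transl hH X) := by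
  refine H.eq_transl hH ?_
  have h1 : ∀ x, H.galois (H.omap (H.sL b) LinearMap.id (H.sL_tR b) (fun _ _ => rfl) x)
      = H.diamSL H.sL b (H.galois x) := by
    intro x
    refine BalTensor.hom_ext_apply (φ := H.galois ∘ₗ _) (ψ := H.diamSL H.sL b ∘ₗ H.galois)
      (fun X Y => ?_) x
    simp only [LinearMap.comp_apply, BalTensor.map_tmul, galois_omul, EnvRing.sL_apply,
      H.comul_source, LinearMap.id_apply]
    generalize H.comul X = y
    refine BalTensor.hom_ext_apply (φ := H.diamMulRight.flip Y ∘ₗ H.diamSL H.sL b)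
      (ψ := H.diamSL H.sL b ∘ₗ H.diamMulRight.flip Y) (fun X Z => ?_) y
    simp
  rw [h1, galois_transl, EnvRing.diamSL_dmul]

theorem transl_mul_s (hH : H.IsLeftHopf) (b : B) (X : L) :
    H.transl hH (X * H.s b)
      = H.omap (H.sR b) LinearMap.id (H.sR_tR b) (fun _ _ => rfl) (H.transl hH X) := by
  refine H.eq_transl hH ?_
  have h1 : ∀ x, H.galois (H.omap (H.sR b) LinearMap.id (H.sR_tR b) (fun _ _ => rfl) x)
      = H.diamSR H.sL b (H.galois x) := by
    intro x
    refine BalTensor.hom_ext_apply (φ := H.galois ∘ₗ _) (ψ := H.diamSR H.sL b ∘ₗ H.galois)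
      (fun X Y => ?_) x
    simp only [LinearMap.comp_apply, BalTensor.map_tmul, galois_omul, EnvRing.sR_apply,
      H.comul_mul_s, LinearMap.id_apply]
    generalize H.comul X = y
    refine BalTensor.hom_ext_apply (φ := H.diamMulRight.flip Y ∘ₗ H.diamSR H.sL b)
      (ψ := H.diamSR H.sL b ∘ₗ H.diamMulRight.flip Y) (fun X Z => ?_) y
    simp
  rw [h1, galois_transl, EnvRing.diamSR_dmul]

/-- `b̄ X₊ ⊗ X₋ = X₊ ⊗ X₋ b̄`. -/
theorem transl_bal (hH : H.IsLeftHopf) (b : B) (X : L) :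
    H.omap (H.tL b) LinearMap.id (H.tL_tR b) (fun _ _ => rfl) (H.transl hH X)
      = H.omap LinearMap.id (H.tR b) (fun _ _ => rfl) (H.tR_tL' b) (H.transl hH X) := by
  refine hH.1 ?_
  have h1 : ∀ x, H.galois (H.omap (H.tL b) LinearMap.id (H.tL_tR b) (fun _ _ => rfl) x)
      = H.diamMap (H.tL b) (H.tL_sL b) (H.galois x) := by
    intro x
    refine BalTensor.hom_ext_apply (φ := H.galois ∘ₗ _)
      (ψ := H.diamMap (H.tL b) (H.tL_sL b) ∘ₗ H.galois) (fun X Y => ?_) x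
    simp only [LinearMap.comp_apply, BalTensor.map_tmul, galois_omul, EnvRing.tL_apply,
      H.comul_target, LinearMap.id_apply]
    generalize H.comul X = y
    refine BalTensor.hom_ext_apply (φ := H.diamMulRight.flip Y ∘ₗ H.diamMap (H.tL b) (H.tL_sL b))
      (ψ := H.diamMap (H.tL b) (H.tL_sL b) ∘ₗ H.diamMulRight.flip Y) (fun X Z => ?_) y
    simp [mul_assoc]
  have h2 : ∀ x, H.galois (H.omap LinearMap.id (H.tR b) (fun _ _ => rfl) (H.tR_tL' b) x)
      = H.diamMap (H.tR b) (H.tR_sL b) (H.galois x) := by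
    intro x
    refine BalTensor.hom_ext_apply (φ := H.galois ∘ₗ _)
      (ψ := H.diamMap (H.tR b) (H.tR_sL b) ∘ₗ H.galois) (fun X Y => ?_) x
    simp only [LinearMap.comp_apply, BalTensor.map_tmul, galois_omul, EnvRing.tR_apply,
      LinearMap.id_apply]
    generalize H.comul X = y
    refine BalTensor.hom_ext_apply (φ := H.diamMulRight.flip (Y * H.t b))
      (ψ := H.diamMap (H.tR b) (H.tR_sL b) ∘ₗ H.diamMulRight.flip Y) (fun X Z => ?_) y
    simp [mul_assoc]
  rw [h1, h2, galois_transl, EnvRing.diamMap_dmul, EnvRing.diamMap_dmul]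
  simp

/-! ## Left comodules -/

/-- A left comodule of a left `B`-bialgebroid `L`: a `B`-bimodule `M` (the field `right` is the
right action) with a `B`-bilinear coassociative counital coaction `M → L ×_B M ⊆ L ⋄_B M`. -/
structure Comodule where
  carrier : Type u
  [addCommGroup : AddCommGroup carrier]
  [module : Module k carrier]
  left : B →ₐ[k] Module.End k carrier
  right : Bᵐᵒᵖ →ₐ[k] Module.End k carrier
  right_left : ∀ a b m, right a (left b m) = left b (right a m)
  coact : carrier →ₗ[k] H.Diam left
  coact_left : ∀ b m, coact (left b m) = H.diamSL left b (coact m)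
  coact_right : ∀ b m, coact (right (op b) m) = H.diamSR left b (coact m)
  coact_takeuchi : ∀ b m, H.diamTR left b (coact m)
    = H.diamMap (right (op b)) (right_left (op b)) (coact m)
  coassoc : ∀ m, H.diamMap coact coact_left (coact m)
    = H.comulDiam H.comul H.comul_target left (coact m)
  counit_coact : ∀ m, H.counitDiam H.counit H.counit_target left (coact m) = m


namespace Comodule

attribute [instance] Comodule.addCommGroup Comodule.module

variable {H} (M N P : H.Comodule)

section Balanced

variable {M} {N A C W : Type*} [AddCommGroup N] [Module k N] [AddCommGroup A] [Module k A]
  [AddCommGroup C] [Module k C] [AddCommGroup W] [Module k W] {l : B → Module.End k N}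
  {α : L →ₗ[k] L →ₗ[k] A} {β : M.carrier →ₗ[k] N →ₗ[k] C} {γ : A →ₗ[k] C →ₗ[k] W}

variable (M l α β γ) in
/-- The conditions under which `γ (α (m₋₁, Y), β (m₀, n))` is well defined for
`m₋₁ ⋄ m₀ ∈ L ×_B M` and `Y ⋄ n ∈ L ⋄_B N`. -/
structure Balanced : Prop where
  bal_left : ∀ b X Y m n, γ (α (H.t b * X) Y) (β m n) = γ (α X Y) (β (M.left b m) n)
  bal_mid : ∀ b X Y m n, γ (α X (H.t b * Y)) (β m n) = γ (α (X * H.t b) Y) (β m n)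
  bal_right : ∀ b X Y m n, γ (α X Y) (β (M.right (op b) m) n) = γ (α X Y) (β m (l b n))

/-- `X ⋄ m ↦ γ (α (X, Y), β (m, n))`. -/
def Balanced.fst (h : M.Balanced l α β γ) (Y : L) (n : N) : H.Diam M.left →ₗ[k] W :=
  BalTensor.lift (γ.compl₁₂ (α.flip Y) (β.flip n)) (fun b X m => h.bal_left b X Y m n)

@[simp] theorem Balanced.fst_dmul (h : M.Balanced l α β γ) (Y : L) (n : N) (X : L)
    (m : M.carrier) : h.fst Y n (H.dmul M.left X m) = γ (α X Y) (β m n) :=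
  BalTensor.lift_tmul _ (fun b X m => h.bal_left b X Y m n) X m

theorem Balanced.fst_bal (h : M.Balanced l α β γ) (m : M.carrier) (b : B) (Y : L) (n : N) :
    h.fst (H.tL b Y) n (M.coact m) = h.fst Y (l b n) (M.coact m) := by
  have h1 : ∀ u, h.fst (H.tL b Y) n u = h.fst Y n (H.diamTR M.left b u) := fun u =>
    BalTensor.hom_ext_apply (ψ := h.fst Y n ∘ₗ H.diamTR M.left b)
      (fun X m => by simpa using h.bal_mid b X Y m n) u
  have h2 : ∀ u, h.fst Y (l b n) u
      = h.fst Y n (H.diamMap (M.right (op b)) (M.right_left (op b)) u) := fun u =>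
    BalTensor.hom_ext_apply
      (ψ := h.fst Y n ∘ₗ H.diamMap (M.right (op b)) (M.right_left (op b)))
      (fun X m => by simpa using (h.bal_right b X Y m n).symm) u
  rw [h1, h2, M.coact_takeuchi]

/-- `(Y, n) ↦ γ (α (X, Y), β (m, n))` for fixed `u = X ⋄ m`. -/
def Balanced.snd (h : M.Balanced l α β γ) (u : H.Diam M.left) : L →ₗ[k] N →ₗ[k] W :=
  LinearMap.mk₂ k (fun Y n => h.fst Y n u)
    (fun Y Y' n => BalTensor.hom_ext_apply (ψ := _ + _) (fun X m => by simp) u)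
    (fun c Y n => BalTensor.hom_ext_apply (ψ := c • _) (fun X m => by simp) u)
    (fun Y n n' => BalTensor.hom_ext_apply (ψ := _ + _) (fun X m => by simp) u)
    (fun c Y n => BalTensor.hom_ext_apply (ψ := c • _) (fun X m => by simp) u)

/-- `(m, Y ⋄ n) ↦ γ (α (m₋₁, Y), β (m₀, n))`. -/
def Balanced.pair (h : M.Balanced l α β γ) : M.carrier →ₗ[k] H.Diam l →ₗ[k] W :=
  LinearMap.mk₂ k (fun m => BalTensor.lift (h.snd (M.coact m)) (h.fst_bal m))
    (fun m m' y => BalTensor.hom_ext_apply (ψ := _ + _)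
      (fun X Z => by simp [Balanced.snd, LinearMap.mk₂_apply]) y)
    (fun c m y => BalTensor.hom_ext_apply (ψ := c • _)
      (fun X Z => by simp [Balanced.snd, LinearMap.mk₂_apply]) y)
    (fun m x y => map_add _ x y) (fun c m x => map_smul _ c x)

@[simp] theorem Balanced.pair_dmul (h : M.Balanced l α β γ) (m : M.carrier) (Y : L) (n : N) :
    h.pair m (H.dmul l Y n) = h.fst Y n (M.coact m) :=
  BalTensor.lift_tmul (h.snd (M.coact m)) (h.fst_bal m) Y n

theorem Balanced.comp_pair (h : M.Balanced l α β γ) {N' A' C' W' : Type*} [AddCommGroup N']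
    [Module k N'] [AddCommGroup A'] [Module k A'] [AddCommGroup C'] [Module k C'] [AddCommGroup W']
    [Module k W'] {l' : B → Module.End k N'} {α' : L →ₗ[k] L →ₗ[k] A'}
    {β' : M.carrier →ₗ[k] N' →ₗ[k] C'} {γ' : A' →ₗ[k] C' →ₗ[k] W'}
    (h' : M.Balanced l' α' β' γ') (χ : W →ₗ[k] W') (ξ : H.Diam l →ₗ[k] H.Diam l')
    (a : L → L) (b : N → N') (hξ : ∀ Y n, ξ (H.dmul l Y n) = H.dmul l' (a Y) (b n))
    (hχ : ∀ X Y m n, χ (γ (α X Y) (β m n)) = γ' (α' X (a Y)) (β' m (b n)))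
    (m : M.carrier) (v : H.Diam l) : χ (h.pair m v) = h'.pair m (ξ v) := by
  refine BalTensor.hom_ext_apply (φ := χ ∘ₗ h.pair m) (ψ := h'.pair m ∘ₗ ξ) (fun Y n => ?_) v
  rw [LinearMap.comp_apply, LinearMap.comp_apply, hξ, h.pair_dmul, h'.pair_dmul]
  exact BalTensor.hom_ext_apply (φ := χ ∘ₗ h.fst Y n) (ψ := h'.fst (a Y) (b n))
    (fun X m => by simp [hχ]) (M.coact m)

end Balanced

/-- The right action as a family of endomorphisms indexed by `B`. -/
def rAct (b : B) : Module.End k M.carrier := M.right (op b)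

/-- The underlying `k`-module of `M ⊗_B N = M ⊗ N / ⟨m b ⊗ n - m ⊗ b n⟩`. -/
abbrev Tensor : Type u := BalTensor M.rAct N.left

/-- The class of `m ⊗ n` in `M ⊗_B N`. -/
abbrev tmul : M.carrier →ₗ[k] N.carrier →ₗ[k] M.Tensor N := BalTensor.tmul M.rAct N.left

theorem tmul_bal (b : B) (m : M.carrier) (n : N.carrier) :
    M.tmul N (M.right (op b) m) n = M.tmul N m (N.left b n) :=
  BalTensor.tmul_bal M.rAct N.left b m n

section
variable {M N} {M' N' : H.Comodule}

/-- `φ ⊗ ψ : M ⊗_B N → M' ⊗_B N'`. -/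
def tmap (φ : M.carrier →ₗ[k] M'.carrier) (ψ : N.carrier →ₗ[k] N'.carrier)
    (hφ : ∀ b m, φ (M.right b m) = M'.right b (φ m))
    (hψ : ∀ b n, ψ (N.left b n) = N'.left b (ψ n)) : M.Tensor N →ₗ[k] M'.Tensor N' :=
  BalTensor.map (f := M.rAct) (f' := M'.rAct) φ ψ (fun b m => hφ (op b) m) hψ

@[simp] theorem tmap_tmul (φ : M.carrier →ₗ[k] M'.carrier) (ψ : N.carrier →ₗ[k] N'.carrier)
    (hφ : ∀ b m, φ (M.right b m) = M'.right b (φ m))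
    (hψ : ∀ b n, ψ (N.left b n) = N'.left b (ψ n)) (m : M.carrier) (n : N.carrier) :
    tmap φ ψ hφ hψ (M.tmul N m n) = M'.tmul N' (φ m) (ψ n) :=
  BalTensor.map_tmul (f := M.rAct) (f' := M'.rAct) φ ψ (fun b m => hφ (op b) m) hψ m n

end

theorem left_right (b : B) (c : Bᵐᵒᵖ) (m : M.carrier) :
    M.left b (M.right c m) = M.right c (M.left b m) := (M.right_left c b m).symm

/-- The left action `b (m ⊗ n) = b m ⊗ n`. -/
def tensorLeft : B →ₐ[k] Module.End k (M.Tensor N) :=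
  AlgHom.ofLinearMap
    { toFun := fun b => tmap (M.left b) LinearMap.id (M.left_right b) (fun _ _ => rfl)
      map_add' := fun a b => BalTensor.hom_ext (fun m n => by simp)
      map_smul' := fun c b => BalTensor.hom_ext (fun m n => by simp) }
    (BalTensor.hom_ext (fun m n => by simp))
    (fun a b => BalTensor.hom_ext (fun m n => by simp))

@[simp] theorem tensorLeft_tmul (b : B) (m : M.carrier) (n : N.carrier) :
    M.tensorLeft N b (M.tmul N m n) = M.tmul N (M.left b m) n :=
  tmap_tmul (M.left b) LinearMap.id (M.left_right b) (fun _ _ => rfl) m n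

/-- The right action `(m ⊗ n) b = m ⊗ n b`. -/
def tensorRight : Bᵐᵒᵖ →ₐ[k] Module.End k (M.Tensor N) :=
  AlgHom.ofLinearMap
    { toFun := fun b => tmap LinearMap.id (N.right b) (fun _ _ => rfl) (N.right_left b)
      map_add' := fun a b => BalTensor.hom_ext (fun m n => by simp)
      map_smul' := fun c b => BalTensor.hom_ext (fun m n => by simp) }
    (BalTensor.hom_ext (fun m n => by simp))
    (fun a b => BalTensor.hom_ext (fun m n => by simp))

@[simp] theorem tensorRight_tmul (b : Bᵐᵒᵖ) (m : M.carrier) (n : N.carrier) :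
    M.tensorRight N b (M.tmul N m n) = M.tmul N m (N.right b n) :=
  tmap_tmul LinearMap.id (N.right b) (fun _ _ => rfl) (N.right_left b) m n

/-- `(X, m, Y, n) ↦ X Y ⋄ (m ⊗ n)` is balanced. -/
theorem codiag : M.Balanced N.left (LinearMap.mul k L) (M.tmul N) (H.dmul (M.tensorLeft N)) where
  bal_left b X Y m n := by simp [mul_assoc, H.dmul_bal]
  bal_mid b X Y m n := by simp [mul_assoc]
  bal_right b X Y m n := by rw [tmul_bal]

theorem fst_codiag_dmul (Y : L) (n : N.carrier) (X : L) (m : M.carrier) :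
    (M.codiag N).fst Y n (H.dmul M.left X m) = H.dmul (M.tensorLeft N) (X * Y) (M.tmul N m n) :=
  (M.codiag N).fst_dmul Y n X m

theorem fst_codiag_diamSR (b : B) (u : H.Diam M.left) (Y : L) (n : N.carrier) :
    (M.codiag N).fst Y n (H.diamSR M.left b u) = (M.codiag N).fst (H.s b * Y) n u :=
  BalTensor.hom_ext_apply (φ := (M.codiag N).fst Y n ∘ₗ H.diamSR M.left b)
    (fun X m => by
      rw [LinearMap.comp_apply, EnvRing.diamSR_dmul, fst_codiag_dmul, fst_codiag_dmul,
        mul_assoc]) u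

theorem fst_codiag_diamSL (b : B) (u : H.Diam M.left) (Y : L) (n : N.carrier) :
    (M.codiag N).fst Y n (H.diamSL M.left b u)
      = H.diamSL (M.tensorLeft N) b ((M.codiag N).fst Y n u) :=
  BalTensor.hom_ext_apply (φ := (M.codiag N).fst Y n ∘ₗ H.diamSL M.left b)
    (ψ := H.diamSL (M.tensorLeft N) b ∘ₗ (M.codiag N).fst Y n)
    (fun X m => by
      rw [LinearMap.comp_apply, LinearMap.comp_apply, EnvRing.diamSL_dmul, fst_codiag_dmul,
        fst_codiag_dmul, EnvRing.diamSL_dmul, mul_assoc]) u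

theorem pair_codiag_diamSL (b : B) (m : M.carrier) (v : H.Diam N.left) :
    (M.codiag N).pair (M.right (op b) m) v = (M.codiag N).pair m (H.diamSL N.left b v) := by
  refine BalTensor.hom_ext_apply (φ := (M.codiag N).pair (M.right (op b) m))
    (ψ := (M.codiag N).pair m ∘ₗ H.diamSL N.left b) (fun Y n => ?_) v
  rw [LinearMap.comp_apply, EnvRing.diamSL_dmul, Balanced.pair_dmul, M.coact_right,
    Balanced.pair_dmul, fst_codiag_diamSR]

theorem pair_codiag_left (b : B) (m : M.carrier) (v : H.Diam N.left) :
    (M.codiag N).pair (M.left b m) v = H.diamSL (M.tensorLeft N) b ((M.codiag N).pair m v) := by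
  refine BalTensor.hom_ext_apply (φ := (M.codiag N).pair (M.left b m))
    (ψ := H.diamSL (M.tensorLeft N) b ∘ₗ (M.codiag N).pair m) (fun Y n => ?_) v
  rw [LinearMap.comp_apply, Balanced.pair_dmul, Balanced.pair_dmul, M.coact_left,
    fst_codiag_diamSL]

theorem pair_codiag_bal (b : B) (m : M.carrier) (n : N.carrier) :
    (M.codiag N).pair (M.right (op b) m) (N.coact n)
      = (M.codiag N).pair m (N.coact (N.left b n)) := by
  rw [N.coact_left, pair_codiag_diamSL]

/-- The codiagonal coaction `m ⊗ n ↦ m₋₁ n₋₁ ⋄ (m₀ ⊗ n₀)` of `M ⊗_B N`. -/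
def tensorCoact : M.Tensor N →ₗ[k] H.Diam (M.tensorLeft N) :=
  BalTensor.lift ((M.codiag N).pair.compl₂ N.coact) (fun b m n => M.pair_codiag_bal N b m n)

theorem tensorCoact_tmul (m : M.carrier) (n : N.carrier) :
    M.tensorCoact N (M.tmul N m n) = (M.codiag N).pair m (N.coact n) :=
  BalTensor.lift_tmul _ (fun b m n => M.pair_codiag_bal N b m n) m n

theorem tensorCoact_left (b : B) (x : M.Tensor N) :
    M.tensorCoact N (M.tensorLeft N b x) = H.diamSL (M.tensorLeft N) b (M.tensorCoact N x) := by
  refine BalTensor.hom_ext_apply (φ := M.tensorCoact N ∘ₗ M.tensorLeft N b)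
    (ψ := H.diamSL (M.tensorLeft N) b ∘ₗ M.tensorCoact N) (fun m n => ?_) x
  rw [LinearMap.comp_apply, LinearMap.comp_apply, tensorLeft_tmul, tensorCoact_tmul,
    tensorCoact_tmul, pair_codiag_left]

theorem tensorCoact_right (b : B) (x : M.Tensor N) :
    M.tensorCoact N (M.tensorRight N (op b) x)
      = H.diamSR (M.tensorLeft N) b (M.tensorCoact N x) := by
  refine BalTensor.hom_ext_apply (φ := M.tensorCoact N ∘ₗ M.tensorRight N (op b))
    (ψ := H.diamSR (M.tensorLeft N) b ∘ₗ M.tensorCoact N) (fun m n => ?_) x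
  rw [LinearMap.comp_apply, LinearMap.comp_apply, tensorRight_tmul, tensorCoact_tmul,
    tensorCoact_tmul, N.coact_right]
  exact ((M.codiag N).comp_pair (M.codiag N) _ _ (· * H.s b) id
    (fun Y n => H.diamSR_dmul _ b Y n) (fun X Y m n => by simp [mul_assoc]) m _).symm

theorem tensorRight_left (a : Bᵐᵒᵖ) (b : B) (x : M.Tensor N) :
    M.tensorRight N a (M.tensorLeft N b x) = M.tensorLeft N b (M.tensorRight N a x) :=
  BalTensor.hom_ext_apply (φ := M.tensorRight N a ∘ₗ M.tensorLeft N b)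
    (ψ := M.tensorLeft N b ∘ₗ M.tensorRight N a) (fun m n => by simp) x

theorem tensorCoact_takeuchi (b : B) (x : M.Tensor N) :
    H.diamTR (M.tensorLeft N) b (M.tensorCoact N x)
      = H.diamMap (M.tensorRight N (op b)) (M.tensorRight_left N (op b)) (M.tensorCoact N x) := by
  refine BalTensor.hom_ext_apply (φ := H.diamTR (M.tensorLeft N) b ∘ₗ M.tensorCoact N)
    (ψ := H.diamMap (M.tensorRight N (op b)) (M.tensorRight_left N (op b)) ∘ₗ M.tensorCoact N)
    (fun m n => ?_) x
  rw [LinearMap.comp_apply, LinearMap.comp_apply, tensorCoact_tmul,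
    (M.codiag N).comp_pair (M.codiag N) _ (H.diamTR N.left b) (· * H.t b) id
    (fun Y n => H.diamTR_dmul _ b Y n) (fun X Y m n => by simp [mul_assoc]) m _,
    (M.codiag N).comp_pair (M.codiag N) _
    (H.diamMap (N.right (op b)) (N.right_left (op b))) id (N.right (op b))
    (fun Y n => H.diamMap_dmul _ (N.right_left (op b)) Y n) (fun X Y m n => by simp) m _,
    N.coact_takeuchi]

/-- `(X, m, Y, w) ↦ X Y ⋄ (m₋₁, m₀) w`, for `w ∈ L ⋄_B N`, is balanced. -/
theorem codiag₂ : M.Balanced (H.diamSL N.left) (LinearMap.mul k L) (M.codiag N).pair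
    (H.dmul (H.diamSL (M.tensorLeft N))) where
  bal_left b X Y m w := by
    rw [pair_codiag_left]
    exact (congrArg (fun Z => H.dmul (H.diamSL (M.tensorLeft N)) Z ((M.codiag N).pair m w))
      (mul_assoc (H.t b) X Y)).trans (H.dmul_bal _ b (X * Y) _)
  bal_mid b X Y m n :=
    congrArg (fun Z => H.dmul (H.diamSL (M.tensorLeft N)) Z ((M.codiag N).pair m n))
      (mul_assoc X (H.t b) Y).symm
  bal_right b X Y m n := by rw [pair_codiag_diamSL]

theorem fst_codiag₂_dmul (Y : L) (w : H.Diam N.left) (X : L) (m : M.carrier) :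
    (M.codiag₂ N).fst Y w (H.dmul M.left X m)
      = H.dmul (H.diamSL (M.tensorLeft N)) (X * Y) ((M.codiag N).pair m w) :=
  (M.codiag₂ N).fst_dmul Y w X m

theorem diamMap_tensorCoact_pair (m : M.carrier) (v : H.Diam N.left) :
    H.diamMap (M.tensorCoact N) (M.tensorCoact_left N) ((M.codiag N).pair m v)
      = (M.codiag₂ N).pair m (H.diamMap N.coact N.coact_left v) :=
  (M.codiag N).comp_pair (M.codiag₂ N) _ _ id N.coact
    (fun Y n => H.diamMap_dmul _ N.coact_left Y n)
    (fun X Y m n => by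
      rw [EnvRing.diamMap_dmul, tensorCoact_tmul, id]) m v

/-- `X ⋄ u ↦ X Y ⋄ u (Z ⊗ n)`. -/
def codiag₃ (Y Z : L) (n : N.carrier) :
    H.Diam (H.diamSL M.left) →ₗ[k] H.Diam (H.diamSL (M.tensorLeft N)) :=
  BalTensor.map (f := H.tL) (f' := H.tL) (g := H.diamSL M.left)
    (g' := H.diamSL (M.tensorLeft N)) (LinearMap.mulRight k Y)
    ((M.codiag N).fst Z n)
    (fun _ _ => mul_assoc _ _ _) (fun b u => M.fst_codiag_diamSL N b u Z n)

theorem codiag₃_dmul (Y Z : L) (n : N.carrier) (X : L) (u : H.Diam M.left) :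
    M.codiag₃ N Y Z n (H.dmul (H.diamSL M.left) X u)
      = H.dmul (H.diamSL (M.tensorLeft N)) (X * Y) ((M.codiag N).fst Z n u) :=
  BalTensor.map_tmul (f := H.tL) (f' := H.tL) (g := H.diamSL M.left)
    (g' := H.diamSL (M.tensorLeft N)) (LinearMap.mulRight k Y)
    ((M.codiag N).fst Z n)
    (fun _ _ => mul_assoc _ _ _) (fun b u => M.fst_codiag_diamSL N b u Z n) X u

theorem fst_codiag₂ (Y Z : L) (n : N.carrier) (u : H.Diam M.left) :
    (M.codiag₂ N).fst Y (H.dmul N.left Z n) u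
      = M.codiag₃ N Y Z n (H.diamMap M.coact M.coact_left u) := by
  refine BalTensor.hom_ext_apply
    (φ := (M.codiag₂ N).fst Y (H.dmul N.left Z n))
    (ψ := M.codiag₃ N Y Z n ∘ₗ H.diamMap M.coact M.coact_left) (fun X m => ?_) u
  rw [LinearMap.comp_apply, EnvRing.diamMap_dmul, codiag₃_dmul, fst_codiag₂_dmul,
    Balanced.pair_dmul]

set_option maxHeartbeats 1000000 in
theorem comulDiam_fst (Y : L) (n : N.carrier) (S : Finset (L × L))
    (hy : BalTensor.proj H.tL H.sL (∑ i ∈ S, i.1 ⊗ₜ[k] i.2) = H.comul Y) (u : H.Diam M.left) :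
    ∑ i ∈ S, M.codiag₃ N i.1 i.2 n (H.comulDiam H.comul H.comul_target M.left u)
      = H.comulDiam H.comul H.comul_target (M.tensorLeft N) ((M.codiag N).fst Y n u) := by
  refine Eq.trans ?_ (BalTensor.hom_ext_apply
    (φ := (∑ i ∈ S, M.codiag₃ N i.1 i.2 n) ∘ₗ H.comulDiam H.comul H.comul_target M.left)
    (ψ := H.comulDiam H.comul H.comul_target (M.tensorLeft N) ∘ₗ (M.codiag N).fst Y n)
    (fun X m => ?_) u)
  · rw [LinearMap.comp_apply, LinearMap.sum_apply]
  obtain ⟨x, hx⟩ := BalTensor.proj_surjective H.tL H.sL (H.comul X)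
  obtain ⟨T, rfl⟩ := TensorProduct.exists_finset x
  rw [LinearMap.comp_apply, LinearMap.comp_apply, EnvRing.comulDiam_dmul, fst_codiag_dmul,
    EnvRing.comulDiam_dmul, H.comul_mul X Y _ _ hx hy, Finset.sum_mul_sum, ← hx]
  simp only [map_sum, LinearMap.sum_apply]
  refine Finset.sum_congr rfl fun i _ => Finset.sum_congr rfl fun j _ => ?_
  rw [BalTensor.proj_tmul, EnvRing.diamInsert_dmul, codiag₃_dmul, fst_codiag_dmul,
    Algebra.TensorProduct.tmul_mul_tmul, BalTensor.proj_tmul, EnvRing.diamInsert_dmul]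

set_option maxHeartbeats 1000000 in
theorem comulDiam_pair (m : M.carrier) (v : H.Diam N.left) :
    (M.codiag₂ N).pair m (H.comulDiam H.comul H.comul_target N.left v)
      = H.comulDiam H.comul H.comul_target (M.tensorLeft N) ((M.codiag N).pair m v) := by
  refine BalTensor.hom_ext_apply
    (φ := (M.codiag₂ N).pair m ∘ₗ H.comulDiam H.comul H.comul_target N.left)
    (ψ := H.comulDiam H.comul H.comul_target (M.tensorLeft N) ∘ₗ (M.codiag N).pair m)
    (fun Y n => ?_) v
  obtain ⟨y, hy⟩ := BalTensor.proj_surjective H.tL H.sL (H.comul Y)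
  obtain ⟨S, rfl⟩ := TensorProduct.exists_finset y
  have h1 : ∀ i : L × L, (M.codiag₂ N).pair m
      (H.diamInsert N.left n (BalTensor.proj H.tL H.sL (i.1 ⊗ₜ[k] i.2)))
      = M.codiag₃ N i.1 i.2 n (H.comulDiam H.comul H.comul_target M.left (M.coact m)) := by
    intro i
    rw [BalTensor.proj_tmul, EnvRing.diamInsert_dmul, Balanced.pair_dmul, fst_codiag₂, M.coassoc]
  rw [LinearMap.comp_apply, LinearMap.comp_apply, EnvRing.comulDiam_dmul, Balanced.pair_dmul,
    ← M.comulDiam_fst N Y n S hy, ← hy, map_sum, map_sum, map_sum]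
  exact Finset.sum_congr rfl (fun i _ => h1 i)

theorem tensorCoact_coassoc (x : M.Tensor N) :
    H.diamMap (M.tensorCoact N) (M.tensorCoact_left N) (M.tensorCoact N x)
      = H.comulDiam H.comul H.comul_target (M.tensorLeft N) (M.tensorCoact N x) := by
  refine BalTensor.hom_ext_apply
    (φ := H.diamMap (M.tensorCoact N) (M.tensorCoact_left N) ∘ₗ M.tensorCoact N)
    (ψ := H.comulDiam H.comul H.comul_target (M.tensorLeft N) ∘ₗ M.tensorCoact N)
    (fun m n => ?_) x
  rw [LinearMap.comp_apply, LinearMap.comp_apply, tensorCoact_tmul, diamMap_tensorCoact_pair,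
    N.coassoc, comulDiam_pair]

theorem tensorCoact_counit (x : M.Tensor N) :
    H.counitDiam H.counit H.counit_target (M.tensorLeft N) (M.tensorCoact N x) = x := by
  refine BalTensor.hom_ext_apply
    (φ := H.counitDiam H.counit H.counit_target (M.tensorLeft N) ∘ₗ M.tensorCoact N)
    (ψ := LinearMap.id) (fun m n => ?_) x
  rw [LinearMap.comp_apply, tensorCoact_tmul, LinearMap.id_apply]
  have h1 : ∀ v : H.Diam N.left, H.counitDiam H.counit H.counit_target (M.tensorLeft N)
      ((M.codiag N).pair m v)
      = M.tmul N m (H.counitDiam H.counit H.counit_target N.left v) := by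
    intro v
    refine BalTensor.hom_ext_apply (φ := H.counitDiam H.counit H.counit_target (M.tensorLeft N) ∘ₗ
      (M.codiag N).pair m)
      (ψ := M.tmul N m ∘ₗ H.counitDiam H.counit H.counit_target N.left) (fun Y n => ?_) v
    rw [LinearMap.comp_apply, LinearMap.comp_apply, Balanced.pair_dmul, EnvRing.counitDiam_dmul,
      ← tmul_bal]
    have h2 : ∀ u : H.Diam M.left, H.counitDiam H.counit H.counit_target (M.tensorLeft N)
        ((M.codiag N).fst Y n u)
        = M.tmul N (H.counitDiam H.counit H.counit_target M.left
            (H.diamTR M.left (H.counit Y) u)) n := fun u =>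
      BalTensor.hom_ext_apply (φ := H.counitDiam H.counit H.counit_target (M.tensorLeft N) ∘ₗ
        (M.codiag N).fst Y n)
        (ψ := (M.tmul N).flip n ∘ₗ H.counitDiam H.counit H.counit_target M.left ∘ₗ
          H.diamTR M.left (H.counit Y))
        (fun X m => by
          simp only [LinearMap.comp_apply, LinearMap.flip_apply, fst_codiag_dmul,
            EnvRing.counitDiam_dmul, EnvRing.diamTR_dmul, tensorLeft_tmul,
            H.counit_mul_target]) u
    have h3 : ∀ (b : B) (u : H.Diam M.left), H.counitDiam H.counit H.counit_target M.left
        (H.diamMap (M.right (op b)) (M.right_left (op b)) u)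
        = M.right (op b) (H.counitDiam H.counit H.counit_target M.left u) := fun b u =>
      BalTensor.hom_ext_apply (φ := H.counitDiam H.counit H.counit_target M.left ∘ₗ
        H.diamMap (M.right (op b)) (M.right_left (op b)))
        (ψ := M.right (op b) ∘ₗ H.counitDiam H.counit H.counit_target M.left)
        (fun X m => by
          rw [LinearMap.comp_apply, LinearMap.comp_apply, EnvRing.diamMap_dmul,
            EnvRing.counitDiam_dmul, EnvRing.counitDiam_dmul, M.right_left]) u
    rw [h2, M.coact_takeuchi, h3, M.counit_coact]
  rw [h1, N.counit_coact]

/-- The tensor product of left comodules: `M ⊗_B N` with the codiagonal coaction. -/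
def tensor : H.Comodule where
  carrier := M.Tensor N
  left := M.tensorLeft N
  right := M.tensorRight N
  right_left := M.tensorRight_left N
  coact := M.tensorCoact N
  coact_left := M.tensorCoact_left N
  coact_right := M.tensorCoact_right N
  coact_takeuchi := M.tensorCoact_takeuchi N
  coassoc := M.tensorCoact_coassoc N
  counit_coact := M.tensorCoact_counit N

/-- Morphisms of left comodules: `B`-bilinear colinear maps. -/
structure Hom where
  toLin : M.carrier →ₗ[k] N.carrier
  map_left : ∀ b m, toLin (M.left b m) = N.left b (toLin m)
  map_right : ∀ b m, toLin (M.right b m) = N.right b (toLin m)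
  map_coact : ∀ m, N.coact (toLin m) = H.diamMap toLin map_left (M.coact m)

variable {M N P} in
theorem Hom.ext' {f g : Hom M N} (h : ∀ m, f.toLin m = g.toLin m) : f = g := by
  cases f; cases g
  congr
  exact LinearMap.ext h

theorem diamMap_id (l : B → Module.End k M.carrier) (h) (u : H.Diam l) :
    H.diamMap (l := l) (l' := l) (LinearMap.id : M.carrier →ₗ[k] M.carrier) h u = u :=
  BalTensor.hom_ext_apply (φ := H.diamMap (l := l) (l' := l) LinearMap.id h)
    (ψ := LinearMap.id) (fun X m => H.diamMap_dmul LinearMap.id h X m) u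

theorem diamMap_comp {M N P : Type*} [AddCommGroup M] [Module k M] [AddCommGroup N] [Module k N]
    [AddCommGroup P] [Module k P] {l : B → Module.End k M} {l' : B → Module.End k N}
    {l'' : B → Module.End k P} (f : M →ₗ[k] N) (g : N →ₗ[k] P) (hf hg hgf) (u : H.Diam l) :
    H.diamMap (l := l') (l' := l'') g hg (H.diamMap (l := l) f hf u)
      = H.diamMap (l := l) (l' := l'') (g ∘ₗ f) hgf u :=
  BalTensor.hom_ext_apply (φ := H.diamMap (l := l') (l' := l'') g hg ∘ₗ H.diamMap (l := l) f hf)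
    (fun X m => by
      rw [LinearMap.comp_apply, EnvRing.diamMap_dmul, EnvRing.diamMap_dmul, EnvRing.diamMap_dmul,
        LinearMap.comp_apply]) u

instance : Category H.Comodule where
  Hom := Hom
  id M := ⟨LinearMap.id, fun _ _ => rfl, fun _ _ => rfl, fun m => (M.diamMap_id _ _ _).symm⟩
  comp {M N P} f g := ⟨g.toLin ∘ₗ f.toLin,
    fun b m => (congrArg g.toLin (f.map_left b m)).trans (g.map_left b _),
    fun b m => (congrArg g.toLin (f.map_right b m)).trans (g.map_right b _),
    fun m => by
      rw [LinearMap.comp_apply, g.map_coact, f.map_coact]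
      exact diamMap_comp _ _ _ _ _ _⟩

variable {M N P} in
/-- The underlying linear map of a morphism of comodules. -/
def lin (f : M ⟶ N) : M.carrier →ₗ[k] N.carrier := Hom.toLin f

variable {M N P} in
@[simp] theorem lin_comp (f : M ⟶ N) (g : N ⟶ P) (m : M.carrier) :
    lin (f ≫ g) m = lin g (lin f m) := rfl

@[simp] theorem lin_id (m : M.carrier) : lin (𝟙 M) m = m := rfl

variable {M N P} in
theorem hom_ext {f g : M ⟶ N} (h : ∀ m, lin f m = lin g m) : f = g := Hom.ext' h

variable {M N} in
theorem lin_left (f : M ⟶ N) (b : B) (m : M.carrier) :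
    lin f (M.left b m) = N.left b (lin f m) := Hom.map_left f b m

variable {M N} in
theorem lin_right (f : M ⟶ N) (b : Bᵐᵒᵖ) (m : M.carrier) :
    lin f (M.right b m) = N.right b (lin f m) := Hom.map_right f b m

variable {M N} in
theorem lin_coact (f : M ⟶ N) (m : M.carrier) :
    N.coact (lin f m) = H.diamMap (lin f) (lin_left f) (M.coact m) := Hom.map_coact f m

/-- A morphism of comodules with a linear inverse is an isomorphism. -/
def isoOfInv {M N : H.Comodule} (f : M ⟶ N) (g : N.carrier →ₗ[k] M.carrier)
    (hgf : ∀ m, g (lin f m) = m) (hfg : ∀ n, lin f (g n) = n) : M ≅ N where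
  hom := f
  inv :=
    { toLin := g
      map_left := fun b n => by
        conv_lhs => rw [← hfg n]
        exact (congrArg g (f.map_left b (g n)).symm).trans (hgf _)
      map_right := fun b n => by
        conv_lhs => rw [← hfg n]
        exact (congrArg g (f.map_right b (g n)).symm).trans (hgf _)
      map_coact := fun n => by
        conv_rhs => rw [← hfg n]
        refine Eq.symm ((congrArg _ (f.map_coact (g n))).trans ?_)
        refine (diamMap_comp f.toLin g _ _ (fun b m => ?_) _).trans ?_
        · exact (hgf _).trans (congrArg _ (hgf m).symm)
        have h : g ∘ₗ f.toLin = LinearMap.id := LinearMap.ext hgf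
        have h' : ∀ (φ : M.carrier →ₗ[k] M.carrier) (hφ : ∀ b m, φ (M.left b m) = M.left b (φ m)),
            φ = LinearMap.id → H.diamMap φ hφ (M.coact (g n)) = M.coact (g n) := by
          rintro φ hφ rfl
          exact M.diamMap_id _ _ _
        exact h' _ _ h }
  hom_inv_id := hom_ext hgf
  inv_hom_id := hom_ext hfg

section TensorHom

variable {M N} {M' N' : H.Comodule}

theorem fst_map (f : M ⟶ M') (g : N ⟶ N') (Y : L) (n : N.carrier) (u : H.Diam M.left)
    (h : ∀ b x, tmap (lin f) (lin g) (lin_right f) (lin_left g) (M.tensorLeft N b x)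
      = M'.tensorLeft N' b (tmap (lin f) (lin g) (lin_right f) (lin_left g) x)) :
    H.diamMap (tmap (lin f) (lin g) (lin_right f) (lin_left g)) h ((M.codiag N).fst Y n u)
      = (M'.codiag N').fst Y (lin g n) (H.diamMap (lin f) (lin_left f) u) :=
  BalTensor.hom_ext_apply (φ := H.diamMap _ h ∘ₗ (M.codiag N).fst Y n)
    (ψ := (M'.codiag N').fst Y (lin g n) ∘ₗ H.diamMap (lin f) (lin_left f))
    (fun X m => by
      rw [LinearMap.comp_apply, LinearMap.comp_apply, EnvRing.diamMap_dmul, fst_codiag_dmul,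
        fst_codiag_dmul, EnvRing.diamMap_dmul, tmap_tmul]) u

theorem pair_map (f : M ⟶ M') (g : N ⟶ N') (m : M.carrier) (v : H.Diam N.left)
    (h : ∀ b x, tmap (lin f) (lin g) (lin_right f) (lin_left g) (M.tensorLeft N b x)
      = M'.tensorLeft N' b (tmap (lin f) (lin g) (lin_right f) (lin_left g) x)) :
    H.diamMap (tmap (lin f) (lin g) (lin_right f) (lin_left g)) h ((M.codiag N).pair m v)
      = (M'.codiag N').pair (lin f m) (H.diamMap (lin g) (lin_left g) v) := by
  refine BalTensor.hom_ext_apply (φ := H.diamMap _ h ∘ₗ (M.codiag N).pair m)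
    (ψ := (M'.codiag N').pair (lin f m) ∘ₗ H.diamMap (lin g) (lin_left g)) (fun Y n => ?_) v
  rw [LinearMap.comp_apply, LinearMap.comp_apply, EnvRing.diamMap_dmul, Balanced.pair_dmul,
    Balanced.pair_dmul, fst_map]
  exact congrArg _ (lin_coact f m).symm

/-- The tensor product `f ⊗ g : M ⊗_B N → M' ⊗_B N'` of morphisms. -/
def tensorHom (f : M ⟶ M') (g : N ⟶ N') : M.tensor N ⟶ M'.tensor N' :=
  have h : ∀ b x, tmap (lin f) (lin g) (lin_right f) (lin_left g) (M.tensorLeft N b x)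
      = M'.tensorLeft N' b (tmap (lin f) (lin g) (lin_right f) (lin_left g) x) := fun b x =>
    BalTensor.hom_ext_apply (φ := tmap (lin f) (lin g) (lin_right f) (lin_left g) ∘ₗ M.tensorLeft N b)
      (ψ := M'.tensorLeft N' b ∘ₗ tmap (lin f) (lin g) (lin_right f) (lin_left g))
      (fun m n => by
        rw [LinearMap.comp_apply, LinearMap.comp_apply, tensorLeft_tmul, tmap_tmul, tmap_tmul,
          tensorLeft_tmul]
        exact congrArg (fun z => M'.tmul N' z _) ((lin_left f) b m)) x
  { toLin := tmap (lin f) (lin g) (lin_right f) (lin_left g)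
    map_left := h
    map_right := fun b x =>
      BalTensor.hom_ext_apply
        (φ := tmap (lin f) (lin g) (lin_right f) (lin_left g) ∘ₗ M.tensorRight N b)
        (ψ := M'.tensorRight N' b ∘ₗ tmap (lin f) (lin g) (lin_right f) (lin_left g))
        (fun m n => by
          rw [LinearMap.comp_apply, LinearMap.comp_apply, tensorRight_tmul, tmap_tmul, tmap_tmul,
            tensorRight_tmul]
          exact congrArg (fun z => M'.tmul N' _ z) ((lin_right g) b n)) x
    map_coact := fun x =>
      BalTensor.hom_ext_apply
        (φ := M'.tensorCoact N' ∘ₗ tmap (lin f) (lin g) (lin_right f) (lin_left g))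
        (ψ := H.diamMap _ h ∘ₗ M.tensorCoact N)
        (fun m n => by
          rw [LinearMap.comp_apply, LinearMap.comp_apply, tmap_tmul, tensorCoact_tmul,
            tensorCoact_tmul, pair_map]
          exact congrArg _ (lin_coact g n)) x }

@[simp] theorem lin_tensorHom (f : M ⟶ M') (g : N ⟶ N') (m : M.carrier) (n : N.carrier) :
    lin (tensorHom f g) (M.tmul N m n) = M'.tmul N' (lin f m) (lin g n) :=
  tmap_tmul (lin f) (lin g) (lin_right f) (lin_left g) m n

end TensorHom

section Unit

variable (H)

/-- The left action of `B` on itself. -/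
def unitLeft : B →ₐ[k] Module.End k B := Algebra.lmul k B

/-- The right action of `B` on itself. -/
def unitRight : Bᵐᵒᵖ →ₐ[k] Module.End k B := Algebra.lsmul k k B

theorem unitLeft_apply (b x : B) : unitLeft (k := k) b x = b * x := rfl
theorem unitRight_apply (b : Bᵐᵒᵖ) (x : B) : unitRight (k := k) b x = x * unop b := rfl

theorem unitRight_left (a : Bᵐᵒᵖ) (b x : B) :
    unitRight (k := k) a (unitLeft (k := k) b x) = unitLeft (k := k) b (unitRight (k := k) a x) :=
  mul_assoc b x (unop a)

/-- The coaction `b ↦ b ⋄ 1` of `B`. -/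
def unitCoact : B →ₗ[k] H.Diam (unitLeft (k := k) (B := B)) :=
  (H.dmul (unitLeft (k := k) (B := B))).flip 1 ∘ₗ H.s

theorem unitCoact_apply (b : B) :
    unitCoact H b = H.dmul (unitLeft (k := k) (B := B)) (H.s b) 1 := rfl

theorem unitCoact_left (b x : B) : unitCoact H (unitLeft (k := k) b x)
    = H.diamSL (unitLeft (k := k) (B := B)) b (unitCoact H x) := by
  rw [unitCoact_apply, unitCoact_apply, EnvRing.diamSL_dmul, unitLeft_apply, H.s_mul]

/-- The unit comodule: `B` with coaction `b ↦ b ⋄ 1`. -/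
def unit : H.Comodule where
  carrier := B
  left := unitLeft
  right := unitRight
  right_left := unitRight_left
  coact := unitCoact H
  coact_left := unitCoact_left H
  coact_right b x := by
    rw [unitCoact_apply, unitCoact_apply, EnvRing.diamSR_dmul, unitRight_apply, H.s_mul, unop_op]
  coact_takeuchi b x := by
    rw [unitCoact_apply, EnvRing.diamTR_dmul, EnvRing.diamMap_dmul, H.s_t, H.dmul_bal,
      unitLeft_apply, unitRight_apply, mul_one, one_mul, unop_op]
  coassoc x := by
    rw [unitCoact_apply, EnvRing.diamMap_dmul, EnvRing.comulDiam_dmul, H.comul_s,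
      EnvRing.diamInsert_dmul, unitCoact_apply, H.s_one]
  counit_coact x := by
    have h := H.counit_source x 1
    rw [mul_one, H.counit_one, mul_one] at h
    rw [unitCoact_apply, EnvRing.counitDiam_dmul, h, unitLeft_apply, mul_one]

end Unit

variable (H) in
/-- `L` itself, with coaction `Δ` and bimodule structure `b.X.b' = b X b'`. -/
def regular : H.Comodule where
  carrier := L
  left := H.sL
  right := (Algebra.lsmul k k L : Lᵐᵒᵖ →ₐ[k] Module.End k L).comp (AlgHom.op H.source)
  right_left _ _ _ := mul_assoc _ _ _
  coact := H.comul
  coact_left := H.comul_source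
  coact_right := fun b X => H.comul_mul_s b X
  coact_takeuchi := fun b X => H.comul_takeuchi b X
  coassoc := H.coassoc
  counit_coact := H.counit_comul

/-! ### The monoidal category of left comodules -/

/-- The class of `m ⊗ n` in the comodule `M ⊗_B N`. -/
def ten : M.carrier →ₗ[k] N.carrier →ₗ[k] (M.tensor N).carrier := M.tmul N

variable {M N} in
theorem ten_ext {W : Type*} [AddCommGroup W] [Module k W] {φ ψ : (M.tensor N).carrier →ₗ[k] W}
    (h : ∀ m n, φ (M.ten N m n) = ψ (M.ten N m n)) (x : (M.tensor N).carrier) : φ x = ψ x :=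
  BalTensor.hom_ext_apply h x

theorem ten_bal (b : B) (m : M.carrier) (n : N.carrier) :
    M.ten N (M.right (op b) m) n = M.ten N m (N.left b n) := M.tmul_bal N b m n

theorem left_ten (b : B) (m : M.carrier) (n : N.carrier) :
    (M.tensor N).left b (M.ten N m n) = M.ten N (M.left b m) n := M.tensorLeft_tmul N b m n

theorem right_ten (b : Bᵐᵒᵖ) (m : M.carrier) (n : N.carrier) :
    (M.tensor N).right b (M.ten N m n) = M.ten N m (N.right b n) := M.tensorRight_tmul N b m n

/-- `(X, m, Y, n) ↦ X Y ⋄ (m ⊗ n)` is balanced. -/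
theorem cod : M.Balanced N.left (LinearMap.mul k L) (M.ten N) (H.dmul (M.tensor N).left) :=
  M.codiag N

theorem coact_ten (m : M.carrier) (n : N.carrier) :
    (M.tensor N).coact (M.ten N m n) = (M.cod N).pair m (N.coact n) := M.tensorCoact_tmul N m n

theorem fst_cod_dmul (Y : L) (n : N.carrier) (X : L) (m : M.carrier) :
    (M.cod N).fst Y n (H.dmul M.left X m) = H.dmul (M.tensor N).left (X * Y) (M.ten N m n) :=
  (M.cod N).fst_dmul Y n X m

variable {M N} in
/-- The universal property of `M ⊗_B N`. -/
def tlift {W : Type*} [AddCommGroup W] [Module k W] (φ : M.carrier →ₗ[k] N.carrier →ₗ[k] W)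
    (h : ∀ b m n, φ (M.right (op b) m) n = φ m (N.left b n)) : (M.tensor N).carrier →ₗ[k] W :=
  BalTensor.lift (f := M.rAct) φ h

variable {M N} in
theorem tlift_ten {W : Type*} [AddCommGroup W] [Module k W]
    (φ : M.carrier →ₗ[k] N.carrier →ₗ[k] W)
    (h : ∀ b m n, φ (M.right (op b) m) n = φ m (N.left b n)) (m : M.carrier) (n : N.carrier) :
    tlift φ h (M.ten N m n) = φ m n := BalTensor.lift_tmul (f := M.rAct) φ h m n

theorem lin_tensorHom_ten {M' N' : H.Comodule} (f : M ⟶ M') (g : N ⟶ N') (m : M.carrier)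
    (n : N.carrier) : lin (tensorHom f g) (M.ten N m n) = M'.ten N' (lin f m) (lin g n) :=
  lin_tensorHom f g m n

section Associator

/-- `(m, n, p) ↦ m ⊗ (n ⊗ p)`. -/
def assocAux₀ : M.carrier →ₗ[k] N.carrier →ₗ[k]
    P.carrier →ₗ[k] (M.tensor (N.tensor P)).carrier :=
  LinearMap.mk₂ k (fun m n => M.ten (N.tensor P) m ∘ₗ N.ten P n)
    (fun m m' n => by rw [map_add, LinearMap.add_comp])
    (fun c m n => by rw [map_smul, LinearMap.smul_comp])
    (fun m n n' => by rw [map_add, LinearMap.comp_add])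
    (fun c m n => by rw [map_smul, LinearMap.comp_smul])

theorem assocAux₀_apply (m : M.carrier) (n : N.carrier) (p : P.carrier) :
    M.assocAux₀ N P m n p = M.ten (N.tensor P) m (N.ten P n p) := rfl

theorem assocAux₀_bal (b : B) (m : M.carrier) (n : N.carrier) :
    M.assocAux₀ N P (M.right (op b) m) n = M.assocAux₀ N P m (N.left b n) :=
  LinearMap.ext fun p => by
    rw [assocAux₀_apply, assocAux₀_apply, ten_bal, left_ten]

/-- `(m ⊗ n, p) ↦ m ⊗ (n ⊗ p)`. -/
def assocAux₁ : (M.tensor N).carrier →ₗ[k]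
    P.carrier →ₗ[k] (M.tensor (N.tensor P)).carrier :=
  tlift (M.assocAux₀ N P) (M.assocAux₀_bal N P)

theorem assocAux₁_ten (m : M.carrier) (n : N.carrier) (p : P.carrier) :
    M.assocAux₁ N P (M.ten N m n) p = M.ten (N.tensor P) m (N.ten P n p) :=
  LinearMap.congr_fun (tlift_ten (M.assocAux₀ N P) (M.assocAux₀_bal N P) m n) p

theorem assocAux₁_bal (b : B) (x : (M.tensor N).carrier) (p : P.carrier) :
    M.assocAux₁ N P ((M.tensor N).right (op b) x) p = M.assocAux₁ N P x (P.left b p) :=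
  ten_ext (φ := (M.assocAux₁ N P).flip p ∘ₗ (M.tensor N).right (op b))
    (ψ := (M.assocAux₁ N P).flip (P.left b p))
    (fun m n => by
      rw [LinearMap.comp_apply, LinearMap.flip_apply, LinearMap.flip_apply, right_ten,
        assocAux₁_ten, assocAux₁_ten, ten_bal]) x

/-- `(m ⊗ n) ⊗ p ↦ m ⊗ (n ⊗ p)`. -/
def assocLin : ((M.tensor N).tensor P).carrier →ₗ[k] (M.tensor (N.tensor P)).carrier :=
  tlift (M.assocAux₁ N P) (M.assocAux₁_bal N P)

theorem assocLin_ten (m : M.carrier) (n : N.carrier) (p : P.carrier) :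
    M.assocLin N P ((M.tensor N).ten P (M.ten N m n) p) = M.ten (N.tensor P) m (N.ten P n p) :=
  (tlift_ten (M.assocAux₁ N P) (M.assocAux₁_bal N P) (M.ten N m n) p).trans
    (M.assocAux₁_ten N P m n p)

variable {M N P} in
theorem ten_ext₃ {W : Type*} [AddCommGroup W] [Module k W]
    {φ ψ : ((M.tensor N).tensor P).carrier →ₗ[k] W}
    (h : ∀ m n p, φ ((M.tensor N).ten P (M.ten N m n) p) = ψ ((M.tensor N).ten P (M.ten N m n) p))
    (x : ((M.tensor N).tensor P).carrier) : φ x = ψ x :=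
  ten_ext (fun y p => ten_ext (φ := φ ∘ₗ ((M.tensor N).ten P).flip p)
    (ψ := ψ ∘ₗ ((M.tensor N).ten P).flip p) (fun m n => h m n p) y) x

variable {M N P} in
theorem ten_ext₃' {W : Type*} [AddCommGroup W] [Module k W]
    {φ ψ : (M.tensor (N.tensor P)).carrier →ₗ[k] W}
    (h : ∀ m n p, φ (M.ten (N.tensor P) m (N.ten P n p)) = ψ (M.ten (N.tensor P) m (N.ten P n p)))
    (x : (M.tensor (N.tensor P)).carrier) : φ x = ψ x :=
  ten_ext (fun m y => ten_ext (φ := φ ∘ₗ M.ten (N.tensor P) m)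
    (ψ := ψ ∘ₗ M.ten (N.tensor P) m) (fun n p => h m n p) y) x

theorem assocInv_bal (m : M.carrier) (b : B) (n : N.carrier) (p : P.carrier) :
    ((M.tensor N).ten P ∘ₗ M.ten N m) (N.right (op b) n) p
      = ((M.tensor N).ten P ∘ₗ M.ten N m) n (P.left b p) := by
  rw [LinearMap.comp_apply, LinearMap.comp_apply, ← right_ten, ten_bal]

/-- `(m, n ⊗ p) ↦ (m ⊗ n) ⊗ p`. -/
def assocInv₁ : M.carrier →ₗ[k] (N.tensor P).carrier →ₗ[k] ((M.tensor N).tensor P).carrier :=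
  LinearMap.mk₂ k (fun m => tlift ((M.tensor N).ten P ∘ₗ M.ten N m) (M.assocInv_bal N P m))
    (fun m m' y => ten_ext (ψ := _ + _) (fun n p => by
      rw [LinearMap.add_apply, tlift_ten, tlift_ten, tlift_ten, map_add, LinearMap.comp_add,
        LinearMap.add_apply, LinearMap.add_apply]) y)
    (fun c m y => ten_ext (ψ := c • _) (fun n p => by
      rw [LinearMap.smul_apply, tlift_ten, tlift_ten, map_smul, LinearMap.comp_smul,
        LinearMap.smul_apply, LinearMap.smul_apply]) y)
    (fun m y y' => map_add _ y y') (fun c m y => map_smul _ c y)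

theorem assocInv₁_ten (m : M.carrier) (n : N.carrier) (p : P.carrier) :
    M.assocInv₁ N P m (N.ten P n p) = (M.tensor N).ten P (M.ten N m n) p :=
  tlift_ten ((M.tensor N).ten P ∘ₗ M.ten N m) (M.assocInv_bal N P m) n p

theorem assocInv₁_bal (b : B) (m : M.carrier) (y : (N.tensor P).carrier) :
    M.assocInv₁ N P (M.right (op b) m) y = M.assocInv₁ N P m ((N.tensor P).left b y) :=
  ten_ext (φ := M.assocInv₁ N P (M.right (op b) m))
    (ψ := M.assocInv₁ N P m ∘ₗ (N.tensor P).left b)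
    (fun n p => by
      rw [LinearMap.comp_apply, left_ten, assocInv₁_ten, assocInv₁_ten, ten_bal]) y

/-- `m ⊗ (n ⊗ p) ↦ (m ⊗ n) ⊗ p`. -/
def assocInv : (M.tensor (N.tensor P)).carrier →ₗ[k] ((M.tensor N).tensor P).carrier :=
  tlift (M.assocInv₁ N P) (M.assocInv₁_bal N P)

theorem assocInv_ten (m : M.carrier) (n : N.carrier) (p : P.carrier) :
    M.assocInv N P (M.ten (N.tensor P) m (N.ten P n p)) = (M.tensor N).ten P (M.ten N m n) p :=
  (tlift_ten (M.assocInv₁ N P) (M.assocInv₁_bal N P) m (N.ten P n p)).trans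
    (M.assocInv₁_ten N P m n p)

theorem assocLin_left (b : B) (x : ((M.tensor N).tensor P).carrier) :
    M.assocLin N P (((M.tensor N).tensor P).left b x)
      = (M.tensor (N.tensor P)).left b (M.assocLin N P x) :=
  ten_ext₃ (φ := M.assocLin N P ∘ₗ ((M.tensor N).tensor P).left b)
    (ψ := (M.tensor (N.tensor P)).left b ∘ₗ M.assocLin N P)
    (fun m n p => by
      rw [LinearMap.comp_apply, LinearMap.comp_apply, left_ten, left_ten, assocLin_ten,
        assocLin_ten, left_ten]) x

theorem assocLin_right (b : Bᵐᵒᵖ) (x : ((M.tensor N).tensor P).carrier) :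
    M.assocLin N P (((M.tensor N).tensor P).right b x)
      = (M.tensor (N.tensor P)).right b (M.assocLin N P x) :=
  ten_ext₃ (φ := M.assocLin N P ∘ₗ ((M.tensor N).tensor P).right b)
    (ψ := (M.tensor (N.tensor P)).right b ∘ₗ M.assocLin N P)
    (fun m n p => by
      rw [LinearMap.comp_apply, LinearMap.comp_apply, right_ten, assocLin_ten,
        assocLin_ten, right_ten, right_ten]) x

theorem diamMap_assoc_fst (Z : L) (p : P.carrier) (m : M.carrier) (w : H.Diam N.left) :
    H.diamMap (M.assocLin N P) (M.assocLin_left N P)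
        (((M.tensor N).cod P).fst Z p ((M.cod N).pair m w))
      = (M.cod (N.tensor P)).pair m ((N.cod P).fst Z p w) :=
  (M.cod N).comp_pair (M.cod (N.tensor P))
    (H.diamMap (M.assocLin N P) (M.assocLin_left N P) ∘ₗ ((M.tensor N).cod P).fst Z p)
    ((N.cod P).fst Z p) (· * Z) (fun n => N.ten P n p)
    (fun Y n => N.fst_cod_dmul P Z p Y n)
    (fun X Y m n => by
      rw [LinearMap.comp_apply, fst_cod_dmul, EnvRing.diamMap_dmul, assocLin_ten,
        LinearMap.mul_apply', LinearMap.mul_apply', mul_assoc]) m w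

theorem diamMap_assoc_pair (m : M.carrier) (n : N.carrier) (v : H.Diam P.left) :
    H.diamMap (M.assocLin N P) (M.assocLin_left N P) (((M.tensor N).cod P).pair (M.ten N m n) v)
      = (M.cod (N.tensor P)).pair m ((N.cod P).pair n v) :=
  BalTensor.hom_ext_apply
    (φ := H.diamMap (M.assocLin N P) (M.assocLin_left N P) ∘ₗ
      ((M.tensor N).cod P).pair (M.ten N m n))
    (ψ := (M.cod (N.tensor P)).pair m ∘ₗ (N.cod P).pair n)
    (fun Z p => by
      rw [LinearMap.comp_apply, LinearMap.comp_apply, Balanced.pair_dmul, Balanced.pair_dmul,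
        coact_ten, diamMap_assoc_fst]) v

theorem assocLin_coact (x : ((M.tensor N).tensor P).carrier) :
    (M.tensor (N.tensor P)).coact (M.assocLin N P x)
      = H.diamMap (M.assocLin N P) (M.assocLin_left N P) (((M.tensor N).tensor P).coact x) :=
  ten_ext₃ (φ := (M.tensor (N.tensor P)).coact ∘ₗ M.assocLin N P)
    (ψ := H.diamMap (M.assocLin N P) (M.assocLin_left N P) ∘ₗ ((M.tensor N).tensor P).coact)
    (fun m n p => by
      rw [LinearMap.comp_apply, LinearMap.comp_apply, assocLin_ten, coact_ten, coact_ten,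
        coact_ten, diamMap_assoc_pair]) x

/-- `(m ⊗ n) ⊗ p ↦ m ⊗ (n ⊗ p)`, as a morphism of comodules. -/
def assocHom : (M.tensor N).tensor P ⟶ M.tensor (N.tensor P) :=
  Hom.mk (M.assocLin N P) (M.assocLin_left N P) (M.assocLin_right N P) (M.assocLin_coact N P)

/-- The associativity constraint. -/
def assocIso : (M.tensor N).tensor P ≅ M.tensor (N.tensor P) :=
  isoOfInv (M.assocHom N P) (M.assocInv N P)
    (fun x => ten_ext₃ (φ := M.assocInv N P ∘ₗ M.assocLin N P) (ψ := LinearMap.id)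
      (fun m n p => by
        rw [LinearMap.comp_apply, assocLin_ten, assocInv_ten, LinearMap.id_apply]) x)
    (fun x => ten_ext₃' (φ := M.assocLin N P ∘ₗ M.assocInv N P) (ψ := LinearMap.id)
      (fun m n p => by
        rw [LinearMap.comp_apply, assocInv_ten, assocLin_ten, LinearMap.id_apply]) x)

theorem lin_assocIso (m : M.carrier) (n : N.carrier) (p : P.carrier) :
    lin (M.assocIso N P).hom ((M.tensor N).ten P (M.ten N m n) p)
      = M.ten (N.tensor P) m (N.ten P n p) := M.assocLin_ten N P m n p

end Associator

section Unitors

variable (H) in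
/-- The identification of `B` with the underlying module of the unit comodule. -/
def ofB : B →ₗ[k] (unit H).carrier := LinearMap.id

variable (H) in
/-- The identification of the underlying module of the unit comodule with `B`. -/
def toB : (unit H).carrier →ₗ[k] B := LinearMap.id

theorem toB_ofB (b : B) : toB H (ofB H b) = b := rfl
theorem ofB_toB (x : (unit H).carrier) : ofB H (toB H x) = x := rfl
theorem toB_left (b : B) (x : (unit H).carrier) : toB H ((unit H).left b x) = b * toB H x := rfl
theorem toB_right (b : Bᵐᵒᵖ) (x : (unit H).carrier) :
    toB H ((unit H).right b x) = toB H x * unop b := rfl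
theorem left_ofB (b : B) (x : B) : (unit H).left b (ofB H x) = ofB H (b * x) := rfl
theorem right_ofB (b : Bᵐᵒᵖ) (x : B) : (unit H).right b (ofB H x) = ofB H (x * unop b) := rfl
theorem unit_coact (b : (unit H).carrier) :
    (unit H).coact b = H.dmul (unit H).left (H.s (toB H b)) (ofB H 1) := rfl

/-- `(b, m) ↦ b m`. -/
def leftUnitAux : (unit H).carrier →ₗ[k] M.carrier →ₗ[k] M.carrier :=
  M.left.toLinearMap ∘ₗ toB H

theorem leftUnitAux_apply (b : (unit H).carrier) (m : M.carrier) :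
    M.leftUnitAux b m = M.left (toB H b) m := rfl

theorem leftUnit_bal (b : B) (x : (unit H).carrier) (m : M.carrier) :
    M.leftUnitAux ((unit H).right (op b) x) m = M.leftUnitAux x (M.left b m) := by
  rw [leftUnitAux_apply, leftUnitAux_apply, toB_right, unop_op, map_mul, Module.End.mul_apply]

/-- `b ⊗ m ↦ b m`. -/
def leftUnit : ((unit H).tensor M).carrier →ₗ[k] M.carrier :=
  tlift M.leftUnitAux M.leftUnit_bal

theorem leftUnit_ten (b : (unit H).carrier) (m : M.carrier) :
    M.leftUnit ((unit H).ten M b m) = M.left (toB H b) m :=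
  tlift_ten M.leftUnitAux M.leftUnit_bal b m

theorem leftUnit_left (b : B) (x : ((unit H).tensor M).carrier) :
    M.leftUnit (((unit H).tensor M).left b x) = M.left b (M.leftUnit x) :=
  ten_ext (φ := M.leftUnit ∘ₗ ((unit H).tensor M).left b) (ψ := M.left b ∘ₗ M.leftUnit)
    (fun c m => by
      rw [LinearMap.comp_apply, LinearMap.comp_apply, left_ten, leftUnit_ten, leftUnit_ten,
        toB_left, map_mul, Module.End.mul_apply]) x

theorem leftUnit_right (b : Bᵐᵒᵖ) (x : ((unit H).tensor M).carrier) :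
    M.leftUnit (((unit H).tensor M).right b x) = M.right b (M.leftUnit x) :=
  ten_ext (φ := M.leftUnit ∘ₗ ((unit H).tensor M).right b) (ψ := M.right b ∘ₗ M.leftUnit)
    (fun c m => by
      rw [LinearMap.comp_apply, LinearMap.comp_apply, right_ten, leftUnit_ten, leftUnit_ten,
        M.right_left]) x

theorem leftUnit_pair (b : (unit H).carrier) (v : H.Diam M.left) :
    H.diamMap M.leftUnit M.leftUnit_left (((unit H).cod M).pair b v)
      = H.diamSL M.left (toB H b) v :=
  BalTensor.hom_ext_apply (φ := H.diamMap M.leftUnit M.leftUnit_left ∘ₗ ((unit H).cod M).pair b)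
    (ψ := H.diamSL M.left (toB H b))
    (fun Y m => by
      rw [LinearMap.comp_apply, Balanced.pair_dmul, unit_coact, fst_cod_dmul,
        EnvRing.diamMap_dmul, leftUnit_ten, toB_ofB, map_one, Module.End.one_apply,
        EnvRing.diamSL_dmul]) v

theorem leftUnit_coact (x : ((unit H).tensor M).carrier) : M.coact (M.leftUnit x)
    = H.diamMap M.leftUnit M.leftUnit_left (((unit H).tensor M).coact x) :=
  ten_ext (φ := M.coact ∘ₗ M.leftUnit)
    (ψ := H.diamMap M.leftUnit M.leftUnit_left ∘ₗ ((unit H).tensor M).coact)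
    (fun b m => by
      rw [LinearMap.comp_apply, LinearMap.comp_apply, leftUnit_ten, M.coact_left, coact_ten,
        leftUnit_pair]) x

/-- `b ⊗ m ↦ b m`, as a morphism of comodules. -/
def leftUnitHom : (unit H).tensor M ⟶ M :=
  Hom.mk M.leftUnit M.leftUnit_left M.leftUnit_right M.leftUnit_coact

theorem leftUnit_inv (x : ((unit H).tensor M).carrier) :
    (unit H).ten M (ofB H 1) (M.leftUnit x) = x :=
  ten_ext (φ := (unit H).ten M (ofB H 1) ∘ₗ M.leftUnit) (ψ := LinearMap.id)
    (fun b m => by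
      rw [LinearMap.comp_apply, leftUnit_ten, ← ten_bal, right_ofB, unop_op, one_mul, ofB_toB,
        LinearMap.id_apply]) x

/-- The left unit constraint. -/
def leftUnitIso : (unit H).tensor M ≅ M :=
  isoOfInv M.leftUnitHom ((unit H).ten M (ofB H 1)) M.leftUnit_inv
    (fun m => (M.leftUnit_ten (ofB H 1) m).trans (by rw [toB_ofB, map_one, Module.End.one_apply]))

theorem lin_leftUnitIso (b : (unit H).carrier) (m : M.carrier) :
    lin M.leftUnitIso.hom ((unit H).ten M b m) = M.left (toB H b) m := M.leftUnit_ten b m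

/-- `(m, b) ↦ m b`. -/
def rightUnitAux : M.carrier →ₗ[k] (unit H).carrier →ₗ[k] M.carrier :=
  (M.right.toLinearMap ∘ₗ (opLinearEquiv k (M := B)).toLinearMap ∘ₗ toB H).flip

theorem rightUnitAux_apply (m : M.carrier) (b : (unit H).carrier) :
    M.rightUnitAux m b = M.right (op (toB H b)) m := rfl

theorem rightUnit_bal (b : B) (m : M.carrier) (x : (unit H).carrier) :
    M.rightUnitAux (M.right (op b) m) x = M.rightUnitAux m ((unit H).left b x) := by
  rw [rightUnitAux_apply, rightUnitAux_apply, toB_left, op_mul, map_mul, Module.End.mul_apply]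

/-- `m ⊗ b ↦ m b`. -/
def rightUnit : (M.tensor (unit H)).carrier →ₗ[k] M.carrier :=
  tlift M.rightUnitAux M.rightUnit_bal

theorem rightUnit_ten (m : M.carrier) (b : (unit H).carrier) :
    M.rightUnit (M.ten (unit H) m b) = M.right (op (toB H b)) m :=
  tlift_ten M.rightUnitAux M.rightUnit_bal m b

theorem rightUnit_left (b : B) (x : (M.tensor (unit H)).carrier) :
    M.rightUnit ((M.tensor (unit H)).left b x) = M.left b (M.rightUnit x) :=
  ten_ext (φ := M.rightUnit ∘ₗ (M.tensor (unit H)).left b) (ψ := M.left b ∘ₗ M.rightUnit)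
    (fun m c => by
      rw [LinearMap.comp_apply, LinearMap.comp_apply, left_ten, rightUnit_ten, rightUnit_ten,
        M.right_left]) x

theorem rightUnit_right (b : Bᵐᵒᵖ) (x : (M.tensor (unit H)).carrier) :
    M.rightUnit ((M.tensor (unit H)).right b x) = M.right b (M.rightUnit x) :=
  ten_ext (φ := M.rightUnit ∘ₗ (M.tensor (unit H)).right b) (ψ := M.right b ∘ₗ M.rightUnit)
    (fun m c => by
      rw [LinearMap.comp_apply, LinearMap.comp_apply, right_ten, rightUnit_ten, rightUnit_ten,
        toB_right, op_mul, op_unop, map_mul, Module.End.mul_apply]) x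

theorem rightUnit_fst (b : B) (u : H.Diam M.left) :
    H.diamMap M.rightUnit M.rightUnit_left ((M.cod (unit H)).fst (H.s b) (ofB H 1) u)
      = H.diamSR M.left b u :=
  BalTensor.hom_ext_apply
    (φ := H.diamMap M.rightUnit M.rightUnit_left ∘ₗ (M.cod (unit H)).fst (H.s b) (ofB H 1))
    (ψ := H.diamSR M.left b)
    (fun X m => by
      rw [LinearMap.comp_apply, fst_cod_dmul, EnvRing.diamMap_dmul, rightUnit_ten, toB_ofB, op_one,
        map_one, Module.End.one_apply, EnvRing.diamSR_dmul]) u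

theorem rightUnit_coact (x : (M.tensor (unit H)).carrier) : M.coact (M.rightUnit x)
    = H.diamMap M.rightUnit M.rightUnit_left ((M.tensor (unit H)).coact x) :=
  ten_ext (φ := M.coact ∘ₗ M.rightUnit)
    (ψ := H.diamMap M.rightUnit M.rightUnit_left ∘ₗ (M.tensor (unit H)).coact)
    (fun m b => by
      rw [LinearMap.comp_apply, LinearMap.comp_apply, rightUnit_ten, M.coact_right, coact_ten,
        unit_coact, Balanced.pair_dmul, rightUnit_fst]) x

/-- `m ⊗ b ↦ m b`, as a morphism of comodules. -/
def rightUnitHom : M.tensor (unit H) ⟶ M :=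
  Hom.mk M.rightUnit M.rightUnit_left M.rightUnit_right M.rightUnit_coact

theorem rightUnit_inv (x : (M.tensor (unit H)).carrier) :
    (M.ten (unit H)).flip (ofB H 1) (M.rightUnit x) = x :=
  ten_ext (φ := (M.ten (unit H)).flip (ofB H 1) ∘ₗ M.rightUnit) (ψ := LinearMap.id)
    (fun m b => by
      rw [LinearMap.comp_apply, rightUnit_ten, LinearMap.flip_apply, ten_bal, left_ofB, mul_one,
        ofB_toB, LinearMap.id_apply]) x

/-- The right unit constraint. -/
def rightUnitIso : M.tensor (unit H) ≅ M :=
  isoOfInv M.rightUnitHom ((M.ten (unit H)).flip (ofB H 1)) M.rightUnit_inv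
    (fun m => (M.rightUnit_ten m (ofB H 1)).trans
      (by rw [toB_ofB, op_one, map_one, Module.End.one_apply]))

theorem lin_rightUnitIso (m : M.carrier) (b : (unit H).carrier) :
    lin M.rightUnitIso.hom (M.ten (unit H) m b) = M.right (op (toB H b)) m := M.rightUnit_ten m b

end Unitors

variable {M N P} in
theorem hom_ten_ext {f g : M.tensor N ⟶ P}
    (h : ∀ m n, lin f (M.ten N m n) = lin g (M.ten N m n)) : f = g :=
  hom_ext (ten_ext h)

/-- The monoidal structure `⊗_B` on left comodules. -/
instance : MonoidalCategoryStruct H.Comodule where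
  tensorObj M N := M.tensor N
  whiskerLeft M _ _ g := tensorHom (𝟙 M) g
  whiskerRight f N := tensorHom f (𝟙 N)
  tensorHom f g := tensorHom f g
  tensorUnit := unit H
  associator M N P := M.assocIso N P
  leftUnitor M := M.leftUnitIso
  rightUnitor M := M.rightUnitIso

/-- The monoidal category of left comodules. -/
instance : MonoidalCategory H.Comodule :=
  MonoidalCategory.ofTensorHom
    (fun M N => hom_ten_ext (P := M.tensor N) (fun m n => (lin_tensorHom_ten M N (𝟙 M) (𝟙 N) m n)))
    (fun _ _ _ _ => rfl) (fun _ _ => rfl)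
    (fun {M₁ N₁ P₁ M₂ N₂ P₂} f₁ f₂ g₁ g₂ => hom_ten_ext (M := M₁) (N := M₂) (P := P₁.tensor P₂)
      (fun m n => by
        refine (lin_comp (tensorHom f₁ f₂) (tensorHom g₁ g₂) _).trans ?_
        refine Eq.trans ?_ (lin_tensorHom_ten M₁ M₂ (f₁ ≫ g₁) (f₂ ≫ g₂) m n).symm
        rw [lin_tensorHom_ten, lin_tensorHom_ten, lin_comp, lin_comp]))
    (fun {M₁ M₂ M₃ N₁ N₂ N₃} f g h => hom_ext (ten_ext₃ (fun m n p => by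
        refine (lin_comp (tensorHom (tensorHom f g) h) (N₁.assocIso N₂ N₃).hom _).trans ?_
        refine Eq.trans ?_ (lin_comp (M₁.assocIso M₂ M₃).hom (tensorHom f (tensorHom g h))
          _).symm
        rw [lin_tensorHom_ten, lin_tensorHom_ten, lin_assocIso, lin_assocIso, lin_tensorHom_ten,
          lin_tensorHom_ten])))
    (fun {M N} f => hom_ten_ext (M := unit H) (fun b m => by
        refine (lin_comp (tensorHom (𝟙 (unit H)) f) N.leftUnitIso.hom _).trans ?_
        refine Eq.trans ?_ (lin_comp M.leftUnitIso.hom f _).symm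
        rw [lin_tensorHom_ten, lin_leftUnitIso, lin_leftUnitIso, lin_left, lin_id]))
    (fun {M N} f => hom_ten_ext (N := unit H) (fun m b => by
        refine (lin_comp (tensorHom f (𝟙 (unit H))) N.rightUnitIso.hom _).trans ?_
        refine Eq.trans ?_ (lin_comp M.rightUnitIso.hom f _).symm
        rw [lin_tensorHom_ten, lin_rightUnitIso, lin_rightUnitIso, lin_right, lin_id]))
    (fun M N P Q => hom_ten_ext (M := (M.tensor N).tensor P) (N := Q) (fun x q =>
      ten_ext₃ (φ := lin (tensorHom (M.assocIso N P).hom (𝟙 Q) ≫ (M.assocIso (N.tensor P) Q).hom ≫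
          tensorHom (𝟙 M) (N.assocIso P Q).hom) ∘ₗ (((M.tensor N).tensor P).ten Q).flip q)
        (ψ := lin (((M.tensor N).assocIso P Q).hom ≫ (M.assocIso N (P.tensor Q)).hom) ∘ₗ
          (((M.tensor N).tensor P).ten Q).flip q)
        (fun m n p => by
          rw [LinearMap.comp_apply, LinearMap.comp_apply, LinearMap.flip_apply, lin_comp, lin_comp,
            lin_comp, lin_tensorHom_ten, lin_assocIso, lin_assocIso, lin_assocIso, lin_id,
            lin_assocIso, lin_tensorHom_ten, lin_assocIso, lin_id]) x))
    (fun M N => hom_ext (ten_ext₃ (N := unit H) (fun m b n => by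
        refine (lin_comp (M.assocIso (unit H) N).hom (tensorHom (𝟙 M) N.leftUnitIso.hom)
          _).trans ?_
        refine Eq.trans ?_ (lin_tensorHom_ten (M.tensor (unit H)) N M.rightUnitIso.hom (𝟙 N)
          _ _).symm
        rw [lin_assocIso, lin_tensorHom_ten, lin_leftUnitIso, lin_rightUnitIso, lin_id, lin_id,
          ten_bal])))

end Comodule

/-! ## Left 2-cocycles -/

/-- An element `Γ` of `Hom_{B̄-}(L ⊗_{B̄} L, B)`. -/
structure OpForm where
  toFun : H.OpTensor →ₗ[k] B
  map_target : ∀ b X Y, toFun (H.omul (H.t b * X) Y) = toFun (H.omul X Y) * b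

namespace OpForm

variable {H} (Γ : H.OpForm)

/-- `(X, Y) ↦ Γ(X, Y)`. -/
def form : L →ₗ[k] L →ₗ[k] B := H.omul.compr₂ Γ.toFun

theorem form_t (b : B) (X Y : L) : Γ.form (H.t b * X) Y = Γ.form X Y * b := Γ.map_target b X Y

theorem form_bal (b : B) (X Y : L) : Γ.form (X * H.t b) Y = Γ.form X (H.t b * Y) :=
  congrArg Γ.toFun (H.omul_bal b X Y)

theorem form_s_t (a b : B) (X : L) : Γ.form (H.s a) (H.t b * X) = Γ.form (H.s a) X * b := by
  rw [← form_bal, H.s_t, form_t]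

/-- The product of `L`, as a map on the regular comodule. -/
def regMul : (Comodule.regular H).carrier →ₗ[k] L →ₗ[k] L := LinearMap.mul k L

theorem regMul_left (b : B) (X : (Comodule.regular H).carrier) (Y : L) :
    regMul ((Comodule.regular H).left b X) Y = H.s b * regMul X Y := mul_assoc (H.s b) _ Y

theorem regMul_right (b : B) (X : (Comodule.regular H).carrier) (Y : L) :
    regMul ((Comodule.regular H).right (op b) X) Y = regMul X (H.s b * Y) := mul_assoc _ (H.s b) Y

theorem sL_mul (a b : B) (X : L) : H.sL (a * b) X = H.sL a (H.s b * X) := by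
  rw [map_mul, Module.End.mul_apply, EnvRing.sL_apply H.toEnvRing b]

theorem tw_balanced : (Comodule.regular H).Balanced H.sL Γ.form regMul H.sL.toLinearMap where
  bal_left b X Y m n := by
    rw [form_t, regMul_left]
    exact sL_mul _ _ _
  bal_mid b X Y m n := by rw [form_bal]
  bal_right b X Y m n := by rw [regMul_right, EnvRing.sL_apply]

/-- `(X, Y) ↦ Γ(X₁, Y₁) X₂ Y₂`. -/
def tw : L →ₗ[k] L →ₗ[k] L := Γ.tw_balanced.pair.compl₂ H.comul

end OpForm

/-- A left 2-cocycle. -/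
structure LeftCocycle extends OpForm H where
  cocycle : ∀ X Y Z, toOpForm.form X (toOpForm.tw Y Z) = toOpForm.form (toOpForm.tw X Y) Z
  one_left : ∀ X, toOpForm.form 1 X = H.counit X
  one_right : ∀ X, toOpForm.form X 1 = H.counit X

namespace LeftCocycle

variable {H} (Γ : H.LeftCocycle)

section Eval

variable (g : L →ₗ[k] B) (hg : ∀ b X, g (H.t b * X) = g X * b)

/-- `X ↦ g(X₁) X₂`. -/
def conv : L →ₗ[k] L := H.counitDiam g hg H.sL ∘ₗ H.comul

theorem conv_tL (b : B) (X : L) : conv g hg (H.tL b X) = H.tL b (conv g hg X) := by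
  refine (congrArg (H.counitDiam g hg H.sL) (H.comul_target b X)).trans ?_
  exact BalTensor.hom_ext_apply (φ := H.counitDiam g hg H.sL ∘ₗ H.diamMap (H.tL b) (H.tL_sL b))
    (ψ := H.tL b ∘ₗ H.counitDiam g hg H.sL) (fun X Y => by
      rw [LinearMap.comp_apply, LinearMap.comp_apply, EnvRing.diamMap_dmul,
        EnvRing.counitDiam_dmul, EnvRing.counitDiam_dmul, H.sL_tL]) (H.comul X)

variable (M : H.Comodule)

/-- `X ⋄ m ↦ conv g X ⋄ m`. -/
def convDiam : H.Diam M.left →ₗ[k] H.Diam M.left :=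
  BalTensor.map (f := H.tL) (f' := H.tL) (g := ⇑M.left) (g' := ⇑M.left) (conv g hg) LinearMap.id
    (conv_tL g hg) (fun _ _ => rfl)

theorem convDiam_dmul (X : L) (m : M.carrier) :
    convDiam g hg M (H.dmul M.left X m) = H.dmul M.left (conv g hg X) m :=
  BalTensor.map_tmul (f := H.tL) (f' := H.tL) (g := ⇑M.left) (g' := ⇑M.left) (conv g hg)
    LinearMap.id (conv_tL g hg) (fun _ _ => rfl) X m

theorem diamSL_mul (a b : B) (u : H.Diam M.left) :
    H.diamSL M.left (a * b) u = H.diamSL M.left a (H.diamSL M.left b u) :=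
  BalTensor.hom_ext_apply (φ := H.diamSL M.left (a * b))
    (ψ := H.diamSL M.left a ∘ₗ H.diamSL M.left b)
    (fun X m => by
      rw [LinearMap.comp_apply, EnvRing.diamSL_dmul, EnvRing.diamSL_dmul, EnvRing.diamSL_dmul,
        H.s_mul, mul_assoc]) u

/-- `X ⋄ u ↦ g(X) u` on `L ⋄_B (L ⋄_B M)`. -/
def evalDiam : H.Diam (H.diamSL M.left) →ₗ[k] H.Diam M.left :=
  BalTensor.lift (f := H.tL) (g := H.diamSL M.left)
    (LinearMap.mk₂ k (fun X u => H.diamSL M.left (g X) u)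
      (fun X X' u => BalTensor.hom_ext_apply (ψ := _ + _) (fun Y m => by
        rw [LinearMap.add_apply, EnvRing.diamSL_dmul, EnvRing.diamSL_dmul, EnvRing.diamSL_dmul,
          map_add, map_add, add_mul, map_add, LinearMap.add_apply]) u)
      (fun c X u => BalTensor.hom_ext_apply (ψ := c • _) (fun Y m => by
        rw [LinearMap.smul_apply, EnvRing.diamSL_dmul, EnvRing.diamSL_dmul,
          map_smul, map_smul, smul_mul_assoc, map_smul, LinearMap.smul_apply]) u)
      (fun X u u' => map_add _ u u') (fun c X u => map_smul _ c u))
    (fun b X u => by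
      rw [LinearMap.mk₂_apply, LinearMap.mk₂_apply, EnvRing.tL_apply, hg, diamSL_mul])

theorem evalDiam_dmul (X : L) (u : H.Diam M.left) :
    evalDiam g hg M (H.dmul (H.diamSL M.left) X u) = H.diamSL M.left (g X) u :=
  BalTensor.lift_tmul (f := H.tL) (g := H.diamSL M.left) _ _ X u

/-- `m ↦ g(m₋₁) m₀`. -/
def act : Module.End k M.carrier := H.counitDiam g hg M.left ∘ₗ M.coact

theorem evalDiam_comulDiam (u : H.Diam M.left) :
    evalDiam g hg M (H.comulDiam H.comul H.comul_target M.left u) = convDiam g hg M u :=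
  BalTensor.hom_ext_apply
    (φ := evalDiam g hg M ∘ₗ H.comulDiam H.comul H.comul_target M.left) (ψ := convDiam g hg M)
    (fun X m => by
      rw [LinearMap.comp_apply, EnvRing.comulDiam_dmul, convDiam_dmul]
      exact BalTensor.hom_ext_apply (φ := evalDiam g hg M ∘ₗ H.diamInsert M.left m)
        (ψ := (H.dmul M.left).flip m ∘ₗ H.counitDiam g hg H.sL)
        (fun X Y => by
          rw [LinearMap.comp_apply, LinearMap.comp_apply, EnvRing.diamInsert_dmul, evalDiam_dmul,
            EnvRing.diamSL_dmul, EnvRing.counitDiam_dmul, LinearMap.flip_apply,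
            EnvRing.sL_apply]) (H.comul X)) u

theorem coact_act (m : M.carrier) : M.coact (act g hg M m) = convDiam g hg M (M.coact m) := by
  rw [← evalDiam_comulDiam, ← M.coassoc]
  exact BalTensor.hom_ext_apply (φ := M.coact ∘ₗ H.counitDiam g hg M.left)
    (ψ := evalDiam g hg M ∘ₗ H.diamMap M.coact M.coact_left)
    (fun X m => by
      rw [LinearMap.comp_apply, LinearMap.comp_apply, EnvRing.diamMap_dmul, evalDiam_dmul,
        EnvRing.counitDiam_dmul, M.coact_left]) (M.coact m)

end Eval

theorem form_flip_t (a b : B) (X : L) :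
    Γ.form.flip (H.s a) (H.t b * X) = Γ.form.flip (H.s a) X * b := Γ.form_t b X (H.s a)

theorem conv_left (b : B) (X : L) : conv (Γ.form (H.s b)) (Γ.form_s_t b) X = Γ.tw (H.s b) X :=
  BalTensor.hom_ext_apply (φ := H.counitDiam (Γ.form (H.s b)) (Γ.form_s_t b) H.sL)
    (ψ := Γ.tw_balanced.pair (H.s b)) (fun Y Z => by
      rw [EnvRing.counitDiam_dmul]
      refine Eq.symm ((Γ.tw_balanced.pair_dmul (H.s b) Y Z).trans ?_)
      refine (congrArg (Γ.tw_balanced.fst Y Z) (H.comul_s b)).trans ?_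
      refine (Γ.tw_balanced.fst_dmul Y Z (H.s b) (1 : L)).trans ?_
      exact congrArg (H.sL (Γ.form (H.s b) Y)) (one_mul Z)) (H.comul X)

theorem conv_right (b : B) (X : L) :
    conv (Γ.form.flip (H.s b)) (Γ.form_flip_t b) X = Γ.tw X (H.s b) := by
  refine Eq.trans ?_ (congrArg (Γ.tw_balanced.pair X) (H.comul_s b)).symm
  refine Eq.trans ?_ (Γ.tw_balanced.pair_dmul X (H.s b) 1).symm
  exact BalTensor.hom_ext_apply
    (φ := H.counitDiam (Γ.form.flip (H.s b)) (Γ.form_flip_t b) H.sL)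
    (ψ := Γ.tw_balanced.fst (H.s b) 1) (fun Y Z => by
      rw [EnvRing.counitDiam_dmul]
      refine Eq.symm ((Γ.tw_balanced.fst_dmul (H.s b) 1 Y Z).trans ?_)
      exact congrArg (H.sL (Γ.form Y (H.s b))) (mul_one Z)) (H.comul X)

section Sharp

variable (M N : H.Comodule)

/-- The action `b ·_Γ m = Γ(b, m₋₁) m₀` of `B^Γ`. -/
def twL (b : B) : Module.End k M.carrier := act (Γ.form (H.s b)) (Γ.form_s_t b) M

/-- The action `m ·_Γ b = Γ(m₋₁, b) m₀` of `B^Γ`. -/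
def twR (b : B) : Module.End k M.carrier := act (Γ.form.flip (H.s b)) (Γ.form_flip_t b) M

theorem sharp_balanced :
    M.Balanced N.left Γ.form (M.ten N) (M.tensor N).left.toLinearMap where
  bal_left b X Y m n := by
    rw [Γ.form_t, ← Comodule.left_ten, AlgHom.toLinearMap_apply, AlgHom.toLinearMap_apply, map_mul,
      Module.End.mul_apply]
  bal_mid b X Y m n := by rw [Γ.form_bal]
  bal_right b X Y m n := by rw [Comodule.ten_bal]

/-- `(m, n) ↦ Γ(m₋₁, n₋₁) m₀ ⊗ n₀`. -/
def sharp₀ : M.carrier →ₗ[k] N.carrier →ₗ[k] (M.tensor N).carrier :=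
  (Γ.sharp_balanced M N).pair.compl₂ N.coact

theorem sharp₀_apply (m : M.carrier) (n : N.carrier) :
    Γ.sharp₀ M N m n = (Γ.sharp_balanced M N).pair m (N.coact n) := rfl

theorem fst_convDiam (b : B) (Y : L) (n : N.carrier) (u : H.Diam M.left) :
    (Γ.sharp_balanced M N).fst Y n (convDiam (Γ.form.flip (H.s b)) (Γ.form_flip_t b) M u)
      = (Γ.sharp_balanced M N).fst (Γ.tw (H.s b) Y) n u :=
  BalTensor.hom_ext_apply
    (φ := (Γ.sharp_balanced M N).fst Y n ∘ₗ convDiam (Γ.form.flip (H.s b)) (Γ.form_flip_t b) M)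
    (ψ := (Γ.sharp_balanced M N).fst (Γ.tw (H.s b) Y) n)
    (fun X m => by
      rw [LinearMap.comp_apply, convDiam_dmul, Comodule.Balanced.fst_dmul,
        Comodule.Balanced.fst_dmul, conv_right, Γ.cocycle]) u

theorem pair_convDiam (b : B) (m : M.carrier) (v : H.Diam N.left) :
    (Γ.sharp_balanced M N).pair (Γ.twR M b m) v
      = (Γ.sharp_balanced M N).pair m (convDiam (Γ.form (H.s b)) (Γ.form_s_t b) N v) :=
  BalTensor.hom_ext_apply
    (φ := (Γ.sharp_balanced M N).pair (Γ.twR M b m))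
    (ψ := (Γ.sharp_balanced M N).pair m ∘ₗ convDiam (Γ.form (H.s b)) (Γ.form_s_t b) N)
    (fun Y n => by
      rw [LinearMap.comp_apply, convDiam_dmul, Comodule.Balanced.pair_dmul,
        Comodule.Balanced.pair_dmul, conv_left]
      refine (congrArg _ (coact_act (Γ.form.flip (H.s b)) (Γ.form_flip_t b) M m)).trans ?_
      exact Γ.fst_convDiam M N b Y n (M.coact m)) v

theorem sharp₀_bal (b : B) (m : M.carrier) (n : N.carrier) :
    Γ.sharp₀ M N (Γ.twR M b m) n = Γ.sharp₀ M N m (Γ.twL N b n) := by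
  rw [sharp₀_apply, sharp₀_apply, pair_convDiam]
  exact congrArg _ (coact_act (Γ.form (H.s b)) (Γ.form_s_t b) N n).symm

/-- The map `Γ^# : M ⊗_{B^Γ} N → M ⊗_B N`, `m ⊗ n ↦ Γ(m₋₁, n₋₁) m₀ ⊗ n₀`. -/
def sharp : BalTensor (Γ.twR M) (Γ.twL N) →ₗ[k] (M.tensor N).carrier :=
  BalTensor.lift (Γ.sharp₀ M N) (Γ.sharp₀_bal M N)

end Sharp

/-- A left 2-cocycle `Γ` is invertible if `Γ^#` is bijective for all left comodules. -/
def IsInvertible : Prop := ∀ M N : H.Comodule, Function.Bijective (Γ.sharp M N)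

/-! ## The cotwist -/

section Cotwist

variable (hH : H.IsLeftHopf)

/-- `D ⊗ E ↦ A D Γ(E, C)‾` on `L ⊗_{B̄} L`. -/
def prodAux (A C : L) : H.OpTensor →ₗ[k] L :=
  BalTensor.lift
    (LinearMap.mk₂ k (fun D E => A * D * H.t (Γ.form E C))
      (fun D D' E => by rw [mul_add, add_mul])
      (fun c D E => by rw [mul_smul_comm, smul_mul_assoc])
      (fun D E E' => by rw [map_add, LinearMap.add_apply, map_add, mul_add])
      (fun c D E => by rw [map_smul, LinearMap.smul_apply, map_smul, mul_smul_comm]))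
    (fun b D E => by
      rw [LinearMap.mk₂_apply, LinearMap.mk₂_apply, EnvRing.tR_apply, EnvRing.tL_apply, Γ.form_t,
        H.t_mul, mul_assoc, mul_assoc, mul_assoc])

theorem prodAux_omul (A C D E : L) :
    Γ.prodAux A C (H.omul D E) = A * D * H.t (Γ.form E C) := BalTensor.lift_tmul _ _ D E

/-- `(A, C) ↦ A D Γ(E, C)‾` for fixed `y = D ⊗ E`. -/
def prodAux₂ (y : H.OpTensor) : L →ₗ[k] L →ₗ[k] L :=
  LinearMap.mk₂ k (fun A C => Γ.prodAux A C y)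
    (fun A A' C => BalTensor.hom_ext_apply (ψ := _ + _) (fun D E => by
      rw [LinearMap.add_apply, prodAux_omul, prodAux_omul, prodAux_omul, add_mul, add_mul]) y)
    (fun c A C => BalTensor.hom_ext_apply (ψ := c • _) (fun D E => by
      rw [LinearMap.smul_apply, prodAux_omul, prodAux_omul, smul_mul_assoc, smul_mul_assoc]) y)
    (fun A C C' => BalTensor.hom_ext_apply (ψ := _ + _) (fun D E => by
      rw [LinearMap.add_apply, prodAux_omul, prodAux_omul, prodAux_omul, map_add, map_add,
        mul_add]) y)
    (fun c A C => BalTensor.hom_ext_apply (ψ := c • _) (fun D E => by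
      rw [LinearMap.smul_apply, prodAux_omul, prodAux_omul, map_smul, map_smul,
        mul_smul_comm]) y)

theorem prodAux₂_apply (y : H.OpTensor) (A C : L) : Γ.prodAux₂ y A C = Γ.prodAux A C y := rfl

theorem prodAux₂_bal (Y : L) (b : B) (A C : L) :
    Γ.prodAux₂ (H.transl hH Y) (H.tR b A) C = Γ.prodAux₂ (H.transl hH Y) A (H.tL b C) := by
  rw [prodAux₂_apply, prodAux₂_apply]
  have h1 : ∀ y, Γ.prodAux (H.tR b A) C y
      = Γ.prodAux A C (H.omap (H.tL b) LinearMap.id (H.tL_tR b) (fun _ _ => rfl) y) := fun y =>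
    BalTensor.hom_ext_apply (φ := Γ.prodAux (H.tR b A) C)
      (ψ := Γ.prodAux A C ∘ₗ H.omap (H.tL b) LinearMap.id (H.tL_tR b) (fun _ _ => rfl))
      (fun D E => by
        rw [LinearMap.comp_apply, BalTensor.map_tmul, prodAux_omul, prodAux_omul, EnvRing.tR_apply,
          EnvRing.tL_apply, LinearMap.id_apply, mul_assoc A]) y
  have h2 : ∀ y, Γ.prodAux A (H.tL b C) y
      = Γ.prodAux A C (H.omap LinearMap.id (H.tR b) (fun _ _ => rfl) (H.tR_tL' b) y) := fun y =>
    BalTensor.hom_ext_apply (φ := Γ.prodAux A (H.tL b C))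
      (ψ := Γ.prodAux A C ∘ₗ H.omap LinearMap.id (H.tR b) (fun _ _ => rfl) (H.tR_tL' b))
      (fun D E => by
        rw [LinearMap.comp_apply, BalTensor.map_tmul, prodAux_omul, prodAux_omul, EnvRing.tR_apply,
          EnvRing.tL_apply, LinearMap.id_apply, Γ.form_bal]) y
  rw [h1, h2, H.transl_bal]

/-- `A ⊗ C ↦ A Y₊ Γ(Y₋, C)‾` on `L ⊗_{B̄} L`. -/
noncomputable def prodOp (Y : L) : H.OpTensor →ₗ[k] L :=
  BalTensor.lift (Γ.prodAux₂ (H.transl hH Y)) (Γ.prodAux₂_bal hH Y)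

theorem prodOp_omul (Y A C : L) :
    Γ.prodOp hH Y (H.omul A C) = Γ.prodAux A C (H.transl hH Y) :=
  BalTensor.lift_tmul (Γ.prodAux₂ (H.transl hH Y)) (Γ.prodAux₂_bal hH Y) A C

/-- `(X, Y) ↦ X₊ Y₊ Γ(Y₋, X₋)‾`. -/
noncomputable def prod : L →ₗ[k] L →ₗ[k] L :=
  LinearMap.mk₂ k (fun X Y => Γ.prodOp hH Y (H.transl hH X))
    (fun X X' Y => by rw [map_add, map_add])
    (fun c X Y => by rw [map_smul, map_smul])
    (fun X Y Y' => BalTensor.hom_ext_apply (ψ := _ + _) (fun A C => by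
      rw [LinearMap.add_apply, prodOp_omul, prodOp_omul, prodOp_omul, map_add, map_add])
      (H.transl hH X))
    (fun c X Y => BalTensor.hom_ext_apply (ψ := c • _) (fun A C => by
      rw [LinearMap.smul_apply, prodOp_omul, prodOp_omul, map_smul, map_smul]) (H.transl hH X))

theorem prod_apply (X Y : L) : Γ.prod hH X Y = Γ.prodOp hH Y (H.transl hH X) := rfl

theorem prod_s_mul (b : B) (X Y : L) : Γ.prod hH (H.s b * X) Y = H.s b * Γ.prod hH X Y := by
  rw [prod_apply, prod_apply, H.transl_s_mul]
  refine BalTensor.hom_ext_apply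
    (φ := Γ.prodOp hH Y ∘ₗ H.omap (H.sL b) LinearMap.id (H.sL_tR b) (fun _ _ => rfl))
    (ψ := H.sL b ∘ₗ Γ.prodOp hH Y) (fun A C => ?_) (H.transl hH X)
  rw [LinearMap.comp_apply, LinearMap.comp_apply, BalTensor.map_tmul, prodOp_omul, prodOp_omul,
    LinearMap.id_apply]
  refine BalTensor.hom_ext_apply (φ := Γ.prodAux (H.sL b A) C) (ψ := H.sL b ∘ₗ Γ.prodAux A C)
    (fun D E => ?_) (H.transl hH Y)
  rw [LinearMap.comp_apply, prodAux_omul, prodAux_omul, EnvRing.sL_apply, EnvRing.sL_apply,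
    mul_assoc, mul_assoc, mul_assoc]

theorem prod_mul_s (b : B) (X Y : L) : Γ.prod hH (X * H.s b) Y = Γ.prod hH X (H.s b * Y) := by
  rw [prod_apply, prod_apply, H.transl_mul_s]
  refine BalTensor.hom_ext_apply
    (φ := Γ.prodOp hH Y ∘ₗ H.omap (H.sR b) LinearMap.id (H.sR_tR b) (fun _ _ => rfl))
    (ψ := Γ.prodOp hH (H.s b * Y)) (fun A C => ?_) (H.transl hH X)
  rw [LinearMap.comp_apply, BalTensor.map_tmul, prodOp_omul, prodOp_omul, LinearMap.id_apply,
    H.transl_s_mul]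
  refine BalTensor.hom_ext_apply (φ := Γ.prodAux (H.sR b A) C)
    (ψ := Γ.prodAux A C ∘ₗ H.omap (H.sL b) LinearMap.id (H.sL_tR b) (fun _ _ => rfl))
    (fun D E => ?_) (H.transl hH Y)
  rw [LinearMap.comp_apply, BalTensor.map_tmul, prodAux_omul, prodAux_omul, EnvRing.sL_apply,
    EnvRing.sR_apply, LinearMap.id_apply, mul_assoc A]

/-- `prod`, as a map on the regular comodule. -/
noncomputable def regProd : (Comodule.regular H).carrier →ₗ[k] L →ₗ[k] L := Γ.prod hH

theorem regProd_left (b : B) (X : (Comodule.regular H).carrier) (Y : L) :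
    Γ.regProd hH ((Comodule.regular H).left b X) Y = H.s b * Γ.regProd hH X Y :=
  Γ.prod_s_mul hH b X Y

theorem regProd_right (b : B) (X : (Comodule.regular H).carrier) (Y : L) :
    Γ.regProd hH ((Comodule.regular H).right (op b) X) Y = Γ.regProd hH X (H.s b * Y) :=
  Γ.prod_mul_s hH b X Y

theorem twMul_balanced :
    (Comodule.regular H).Balanced H.sL Γ.form (Γ.regProd hH) H.sL.toLinearMap where
  bal_left b X Y m n := by
    rw [Γ.form_t, regProd_left]
    exact OpForm.sL_mul _ _ _
  bal_mid b X Y m n := by rw [Γ.form_bal]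
  bal_right b X Y m n := by rw [regProd_right, EnvRing.sL_apply]

/-- The twisted product `X ·_Γ Y = Γ(X₁, Y₁) X₂₊ Y₂₊ Γ(Y₂₋, X₂₋)‾`. -/
noncomputable def twMul : L →ₗ[k] L →ₗ[k] L := (Γ.twMul_balanced hH).pair.compl₂ H.comul

/-- The twisted counit `X ↦ Γ(X₊, X₋)`. -/
noncomputable def twCounit : L →ₗ[k] B := Γ.toFun ∘ₗ H.transl hH

variable (M : H.Comodule)

/-- `A ⊗ C ↦ A Γ(C, Y)‾ ⋄ m` on `L ⊗_{B̄} L`. -/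
def sharpAux (Y : L) (m : M.carrier) : H.OpTensor →ₗ[k] H.Diam M.left :=
  BalTensor.lift
    (LinearMap.mk₂ k (fun A C => H.dmul M.left (A * H.t (Γ.form C Y)) m)
      (fun A A' C => by rw [add_mul, map_add, LinearMap.add_apply])
      (fun c A C => by rw [smul_mul_assoc, map_smul, LinearMap.smul_apply])
      (fun A C C' => by
        rw [map_add, LinearMap.add_apply, map_add, mul_add, map_add, LinearMap.add_apply])
      (fun c A C => by
        rw [map_smul, LinearMap.smul_apply, map_smul, mul_smul_comm, map_smul,
          LinearMap.smul_apply]))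
    (fun b A C => by
      rw [LinearMap.mk₂_apply, LinearMap.mk₂_apply, EnvRing.tR_apply, EnvRing.tL_apply, Γ.form_t,
        H.t_mul, mul_assoc])

theorem sharpAux_omul (Y : L) (m : M.carrier) (A C : L) :
    Γ.sharpAux M Y m (H.omul A C) = H.dmul M.left (A * H.t (Γ.form C Y)) m :=
  BalTensor.lift_tmul _ _ A C

/-- `(Y, m) ↦ A Γ(C, Y)‾ ⋄ m` for fixed `x = A ⊗ C`. -/
def sharpAux₂ (x : H.OpTensor) : L →ₗ[k] M.carrier →ₗ[k] H.Diam M.left :=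
  LinearMap.mk₂ k (fun Y m => Γ.sharpAux M Y m x)
    (fun Y Y' m => BalTensor.hom_ext_apply (ψ := _ + _) (fun A C => by
      rw [LinearMap.add_apply, sharpAux_omul, sharpAux_omul, sharpAux_omul, map_add, map_add,
        mul_add, map_add, LinearMap.add_apply]) x)
    (fun c Y m => BalTensor.hom_ext_apply (ψ := c • _) (fun A C => by
      rw [LinearMap.smul_apply, sharpAux_omul, sharpAux_omul, map_smul, map_smul, mul_smul_comm,
        map_smul, LinearMap.smul_apply]) x)
    (fun Y m m' => BalTensor.hom_ext_apply (ψ := _ + _) (fun A C => by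
      rw [LinearMap.add_apply, sharpAux_omul, sharpAux_omul, sharpAux_omul, map_add]) x)
    (fun c Y m => BalTensor.hom_ext_apply (ψ := c • _) (fun A C => by
      rw [LinearMap.smul_apply, sharpAux_omul, sharpAux_omul, map_smul]) x)

theorem sharpAux₂_apply (x : H.OpTensor) (Y : L) (m : M.carrier) :
    Γ.sharpAux₂ M x Y m = Γ.sharpAux M Y m x := rfl

theorem sharpAux₂_bal (X : L) (b : B) (Y : L) (m : M.carrier) :
    Γ.sharpAux₂ M (H.transl hH X) (H.tL b Y) m
      = Γ.sharpAux₂ M (H.transl hH X) Y (M.left b m) := by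
  rw [sharpAux₂_apply, sharpAux₂_apply]
  have h1 : ∀ x, Γ.sharpAux M (H.tL b Y) m x
      = Γ.sharpAux M Y m (H.omap LinearMap.id (H.tR b) (fun _ _ => rfl) (H.tR_tL' b) x) := fun x =>
    BalTensor.hom_ext_apply (φ := Γ.sharpAux M (H.tL b Y) m)
      (ψ := Γ.sharpAux M Y m ∘ₗ H.omap LinearMap.id (H.tR b) (fun _ _ => rfl) (H.tR_tL' b))
      (fun A C => by
        rw [LinearMap.comp_apply, BalTensor.map_tmul, sharpAux_omul, sharpAux_omul,
          EnvRing.tR_apply, EnvRing.tL_apply, LinearMap.id_apply, Γ.form_bal]) x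
  have h2 : ∀ x, Γ.sharpAux M Y (M.left b m) x
      = Γ.sharpAux M Y m (H.omap (H.tL b) LinearMap.id (H.tL_tR b) (fun _ _ => rfl) x) := fun x =>
    BalTensor.hom_ext_apply (φ := Γ.sharpAux M Y (M.left b m))
      (ψ := Γ.sharpAux M Y m ∘ₗ H.omap (H.tL b) LinearMap.id (H.tL_tR b) (fun _ _ => rfl))
      (fun A C => by
        rw [LinearMap.comp_apply, BalTensor.map_tmul, sharpAux_omul, sharpAux_omul,
          EnvRing.tL_apply, LinearMap.id_apply, mul_assoc, H.dmul_bal]) x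
  rw [h1, h2, H.transl_bal]

/-- `Y ⋄ m ↦ X₊ Γ(X₋, Y)‾ ⋄ m`. -/
noncomputable def sharpDiam₁ (X : L) : H.Diam M.left →ₗ[k] H.Diam M.left :=
  BalTensor.lift (Γ.sharpAux₂ M (H.transl hH X)) (Γ.sharpAux₂_bal hH M X)

theorem sharpDiam₁_dmul (X Y : L) (m : M.carrier) : Γ.sharpDiam₁ hH M X (H.dmul M.left Y m)
    = Γ.sharpAux M Y m (H.transl hH X) :=
  BalTensor.lift_tmul (Γ.sharpAux₂ M (H.transl hH X)) (Γ.sharpAux₂_bal hH M X) Y m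

/-- `X ⊗ m ↦ X₊ Γ(X₋, m₋₁)‾ ⋄ m₀`, the map `Γ^#` on representatives of `L^Γ ⋄_{B^Γ} M`. -/
noncomputable def sharpDiam : L ⊗[k] M.carrier →ₗ[k] H.Diam M.left :=
  TensorProduct.lift
    (LinearMap.mk₂ k (fun X m => Γ.sharpDiam₁ hH M X (M.coact m))
      (fun X X' m => BalTensor.hom_ext_apply (ψ := _ + _) (fun Y m => by
        rw [LinearMap.add_apply, sharpDiam₁_dmul, sharpDiam₁_dmul, sharpDiam₁_dmul, map_add,
          map_add]) (M.coact m))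
      (fun c X m => BalTensor.hom_ext_apply (ψ := c • _) (fun Y m => by
        rw [LinearMap.smul_apply, sharpDiam₁_dmul, sharpDiam₁_dmul, map_smul, map_smul])
        (M.coact m))
      (fun X m m' => by rw [map_add, map_add]) (fun c X m => by rw [map_smul, map_smul]))

/-- A realization of the cotwist `L^Γ` over `B^Γ`: a left Hopf algebroid whose underlying modules
are identified with `B` and `L` by `eB` and `eL`, and whose operations are given by the formulas of
the cotwist. -/
structure Cotwist where
  B' : Type u
  L' : Type u
  [ringB : Ring B']
  [algebraB : Algebra k B']
  [ringL : Ring L']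
  [algebraL : Algebra k L']
  hopf : LeftBialgebroid k B' L'
  isLeftHopf : hopf.IsLeftHopf
  eB : B ≃ₗ[k] B'
  eL : L ≃ₗ[k] L'
  /-- `a ·_Γ b = Γ(a, b)` in `B^Γ`. -/
  eB_mul : ∀ a b, eB a * eB b = eB (Γ.form (H.s a) (H.s b))
  eB_one : eB 1 = 1
  /-- `X ·_Γ Y = Γ(X₁, Y₁) X₂₊ Y₂₊ Γ(Y₂₋, X₂₋)‾` in `L^Γ`. -/
  eL_mul : ∀ X Y, eL X * eL Y = eL (Γ.twMul hH X Y)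
  eL_one : eL 1 = 1
  source_eB : ∀ b, hopf.s (eB b) = eL (H.s b)
  target_eB : ∀ b, hopf.t (eB b) = eL (H.t b)
  /-- `Γ^#(Δ^Γ(X)) = Δ(X)`; here `w` is any representative of `Δ^Γ(X)` in `L ⊗ L`. -/
  comul_eL : ∀ (X : L) (w : L ⊗[k] L),
    BalTensor.proj hopf.tL hopf.sL (TensorProduct.map eL.toLinearMap eL.toLinearMap w)
      = hopf.comul (eL X) → Γ.sharpDiam hH (Comodule.regular H) w = H.comul X
  counit_eL : ∀ X, hopf.counit (eL X) = eB (Γ.twCounit hH X)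

attribute [instance] Cotwist.ringB Cotwist.algebraB Cotwist.ringL Cotwist.algebraL

end Cotwist

end LeftCocycle

end LeftBialgebroid

/-!
Everything is expressed through the natural maps `Γ^#_{M,N} : (m, n) ↦ Γ(m₋₁, n₋₁) m₀ ⊗ n₀` of
comodules (`sharp₀`). They are natural in colinear maps (`sharp₀_natural`), and the cocycle identity
says that they satisfy the associativity condition of a monoidal functor (`assoc_sharp₀`). Hence an
associative law between colinear products persists when the maps `Γ^#` are inserted
(`sharp₀_assoc`); this one fact yields the twisted algebras and the twisted actions.

The algebra `L` is a comodule in two ways: with its coproduct (`regular`), and with the actions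
`b · X · c = c̄ X b̄` and the coaction `X ↦ X₋ ⋄ X₊` (`dual`). The underlying module of
`dual ⊗_B M` is `L ⋄_B M`, and the map `Γ^# : L^Γ ⋄_{B^Γ} M → L ⋄_B M` is the twisting map of `dual`
and `M` (`sharpDiam_tmul`). In particular it is bijective when `Γ` is invertible
(`sharpCofree_bijective`), so that the coaction `δ^Γ = Γ^#⁻¹ ∘ δ` exists.

*The product of `L^Γ`.* The opposite product is a morphism `dual ⊗ dual → dual` (`isMor_dualMul`).
Its twist `X₊ Y₊ Γ(Y₋, X₋)‾` is again associative, and it is colinear for the regular coactions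
(`isMor_prodLin`). Twisting a second time gives `X ·_Γ Y` (`twMul_eq`, `twMul_assoc`).

*The coactions.* The element `δ(m)` of `dual ⊗_B M` is coinvariant and commutes with `B`
(`isCentral_coact`), and `Γ^#` is the identity on tensors with such a factor. This gives the
Takeuchi condition for `δ^Γ`, and it is the reason for the key identity `sharpProd_twCoact`, from
which both the multiplicativity of `Δ^Γ` (`comul_twMul`) and the colinearity of `Γ^#_{M,N}`
(`muLin_coact`) follow. Moreover `Γ^# : L^Γ ⋄_{B^Γ} M → L ⋄_B M` is colinear for the coactions of
the first factor (`isMor_sharpCofree`), so `δ^Γ` is a morphism of `L`-comodules, and it is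
coassociative by naturality. The left counit axiom comes from `Γ(X₊₁, X₋₁) X₊₂ X₋₂ = Γ(X₊, X₋)`
(`twOp_transl`); the right one follows from it because the Galois map is surjective. The composite
of the Galois map of `L^Γ` with `Γ^#` is the Galois map of `L` composed with `Γ^#_{dual, dual}`
(`galois_opFlip`), hence `L^Γ` is a left Hopf algebroid.

*The equivalence.* The twisting functor is the identity on underlying maps, hence faithful. It is
full because a morphism between twists, followed by the coaction of its target, is a composite of
colinear maps (`isMor_of_twist`). It is essentially surjective because an `L^Γ`-comodule `V` is the
equalizer of two colinear maps out of the `L`-comodule `L^Γ ⋄_{B^Γ} V`. This pair is split over `B`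
by `(ε ⋄ id) ∘ Γ^#` (`sharpCounit`), so its equalizer is an `L`-comodule (`exists_equalizer`), and
the twist of that comodule is `V` (`exists_iso`).
-/

-- The carrier of the regular comodule has to unfold to `L` where instances are unified.
attribute [reducible] LeftBialgebroid.Comodule.regular

/-! ### Generalities on balanced tensor products and on `L ⋄_B M` -/

namespace BalTensor

variable {k : Type*} [CommRing k] {S M N : Type*} [AddCommGroup M] [Module k M]
  [AddCommGroup N] [Module k N] {f : S → Module.End k M} {g : S → Module.End k N}

theorem ind {p : BalTensor f g → Prop} (tmul : ∀ m n, p (tmul f g m n))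
    (add : ∀ x y, p x → p y → p (x + y)) (x : BalTensor f g) : p x := by
  obtain ⟨y, rfl⟩ := proj_surjective f g x
  induction y using TensorProduct.induction_on with
  | zero => simpa using tmul 0 0
  | tmul m n => exact tmul m n
  | add a b ha hb => simpa using add _ _ ha hb

end BalTensor

namespace EnvRing

variable {k : Type v} {B L : Type u} [CommRing k] [Ring B] [Algebra k B] [Ring L] [Algebra k L]
  (R : EnvRing k B L) {M N : Type*} [AddCommGroup M] [Module k M] [AddCommGroup N] [Module k N]
  {l : B → Module.End k M} {l' : B → Module.End k N}

theorem diamMap_diamSL (φ : M →ₗ[k] N) (h : ∀ b m, φ (l b m) = l' b (φ m)) (b : B)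
    (u : R.Diam l) : R.diamMap φ h (R.diamSL l b u) = R.diamSL l' b (R.diamMap φ h u) :=
  BalTensor.hom_ext_apply (φ := R.diamMap φ h ∘ₗ R.diamSL l b)
    (ψ := R.diamSL l' b ∘ₗ R.diamMap φ h) (fun X m => by simp) u

theorem diamMap_diamSR (φ : M →ₗ[k] N) (h : ∀ b m, φ (l b m) = l' b (φ m)) (b : B)
    (u : R.Diam l) : R.diamMap φ h (R.diamSR l b u) = R.diamSR l' b (R.diamMap φ h u) :=
  BalTensor.hom_ext_apply (φ := R.diamMap φ h ∘ₗ R.diamSR l b)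
    (ψ := R.diamSR l' b ∘ₗ R.diamMap φ h) (fun X m => by simp) u

theorem diamMap_diamTR (φ : M →ₗ[k] N) (h : ∀ b m, φ (l b m) = l' b (φ m)) (b : B)
    (u : R.Diam l) : R.diamMap φ h (R.diamTR l b u) = R.diamTR l' b (R.diamMap φ h u) :=
  BalTensor.hom_ext_apply (φ := R.diamMap φ h ∘ₗ R.diamTR l b)
    (ψ := R.diamTR l' b ∘ₗ R.diamMap φ h) (fun X m => by simp) u

theorem diamMap_diamMap {P : Type*} [AddCommGroup P] [Module k P] {l'' : B → Module.End k P}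
    (φ : M →ₗ[k] N) (h : ∀ b m, φ (l b m) = l' b (φ m)) (ψ : N →ₗ[k] P)
    (h' : ∀ b m, ψ (l' b m) = l'' b (ψ m)) (χ : M →ₗ[k] P)
    (h'' : ∀ b m, χ (l b m) = l'' b (χ m)) (e : ∀ m, ψ (φ m) = χ m) (u : R.Diam l) :
    R.diamMap ψ h' (R.diamMap φ h u) = R.diamMap χ h'' u :=
  BalTensor.hom_ext_apply (φ := R.diamMap ψ h' ∘ₗ R.diamMap φ h) (fun X m => by simp [e]) u

theorem diamMap_comm {P N' : Type*} [AddCommGroup P] [Module k P] [AddCommGroup N'] [Module k N']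
    {l'' : B → Module.End k P} {m' : B → Module.End k N'}
    {φ : M →ₗ[k] N} {h : ∀ b m, φ (l b m) = l' b (φ m)} {ψ : N →ₗ[k] P}
    {h' : ∀ b m, ψ (l' b m) = l'' b (ψ m)} {φ' : M →ₗ[k] N'}
    {i : ∀ b m, φ' (l b m) = m' b (φ' m)} {ψ' : N' →ₗ[k] P}
    {i' : ∀ b m, ψ' (m' b m) = l'' b (ψ' m)} (e : ∀ m, ψ (φ m) = ψ' (φ' m)) (u : R.Diam l) :
    R.diamMap ψ h' (R.diamMap φ h u) = R.diamMap ψ' i' (R.diamMap φ' i u) :=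
  BalTensor.hom_ext_apply (φ := R.diamMap ψ h' ∘ₗ R.diamMap φ h)
    (ψ := R.diamMap ψ' i' ∘ₗ R.diamMap φ' i) (fun X m => by simp [e]) u

theorem diamMap_leftInverse {φ : M →ₗ[k] N} {h : ∀ b m, φ (l b m) = l' b (φ m)} {ψ : N →ₗ[k] M}
    {h' : ∀ b m, ψ (l' b m) = l b (ψ m)} (e : ∀ m, ψ (φ m) = m) (u : R.Diam l) :
    R.diamMap ψ h' (R.diamMap φ h u) = u :=
  BalTensor.hom_ext_apply (φ := R.diamMap ψ h' ∘ₗ R.diamMap φ h) (ψ := LinearMap.id)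
    (fun X m => by simp [e]) u

/-- The naturality of `Δ ⋄ id`. -/
theorem comulDiam_diamMap (Δ : L →ₗ[k] R.Diam R.sL)
    (hΔ : ∀ b X, Δ (R.t b * X) = R.diamMap (R.tL b) (R.tL_sL b) (Δ X))
    (φ : M →ₗ[k] N) (h : ∀ b m, φ (l b m) = l' b (φ m)) (u : R.Diam l) :
    R.comulDiam Δ hΔ l' (R.diamMap φ h u)
      = R.diamMap (R.diamMap φ h) (R.diamMap_diamSL φ h) (R.comulDiam Δ hΔ l u) :=
  BalTensor.hom_ext_apply (φ := R.comulDiam Δ hΔ l' ∘ₗ R.diamMap φ h)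
    (ψ := R.diamMap (R.diamMap φ h) (R.diamMap_diamSL φ h) ∘ₗ R.comulDiam Δ hΔ l)
    (fun X m => by
      simp only [LinearMap.comp_apply, diamMap_dmul, comulDiam_dmul]
      exact BalTensor.hom_ext_apply (φ := R.diamInsert l' (φ m))
        (ψ := R.diamMap (R.diamMap φ h) (R.diamMap_diamSL φ h) ∘ₗ R.diamInsert l m)
        (fun X Y => by simp) (Δ X)) u

theorem counitDiam_diamMap (ε : L →ₗ[k] B) (hε : ∀ b X, ε (R.t b * X) = ε X * b)
    {l : B →ₐ[k] Module.End k M} {l' : B →ₐ[k] Module.End k N}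
    (φ : M →ₗ[k] N) (h : ∀ b m, φ (l b m) = l' b (φ m)) (u : R.Diam l) :
    R.counitDiam ε hε l' (R.diamMap φ h u) = φ (R.counitDiam ε hε l u) :=
  BalTensor.hom_ext_apply (φ := R.counitDiam ε hε l' ∘ₗ R.diamMap φ h)
    (ψ := φ ∘ₗ R.counitDiam ε hε l) (fun X m => by simp [h]) u

end EnvRing

namespace LeftBialgebroid

variable {k : Type v} {B L : Type u} [CommRing k] [Ring B] [Algebra k B] [Ring L] [Algebra k L]
  {H : LeftBialgebroid k B L}

namespace Comodule

/-! ### Morphisms of comodules as a property of linear maps -/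

/-- The linear map `φ` underlies a morphism of comodules. -/
def IsMor (M N : H.Comodule) (φ : M.carrier →ₗ[k] N.carrier) : Prop := ∃ f : M ⟶ N, lin f = φ

variable {M N P : H.Comodule}

theorem ten_ind {p : (M.tensor N).carrier → Prop} (ten : ∀ m n, p (M.ten N m n))
    (add : ∀ x y, p x → p y → p (x + y)) (x : (M.tensor N).carrier) : p x :=
  BalTensor.ind ten add x

theorem isMor_lin (f : M ⟶ N) : IsMor M N (lin f) := ⟨f, rfl⟩

theorem isMor_id : IsMor M M LinearMap.id := ⟨𝟙 M, rfl⟩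

theorem IsMor.comp {ψ : N.carrier →ₗ[k] P.carrier} {φ : M.carrier →ₗ[k] N.carrier}
    (hψ : IsMor N P ψ) (hφ : IsMor M N φ) : IsMor M P (ψ ∘ₗ φ) := by
  obtain ⟨f, rfl⟩ := hφ
  obtain ⟨g, rfl⟩ := hψ
  exact ⟨f ≫ g, rfl⟩

theorem IsMor.of_eq {φ ψ : M.carrier →ₗ[k] N.carrier} (hφ : IsMor M N φ)
    (e : ∀ m, φ m = ψ m) : IsMor M N ψ := by
  rwa [← LinearMap.ext e]

theorem IsMor.mk {φ : M.carrier →ₗ[k] N.carrier} (hl : ∀ b m, φ (M.left b m) = N.left b (φ m))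
    (hr : ∀ b m, φ (M.right (op b) m) = N.right (op b) (φ m))
    (hc : ∀ m, N.coact (φ m) = H.diamMap φ hl (M.coact m)) : IsMor M N φ :=
  ⟨⟨φ, hl, fun b => hr (unop b), hc⟩, rfl⟩

theorem IsMor.left {φ : M.carrier →ₗ[k] N.carrier} (h : IsMor M N φ) (b : B) (m : M.carrier) :
    φ (M.left b m) = N.left b (φ m) := by
  obtain ⟨f, rfl⟩ := h; exact lin_left f b m

theorem IsMor.right {φ : M.carrier →ₗ[k] N.carrier} (h : IsMor M N φ) (b : Bᵐᵒᵖ) (m : M.carrier) :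
    φ (M.right b m) = N.right b (φ m) := by
  obtain ⟨f, rfl⟩ := h; exact lin_right f b m

theorem IsMor.coact {φ : M.carrier →ₗ[k] N.carrier} (h : IsMor M N φ) (m : M.carrier) :
    N.coact (φ m) = H.diamMap φ h.left (M.coact m) := by
  obtain ⟨f, rfl⟩ := h; exact lin_coact f m

/-- The inverse of a bijective morphism is a morphism. -/
theorem IsMor.symm {φ : M.carrier →ₗ[k] N.carrier} (h : IsMor M N φ)
    {ψ : N.carrier →ₗ[k] M.carrier} (h₁ : ∀ m, ψ (φ m) = m) (h₂ : ∀ n, φ (ψ n) = n) :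
    IsMor N M ψ := by
  obtain ⟨f, rfl⟩ := h; exact ⟨(isoOfInv f ψ h₁ h₂).inv, rfl⟩

/-- A linear map into `M` whose composite with an injective morphism `ι : M → N` that has a left
`B`-linear retraction is a morphism, is a morphism. -/
theorem IsMor.of_comp {ι : N.carrier →ₗ[k] P.carrier} (hι : IsMor N P ι)
    (r : P.carrier →ₗ[k] N.carrier) (hr : ∀ b p, r (P.left b p) = N.left b (r p))
    (hrι : ∀ n, r (ι n) = n) {φ : M.carrier →ₗ[k] N.carrier} (h : IsMor M P (ι ∘ₗ φ)) :
    IsMor M N φ := by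
  have inj : Function.Injective ι := Function.LeftInverse.injective hrι
  have hl : ∀ b m, φ (M.left b m) = N.left b (φ m) := fun b m => inj <| by
    rw [hι.left]; exact h.left b m
  refine IsMor.mk hl (fun b m => inj ?_) (fun m => ?_)
  · rw [hι.right]; exact h.right (op b) m
  · have inj' : ∀ x, H.diamMap r hr (H.diamMap ι hι.left x) = x :=
      fun x => H.diamMap_leftInverse hrι x
    rw [← inj' (N.coact (φ m)), ← inj' (H.diamMap φ hl (M.coact m)), ← hι.coact]
    congr 1
    rw [H.diamMap_diamMap _ _ _ _ (ι ∘ₗ φ) h.left (fun _ => rfl)]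
    exact h.coact m

/-- A linear map `ν` on `N` is a morphism if `N` is spanned by images of morphisms `j` such that
`ν ∘ j` is a morphism. -/
theorem isMor_of_local {ν : N.carrier →ₗ[k] P.carrier}
    (h : ∀ n, n ∈ AddSubmonoid.closure
      {n | ∃ (M : H.Comodule) (j : M ⟶ N) (m : M.carrier), lin j m = n ∧ IsMor M P (ν ∘ₗ lin j)}) :
    IsMor N P ν := by
  have hl : ∀ b n, ν (N.left b n) = P.left b (ν n) := fun b n => by
    induction h n using AddSubmonoid.closure_induction with
    | mem n hn =>
      obtain ⟨M, j, m, rfl, hj⟩ := hn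
      rw [← lin_left]; exact hj.left b m
    | zero => simp
    | add x y _ _ hx hy => simp only [map_add, hx, hy]
  refine IsMor.mk hl (fun b n => ?_) (fun n => ?_)
  · induction h n using AddSubmonoid.closure_induction with
    | mem n hn =>
      obtain ⟨M, j, m, rfl, hj⟩ := hn
      rw [← lin_right]; exact hj.right (op b) m
    | zero => simp
    | add x y _ _ hx hy => simp only [map_add, hx, hy]
  · induction h n using AddSubmonoid.closure_induction with
    | mem n hn =>
      obtain ⟨M, j, m, rfl, hj⟩ := hn
      rw [lin_coact, H.diamMap_diamMap _ _ _ _ (ν ∘ₗ lin j) hj.left (fun _ => rfl)]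
      exact hj.coact m
    | zero => simp
    | add x y _ _ hx hy => simp only [map_add, hx, hy]

theorem isMor_tensorHom {M' N' : H.Comodule} (f : M ⟶ M') (g : N ⟶ N') :
    IsMor (M.tensor N) (M'.tensor N') (lin (tensorHom f g)) := isMor_lin _

/-! ### Balanced tensor products of a comodule with a module -/

section BTensor

variable (P) {S : Type*} {V : Type u} [AddCommGroup V] [Module k V]
  (f : S → Module.End k P.carrier) (hf : ∀ c, IsMor P P (f c)) (l : S → Module.End k V)

/-- The action on the first factor of `P ⊗_S V` of a linear map that commutes with `S`. -/
def btAct (hφ : Module.End k P.carrier) (h : ∀ c p, hφ (f c p) = f c (hφ p)) :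
    Module.End k (BalTensor f l) := BalTensor.map hφ LinearMap.id h (fun _ _ => rfl)

@[simp] theorem btAct_tmul (φ : Module.End k P.carrier) (h : ∀ c p, φ (f c p) = f c (φ p))
    (p : P.carrier) (v : V) :
    P.btAct f l φ h (BalTensor.tmul f l p v) = BalTensor.tmul f l (φ p) v :=
  BalTensor.map_tmul (g := l) (g' := l) φ LinearMap.id h (fun _ _ => rfl) p v

theorem bt_left_comm (hf : ∀ c, IsMor P P (f c)) (b : B) (c : S) (p : P.carrier) :
    P.left b (f c p) = f c (P.left b p) := ((hf c).left b p).symm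

theorem bt_right_comm (hf : ∀ c, IsMor P P (f c)) (b : Bᵐᵒᵖ) (c : S) (p : P.carrier) :
    P.right b (f c p) = f c (P.right b p) := ((hf c).right b p).symm

/-- The left action of `B` on `P ⊗_S V`. -/
def btLeft : B →ₐ[k] Module.End k (BalTensor f l) :=
  AlgHom.ofLinearMap
    { toFun := fun b => P.btAct f l (P.left b) (P.bt_left_comm f hf b)
      map_add' := fun a b => BalTensor.hom_ext (fun m n => by simp)
      map_smul' := fun c b => BalTensor.hom_ext (fun m n => by simp) }
    (BalTensor.hom_ext (fun m n => by simp))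
    (fun a b => BalTensor.hom_ext (fun m n => by simp))

/-- The right action of `B` on `P ⊗_S V`. -/
def btRight : Bᵐᵒᵖ →ₐ[k] Module.End k (BalTensor f l) :=
  AlgHom.ofLinearMap
    { toFun := fun b => P.btAct f l (P.right b) (P.bt_right_comm f hf b)
      map_add' := fun a b => BalTensor.hom_ext (fun m n => by simp)
      map_smul' := fun c b => BalTensor.hom_ext (fun m n => by simp) }
    (BalTensor.hom_ext (fun m n => by simp))
    (fun a b => BalTensor.hom_ext (fun m n => by simp))

@[simp] theorem btLeft_tmul (b : B) (p : P.carrier) (v : V) :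
    P.btLeft f hf l b (BalTensor.tmul f l p v) = BalTensor.tmul f l (P.left b p) v :=
  P.btAct_tmul f l _ (P.bt_left_comm f hf b) p v

@[simp] theorem btRight_tmul (b : Bᵐᵒᵖ) (p : P.carrier) (v : V) :
    P.btRight f hf l b (BalTensor.tmul f l p v) = BalTensor.tmul f l (P.right b p) v :=
  P.btAct_tmul f l _ (P.bt_right_comm f hf b) p v

/-- `p ↦ p ⊗ v`. -/
def btIncl : V →ₗ[k] P.carrier →ₗ[k] BalTensor f l := (BalTensor.tmul f l).flip

theorem btIncl_left (v : V) (b : B) (p : P.carrier) :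
    P.btIncl f l v (P.left b p) = P.btLeft f hf l b (P.btIncl f l v p) :=
  (P.btLeft_tmul f hf l b p v).symm

/-- `u ↦ (id ⋄ (- ⊗ v)) u`. -/
def btInsert : V →ₗ[k] H.Diam P.left →ₗ[k] H.Diam (P.btLeft f hf l) :=
  LinearMap.mk₂ k (fun v u => H.diamMap (P.btIncl f l v) (P.btIncl_left f hf l v) u)
    (fun v v' u => BalTensor.hom_ext_apply (ψ := _ + _) (fun X p => by simp) u)
    (fun c v u => BalTensor.hom_ext_apply (ψ := c • _) (fun X p => by simp) u)
    (fun v u u' => map_add _ u u') (fun c v u => map_smul _ c u)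

theorem btInsert_apply (v : V) (u : H.Diam P.left) :
    P.btInsert f hf l v u = H.diamMap (P.btIncl f l v) (P.btIncl_left f hf l v) u := rfl

theorem btInsert_bal (c : S) (p : P.carrier) (v : V) :
    (P.btInsert f hf l).flip (P.coact (f c p)) v
      = (P.btInsert f hf l).flip (P.coact p) (l c v) := by
  rw [LinearMap.flip_apply, LinearMap.flip_apply, (hf c).coact, btInsert_apply, btInsert_apply]
  exact H.diamMap_diamMap _ _ _ _ _ _ (fun m => BalTensor.tmul_bal f l c m v) _

/-- The coaction `p ⊗ v ↦ p₋₁ ⋄ (p₀ ⊗ v)`. -/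
def btCoact : BalTensor f l →ₗ[k] H.Diam (P.btLeft f hf l) :=
  BalTensor.lift ((P.btInsert f hf l).flip ∘ₗ P.coact) (P.btInsert_bal f hf l)

theorem btCoact_tmul (p : P.carrier) (v : V) :
    P.btCoact f hf l (BalTensor.tmul f l p v)
      = H.diamMap (P.btIncl f l v) (P.btIncl_left f hf l v) (P.coact p) :=
  BalTensor.lift_tmul _ (P.btInsert_bal f hf l) p v

theorem btCoact_left (b : B) (x : BalTensor f l) :
    P.btCoact f hf l (P.btLeft f hf l b x) = H.diamSL (P.btLeft f hf l) b (P.btCoact f hf l x) := by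
  induction x using BalTensor.ind with
  | tmul p v => rw [btLeft_tmul, btCoact_tmul, btCoact_tmul, P.coact_left, H.diamMap_diamSL]
  | add x y hx hy => simp only [map_add, hx, hy]

/-- The balanced tensor product `P ⊗_S V` of a comodule `P`, on which `S` acts by
endomorphisms, and a module `V`; bimodule structure and coaction are those of `P`. -/
abbrev btensor : H.Comodule where
  carrier := BalTensor f l
  left := P.btLeft f hf l
  right := P.btRight f hf l
  right_left a b x := by
    induction x using BalTensor.ind with
    | tmul p v => rw [btLeft_tmul, btRight_tmul, btRight_tmul, btLeft_tmul, P.right_left]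
    | add x y hx hy => simp only [map_add, hx, hy]
  coact := P.btCoact f hf l
  coact_left := P.btCoact_left f hf l
  coact_right b x := by
    induction x using BalTensor.ind with
    | tmul p v => rw [btRight_tmul, btCoact_tmul, btCoact_tmul, P.coact_right, H.diamMap_diamSR]
    | add x y hx hy => simp only [map_add, hx, hy]
  coact_takeuchi b x := by
    induction x using BalTensor.ind with
    | tmul p v =>
      rw [btCoact_tmul, ← H.diamMap_diamTR, P.coact_takeuchi]
      exact H.diamMap_comm (fun m => (P.btRight_tmul f hf l (op b) m v).symm) _
    | add x y hx hy => simp only [map_add, hx, hy]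
  coassoc x := by
    induction x using BalTensor.ind with
    | tmul p v =>
      rw [btCoact_tmul, H.comulDiam_diamMap, ← P.coassoc]
      exact H.diamMap_comm (fun m => P.btCoact_tmul f hf l m v) _
    | add x y hx hy => simp only [map_add, hx, hy]
  counit_coact x := by
    induction x using BalTensor.ind with
    | tmul p v => rw [btCoact_tmul, H.counitDiam_diamMap, P.counit_coact]; rfl
    | add x y hx hy => simp only [map_add, hx, hy]

theorem isMor_btIncl (v : V) : IsMor P (P.btensor f hf l) (P.btIncl f l v) :=
  IsMor.mk (P.btIncl_left f hf l v) (fun b p => (P.btRight_tmul f hf l (op b) p v).symm)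
    (fun p => P.btCoact_tmul f hf l p v)

/-- A linear map on `P ⊗_S V` is a morphism if its restrictions to the images of `P ⊗ v` are. -/
theorem btensor_cover {Q : H.Comodule} (ν : BalTensor f l →ₗ[k] Q.carrier)
    (h : ∀ v, IsMor P Q (ν ∘ₗ P.btIncl f l v)) : IsMor (P.btensor f hf l) Q ν := by
  refine isMor_of_local (N := P.btensor f hf l) fun n => ?_
  induction n using BalTensor.ind with
  | tmul p v =>
    obtain ⟨j, hj⟩ := P.isMor_btIncl f hf l v
    exact AddSubmonoid.subset_closure ⟨P, j, p, by rw [hj]; rfl, by rw [hj]; exact h v⟩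
  | add x y hx hy => exact AddSubmonoid.add_mem _ hx hy

/-- A linear map on `(P ⊗_S V) ⊗_B N` is a morphism if its restrictions to the images of
`(P ⊗ v) ⊗_B N` are. -/
theorem btensor_tensor_cover {Q N : H.Comodule}
    (ν : ((P.btensor f hf l).tensor N).carrier →ₗ[k] Q.carrier)
    (μ : V → (P.tensor N ⟶ Q))
    (h : ∀ p v n, ν ((P.btensor f hf l).ten N (BalTensor.tmul f l p v) n)
      = lin (μ v) (P.ten N p n)) : IsMor ((P.btensor f hf l).tensor N) Q ν := by
  refine isMor_of_local fun x => ?_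
  induction x using BalTensor.ind with
  | tmul x n =>
    induction x using BalTensor.ind with
    | tmul p v =>
      obtain ⟨j, hj⟩ := P.isMor_btIncl f hf l v
      refine AddSubmonoid.subset_closure ⟨P.tensor N, tensorHom j (𝟙 N), P.ten N p n, ?_, μ v, ?_⟩
      · rw [lin_tensorHom_ten, hj]; rfl
      · refine LinearMap.ext fun y => ten_ext (ψ := ν ∘ₗ lin (tensorHom j (𝟙 N)))
          (fun p n => ?_) y
        rw [LinearMap.comp_apply, lin_tensorHom_ten, hj]
        exact (h p v n).symm
    | add x y hx hy =>
      refine (congrArg (· ∈ _) (LinearMap.map_add₂ ((P.btensor f hf l).ten N) x y n)).mpr ?_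
      exact AddSubmonoid.add_mem _ hx hy
  | add x y hx hy => exact AddSubmonoid.add_mem _ hx hy

end BTensor

end Comodule

end LeftBialgebroid

namespace BalTensor

variable {k : Type*} [CommRing k] {S M N : Type*} [AddCommGroup M] [Module k M]
  [AddCommGroup N] [Module k N] {f : S → Module.End k M} {g : S → Module.End k N}
  {S' X Y V W : Type*} [AddCommGroup X] [Module k X] [AddCommGroup Y] [Module k Y]
  [AddCommGroup V] [Module k V] [AddCommGroup W] [Module k W]
  {φ : S' → Module.End k Y} {ψ : S' → Module.End k V}

/-- The universal property of the balanced tensor product, with two linear parameters. -/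
def lift₂ (Φ : Y →ₗ[k] V →ₗ[k] M →ₗ[k] N →ₗ[k] W)
    (h : ∀ y v b m n, Φ y v (f b m) n = Φ y v m (g b n)) :
    Y →ₗ[k] V →ₗ[k] BalTensor f g →ₗ[k] W :=
  LinearMap.mk₂ k (fun y v => lift (Φ y v) (h y v))
    (fun _ _ _ => hom_ext fun _ _ => by simp) (fun _ _ _ => hom_ext fun _ _ => by simp)
    (fun _ _ _ => hom_ext fun _ _ => by simp) (fun _ _ _ => hom_ext fun _ _ => by simp)

@[simp] theorem lift₂_tmul (Φ : Y →ₗ[k] V →ₗ[k] M →ₗ[k] N →ₗ[k] W)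
    (h : ∀ y v b m n, Φ y v (f b m) n = Φ y v m (g b n)) (y : Y) (v : V) (m : M) (n : N) :
    lift₂ Φ h y v (tmul f g m n) = Φ y v m n := lift_tmul (Φ y v) (h y v) m n

/-- The map `(x, y ⊗ v) ↦ Φ y v (τ x)`, which need only be balanced on the image of `τ`. -/
def pairing {U : Type*} [AddCommGroup U] [Module k U] (τ : X →ₗ[k] U)
    (Φ : Y →ₗ[k] V →ₗ[k] U →ₗ[k] W) (h : ∀ x b y v, Φ (φ b y) v (τ x) = Φ y (ψ b v) (τ x)) :
    X →ₗ[k] BalTensor φ ψ →ₗ[k] W :=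
  (lift (f := φ) (g := ψ) (Φ.compr₂ (LinearMap.lcomp k W τ))
    (fun b y v => LinearMap.ext fun x => h x b y v)).flip

@[simp] theorem pairing_tmul {U : Type*} [AddCommGroup U] [Module k U] (τ : X →ₗ[k] U)
    (Φ : Y →ₗ[k] V →ₗ[k] U →ₗ[k] W) (h : ∀ x b y v, Φ (φ b y) v (τ x) = Φ y (ψ b v) (τ x))
    (x : X) (y : Y) (v : V) : pairing τ Φ h x (tmul φ ψ y v) = Φ y v (τ x) := by
  simp [pairing]

end BalTensor

namespace LeftBialgebroid

variable {k : Type v} {B L : Type u} [CommRing k] [Ring B] [Algebra k B] [Ring L] [Algebra k L]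
  {H : LeftBialgebroid k B L}

namespace Comodule

/-! ### Cofree comodules -/

theorem isMor_tL (b : B) : IsMor (regular H) (regular H) (H.tL b) :=
  IsMor.mk (N := regular H) (M := regular H) (fun c X => H.tL_sL b c X)
    (fun c X => (mul_assoc (H.t b) X (H.s c)).symm) (fun X => H.comul_target b X)

theorem isMor_tR (b : B) : IsMor (regular H) (regular H) (H.tR b) :=
  IsMor.mk (N := regular H) (M := regular H) (fun c X => mul_assoc (H.s c) X (H.t b))
    (fun c X => (H.sR_tR c b X).symm) (fun X => H.comul_mul_t b X)

section Cofree

variable {V : Type u} [AddCommGroup V] [Module k V] (l : B → Module.End k V)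

variable (H) in
/-- The comodule `L ⋄_B V` with the coaction `Δ ⋄ id`. -/
abbrev cofree : H.Comodule := (regular H).btensor H.tL isMor_tL l

theorem isMor_dmul (v : V) : IsMor (regular H) (cofree H l) ((H.dmul l).flip v) :=
  isMor_btIncl _ _ _ _ v

/-- The coaction embeds a comodule in a cofree one. This embedding has the retraction `ε ⋄ id`,
which is left `B`-linear. -/
theorem isMor_coact (N : H.Comodule) : IsMor N (cofree H N.left) N.coact :=
  IsMor.mk (N := cofree H N.left) N.coact_left N.coact_right
    (fun m => (N.coassoc m).symm)

variable {l} in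
theorem isMor_diamMap {V' : Type u} [AddCommGroup V'] [Module k V'] {l' : B → Module.End k V'}
    (φ : V →ₗ[k] V') (h : ∀ b v, φ (l b v) = l' b (φ v)) :
    IsMor (cofree H l) (cofree H l') (H.diamMap φ h) :=
  btensor_cover _ _ _ _ _ fun v => (isMor_dmul l' (φ v)).of_eq fun X =>
    (H.diamMap_dmul φ h X v).symm

end Cofree

variable (H) in
/-- The comodule `L ⊗_{B̄} L`, with the coaction of the first factor. -/
abbrev opCom : H.Comodule := (regular H).btensor H.tR isMor_tR H.tL

/-- The Galois map is colinear for the coactions of the first factors. -/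
theorem isMor_galois : IsMor (opCom H) (cofree H H.sL) H.galois :=
  btensor_cover _ _ _ _ _ fun Y =>
    ((isMor_diamMap (LinearMap.mulRight k Y) (H.mulRight_sL Y)).comp
      (isMor_coact (regular H))).of_eq fun X => (H.galois_omul X Y).symm

end Comodule

open Comodule

/-! ### The translation map -/

section Transl

variable (hH : H.IsLeftHopf)

/-- The inverse of the Galois map. -/
noncomputable def galoisInv (H : LeftBialgebroid k B L) (hH : H.IsLeftHopf) :
    H.Diam H.sL →ₗ[k] H.OpTensor :=
  (LinearEquiv.ofBijective H.galois hH).symm.toLinearMap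

theorem galois_galoisInv (x : H.Diam H.sL) : H.galois (H.galoisInv hH x) = x :=
  (LinearEquiv.ofBijective H.galois hH).apply_symm_apply _

theorem galoisInv_galois (x : H.OpTensor) : H.galoisInv hH (H.galois x) = x :=
  (LinearEquiv.ofBijective H.galois hH).symm_apply_apply _

theorem isMor_galoisInv : IsMor (cofree H H.sL) (opCom H) (H.galoisInv hH) :=
  isMor_galois.symm (galoisInv_galois hH) (galois_galoisInv hH)

/-- The translation map is colinear: `X₊₁ ⊗ X₊₂ ⊗ X₋ = X₁ ⊗ X₂₊ ⊗ X₂₋`. -/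
theorem isMor_transl : IsMor (regular H) (opCom H) (H.transl hH) :=
  (isMor_galoisInv hH).comp (isMor_dmul H.sL (1 : L))

theorem galoisInv_comul (X : L) : H.galoisInv hH (H.comul X) = H.omul X 1 := by
  rw [← galoisInv_galois hH (H.omul X 1), galois_omul]
  congr 1
  refine BalTensor.hom_ext_apply (φ := LinearMap.id) (ψ := H.diamMulRight.flip 1)
    (fun X Y => ?_) (H.comul X)
  simp

theorem galois_omap_id (φ : Module.End k L) (hφ : ∀ b X, φ (H.tL b X) = H.tL b (φ X))
    (hφ' : ∀ b X, φ (H.sL b X) = H.sL b (φ X)) (h : ∀ X Y, φ (X * Y) = X * φ Y)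
    (x : H.OpTensor) :
    H.galois (H.omap LinearMap.id φ (fun _ _ => rfl) hφ x) = H.diamMap φ hφ' (H.galois x) := by
  induction x using BalTensor.ind with
  | tmul A C =>
    simp only [BalTensor.map_tmul, galois_omul, LinearMap.id_apply]
    exact BalTensor.hom_ext_apply (φ := H.diamMulRight.flip (φ C))
      (ψ := H.diamMap φ hφ' ∘ₗ H.diamMulRight.flip C) (fun X Z => by simp [h]) (H.comul A)
  | add x y hx hy => simp only [map_add, hx, hy]

theorem mulRight_tL (Y : L) (b : B) (X : L) :
    LinearMap.mulRight k Y (H.tL b X) = H.tL b (LinearMap.mulRight k Y X) := by simp [mul_assoc]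

/-- `λ⁻¹(X ⋄ Y) = X₊ ⊗ X₋ Y`. -/
theorem galoisInv_dmul (X Y : L) : H.galoisInv hH (H.dmul H.sL X Y)
    = H.omap LinearMap.id (LinearMap.mulRight k Y) (fun _ _ => rfl) (mulRight_tL Y)
      (H.transl hH X) := by
  rw [← galoisInv_galois hH (H.omap _ _ _ _ _), galois_omap_id _ _ (H.mulRight_sL Y)
    (fun X Z => by simp [mul_assoc]), galois_transl, EnvRing.diamMap_dmul]
  simp

theorem transl_one : H.transl hH 1 = H.omul 1 1 :=
  H.eq_transl hH (by rw [galois_omul, H.comul_one, diamMulRight_dmul, mul_one])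

/-- `(b̄ X)₊ ⊗ (b̄ X)₋ = X₊ ⊗ X₋ b`. -/
theorem transl_t_mul (b : B) (X : L) : H.transl hH (H.t b * X)
    = H.omap LinearMap.id (H.sR b) (fun _ _ => rfl) (H.sR_tL b) (H.transl hH X) := by
  refine H.eq_transl hH ?_
  rw [galois_omap_id _ _ (H.sR_sL b) (fun X Y => by simp [mul_assoc]), galois_transl,
    EnvRing.diamMap_dmul, H.dmul_bal]
  simp

/-- `(X b̄)₊ ⊗ (X b̄)₋ = X₊ ⊗ b X₋`. -/
theorem transl_mul_t (b : B) (X : L) : H.transl hH (X * H.t b)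
    = H.omap LinearMap.id (H.sL b) (fun _ _ => rfl) (H.sL_tL b) (H.transl hH X) := by
  refine H.eq_transl hH ?_
  have h : ∀ x, H.galois (H.omap LinearMap.id (H.sL b) (fun _ _ => rfl) (H.sL_tL b) x)
      = H.diamTR H.sL b (H.galois x) := fun x => by
    induction x using BalTensor.ind with
    | tmul A C =>
      simp only [BalTensor.map_tmul, galois_omul, LinearMap.id_apply]
      have h1 : ∀ u, H.diamMulRight u (H.sL b C)
          = H.diamMulRight (H.diamMap (H.sR b) (H.sR_sL b) u) C := fun u =>
        BalTensor.hom_ext_apply (φ := H.diamMulRight.flip (H.sL b C))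
          (ψ := H.diamMulRight.flip C ∘ₗ H.diamMap (H.sR b) (H.sR_sL b))
          (fun X Z => by simp [mul_assoc]) u
      have h2 : ∀ u, H.diamMulRight (H.diamTR H.sL b u) C
          = H.diamTR H.sL b (H.diamMulRight u C) := fun u =>
        BalTensor.hom_ext_apply (φ := H.diamMulRight.flip C ∘ₗ H.diamTR H.sL b)
          (ψ := H.diamTR H.sL b ∘ₗ H.diamMulRight.flip C) (fun X Z => by simp) u
      rw [h1, ← H.comul_takeuchi, h2]
    | add x y hx hy => simp only [map_add, hx, hy]
  rw [h, galois_transl, EnvRing.diamTR_dmul]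

theorem transl_s (b : B) : H.transl hH (H.s b) = H.omul (H.s b) 1 := by
  have h := H.transl_s_mul hH b 1
  rw [mul_one, transl_one, BalTensor.map_tmul] at h
  simpa using h

theorem transl_t (b : B) : H.transl hH (H.t b) = H.omul 1 (H.s b) := by
  have h := transl_t_mul hH b 1
  rw [mul_one, transl_one, BalTensor.map_tmul] at h
  simpa using h

variable (H) in
/-- `A ⊗ C ↦ A ε(C)‾`. -/
def counitOp : H.OpTensor →ₗ[k] L :=
  BalTensor.lift ((LinearMap.mul k L).compl₂ (H.t ∘ₗ H.counit)) (fun b A C => by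
    simp [H.counit_target, H.t_mul, mul_assoc])

@[simp] theorem counitOp_omul (A C : L) :
    counitOp H (H.omul A C) = A * H.t (H.counit C) := by simp [counitOp]

theorem counitRight_dmul (A C : L) : H.counitRight H.counit H.counit_source (H.dmul H.sL A C)
    = H.t (H.counit C) * A := by simp [EnvRing.counitRight]

/-- `X₊ ε(X₋)‾ = X`. -/
theorem counitOp_transl (X : L) : counitOp H (H.transl hH X) = X := by
  have h : ∀ x, counitOp H x = H.counitRight H.counit H.counit_source (H.galois x) := fun x => by
    induction x using BalTensor.ind with
    | tmul A C =>
      rw [counitOp_omul, galois_omul]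
      refine (H.comul_counit (A * H.t (H.counit C))).symm.trans ?_
      rw [H.comul_mul_t]
      exact BalTensor.hom_ext_apply
        (φ := H.counitRight H.counit H.counit_source ∘ₗ H.diamMap (H.tR (H.counit C)) (H.tR_sL _))
        (ψ := H.counitRight H.counit H.counit_source ∘ₗ H.diamMulRight.flip C)
        (fun X Z => by
          simp only [LinearMap.comp_apply, EnvRing.diamMap_dmul, LinearMap.flip_apply,
            diamMulRight_dmul, counitRight_dmul, EnvRing.tR_apply, H.counit_mul_target])
        (H.comul A)
    | add x y hx hy => simp only [map_add, hx, hy]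
  rw [h, galois_transl, counitRight_dmul, H.counit_one, H.t_one, one_mul]

/-! ### Identities for the translation map -/

section TranslPair

variable {V : Type u} [AddCommGroup V] [Module k V] (l : B → Module.End k V)

variable (H) in
/-- `(Y, v, A, C) ↦ C Y ⋄ (A ⋄ v)`. -/
def translPairAux : L →ₗ[k] V →ₗ[k] H.OpTensor →ₗ[k] H.Diam (H.diamTR l) :=
  BalTensor.lift₂
    (LinearMap.mk₂ k
      (fun Y v => (H.dmul (H.diamTR l)).flip.compl₁₂ ((H.dmul l).flip v) (LinearMap.mulRight k Y))
      (fun _ _ _ => LinearMap.ext₂ fun _ _ => by simp [mul_add])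
      (fun _ _ _ => LinearMap.ext₂ fun _ _ => by simp)
      (fun _ _ _ => LinearMap.ext₂ fun _ _ => by simp)
      (fun _ _ _ => LinearMap.ext₂ fun _ _ => by simp))
    (fun Y v b A C => by
      simp only [LinearMap.mk₂_apply, LinearMap.compl₁₂_apply, LinearMap.flip_apply,
        EnvRing.tR_apply, EnvRing.tL_apply, LinearMap.mulRight_apply, mul_assoc, H.dmul_bal,
        EnvRing.diamTR_dmul])

theorem translPairAux_omul (Y : L) (v : V) (A C : L) :
    translPairAux H l Y v (H.omul A C) = H.dmul (H.diamTR l) (C * Y) (H.dmul l A v) :=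
  BalTensor.lift₂_tmul _ _ Y v A C

/-- The map `Y ⋄ v ↦ X₋ Y ⋄ (X₊ ⋄ v)` is well defined since `b̄ X₊ ⊗ X₋ = X₊ ⊗ X₋ b̄`. -/
theorem translPairAux_bal (X : L) (b : B) (Y : L) (v : V) :
    translPairAux H l (H.tL b Y) v (H.transl hH X)
      = translPairAux H l Y (l b v) (H.transl hH X) := by
  have h1 : ∀ x, translPairAux H l (H.tL b Y) v x = translPairAux H l Y v
      (H.omap LinearMap.id (H.tR b) (fun _ _ => rfl) (H.tR_tL' b) x) := fun x => by
    induction x using BalTensor.ind with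
    | tmul A C => rw [BalTensor.map_tmul, translPairAux_omul, translPairAux_omul]; simp [mul_assoc]
    | add x y hx hy => simp only [map_add, hx, hy]
  have h2 : ∀ x, translPairAux H l Y (l b v) x = translPairAux H l Y v
      (H.omap (H.tL b) LinearMap.id (H.tL_tR b) (fun _ _ => rfl) x) := fun x => by
    induction x using BalTensor.ind with
    | tmul A C =>
      rw [BalTensor.map_tmul, translPairAux_omul, translPairAux_omul, EnvRing.tL_apply, H.dmul_bal]
      simp
    | add x y hx hy => simp only [map_add, hx, hy]
  rw [h1, h2, H.transl_bal]

/-- `(X, Y ⋄ v) ↦ X₋ Y ⋄ (X₊ ⋄ v)`. -/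
noncomputable def translPair : L →ₗ[k] H.Diam l →ₗ[k] H.Diam (H.diamTR l) :=
  BalTensor.pairing (H.transl hH) (translPairAux H l) (translPairAux_bal hH l)

theorem translPair_dmul (X Y : L) (v : V) : translPair hH l X (H.dmul l Y v)
    = translPairAux H l Y v (H.transl hH X) :=
  BalTensor.pairing_tmul (H.transl hH) (translPairAux H l) (translPairAux_bal hH l) X Y v

theorem translPair_one (X : L) : translPair hH H.sL X (H.dmul H.sL 1 1)
    = translPairAux H H.sL 1 1 (H.transl hH X) := translPair_dmul hH H.sL X 1 1

theorem translPair_t_mul (b : B) (X : L) (u : H.Diam l) :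
    translPair hH l (H.t b * X) u = translPair hH l X (H.diamSL l b u) := by
  induction u using BalTensor.ind with
  | tmul Y v =>
    rw [EnvRing.diamSL_dmul, translPair_dmul, translPair_dmul, transl_t_mul]
    generalize H.transl hH X = x
    induction x using BalTensor.ind with
    | tmul A C => rw [BalTensor.map_tmul, translPairAux_omul, translPairAux_omul]; simp [mul_assoc]
    | add x y hx hy => simp only [map_add, hx, hy]
  | add x y hx hy => simp only [map_add, hx, hy]

/-- `X ⋄ u ↦ X₋ u₁ ⋄ (X₊ ⋄ u₂)`. -/
noncomputable def translEval : H.Diam (H.diamSL l) →ₗ[k] H.Diam (H.diamTR l) :=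
  BalTensor.lift (translPair hH l) (translPair_t_mul hH l)

theorem translEval_dmul (X : L) (u : H.Diam l) :
    translEval hH l (H.dmul (H.diamSL l) X u) = translPair hH l X u :=
  BalTensor.lift_tmul (translPair hH l) (translPair_t_mul hH l) X u

/-- `X₁₋ X₂ ⋄ X₁₊ = 1 ⋄ X`. -/
theorem translEval_comul (X : L) (v : V) : translEval hH l (H.diamInsert l v (H.comul X))
    = H.dmul (H.diamTR l) 1 (H.dmul l X v) := by
  have h : ∀ u, translEval hH l (H.diamInsert l v u)
      = translPairAux H l 1 v (H.galoisInv hH u) := fun u => by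
    induction u using BalTensor.ind with
    | tmul Y Z =>
      rw [EnvRing.diamInsert_dmul, translEval_dmul, translPair_dmul, galoisInv_dmul]
      generalize H.transl hH Y = x
      induction x using BalTensor.ind with
      | tmul A C => rw [BalTensor.map_tmul, translPairAux_omul, translPairAux_omul]; simp
      | add x y hx hy => simp only [map_add, hx, hy]
    | add x y hx hy => simp only [map_add, hx, hy]
  rw [h, galoisInv_comul, translPairAux_omul, one_mul]

/-- `u₁₋ u₂ ⋄ (u₁₊ ⋄ u₃) = 1 ⋄ u`. -/
theorem translEval_comulDiam (u : H.Diam l) :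
    translEval hH l (H.comulDiam H.comul H.comul_target l u) = H.dmul (H.diamTR l) 1 u := by
  induction u using BalTensor.ind with
  | tmul X v => rw [EnvRing.comulDiam_dmul, translEval_comul]
  | add x y hx hy => simp only [map_add, hx, hy]

end TranslPair

/-! ### The dual comodule -/

variable (H) in
/-- The left action `b · X = X b̄`. -/
def dualLeft : B →ₐ[k] Module.End k L :=
  AlgHom.ofLinearMap
    { toFun := H.tR
      map_add' := fun a b => LinearMap.ext fun X => by simp [mul_add]
      map_smul' := fun c b => LinearMap.ext fun X => by simp }
    (LinearMap.ext fun X => by simp [H.t_one])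
    (fun a b => LinearMap.ext fun X => by simp [H.t_mul, mul_assoc])

theorem tL_dualLeft (b c : B) (X : L) :
    H.tL b (dualLeft H c X) = dualLeft H c (H.tL b X) := H.tL_tR b c X

variable (H) in
/-- `A ⊗ C ↦ C ⋄ A`. -/
def opFlip : H.OpTensor →ₗ[k] H.Diam (dualLeft H) :=
  BalTensor.lift (H.dmul (dualLeft H)).flip (fun b A C => (H.dmul_bal (dualLeft H) b C A).symm)

@[simp] theorem opFlip_omul (A C : L) : opFlip H (H.omul A C) = H.dmul (dualLeft H) C A :=
  BalTensor.lift_tmul (H.dmul (dualLeft H)).flip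
    (fun b A C => (H.dmul_bal (dualLeft H) b C A).symm) A C

variable (H) in
/-- `C ⋄ A ↦ A ⊗ C`. -/
def opUnflip : H.Diam (dualLeft H) →ₗ[k] H.OpTensor :=
  BalTensor.lift H.omul.flip (fun b C A => (H.omul_bal b A C).symm)

@[simp] theorem opUnflip_dmul (A C : L) : opUnflip H (H.dmul (dualLeft H) C A) = H.omul A C :=
  BalTensor.lift_tmul H.omul.flip (fun b C A => (H.omul_bal b A C).symm) C A

theorem opUnflip_opFlip (x : H.OpTensor) : opUnflip H (opFlip H x) = x := by
  induction x using BalTensor.ind with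
  | tmul A C => rw [opFlip_omul, opUnflip_dmul]
  | add x y hx hy => simp only [map_add, hx, hy]

theorem opFlip_opUnflip (x : H.Diam (dualLeft H)) : opFlip H (opUnflip H x) = x := by
  induction x using BalTensor.ind with
  | tmul A C => rw [opUnflip_dmul, opFlip_omul]
  | add x y hx hy => simp only [map_add, hx, hy]

variable (H) in
/-- `C ⋄ A ↦ A₁ ⋄ A₂ C`. -/
def galoisFlip : H.Diam (dualLeft H) →ₗ[k] H.Diam H.sL := H.galois ∘ₗ opUnflip H

/-- The Takeuchi property of the coproduct, in terms of `galoisFlip`. -/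
theorem galoisFlip_left (b : B) (x : H.Diam (dualLeft H)) :
    galoisFlip H (H.diamSL (dualLeft H) b x) = H.diamTR H.sL b (galoisFlip H x) := by
  induction x using BalTensor.ind with
  | tmul C A =>
    rw [EnvRing.diamSL_dmul, galoisFlip, LinearMap.comp_apply, LinearMap.comp_apply, opUnflip_dmul,
      opUnflip_dmul, galois_omul, galois_omul]
    have h1 : ∀ u, H.diamMulRight u (H.s b * C)
        = H.diamMulRight (H.diamMap (H.sR b) (H.sR_sL b) u) C := fun u =>
      BalTensor.hom_ext_apply (φ := H.diamMulRight.flip (H.s b * C))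
        (ψ := H.diamMulRight.flip C ∘ₗ H.diamMap (H.sR b) (H.sR_sL b))
        (fun X Z => by simp [mul_assoc]) u
    have h2 : ∀ u, H.diamMulRight (H.diamTR H.sL b u) C
        = H.diamTR H.sL b (H.diamMulRight u C) := fun u =>
      BalTensor.hom_ext_apply (φ := H.diamMulRight.flip C ∘ₗ H.diamTR H.sL b)
        (ψ := H.diamTR H.sL b ∘ₗ H.diamMulRight.flip C) (fun X Z => by simp) u
    rw [h1, ← H.comul_takeuchi, h2]
  | add x y hx hy => simp only [map_add, hx, hy]

end Transl

end LeftBialgebroid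

namespace LeftBialgebroid

variable {k : Type v} {B L : Type u} [CommRing k] [Ring B] [Algebra k B] [Ring L] [Algebra k L]
  {H : LeftBialgebroid k B L} (hH : H.IsLeftHopf)

open Comodule

section DualComodule

variable (H) in
/-- The right action `X · b = b̄ X`. -/
def dualRight : Bᵐᵒᵖ →ₐ[k] Module.End k L := (Algebra.lmul k L).comp H.target

theorem galoisFlip_coact (Y : L) :
    galoisFlip H (opFlip H (H.transl hH Y)) = H.dmul H.sL Y 1 := by
  rw [galoisFlip, LinearMap.comp_apply, opUnflip_opFlip, galois_transl]

/-- `Y ⋄ Z ↦ Y c ⋄ Z d`. -/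
def mulRight₂ (H : LeftBialgebroid k B L) (c d : L) : H.Diam H.sL →ₗ[k] H.Diam H.sL :=
  BalTensor.map (LinearMap.mulRight k c) (LinearMap.mulRight k d) (H.mulRight_tL c)
    (H.mulRight_sL d)

theorem mulRight₂_dmul (c d Y Z : L) :
    mulRight₂ H c d (H.dmul H.sL Y Z) = H.dmul H.sL (Y * c) (Z * d) :=
  BalTensor.map_tmul _ _ (H.mulRight_tL c) (H.mulRight_sL d) Y Z

theorem mulRight₂_diamSL (c d : L) (b : B) (u : H.Diam H.sL) :
    mulRight₂ H c d (H.diamSL H.sL b u) = H.diamSL H.sL b (mulRight₂ H c d u) := by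
  induction u using BalTensor.ind with
  | tmul Y Z =>
    rw [EnvRing.diamSL_dmul, mulRight₂_dmul, mulRight₂_dmul, EnvRing.diamSL_dmul, mul_assoc]
  | add x y hx hy => simp only [map_add, hx, hy]

/-- `Δ(X Y) = ∑ X₁ c ⋄ X₂ d` if `Δ(Y) = ∑ c ⋄ d`. -/
theorem comul_mul_eq_sum (X Y : L) (S : Finset (L × L))
    (hY : BalTensor.proj H.tL H.sL (∑ i ∈ S, i.1 ⊗ₜ[k] i.2) = H.comul Y) :
    H.comul (X * Y) = ∑ i ∈ S, mulRight₂ H i.1 i.2 (H.comul X) := by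
  obtain ⟨x, hx⟩ := BalTensor.proj_surjective H.tL H.sL (H.comul X)
  rw [H.comul_mul X Y x _ hx hY, Finset.mul_sum, map_sum, ← hx]
  refine Finset.sum_congr rfl fun i _ => ?_
  have : BalTensor.proj H.tL H.sL ∘ₗ LinearMap.mulRight k (i.1 ⊗ₜ[k] i.2)
      = mulRight₂ H i.1 i.2 ∘ₗ BalTensor.proj H.tL H.sL :=
    TensorProduct.ext' fun X Y => by
      simp only [LinearMap.comp_apply, LinearMap.mulRight_apply,
        Algebra.TensorProduct.tmul_mul_tmul, BalTensor.proj_tmul, mulRight₂_dmul]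
  exact LinearMap.congr_fun this x

/-- `C ⋄ v ↦ C Y ⋄ v`. -/
def diamMulOut {V : Type*} [AddCommGroup V] [Module k V] (H : LeftBialgebroid k B L)
    (l : B → Module.End k V) (Y : L) : Module.End k (H.Diam l) :=
  BalTensor.map (LinearMap.mulRight k Y) LinearMap.id (H.mulRight_tL Y) (fun _ _ => rfl)

theorem diamMulOut_dmul {V : Type*} [AddCommGroup V] [Module k V]
    (l : B → Module.End k V) (Y X : L) (v : V) :
    diamMulOut H l Y (H.dmul l X v) = H.dmul l (X * Y) v :=
  BalTensor.map_tmul (g := l) (g' := l) _ LinearMap.id (H.mulRight_tL Y) (fun _ _ => rfl) X v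

/-- `A₁₋ A₂ C₁ ⋄ (A₁₊ ⋄ A₃ C₂) = C₁ ⋄ (A₁ ⋄ A₂ C₂)`, where `Δ(C)` is given by representatives. -/
theorem translEval_sum (C A : L) (S : Finset (L × L))
    (hC : BalTensor.proj H.tL H.sL (∑ i ∈ S, i.1 ⊗ₜ[k] i.2) = H.comul C) :
    translEval hH H.sL (H.diamMap H.comul H.comul_source (H.galois (H.omul A C)))
      = ∑ i ∈ S, H.dmul (H.diamTR H.sL) i.1 (H.galois (H.omul A i.2)) := by
  have h1 : ∀ u, translEval hH H.sL (H.diamMap H.comul H.comul_source (H.diamMulRight u C))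
      = ∑ i ∈ S, translEval hH H.sL (H.diamMap (mulRight₂ H i.1 i.2) (mulRight₂_diamSL i.1 i.2)
        (H.diamMap H.comul H.comul_source u)) := fun u => by
    induction u using BalTensor.ind with
    | tmul Y Z =>
      rw [diamMulRight_dmul]
      refine (congrArg _ (H.diamMap_dmul H.comul H.comul_source Y (Z * C))).trans ?_
      rw [comul_mul_eq_sum Z C S hC, map_sum, map_sum]
      refine Finset.sum_congr rfl fun i _ => congrArg _ ?_
      refine Eq.trans ?_ (congrArg _ (H.diamMap_dmul H.comul H.comul_source Y Z)).symm
      exact (H.diamMap_dmul _ (mulRight₂_diamSL i.1 i.2) Y _).symm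
    | add x y hx hy =>
      simp only [map_add, LinearMap.add_apply, hx, hy, Finset.sum_add_distrib]
  have h2 : ∀ (c d : L) (v : H.Diam H.sL), translEval hH H.sL
      (H.diamMap (mulRight₂ H c d) (mulRight₂_diamSL c d)
        (H.comulDiam H.comul H.comul_target H.sL v))
      = H.dmul (H.diamTR H.sL) c (H.diamMulRight v d) := fun c d v => by
    induction v using BalTensor.ind with
    | tmul Y Z =>
      rw [EnvRing.comulDiam_dmul, diamMulRight_dmul]
      have h3 : ∀ w, translEval hH H.sL (H.diamMap (mulRight₂ H c d) (mulRight₂_diamSL c d)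
          (H.diamInsert H.sL Z w))
          = diamMulOut H _ c (translEval hH H.sL (H.diamInsert H.sL (Z * d) w)) := fun w => by
        induction w using BalTensor.ind with
        | tmul P Q =>
          rw [EnvRing.diamInsert_dmul, EnvRing.diamInsert_dmul, EnvRing.diamMap_dmul,
            mulRight₂_dmul, translEval_dmul, translEval_dmul, translPair_dmul, translPair_dmul]
          generalize H.transl hH P = x
          induction x using BalTensor.ind with
          | tmul A C =>
            rw [translPairAux_omul, translPairAux_omul, diamMulOut_dmul, mul_assoc]
          | add x y hx hy => simp only [map_add, hx, hy]
        | add x y hx hy => simp only [map_add, hx, hy]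
      rw [h3, translEval_comul, diamMulOut_dmul, one_mul]
    | add x y hx hy => simp only [map_add, hx, hy, LinearMap.add_apply]
  rw [galois_omul, h1, H.coassoc]
  refine Finset.sum_congr rfl fun i _ => ?_
  rw [h2, galois_omul]

/-- `C₁ ⋄ (A₁ ⋄ A₂ C₂) = D₋ E₁ ⋄ (D₊ ⋄ E₂)` for `D ⋄ E = A₁ ⋄ A₂ C`. -/
theorem galoisFlip_comulDiam (x : H.OpTensor) :
    H.diamMap (galoisFlip H) galoisFlip_left
        (H.comulDiam H.comul H.comul_target (dualLeft H) (opFlip H x))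
      = translEval hH H.sL (H.diamMap H.comul H.comul_source (H.galois x)) := by
  induction x using BalTensor.ind with
  | tmul A C =>
    obtain ⟨y, hy⟩ := BalTensor.proj_surjective H.tL H.sL (H.comul C)
    obtain ⟨S, rfl⟩ := TensorProduct.exists_finset y
    rw [translEval_sum hH C A S hy, opFlip_omul, EnvRing.comulDiam_dmul, ← hy, map_sum, map_sum,
      map_sum]
    refine Finset.sum_congr rfl fun i _ => ?_
    rw [BalTensor.proj_tmul, EnvRing.diamInsert_dmul, EnvRing.diamMap_dmul, galoisFlip,
      LinearMap.comp_apply, opUnflip_dmul]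
  | add x y hx hy => simp only [map_add, hx, hy]

theorem transl_coact_left (b : B) (X : L) : opFlip H (H.transl hH (X * H.t b))
    = H.diamSL (dualLeft H) b (opFlip H (H.transl hH X)) := by
  rw [transl_mul_t]
  generalize H.transl hH X = x
  induction x using BalTensor.ind with
  | tmul A C => rw [BalTensor.map_tmul, opFlip_omul, opFlip_omul, EnvRing.diamSL_dmul]; rfl
  | add x y hx hy => simp only [map_add, hx, hy]

/-- `X₋₁ ⋄ (X₋₂ ⋄ X₊) = X₋ ⋄ (X₊₋ ⋄ X₊₊)`. -/
theorem transl_coassoc (X : L) :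
    H.diamMap (l := dualLeft H) (l' := H.diamSL (dualLeft H)) (opFlip H ∘ₗ H.transl hH)
        (transl_coact_left hH)
        (opFlip H (H.transl hH X))
      = H.comulDiam H.comul H.comul_target (dualLeft H) (opFlip H (H.transl hH X)) := by
  -- Applying the injective map `A ⋄ C ↦ C₁ ⋄ C₂ A` to the two inner factors turns both sides into
  -- `X₋ ⋄ (X₊ ⋄ 1)`.
  have inv : ∀ x : H.Diam (dualLeft H), opFlip H (H.galoisInv hH (galoisFlip H x)) = x :=
      fun x => by
    rw [galoisFlip, LinearMap.comp_apply, galoisInv_galois, opFlip_opUnflip]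
  have inv' : ∀ y : H.Diam H.sL, galoisFlip H (opFlip H (H.galoisInv hH y)) = y := fun y => by
    rw [galoisFlip, LinearMap.comp_apply, opUnflip_opFlip, galois_galoisInv]
  have hl : ∀ b y, (opFlip H ∘ₗ H.galoisInv hH) (H.diamTR H.sL b y)
      = H.diamSL (dualLeft H) b ((opFlip H ∘ₗ H.galoisInv hH) y) := fun b y => by
    refine Function.LeftInverse.injective inv ?_
    rw [galoisFlip_left, LinearMap.comp_apply, LinearMap.comp_apply, inv', inv']
  refine Function.LeftInverse.injective
    (H.diamMap_leftInverse (h := galoisFlip_left) (h' := hl) inv) ?_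
  refine Eq.trans ?_ (galoisFlip_comulDiam hH _).symm
  rw [galois_transl]
  refine Eq.trans ?_ (congrArg _ (H.diamMap_dmul H.comul H.comul_source X 1)).symm
  rw [H.comul_one, translEval_dmul, translPair_one]
  refine (H.diamMap_diamMap (l := dualLeft H) (l' := H.diamSL (dualLeft H)) _ _ _ _
    ((H.dmul H.sL).flip 1) (fun b X => (H.diamTR_dmul H.sL b X 1).symm)
    (fun X => galoisFlip_coact hH X) _).trans ?_
  generalize H.transl hH X = x
  induction x using BalTensor.ind with
  | tmul A C =>
    rw [opFlip_omul, translPairAux_omul, mul_one]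
    exact H.diamMap_dmul ((H.dmul H.sL).flip 1) _ C A
  | add x y hx hy => simp only [map_add, hx, hy]

/-- The algebra `L` as a comodule with `b · X · c = c̄ X b̄` and coaction `X ↦ X₋ ⋄ X₊`. For a
comodule `M`, the module `L ⋄_B M` underlies the tensor product of this comodule with `M`. -/
noncomputable abbrev dual : H.Comodule where
  carrier := L
  left := dualLeft H
  right := dualRight H
  right_left _ _ _ := (mul_assoc _ _ _).symm
  coact := opFlip H ∘ₗ H.transl hH
  coact_left := transl_coact_left hH
  coact_right b X := by
    refine (congrArg (opFlip H) (transl_t_mul hH b X)).trans ?_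
    change _ = H.diamSR (dualLeft H) b (opFlip H (H.transl hH X))
    generalize H.transl hH X = x
    induction x using BalTensor.ind with
    | tmul A C => rw [BalTensor.map_tmul, opFlip_omul, opFlip_omul, EnvRing.diamSR_dmul]; rfl
    | add x y hx hy => simp only [map_add, hx, hy]
  coact_takeuchi b X := by
    have h1 : ∀ x, H.diamTR (dualLeft H) b (opFlip H x)
        = opFlip H (H.omap LinearMap.id (H.tR b) (fun _ _ => rfl) (H.tR_tL' b) x) := fun x => by
      induction x using BalTensor.ind with
      | tmul A C => rw [BalTensor.map_tmul, opFlip_omul, opFlip_omul, EnvRing.diamTR_dmul]; rfl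
      | add x y hx hy => simp only [map_add, hx, hy]
    have h2 : ∀ x, H.diamMap (H.tL b) (tL_dualLeft b) (opFlip H x)
        = opFlip H (H.omap (H.tL b) LinearMap.id (H.tL_tR b) (fun _ _ => rfl) x) := fun x => by
      induction x using BalTensor.ind with
      | tmul A C => rw [BalTensor.map_tmul, opFlip_omul, opFlip_omul, EnvRing.diamMap_dmul]; rfl
      | add x y hx hy => simp only [map_add, hx, hy]
    refine (h1 _).trans (Eq.trans ?_ (h2 _).symm)
    rw [H.transl_bal]
  coassoc X := transl_coassoc hH X
  counit_coact X := by
    refine Eq.trans ?_ (counitOp_transl hH X)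
    change H.counitDiam _ _ (dualLeft H) (opFlip H (H.transl hH X)) = _
    generalize H.transl hH X = x
    induction x using BalTensor.ind with
    | tmul A C =>
      rw [opFlip_omul, counitOp_omul]
      exact H.counitDiam_dmul _ _ (dualLeft H) C A
    | add x y hx hy =>
      simp only [map_add, hx, hy]

end DualComodule

end LeftBialgebroid

namespace LeftBialgebroid

variable {k : Type v} {B L : Type u} [CommRing k] [Ring B] [Algebra k B] [Ring L] [Algebra k L]
  {H : LeftBialgebroid k B L}

open Comodule

/-! ### Central coinvariant elements -/

namespace Comodule

variable {M N P Q : H.Comodule}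

/-- An element `q` of a comodule with `δ(q) = 1 ⋄ q` and `b q = q b`. -/
structure IsCentral (Q : H.Comodule) (q : Q.carrier) : Prop where
  coact_eq : Q.coact q = H.dmul Q.left 1 q
  comm : ∀ b, Q.left b q = Q.right (op b) q

/-- The map `b ↦ b q` on the unit comodule. It is a morphism if `q` is central and coinvariant. -/
def centralMap (Q : H.Comodule) (q : Q.carrier) : (unit H).carrier →ₗ[k] Q.carrier :=
  Q.left.toLinearMap.flip q ∘ₗ toB H

theorem centralMap_apply (q : Q.carrier) (b : B) :
    centralMap Q q (ofB H b) = Q.left b q := rfl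

theorem IsCentral.isMor {q : Q.carrier} (h : IsCentral Q q) :
    IsMor (unit H) Q (centralMap Q q) := by
  have hl : ∀ b m, centralMap Q q ((unit H).left b m) = Q.left b (centralMap Q q m) := fun b m => by
    change Q.left (b * toB H m) q = Q.left b (Q.left (toB H m) q)
    rw [map_mul, Module.End.mul_apply]
  refine IsMor.mk hl (fun b m => ?_) (fun m => ?_)
  · change Q.left (toB H m * b) q = Q.right (op b) (Q.left (toB H m) q)
    rw [map_mul, Module.End.mul_apply, h.comm, Q.right_left]
  · rw [unit_coact]
    change Q.coact (Q.left (toB H m) q) = _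
    rw [Q.coact_left, h.coact_eq, EnvRing.diamSL_dmul, EnvRing.diamMap_dmul, mul_one,
      centralMap_apply, map_one, Module.End.one_apply]

theorem isCentral_one : IsCentral (regular H) (1 : L) where
  coact_eq := H.comul_one
  comm b := (mul_one (H.s b)).trans (one_mul (H.s b)).symm

theorem isCentral_t (b : B) : IsCentral (regular H) (H.t b) where
  coact_eq := H.comul_t b
  comm c := H.s_t c b

theorem isCentral_dual_one (hH : H.IsLeftHopf) : IsCentral (dual hH) (1 : L) where
  coact_eq := (congrArg (opFlip H) (transl_one hH)).trans (opFlip_omul 1 1)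
  comm b := (one_mul (H.t b)).trans (mul_one (H.t b)).symm

/-- The element `m₋₁ ⋄ m₀` of `L ⋄_B M` is coinvariant for the coaction
`X ⋄ m ↦ X₋ m₋₁ ⋄ (X₊ ⋄ m₀)`. -/
theorem isCentral_coact (hH : H.IsLeftHopf) (m : M.carrier) :
    IsCentral ((dual hH).tensor M) (M.coact m) where
  coact_eq := by
    have h : ∀ u : H.Diam M.left, ((dual hH).tensor M).coact u
        = translEval hH M.left (H.diamMap M.coact M.coact_left u) := fun u => by
      induction u using BalTensor.ind with
      | tmul X m =>
        rw [EnvRing.diamMap_dmul, translEval_dmul]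
        refine ((dual hH).coact_ten M X m).trans ?_
        generalize M.coact m = v
        induction v using BalTensor.ind with
        | tmul Y n =>
          rw [translPair_dmul, Balanced.pair_dmul]
          change _ = translPairAux H M.left Y n (H.transl hH X)
          change ((dual hH).cod M).fst Y n (opFlip H (H.transl hH X)) = _
          generalize H.transl hH X = x
          induction x using BalTensor.ind with
          | tmul A C =>
            rw [opFlip_omul, translPairAux_omul]
            exact (dual hH).fst_cod_dmul M Y n C A
          | add x y hx hy =>
            rw [map_add, map_add, map_add]; exact congrArg₂ (· + ·) hx hy
        | add x y hx hy => rw [map_add, map_add]; exact congrArg₂ (· + ·) hx hy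
      | add x y hx hy =>
        rw [map_add, map_add, ← hx, ← hy]; exact map_add ((dual hH).tensor M).coact x y
    refine (h _).trans ?_
    rw [M.coassoc, translEval_comulDiam]
    rfl
  comm b := M.coact_takeuchi b m

/-! ### Products as morphisms -/

theorem regMul_bal (b : B) (m n : (regular H).carrier) :
    LinearMap.mul k L ((regular H).right (op b) m) n
      = LinearMap.mul k L m ((regular H).left b n) := mul_assoc m (H.s b) n

variable (H) in
/-- `X ⊗ Y ↦ X Y`. -/
def regMulLin : ((regular H).tensor (regular H)).carrier →ₗ[k] (regular H).carrier :=
  tlift (M := regular H) (N := regular H) (LinearMap.mul k L) regMul_bal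

theorem regMulLin_ten (X Y : L) :
    regMulLin H ((regular H).ten (regular H) X Y) = (X * Y : L) :=
  tlift_ten (M := regular H) (N := regular H) (LinearMap.mul k L) regMul_bal X Y

theorem regMulLin_left (b : B) (x : ((regular H).tensor (regular H)).carrier) :
    regMulLin H (((regular H).tensor (regular H)).left b x)
      = (regular H).left b (regMulLin H x) := by
  induction x using ten_ind with
  | ten X Y =>
    refine (congrArg _ ((regular H).left_ten (regular H) b X Y)).trans ?_
    refine (regMulLin_ten _ _).trans ((mul_assoc (H.s b) X Y).trans ?_)
    exact congrArg ((regular H).left b) (regMulLin_ten X Y).symm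
  | add x y hx hy => simp only [map_add, hx, hy]

/-- `Δ(X Y) = X₁ Y₁ ⋄ X₂ Y₂`, in terms of `Δ(Y)` and the codiagonal coaction. -/
theorem comul_mul_pair (X Y : L) : H.comul (X * Y)
    = H.diamMap (regMulLin H) regMulLin_left
        (((regular H).cod (regular H)).pair X (H.comul Y)) := by
  obtain ⟨y, hy⟩ := BalTensor.proj_surjective H.tL H.sL (H.comul Y)
  obtain ⟨S, rfl⟩ := TensorProduct.exists_finset y
  have e : ((regular H).cod (regular H)).pair X (H.comul Y)
      = ∑ i ∈ S, ((regular H).cod (regular H)).fst i.1 i.2 (H.comul X) := by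
    rw [← hy, map_sum]
    refine (map_sum (((regular H).cod (regular H)).pair X) _ S).trans
      (Finset.sum_congr rfl fun i _ => ?_)
    exact ((regular H).cod (regular H)).pair_dmul X i.1 i.2
  rw [comul_mul_eq_sum X Y S hy, e]
  refine Eq.trans (Finset.sum_congr rfl fun i _ => ?_)
    (map_sum (H.diamMap (regMulLin H) regMulLin_left) _ S).symm
  generalize H.comul X = x
  induction x using BalTensor.ind with
  | tmul P Q =>
    rw [mulRight₂_dmul]
    refine Eq.trans ?_ (congrArg _ ((regular H).fst_cod_dmul (regular H) i.1 i.2 P Q)).symm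
    refine Eq.trans ?_ (H.diamMap_dmul _ regMulLin_left _ _).symm
    exact congrArg _ (regMulLin_ten Q i.2).symm
  | add x y hx hy => rw [map_add, hx, hy, map_add, map_add]

/-- The product is a morphism for the regular coaction. -/
theorem isMor_regMul :
    IsMor ((regular H).tensor (regular H)) (regular H) (regMulLin H) := by
  refine IsMor.mk regMulLin_left (fun b x => ?_) (fun x => ?_)
  · induction x using ten_ind with
    | ten X Y =>
      refine (congrArg _ ((regular H).right_ten (regular H) (op b) X Y)).trans ?_
      refine (regMulLin_ten _ _).trans ((mul_assoc X Y (H.s b)).symm.trans ?_)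
      exact congrArg ((regular H).right (op b)) (regMulLin_ten X Y).symm
    | add x y hx hy => simp only [map_add, hx, hy]
  · induction x using ten_ind with
    | ten X Y =>
      refine (congrArg H.comul (regMulLin_ten X Y)).trans ((comul_mul_pair X Y).trans ?_)
      exact congrArg _ ((regular H).coact_ten (regular H) X Y).symm
    | add x y hx hy => simp only [map_add, hx, hy]

section Dual

variable (hH : H.IsLeftHopf)

/-- `X ⊗ Y ↦ Y X`. -/
noncomputable def dualMulLin : ((dual hH).tensor (dual hH)).carrier →ₗ[k] (dual hH).carrier :=
  tlift (M := dual hH) (N := dual hH) (LinearMap.mul k L).flip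
    (fun b X Y => (mul_assoc Y (H.t b) X).symm)

theorem dualMulLin_ten (X Y : L) :
    dualMulLin hH ((dual hH).ten (dual hH) X Y) = (Y * X : L) :=
  tlift_ten (M := dual hH) (N := dual hH) (LinearMap.mul k L).flip
    (fun b X Y => (mul_assoc Y (H.t b) X).symm) X Y

theorem dualMulLin_left (b : B) (x : ((dual hH).tensor (dual hH)).carrier) :
    dualMulLin hH (((dual hH).tensor (dual hH)).left b x)
      = (dual hH).left b (dualMulLin hH x) := by
  induction x using ten_ind with
  | ten X Y =>
    refine (congrArg _ ((dual hH).left_ten (dual hH) b X Y)).trans ?_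
    refine (dualMulLin_ten hH _ _).trans ((mul_assoc Y X (H.t b)).symm.trans ?_)
    exact congrArg ((dual hH).left b) (dualMulLin_ten hH X Y).symm
  | add x y hx hy => simp only [map_add, hx, hy]

/-- `A ⊗ C ↦ D A ⊗ C E`. -/
def opConj (H : LeftBialgebroid k B L) (D E : L) : Module.End k H.OpTensor :=
  BalTensor.map (LinearMap.mulLeft k D) (LinearMap.mulRight k E)
    (fun b X => (mul_assoc D X (H.t b)).symm) (mulRight_tL E)

theorem opConj_omul (D E A C : L) : opConj H D E (H.omul A C) = H.omul (D * A) (C * E) :=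
  BalTensor.map_tmul _ _ _ (mulRight_tL E) A C

/-- `λ(D X₊ ⊗ X₋ E) = λ(D ⊗ E) (X ⊗ 1)`. -/
theorem galois_opConj_transl (D E X : L) :
    H.galois (opConj H D E (H.transl hH X)) = diamMulOut H H.sL X (H.galois (H.omul D E)) := by
  have h1 : ∀ x, H.galois (opConj H D E x) = H.diamMap (LinearMap.mulRight k E) (H.mulRight_sL E)
      (H.diamMap (regMulLin H) regMulLin_left
        (((regular H).cod (regular H)).pair D (H.galois x))) := fun x => by
    induction x using BalTensor.ind with
    | tmul A C =>
      have h2 : ∀ v : H.Diam H.sL,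
          H.diamMulRight (H.diamMap (regMulLin H) regMulLin_left
            (((regular H).cod (regular H)).pair D v)) (C * E)
          = H.diamMap (LinearMap.mulRight k E) (H.mulRight_sL E)
            (H.diamMap (regMulLin H) regMulLin_left
            (((regular H).cod (regular H)).pair D (H.diamMulRight v C))) := fun v => by
        induction v using BalTensor.ind with
        | tmul Y Z =>
          rw [diamMulRight_dmul]
          have h3 : ∀ Z : L, ((regular H).cod (regular H)).pair D (H.dmul H.sL Y Z)
            = ((regular H).cod (regular H)).fst Y Z (H.comul D) := fun Z =>
              ((regular H).cod (regular H)).pair_dmul D Y Z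
          have h4 : ∀ (Z P Q : L), H.diamMap (regMulLin H) regMulLin_left
              (((regular H).cod (regular H)).fst Y Z (H.dmul H.sL P Q))
              = H.dmul H.sL (P * Y) (Q * Z) := fun Z P Q => by
            refine (congrArg _ ((regular H).fst_cod_dmul (regular H) Y Z P Q)).trans ?_
            refine (H.diamMap_dmul _ regMulLin_left _ _).trans ?_
            exact congrArg _ (regMulLin_ten Q Z)
          rw [h3, h3]
          generalize H.comul D = w
          induction w using BalTensor.ind with
          | tmul P Q =>
            rw [h4]
            refine Eq.trans ?_ (congrArg _ (h4 _ P Q)).symm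
            rw [diamMulRight_dmul, EnvRing.diamMap_dmul, LinearMap.mulRight_apply, mul_assoc,
              mul_assoc, mul_assoc]
          | add x y hx hy =>
            simp only [map_add, LinearMap.add_apply] at hx hy ⊢
            rw [hx, hy]
        | add x y hx hy =>
          simp only [map_add, LinearMap.add_apply] at hx hy ⊢
          rw [hx, hy]
      rw [opConj_omul, galois_omul, comul_mul_pair, galois_omul]
      exact h2 (H.comul A)
    | add x y hx hy => simp only [map_add, hx, hy]
  rw [h1, galois_transl, galois_omul]
  have h3 : ((regular H).cod (regular H)).pair D (H.dmul H.sL X 1)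
      = ((regular H).cod (regular H)).fst X (1 : L) (H.comul D) :=
    ((regular H).cod (regular H)).pair_dmul D X (1 : L)
  rw [h3]
  generalize H.comul D = w
  induction w using BalTensor.ind with
  | tmul P Q =>
    rw [diamMulRight_dmul, diamMulOut_dmul]
    refine (congrArg _ ((congrArg _ ((regular H).fst_cod_dmul (regular H) X (1 : L) P Q)).trans
      ((H.diamMap_dmul _ regMulLin_left _ _).trans
        (congrArg _ (regMulLin_ten Q (1 : L)))))).trans ?_
    refine (H.diamMap_dmul _ (H.mulRight_sL E) _ _).trans ?_
    rw [LinearMap.mulRight_apply, mul_one]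
  | add x y hx hy =>
    simp only [map_add, LinearMap.add_apply] at hx hy ⊢
    rw [hx, hy]

/-- `(Y X)₊ ⊗ (Y X)₋ = Y₊ X₊ ⊗ X₋ Y₋`, in terms of the coaction of the dual comodule. -/
theorem dual_coact_mul (X Y : L) : (dual hH).coact (Y * X : L)
    = H.diamMap (dualMulLin hH) (dualMulLin_left hH)
        (((dual hH).cod (dual hH)).pair X ((dual hH).coact Y)) := by
  have h1 : ∀ x : H.OpTensor, H.diamMap (dualMulLin hH) (dualMulLin_left hH)
      (((dual hH).cod (dual hH)).pair X (opFlip H x))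
      = opFlip H (H.galoisInv hH (diamMulOut H H.sL X (H.galois x))) := fun x => by
    induction x using BalTensor.ind with
    | tmul D E =>
      rw [← galois_opConj_transl hH, galoisInv_galois, opFlip_omul]
      refine (congrArg _ (((dual hH).cod (dual hH)).pair_dmul X E D)).trans ?_
      change H.diamMap (dualMulLin hH) (dualMulLin_left hH)
        (((dual hH).cod (dual hH)).fst E D (opFlip H (H.transl hH X))) = _
      generalize H.transl hH X = x
      induction x using BalTensor.ind with
      | tmul A C =>
        rw [opFlip_omul, opConj_omul, opFlip_omul]
        refine (congrArg _ ((dual hH).fst_cod_dmul (dual hH) E D C A)).trans ?_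
        refine (H.diamMap_dmul _ (dualMulLin_left hH) _ _).trans ?_
        exact congrArg _ (dualMulLin_ten hH A D)
      | add x y hx hy =>
        simp only [map_add] at hx hy ⊢
        rw [← hx, ← hy]
    | add x y hx hy =>
        simp only [map_add] at hx hy ⊢
        rw [← hx, ← hy]
  refine Eq.trans ?_ (h1 (H.transl hH Y)).symm
  rw [galois_transl, diamMulOut_dmul]
  rfl

/-- The opposite product is a morphism for the dual coaction. -/
theorem isMor_dualMul :
    IsMor ((dual hH).tensor (dual hH)) (dual hH) (dualMulLin hH) := by
  refine IsMor.mk (dualMulLin_left hH) (fun b x => ?_) (fun x => ?_)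
  · induction x using ten_ind with
    | ten X Y =>
      refine (congrArg _ ((dual hH).right_ten (dual hH) (op b) X Y)).trans ?_
      refine (dualMulLin_ten hH _ _).trans ((mul_assoc (H.t b) Y X).trans ?_)
      exact congrArg ((dual hH).right (op b)) (dualMulLin_ten hH X Y).symm
    | add x y hx hy => simp only [map_add, hx, hy]
  · induction x using ten_ind with
    | ten X Y =>
      refine (congrArg (dual hH).coact (dualMulLin_ten hH X Y)).trans
        ((dual_coact_mul hH X Y).trans ?_)
      exact congrArg _ ((dual hH).coact_ten (dual hH) X Y).symm
    | add x y hx hy => simp only [map_add, hx, hy]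

end Dual

end Comodule

end LeftBialgebroid

namespace LeftBialgebroid

variable {k : Type v} {B L : Type u} [CommRing k] [Ring B] [Algebra k B] [Ring L] [Algebra k L]
  {H : LeftBialgebroid k B L}

open Comodule

namespace LeftCocycle

variable (Γ : H.LeftCocycle) {M N P Q M' N' A C D : H.Comodule}

/-! ### The twisting maps `(m, n) ↦ Γ(m₋₁, n₋₁) m₀ ⊗ n₀` -/

/-- Naturality of the twisting maps, after arbitrary linear maps `μ` and `ν` from the two tensor
products. -/
theorem sharp₀_natural {φ : M.carrier →ₗ[k] M'.carrier} (hφ : IsMor M M' φ)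
    {ψ : N.carrier →ₗ[k] N'.carrier} (hψ : IsMor N N' ψ) {W : Type*} [AddCommGroup W] [Module k W]
    (μ : (M.tensor N).carrier →ₗ[k] W) (ν : (M'.tensor N').carrier →ₗ[k] W)
    (h : ∀ m n, μ (M.ten N m n) = ν (M'.ten N' (φ m) (ψ n))) (m : M.carrier) (n : N.carrier) :
    μ (Γ.sharp₀ M N m n) = ν (Γ.sharp₀ M' N' (φ m) (ψ n)) := by
  obtain ⟨f, rfl⟩ := hφ
  obtain ⟨g, rfl⟩ := hψ
  have hμ : μ = ν ∘ₗ lin (tensorHom f g) := LinearMap.ext fun x =>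
    ten_ext (ψ := ν ∘ₗ lin (tensorHom f g)) (fun m n => by
      rw [LinearMap.comp_apply, lin_tensorHom_ten, h]) x
  have key : ∀ v, lin (tensorHom f g) ((Γ.sharp_balanced M N).pair m v)
      = (Γ.sharp_balanced M' N').pair (lin f m) (H.diamMap (lin g) (lin_left g) v) := fun v => by
    induction v using BalTensor.ind with
    | tmul Y n =>
      rw [EnvRing.diamMap_dmul, Balanced.pair_dmul, Balanced.pair_dmul, lin_coact]
      generalize M.coact m = u
      induction u using BalTensor.ind with
      | tmul X m =>
        rw [EnvRing.diamMap_dmul, Balanced.fst_dmul, Balanced.fst_dmul, ← lin_tensorHom_ten]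
        exact lin_left _ _ _
      | add x y hx hy => simp only [map_add, hx, hy]
    | add x y hx hy => simp only [map_add, hx, hy]
  rw [hμ, LinearMap.comp_apply, sharp₀_apply, key, ← lin_coact, sharp₀_apply]

theorem sharp₀_tensorHom (f : M ⟶ M') (g : N ⟶ N') (m : M.carrier) (n : N.carrier) :
    lin (tensorHom f g) (Γ.sharp₀ M N m n) = Γ.sharp₀ M' N' (lin f m) (lin g n) :=
  Γ.sharp₀_natural (isMor_lin f) (isMor_lin g) (lin (tensorHom f g)) LinearMap.id
    (fun m n => lin_tensorHom_ten _ _ f g m n) m n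

/-- The twisting map of the regular comodule, followed by the product. -/
theorem tw_eq (X Y : L) :
    Γ.tw X Y = regMulLin H (Γ.sharp₀ (regular H) (regular H) X Y) := by
  have key : ∀ v : H.Diam H.sL, Γ.tw_balanced.pair X v
      = regMulLin H ((Γ.sharp_balanced (regular H) (regular H)).pair X v) := fun v => by
    induction v using BalTensor.ind with
    | tmul Y Z =>
      refine (Γ.tw_balanced.pair_dmul X Y Z).trans (Eq.trans ?_
        (congrArg _ ((Γ.sharp_balanced (regular H) (regular H)).pair_dmul X Y Z)).symm)
      generalize (regular H).coact X = u
      induction u using BalTensor.ind with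
      | tmul P Q =>
        refine (Γ.tw_balanced.fst_dmul Y Z P Q).trans (Eq.trans ?_
          (congrArg _ ((Γ.sharp_balanced (regular H) (regular H)).fst_dmul Y Z P Q)).symm)
        refine Eq.trans ?_ (regMulLin_left _ _).symm
        exact congrArg (H.sL _) (regMulLin_ten Q Z).symm
      | add x y hx hy => simp only [map_add, hx, hy]
    | add x y hx hy => simp only [map_add, hx, hy]
  exact key (H.comul Y)

theorem tw_t_mul (b : B) (X Y : L) : Γ.tw (H.t b * X) Y = H.t b * Γ.tw X Y := by
  rw [tw_eq, tw_eq]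
  exact (Γ.sharp₀_natural (isMor_tL b) isMor_id (H.tL b ∘ₗ regMulLin H) (regMulLin H)
    (fun X Y => by
      refine (congrArg (H.tL b) (regMulLin_ten X Y)).trans
        ((mul_assoc (H.t b) X Y).symm.trans (regMulLin_ten _ _).symm)) X Y).symm

theorem tw_bal (b : B) (X Y : L) : Γ.tw X (H.t b * Y) = Γ.tw (X * H.t b) Y := by
  rw [tw_eq, tw_eq]
  have h := Γ.sharp₀_natural (isMor_tR b) isMor_id
    (regMulLin H ∘ₗ lin (tensorHom (𝟙 (regular H)) (isMor_tL b).choose)) (regMulLin H)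
    (fun X Y => by
      rw [LinearMap.comp_apply, lin_tensorHom_ten, (isMor_tL b).choose_spec]
      refine (regMulLin_ten _ _).trans (Eq.trans ?_ (regMulLin_ten _ _).symm)
      exact (mul_assoc X (H.t b) Y).symm) X Y
  rw [LinearMap.comp_apply, sharp₀_tensorHom, (isMor_tL b).choose_spec] at h
  exact h

/-- `(X, m, Y, n) ↦ Γ(X₁, Y₁) X₂ Y₂ ⋄ (m ⊗ n)` is balanced. -/
theorem twCod (M N : H.Comodule) :
    M.Balanced N.left Γ.tw (M.ten N) (H.dmul (M.tensor N).left) where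
  bal_left b X Y m n := by rw [tw_t_mul, H.dmul_bal, left_ten]
  bal_mid b X Y m n := by rw [tw_bal]
  bal_right b X Y m n := by rw [ten_bal]

theorem twCodAux_bal (C E : L) (n : N.carrier) (b : B) (X : L) (w : H.Diam M.left) :
    H.diamSL (M.tensor N).left (Γ.form (H.t b * X) C) ((M.cod N).fst E n w)
      = H.diamSL (M.tensor N).left (Γ.form X C) ((M.cod N).fst E n (H.diamSL M.left b w)) := by
  rw [Γ.form_t, diamSL_mul]
  exact congrArg _ (M.fst_codiag_diamSL N b w E n).symm

/-- `X ⋄ (Z ⋄ m) ↦ Γ(X, C) Z E ⋄ (m ⊗ n)`. -/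
def twCodAux (M N : H.Comodule) (C E : L) (n : N.carrier) :
    H.Diam (H.diamSL M.left) →ₗ[k] H.Diam (M.tensor N).left :=
  BalTensor.lift (f := H.tL) (g := H.diamSL M.left)
    (((cofree H (M.tensor N).left).left.toLinearMap ∘ₗ Γ.form.flip C).compl₂
      ((M.cod N).fst E n))
    (Γ.twCodAux_bal C E n)

theorem twCodAux_dmul (C E : L) (n : N.carrier) (X : L) (w : H.Diam M.left) :
    Γ.twCodAux M N C E n (H.dmul (H.diamSL M.left) X w)
      = H.diamSL (M.tensor N).left (Γ.form X C) ((M.cod N).fst E n w) :=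
  BalTensor.lift_tmul (f := H.tL) (g := H.diamSL M.left) _ (Γ.twCodAux_bal C E n) X w

/-- `(X, m, Y, Z ⋄ n) ↦ Γ(X, Y) m₋₁ Z ⋄ (m₀ ⊗ n)` is balanced. -/
theorem twCod₂ (M N : H.Comodule) : M.Balanced (H.diamSL N.left) Γ.form (M.cod N).pair
    (cofree H (M.tensor N).left).left.toLinearMap where
  bal_left b X Y m w := by
    rw [Γ.form_t, AlgHom.toLinearMap_apply, AlgHom.toLinearMap_apply, map_mul,
      Module.End.mul_apply]
    exact congrArg _ (M.pair_codiag_left N b m w).symm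
  bal_mid b X Y m w := by rw [Γ.form_bal]
  bal_right b X Y m w := congrArg _ (M.pair_codiag_diamSL N b m w)

theorem coact_pair_sharp (m : M.carrier) (v : H.Diam N.left) :
    (M.tensor N).coact ((Γ.sharp_balanced M N).pair m v)
      = (Γ.twCod₂ M N).pair m (H.diamMap N.coact N.coact_left v) :=
  (Γ.sharp_balanced M N).comp_pair (Γ.twCod₂ M N) _ _ id N.coact
    (fun Y n => H.diamMap_dmul _ N.coact_left Y n)
    (fun X Y m n => by
      rw [AlgHom.toLinearMap_apply, (M.tensor N).coact_left, coact_ten]; rfl) m v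

theorem twCod₂_fst (C E : L) (n : N.carrier) (u : H.Diam M.left) :
    (Γ.twCod₂ M N).fst C (H.dmul N.left E n) u
      = Γ.twCodAux M N C E n (H.diamMap M.coact M.coact_left u) := by
  induction u using BalTensor.ind with
  | tmul X m =>
    rw [EnvRing.diamMap_dmul, twCodAux_dmul, Balanced.fst_dmul, Balanced.pair_dmul]; rfl
  | add x y hx hy => simp only [map_add, hx, hy]

theorem twCodAux_insert (C E : L) (n : N.carrier) (m : M.carrier) (x : H.Diam H.sL) :
    Γ.twCodAux M N C E n (H.diamInsert M.left m x)
      = H.dmul (M.tensor N).left (Γ.tw_balanced.fst C E x) (M.ten N m n) := by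
  induction x using BalTensor.ind with
  | tmul P Q =>
    rw [EnvRing.diamInsert_dmul, twCodAux_dmul, fst_cod_dmul, EnvRing.diamSL_dmul]
    refine congrArg (fun Z => H.dmul (M.tensor N).left Z (M.ten N m n)) ?_
    exact (Γ.tw_balanced.fst_dmul C E P Q).symm
  | add x y hx hy => simp only [map_add, LinearMap.add_apply, hx, hy]

/-- The coaction on the twisting map: `Γ(m₋₁, n₋₁) m₀ ⊗ n₀` is sent to
`Γ(m₋₁₁, n₋₁₁) m₋₁₂ n₋₁₂ ⋄ (m₀ ⊗ n₀)`. -/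
theorem coact_sharp₀ (m : M.carrier) (n : N.carrier) :
    (M.tensor N).coact (Γ.sharp₀ M N m n) = (Γ.twCod M N).pair m (N.coact n) := by
  rw [sharp₀_apply, coact_pair_sharp, N.coassoc]
  generalize N.coact n = v
  induction v using BalTensor.ind with
  | tmul Y n =>
    obtain ⟨y, hy⟩ := BalTensor.proj_surjective H.tL H.sL (H.comul Y)
    obtain ⟨S, rfl⟩ := TensorProduct.exists_finset y
    have e : ∀ X, Γ.tw X Y = ∑ i ∈ S, Γ.tw_balanced.fst i.1 i.2 (H.comul X) := fun X => by
      change Γ.tw_balanced.pair X (H.comul Y) = _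
      rw [← hy, map_sum, map_sum]
      exact Finset.sum_congr rfl fun i _ => Γ.tw_balanced.pair_dmul X i.1 i.2
    have e2 : ∀ u, ∑ i ∈ S, Γ.twCodAux M N i.1 i.2 n
        (H.comulDiam H.comul H.comul_target M.left u) = (Γ.twCod M N).fst Y n u := fun u => by
      induction u using BalTensor.ind with
      | tmul X m =>
        rw [Balanced.fst_dmul, e, map_sum, LinearMap.sum_apply]
        refine Finset.sum_congr rfl fun i _ => ?_
        rw [EnvRing.comulDiam_dmul, twCodAux_insert]
      | add x y hx hy => simp only [map_add, ← hx, ← hy, Finset.sum_add_distrib]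
    rw [EnvRing.comulDiam_dmul, Balanced.pair_dmul, ← e2, ← hy, map_sum, map_sum, map_sum]
    refine Finset.sum_congr rfl fun i _ => ?_
    rw [BalTensor.proj_tmul, EnvRing.diamInsert_dmul, Balanced.pair_dmul, twCod₂_fst, M.coassoc]
  | add x y hx hy => simp only [map_add, hx, hy]

/-- The twisting maps satisfy the associativity condition of a monoidal functor. After the coactions
are written out, this is the cocycle identity for `Γ`. -/
theorem assoc_sharp₀ (m : M.carrier) (n : N.carrier) (p : P.carrier) :
    M.assocLin N P (Γ.sharp₀ (M.tensor N) P (Γ.sharp₀ M N m n) p)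
      = Γ.sharp₀ M (N.tensor P) m (Γ.sharp₀ N P n p) := by
  rw [sharp₀_apply Γ (M.tensor N), sharp₀_apply Γ M (N.tensor P), coact_sharp₀]
  generalize P.coact p = w
  induction w using BalTensor.ind with
  | tmul Z p =>
    rw [Balanced.pair_dmul, Balanced.pair_dmul, coact_sharp₀]
    generalize N.coact n = v
    induction v using BalTensor.ind with
    | tmul Y n =>
      rw [Balanced.pair_dmul, Balanced.fst_dmul, Balanced.pair_dmul]
      generalize M.coact m = u
      induction u using BalTensor.ind with
      | tmul X m =>
        rw [Balanced.fst_dmul, Balanced.fst_dmul, Balanced.fst_dmul, Γ.cocycle,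
          AlgHom.toLinearMap_apply, AlgHom.toLinearMap_apply, assocLin_left, assocLin_ten]
      | add x y hx hy => simp only [map_add, hx, hy]
    | add x y hx hy => simp only [map_add, hx, hy]
  | add x y hx hy => simp only [map_add, hx, hy]

/-- An associativity of morphisms persists if the twisting maps are inserted. -/
theorem sharp₀_assoc {μ : (M.tensor N).carrier →ₗ[k] A.carrier} (hμ : IsMor (M.tensor N) A μ)
    {ν : (N.tensor P).carrier →ₗ[k] C.carrier} (hν : IsMor (N.tensor P) C ν)
    {W : Type*} [AddCommGroup W] [Module k W]
    (μ' : (A.tensor P).carrier →ₗ[k] W) (ν' : (M.tensor C).carrier →ₗ[k] W)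
    (h : ∀ m n p, μ' (A.ten P (μ (M.ten N m n)) p) = ν' (M.ten C m (ν (N.ten P n p))))
    (m : M.carrier) (n : N.carrier) (p : P.carrier) :
    μ' (Γ.sharp₀ A P (μ (Γ.sharp₀ M N m n)) p)
      = ν' (Γ.sharp₀ M C m (ν (Γ.sharp₀ N P n p))) := by
  obtain ⟨f, rfl⟩ := hμ
  obtain ⟨g, rfl⟩ := hν
  have h1 := Γ.sharp₀_tensorHom f (𝟙 P) (Γ.sharp₀ M N m n) p
  have h2 := Γ.sharp₀_tensorHom (𝟙 M) g m (Γ.sharp₀ N P n p)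
  rw [lin_id] at h1 h2
  rw [← h1, ← h2, ← assoc_sharp₀]
  generalize Γ.sharp₀ (M.tensor N) P (Γ.sharp₀ M N m n) p = x
  refine ten_ext₃ (φ := μ' ∘ₗ lin (tensorHom f (𝟙 P)))
    (ψ := ν' ∘ₗ lin (tensorHom (𝟙 M) g) ∘ₗ M.assocLin N P) (fun m n p => ?_) x
  simp only [LinearMap.comp_apply, assocLin_ten, lin_tensorHom_ten, lin_id, h]

/-! ### Units -/

theorem twL_apply (b : B) (m : M.carrier) : Γ.twL M b m
    = H.counitDiam (Γ.form (H.s b)) (Γ.form_s_t b) M.left (M.coact m) := rfl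

theorem twR_apply (b : B) (m : M.carrier) : Γ.twR M b m
    = H.counitDiam (Γ.form.flip (H.s b)) (Γ.form_flip_t b) M.left (M.coact m) := rfl

/-- The twisted left action is the twisting map of the unit comodule. -/
theorem sharp₀_unit_left (b : B) (m : M.carrier) :
    Γ.sharp₀ (unit H) M (ofB H b) m = (unit H).ten M (ofB H 1) (Γ.twL M b m) := by
  rw [← M.leftUnit_inv (Γ.sharp₀ (unit H) M (ofB H b) m)]
  congr 1
  rw [sharp₀_apply, twL_apply]
  generalize M.coact m = v
  induction v using BalTensor.ind with
  | tmul Y m =>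
    rw [Balanced.pair_dmul, unit_coact, Balanced.fst_dmul, EnvRing.counitDiam_dmul,
      AlgHom.toLinearMap_apply, leftUnit_left, leftUnit_ten, toB_ofB, toB_ofB, map_one,
      Module.End.one_apply]
  | add x y hx hy => simp only [map_add, hx, hy]

/-- The twisted right action is the twisting map of the unit comodule. -/
theorem sharp₀_unit_right (b : B) (m : M.carrier) :
    Γ.sharp₀ M (unit H) m (ofB H b) = M.ten (unit H) (Γ.twR M b m) (ofB H 1) := by
  rw [← M.rightUnit_inv (Γ.sharp₀ M (unit H) m (ofB H b)), LinearMap.flip_apply]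
  refine congrArg (fun z => M.ten (unit H) z (ofB H 1)) ?_
  rw [sharp₀_apply, unit_coact, Balanced.pair_dmul, twR_apply]
  generalize M.coact m = v
  induction v using BalTensor.ind with
  | tmul Y m =>
    rw [Balanced.fst_dmul, EnvRing.counitDiam_dmul,
      AlgHom.toLinearMap_apply, rightUnit_left, rightUnit_ten, toB_ofB, toB_ofB, op_one, map_one,
      Module.End.one_apply, LinearMap.flip_apply]
  | add x y hx hy => simp only [map_add, hx, hy]

theorem twL_one (m : M.carrier) : Γ.twL M 1 m = m := by
  refine Eq.trans ?_ (M.counit_coact m)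
  rw [twL_apply]
  generalize M.coact m = v
  induction v using BalTensor.ind with
  | tmul Y m => rw [EnvRing.counitDiam_dmul, EnvRing.counitDiam_dmul, H.s_one, Γ.one_left]
  | add x y hx hy => simp only [map_add, hx, hy]

theorem twR_one (m : M.carrier) : Γ.twR M 1 m = m := by
  refine Eq.trans ?_ (M.counit_coact m)
  rw [twR_apply]
  generalize M.coact m = v
  induction v using BalTensor.ind with
  | tmul Y m =>
    rw [EnvRing.counitDiam_dmul, EnvRing.counitDiam_dmul, H.s_one, LinearMap.flip_apply,
      Γ.one_right]
  | add x y hx hy => simp only [map_add, hx, hy]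

/-- `Γ^#(b q ⊗ m) = q ⊗ (b ·_Γ m)` for a central coinvariant element `q`. -/
theorem sharp₀_central_left {q : Q.carrier} (hq : IsCentral Q q) (b : B) (m : M.carrier) :
    Γ.sharp₀ Q M (Q.left b q) m = Q.ten M q (Γ.twL M b m) := by
  obtain ⟨f, hf⟩ := hq.isMor
  have h := Γ.sharp₀_tensorHom f (𝟙 M) (ofB H b) m
  rw [sharp₀_unit_left, lin_tensorHom_ten, hf, lin_id, lin_id, centralMap_apply, centralMap_apply,
    map_one, Module.End.one_apply] at h
  exact h.symm

/-- `Γ^#(m ⊗ b q) = (m ·_Γ b) ⊗ q` for a central coinvariant element `q`. -/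
theorem sharp₀_central_right {q : Q.carrier} (hq : IsCentral Q q) (b : B) (m : M.carrier) :
    Γ.sharp₀ M Q m (Q.left b q) = M.ten Q (Γ.twR M b m) q := by
  obtain ⟨f, hf⟩ := hq.isMor
  have h := Γ.sharp₀_tensorHom (𝟙 M) f m (ofB H b)
  rw [sharp₀_unit_right, lin_tensorHom_ten, hf, lin_id, lin_id, centralMap_apply, centralMap_apply,
    map_one, Module.End.one_apply] at h
  exact h.symm

theorem sharp₀_central_left_one {q : Q.carrier} (hq : IsCentral Q q) (m : M.carrier) :
    Γ.sharp₀ Q M q m = Q.ten M q m := by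
  have h := Γ.sharp₀_central_left hq 1 m
  rwa [map_one, Module.End.one_apply, twL_one] at h

theorem sharp₀_central_right_one {q : Q.carrier} (hq : IsCentral Q q) (m : M.carrier) :
    Γ.sharp₀ M Q m q = M.ten Q m q := by
  have h := Γ.sharp₀_central_right hq 1 m
  rwa [map_one, Module.End.one_apply, twR_one] at h

/-! ### The twisted actions -/

theorem isMor_leftUnit : IsMor ((unit H).tensor M) M M.leftUnit := ⟨M.leftUnitHom, rfl⟩
theorem isMor_rightUnit : IsMor (M.tensor (unit H)) M M.rightUnit := ⟨M.rightUnitHom, rfl⟩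

theorem leftUnit_sharp₀ (b : B) (m : M.carrier) :
    M.leftUnit (Γ.sharp₀ (unit H) M (ofB H b) m) = Γ.twL M b m := by
  rw [sharp₀_unit_left, leftUnit_ten, toB_ofB, map_one, Module.End.one_apply]

theorem rightUnit_sharp₀ (b : B) (m : M.carrier) :
    M.rightUnit (Γ.sharp₀ M (unit H) m (ofB H b)) = Γ.twR M b m := by
  rw [sharp₀_unit_right, rightUnit_ten, toB_ofB, op_one, map_one, Module.End.one_apply]

theorem twL_natural {φ : M.carrier →ₗ[k] N.carrier} (hφ : IsMor M N φ) (b : B) (m : M.carrier) :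
    φ (Γ.twL M b m) = Γ.twL N b (φ m) := by
  rw [← leftUnit_sharp₀, ← leftUnit_sharp₀]
  exact Γ.sharp₀_natural isMor_id hφ (φ ∘ₗ M.leftUnit) N.leftUnit (fun b m => by
    rw [LinearMap.comp_apply, leftUnit_ten, leftUnit_ten, hφ.left, LinearMap.id_apply]) _ _

theorem twR_natural {φ : M.carrier →ₗ[k] N.carrier} (hφ : IsMor M N φ) (b : B) (m : M.carrier) :
    φ (Γ.twR M b m) = Γ.twR N b (φ m) := by
  rw [← rightUnit_sharp₀, ← rightUnit_sharp₀]
  exact Γ.sharp₀_natural hφ isMor_id (φ ∘ₗ M.rightUnit) N.rightUnit (fun m b => by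
    rw [LinearMap.comp_apply, rightUnit_ten, rightUnit_ten, hφ.right, LinearMap.id_apply]) _ _

theorem twL_unit (a b : B) : Γ.twL (unit H) a (ofB H b) = ofB H (Γ.form (H.s a) (H.s b)) := by
  rw [twL_apply, unit_coact, EnvRing.counitDiam_dmul, left_ofB, mul_one, toB_ofB]

theorem twR_unit (a b : B) : Γ.twR (unit H) b (ofB H a) = ofB H (Γ.form (H.s a) (H.s b)) := by
  rw [twR_apply, unit_coact, EnvRing.counitDiam_dmul, left_ofB, mul_one, toB_ofB,
    LinearMap.flip_apply]

theorem twL_form (a b : B) (m : M.carrier) :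
    Γ.twL M (Γ.form (H.s a) (H.s b)) m = Γ.twL M a (Γ.twL M b m) := by
  have h := Γ.sharp₀_assoc (isMor_leftUnit (M := unit H)) (isMor_leftUnit (M := M))
    M.leftUnit M.leftUnit (fun a b m => by
      rw [leftUnit_ten, leftUnit_ten, leftUnit_ten, leftUnit_ten, toB_left, map_mul,
        Module.End.mul_apply]) (ofB H a) (ofB H b) m
  rwa [leftUnit_sharp₀, twL_unit, leftUnit_sharp₀, leftUnit_sharp₀, leftUnit_sharp₀] at h

theorem twR_form (a b : B) (m : M.carrier) :
    Γ.twR M (Γ.form (H.s a) (H.s b)) m = Γ.twR M b (Γ.twR M a m) := by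
  have h := Γ.sharp₀_assoc (isMor_rightUnit (M := M)) (isMor_rightUnit (M := unit H))
    M.rightUnit M.rightUnit (fun m a b => by
      rw [rightUnit_ten, rightUnit_ten, rightUnit_ten, rightUnit_ten, toB_right, op_mul, map_mul,
        Module.End.mul_apply, op_unop]) m (ofB H a) (ofB H b)
  rw [rightUnit_sharp₀, rightUnit_sharp₀, rightUnit_sharp₀, twR_unit, rightUnit_sharp₀] at h
  exact h.symm

theorem twR_twL (a b : B) (m : M.carrier) :
    Γ.twR M b (Γ.twL M a m) = Γ.twL M a (Γ.twR M b m) := by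
  have h := Γ.sharp₀_assoc (isMor_leftUnit (M := M)) (isMor_rightUnit (M := M))
    M.rightUnit M.leftUnit (fun a m b => by
      rw [rightUnit_ten, leftUnit_ten, leftUnit_ten, rightUnit_ten, M.right_left])
      (ofB H a) m (ofB H b)
  rwa [leftUnit_sharp₀, rightUnit_sharp₀, rightUnit_sharp₀, leftUnit_sharp₀] at h

/-- The left `B^Γ`-action on a tensor product is that on the first factor. -/
theorem sharp₀_twL (b : B) (m : M.carrier) (n : N.carrier) :
    Γ.sharp₀ M N (Γ.twL M b m) n = Γ.twL (M.tensor N) b (Γ.sharp₀ M N m n) := by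
  have h := Γ.sharp₀_assoc (isMor_leftUnit (M := M)) (isMor_id (M := M.tensor N))
    LinearMap.id (M.tensor N).leftUnit (fun a m n => by
      rw [leftUnit_ten, leftUnit_ten, LinearMap.id_apply, LinearMap.id_apply, left_ten])
      (ofB H b) m n
  rwa [leftUnit_sharp₀, leftUnit_sharp₀] at h

/-- The right `B^Γ`-action on a tensor product is that on the second factor. -/
theorem sharp₀_twR (b : B) (m : M.carrier) (n : N.carrier) :
    Γ.sharp₀ M N m (Γ.twR N b n) = Γ.twR (M.tensor N) b (Γ.sharp₀ M N m n) := by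
  have h := Γ.sharp₀_assoc (isMor_id (M := M.tensor N)) (isMor_rightUnit (M := N))
    (M.tensor N).rightUnit LinearMap.id (fun m n a => by
      rw [rightUnit_ten, rightUnit_ten, LinearMap.id_apply, LinearMap.id_apply, right_ten])
      m n (ofB H b)
  rw [rightUnit_sharp₀, rightUnit_sharp₀] at h
  exact h.symm

end LeftCocycle

end LeftBialgebroid

namespace LeftBialgebroid

variable {k : Type v} {B L : Type u} [CommRing k] [Ring B] [Algebra k B] [Ring L] [Algebra k L]
  {H : LeftBialgebroid k B L}

open Comodule

namespace Comodule

variable {M N Q : H.Comodule}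

theorem IsMor.add {φ ψ : M.carrier →ₗ[k] N.carrier} (hφ : IsMor M N φ) (hψ : IsMor M N ψ) :
    IsMor M N (φ + ψ) := by
  have hl : ∀ b m, (φ + ψ) (M.left b m) = N.left b ((φ + ψ) m) := fun b m => by
    simp only [LinearMap.add_apply, map_add, hφ.left, hψ.left]
  refine IsMor.mk hl (fun b m => ?_) (fun m => ?_)
  · simp only [LinearMap.add_apply, map_add, hφ.right, hψ.right]
  · rw [LinearMap.add_apply, map_add, hφ.coact, hψ.coact]
    generalize M.coact m = u
    induction u using BalTensor.ind with
    | tmul X m =>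
      rw [EnvRing.diamMap_dmul, EnvRing.diamMap_dmul, EnvRing.diamMap_dmul, LinearMap.add_apply,
        map_add]
    | add x y hx hy => rw [map_add, map_add, map_add, ← hx, ← hy]; abel

end Comodule

namespace LeftCocycle

variable (Γ : H.LeftCocycle) {M N Q : H.Comodule}

section Central

variable {q : Q.carrier}

theorem twL_central (hq : IsCentral Q q) (a b : B) :
    Γ.twL Q a (Q.left b q) = Q.left (Γ.form (H.s a) (H.s b)) q := by
  rw [← centralMap_apply, ← twL_natural Γ hq.isMor, twL_unit, centralMap_apply]

theorem twR_central (hq : IsCentral Q q) (a b : B) :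
    Γ.twR Q b (Q.left a q) = Q.left (Γ.form (H.s a) (H.s b)) q := by
  rw [← centralMap_apply, ← twR_natural Γ hq.isMor, twR_unit, centralMap_apply]

theorem counit_s (b : B) : H.counit (H.s b) = b := by
  rw [← mul_one (H.s b), H.counit_source, H.counit_one, mul_one]

theorem twL_central_one (hq : IsCentral Q q) (b : B) : Γ.twL Q b q = Q.left b q := by
  have h := Γ.twL_central hq b 1
  rwa [map_one, Module.End.one_apply, H.s_one, Γ.one_right, counit_s] at h

theorem twR_central_one (hq : IsCentral Q q) (b : B) : Γ.twR Q b q = Q.left b q := by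
  have h := Γ.twR_central hq 1 b
  rwa [map_one, Module.End.one_apply, H.s_one, Γ.one_left, counit_s] at h

end Central

variable (hH : H.IsLeftHopf)

/-! ### The twisting maps of the dual comodule -/

theorem sharpAux_pair (X : L) (v : H.Diam M.left) : Γ.sharpDiam₁ hH M X v
    = (Γ.sharp_balanced (dual hH) M).pair X v := by
  induction v using BalTensor.ind with
  | tmul Y m =>
    rw [sharpDiam₁_dmul, Balanced.pair_dmul]
    change _ = (Γ.sharp_balanced (dual hH) M).fst Y m (opFlip H (H.transl hH X))
    generalize H.transl hH X = x
    induction x using BalTensor.ind with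
    | tmul A C =>
      rw [sharpAux_omul, opFlip_omul, Balanced.fst_dmul, AlgHom.toLinearMap_apply, left_ten]
      rfl
    | add x y hx hy => simp only [map_add, hx, hy]; rfl
  | add x y hx hy => simp only [map_add, hx, hy]; rfl

/-- The map `Γ^#` on `L^Γ ⋄_{B^Γ} M` is the twisting map of the dual comodule and `M`. -/
theorem sharpDiam_tmul (X : L) (m : M.carrier) :
    Γ.sharpDiam hH M (X ⊗ₜ m) = Γ.sharp₀ (dual hH) M X m :=
  Γ.sharpAux_pair hH X (M.coact m)

theorem isMor_sharpAux (Y : L) (m : M.carrier) :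
    IsMor (opCom H) (cofree H M.left) (Γ.sharpAux M Y m) :=
  btensor_cover _ _ _ _ _ fun C => ((isMor_dmul M.left m).comp (isMor_tR (Γ.form C Y))).of_eq
    fun A => (Γ.sharpAux_omul M Y m A C).symm

/-- `X ↦ X₊ Γ(X₋, n₋₁)‾ ⋄ n₀`. -/
noncomputable def sharpReg (n : N.carrier) : L →ₗ[k] H.Diam N.left :=
  (Γ.sharp₀ (dual hH) N).flip n

theorem sharpReg_apply (n : N.carrier) (X : L) :
    Γ.sharpReg hH n X = Γ.sharp₀ (dual hH) N X n := rfl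

/-- The translation map being colinear, so is `X ↦ X₊ Γ(X₋, n₋₁)‾ ⋄ n₀`. -/
theorem isMor_sharpReg (n : N.carrier) :
    IsMor (regular H) (cofree H N.left) (Γ.sharpReg hH n) := by
  have h : ∀ v : H.Diam N.left, IsMor (regular H) (cofree H N.left)
      ((Γ.sharp_balanced (dual hH) N).pair.flip v) := fun v => by
    induction v using BalTensor.ind with
    | tmul Y m =>
      refine ((Γ.isMor_sharpAux Y m).comp (isMor_transl hH)).of_eq fun X => ?_
      refine Eq.trans ?_ (Γ.sharpAux_pair hH X (H.dmul N.left Y m))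
      exact (Γ.sharpDiam₁_dmul hH N X Y m).symm
    | add x y hx hy => rw [map_add]; exact hx.add hy
  exact h (N.coact n)

/-! ### The products `X₊ Y₊ Γ(Y₋, X₋)‾` and `X ·_Γ Y` -/

/-- `X₊ Y₊ Γ(Y₋, X₋)‾` is the twist of the opposite product of the dual comodule. -/
theorem prod_eq (X Y : L) :
    Γ.prod hH X Y = dualMulLin hH (Γ.sharp₀ (dual hH) (dual hH) Y X) := by
  rw [prod_apply, sharp₀_apply]
  change _ = dualMulLin hH ((Γ.sharp_balanced (dual hH) (dual hH)).pair Y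
    (opFlip H (H.transl hH X)))
  generalize H.transl hH X = x
  induction x using BalTensor.ind with
  | tmul A C =>
    rw [prodOp_omul, opFlip_omul, Balanced.pair_dmul]
    change _ = dualMulLin hH ((Γ.sharp_balanced (dual hH) (dual hH)).fst C A
      (opFlip H (H.transl hH Y)))
    generalize H.transl hH Y = y
    induction y using BalTensor.ind with
    | tmul D E =>
      rw [prodAux_omul, opFlip_omul, Balanced.fst_dmul, AlgHom.toLinearMap_apply, dualMulLin_left]
      exact congrArg (· * H.t (Γ.form E C)) (dualMulLin_ten hH D A).symm
    | add x y hx hy => simp only [map_add, hx, hy]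
  | add x y hx hy => simp only [map_add, hx, hy]

theorem prod_one_left (X : L) : Γ.prod hH 1 X = X := by
  rw [prod_eq, Γ.sharp₀_central_right_one (isCentral_dual_one hH)]
  exact (dualMulLin_ten hH X 1).trans (one_mul X)

theorem prod_one_right (X : L) : Γ.prod hH X 1 = X := by
  rw [prod_eq, Γ.sharp₀_central_left_one (isCentral_dual_one hH)]
  exact (dualMulLin_ten hH 1 X).trans (mul_one X)

theorem dual_left_one (b : B) : (dual hH).left b (1 : L) = H.t b := one_mul (H.t b)

theorem prod_t_left (b : B) (X : L) : Γ.prod hH (H.t b) X = Γ.twR (dual hH) b X := by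
  rw [prod_eq, ← dual_left_one hH, Γ.sharp₀_central_right (isCentral_dual_one hH)]
  exact (dualMulLin_ten hH _ 1).trans (one_mul _)

theorem prod_t_right (b : B) (X : L) : Γ.prod hH X (H.t b) = Γ.twL (dual hH) b X := by
  rw [prod_eq, ← dual_left_one hH, Γ.sharp₀_central_left (isCentral_dual_one hH)]
  exact (dualMulLin_ten hH 1 _).trans (mul_one _)

theorem prod_assoc (X Y Z : L) :
    Γ.prod hH (Γ.prod hH X Y) Z = Γ.prod hH X (Γ.prod hH Y Z) := by
  rw [prod_eq, prod_eq, prod_eq, prod_eq]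
  refine (Γ.sharp₀_assoc (isMor_dualMul hH) (isMor_dualMul hH) (dualMulLin hH) (dualMulLin hH)
    (fun X Y Z => ?_) Z Y X).symm
  refine (congrArg (fun U => dualMulLin hH ((dual hH).ten (dual hH) U Z))
    (dualMulLin_ten hH X Y)).trans ((dualMulLin_ten hH _ _).trans ?_)
  refine Eq.trans ?_ (congrArg (fun U => dualMulLin hH ((dual hH).ten (dual hH) X U))
    (dualMulLin_ten hH Y Z)).symm
  exact (mul_assoc Z Y X).symm.trans (dualMulLin_ten hH _ _).symm

/-- `X ⊗ Y ↦ X₊ Y₊ Γ(Y₋, X₋)‾`. -/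
noncomputable def prodLin : ((regular H).tensor (regular H)).carrier →ₗ[k] (regular H).carrier :=
  tlift (M := regular H) (N := regular H) (Γ.prod hH) (fun b X Y => Γ.prod_mul_s hH b X Y)

theorem prodLin_ten (X Y : L) :
    Γ.prodLin hH ((regular H).ten (regular H) X Y) = Γ.prod hH X Y :=
  tlift_ten (M := regular H) (N := regular H) (Γ.prod hH)
    (fun b X Y => Γ.prod_mul_s hH b X Y) X Y

/-- `Y ↦ Y₊ Γ(Y₋, C)‾`. -/
noncomputable def contract (C : L) : L →ₗ[k] L := Γ.prodAux 1 C ∘ₗ H.transl hH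

theorem isMor_contract (C : L) : IsMor (regular H) (regular H) (Γ.contract hH C) := by
  refine IsMor.comp (N := opCom H) (btensor_cover _ _ _ _ _ fun E => ?_) (isMor_transl hH)
  refine (isMor_tR (Γ.form E C)).of_eq fun D => ?_
  refine Eq.trans ?_ (Γ.prodAux_omul 1 C D E).symm
  rw [one_mul]; rfl

theorem prodOp_contract (A C Y : L) :
    Γ.prodOp hH Y (H.omul A C) = A * Γ.contract hH C Y := by
  rw [prodOp_omul, contract, LinearMap.comp_apply]
  generalize H.transl hH Y = y
  induction y using BalTensor.ind with
  | tmul D E => rw [prodAux_omul, prodAux_omul, one_mul, mul_assoc]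
  | add x y hx hy => rw [map_add, map_add, hx, hy, mul_add]

/-- `(x, Y) ↦ A Y₊ Γ(Y₋, C)‾` for `x = A ⊗ C`. -/
noncomputable def prodOpLin : H.OpTensor →ₗ[k] L →ₗ[k] L :=
  LinearMap.mk₂ k (fun x Y => Γ.prodOp hH Y x) (fun x y Y => map_add _ x y)
    (fun c x Y => map_smul _ c x)
    (fun x Y Y' => BalTensor.hom_ext_apply (φ := Γ.prodOp hH (Y + Y')) (ψ := _ + _) (fun A C => by
      rw [LinearMap.add_apply, prodOp_contract, prodOp_contract, prodOp_contract, map_add,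
        mul_add]) x)
    (fun c x Y => BalTensor.hom_ext_apply (φ := Γ.prodOp hH (c • Y)) (ψ := c • _) (fun A C => by
      rw [LinearMap.smul_apply, prodOp_contract, prodOp_contract, map_smul,
        mul_smul_comm]) x)

theorem prodOpLin_bal (b : B) (x : (opCom H).carrier) (Y : L) :
    Γ.prodOpLin hH ((opCom H).right (op b) x) Y = Γ.prodOpLin hH x (H.s b * Y) := by
  induction x using BalTensor.ind with
  | tmul A C =>
    refine (congrArg (Γ.prodOp hH Y) (btRight_tmul _ _ isMor_tR _ _ A C)).trans ?_
    refine (Γ.prodOp_contract hH _ C Y).trans ?_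
    refine Eq.trans ?_ (Γ.prodOp_contract hH A C (H.s b * Y)).symm
    refine (mul_assoc A (H.s b) _).trans (congrArg (A * ·) ?_)
    exact ((Γ.isMor_contract hH C).left b Y).symm
  | add x y hx hy =>
    rw [map_add, map_add, map_add, LinearMap.add_apply, LinearMap.add_apply, hx, hy]

/-- The product `X₊ Y₊ Γ(Y₋, X₋)‾` is colinear for the regular coactions: it is the translation map
of the first factor, which is colinear, followed by the maps `A ⊗ Y ↦ A Y₊ Γ(Y₋, C)‾`. -/
theorem isMor_prodLin : IsMor ((regular H).tensor (regular H)) (regular H) (Γ.prodLin hH) := by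
  obtain ⟨f, hf⟩ := isMor_transl hH
  have h : IsMor ((opCom H).tensor (regular H)) (regular H)
      (tlift (M := opCom H) (N := regular H) (Γ.prodOpLin hH) (Γ.prodOpLin_bal hH)) := by
    refine btensor_tensor_cover _ _ _ _ _ (fun C => tensorHom (𝟙 (regular H))
      (Γ.isMor_contract hH C).choose ≫ (isMor_regMul (H := H)).choose) (fun A C Y => ?_)
    rw [lin_comp, lin_tensorHom_ten, (Γ.isMor_contract hH C).choose_spec,
      (isMor_regMul (H := H)).choose_spec]
    refine (tlift_ten (M := opCom H) (N := regular H) (Γ.prodOpLin hH) (Γ.prodOpLin_bal hH)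
      (H.omul A C) Y).trans ((Γ.prodOp_contract hH A C Y).trans ?_)
    exact (regMulLin_ten A _).symm
  refine (h.comp (isMor_tensorHom f (𝟙 (regular H)))).of_eq fun x => ?_
  refine ten_ext (φ := tlift (M := opCom H) (N := regular H) (Γ.prodOpLin hH)
    (Γ.prodOpLin_bal hH) ∘ₗ lin (tensorHom f (𝟙 (regular H)))) (fun X Y => ?_) x
  rw [LinearMap.comp_apply, lin_tensorHom_ten, hf]
  refine (tlift_ten (M := opCom H) (N := regular H) (Γ.prodOpLin hH) (Γ.prodOpLin_bal hH)
      (H.transl hH X) Y).trans ?_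
  exact (Γ.prodLin_ten hH X Y).symm

/-- `X ·_Γ Y` is the twist of the product `X₊ Y₊ Γ(Y₋, X₋)‾` for the regular comodule. -/
theorem twMul_eq (X Y : L) :
    Γ.twMul hH X Y = Γ.prodLin hH (Γ.sharp₀ (regular H) (regular H) X Y) := by
  have key : ∀ v : H.Diam H.sL, (Γ.twMul_balanced hH).pair X v
      = Γ.prodLin hH ((Γ.sharp_balanced (regular H) (regular H)).pair X v) := fun v => by
    induction v using BalTensor.ind with
    | tmul Y Z =>
      refine ((Γ.twMul_balanced hH).pair_dmul X Y Z).trans (Eq.trans ?_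
        (congrArg _ ((Γ.sharp_balanced (regular H) (regular H)).pair_dmul X Y Z)).symm)
      generalize (regular H).coact X = u
      induction u using BalTensor.ind with
      | tmul P Q =>
        refine ((Γ.twMul_balanced hH).fst_dmul Y Z P Q).trans (Eq.trans ?_
          (congrArg _ ((Γ.sharp_balanced (regular H) (regular H)).fst_dmul Y Z P Q)).symm)
        refine Eq.trans ?_ ((Γ.isMor_prodLin hH).left _ _).symm
        exact congrArg (H.sL _) (Γ.prodLin_ten hH Q Z).symm
      | add x y hx hy => simp only [map_add, hx, hy]
    | add x y hx hy => simp only [map_add, hx, hy]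
  exact key (H.comul Y)

theorem twMul_assoc (X Y Z : L) :
    Γ.twMul hH (Γ.twMul hH X Y) Z = Γ.twMul hH X (Γ.twMul hH Y Z) := by
  rw [twMul_eq, twMul_eq, twMul_eq, twMul_eq]
  refine Γ.sharp₀_assoc (Γ.isMor_prodLin hH) (Γ.isMor_prodLin hH) (Γ.prodLin hH) (Γ.prodLin hH)
    (fun X Y Z => ?_) X Y Z
  rw [prodLin_ten, prodLin_ten, prodLin_ten, prodLin_ten, prod_assoc]

theorem regular_left_one (b : B) : (regular H).left b (1 : L) = H.s b := mul_one (H.s b)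

theorem twMul_s_left (b : B) (X : L) : Γ.twMul hH (H.s b) X = Γ.twL (regular H) b X := by
  rw [twMul_eq, ← regular_left_one, Γ.sharp₀_central_left isCentral_one, prodLin_ten,
    prod_one_left]

theorem twMul_s_right (b : B) (X : L) : Γ.twMul hH X (H.s b) = Γ.twR (regular H) b X := by
  rw [twMul_eq, ← regular_left_one, Γ.sharp₀_central_right isCentral_one, prodLin_ten,
    prod_one_right]

theorem twMul_t_left (b : B) (X : L) : Γ.twMul hH (H.t b) X = Γ.twR (dual hH) b X := by
  rw [twMul_eq, Γ.sharp₀_central_left_one (isCentral_t b), prodLin_ten, prod_t_left]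

theorem twMul_t_right (b : B) (X : L) : Γ.twMul hH X (H.t b) = Γ.twL (dual hH) b X := by
  rw [twMul_eq, Γ.sharp₀_central_right_one (isCentral_t b), prodLin_ten, prod_t_right]

theorem twMul_one_left (X : L) : Γ.twMul hH 1 X = X := by
  rw [← H.s_one, twMul_s_left, twL_one]

theorem twMul_one_right (X : L) : Γ.twMul hH X 1 = X := by
  rw [← H.s_one, twMul_s_right, twR_one]

theorem twMul_s_s (a b : B) :
    Γ.twMul hH (H.s a) (H.s b) = H.s (Γ.form (H.s a) (H.s b)) := by
  rw [twMul_s_left]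
  exact (congrArg (Γ.twL (regular H) a) (regular_left_one b).symm).trans
    ((Γ.twL_central isCentral_one a b).trans (regular_left_one _))

theorem twMul_t_t (a b : B) :
    Γ.twMul hH (H.t a) (H.t b) = H.t (Γ.form (H.s b) (H.s a)) := by
  rw [twMul_t_right, ← dual_left_one hH a, Γ.twL_central (isCentral_dual_one hH), dual_left_one]

theorem twMul_s_t (a b : B) : Γ.twMul hH (H.s a) (H.t b) = Γ.twMul hH (H.t b) (H.s a) := by
  rw [twMul_s_left, twMul_s_right, Γ.twL_central_one (isCentral_t b),
    Γ.twR_central_one (isCentral_t b)]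

/-! ### The Galois map and the twisting map of the dual comodule -/

/-- `Y ⊗ X ↦ X ⊗ Y`. -/
noncomputable def dualFlip : ((dual hH).tensor (dual hH)).carrier →ₗ[k] H.OpTensor :=
  tlift (M := dual hH) (N := dual hH) H.omul.flip (fun b Y X => (H.omul_bal b X Y).symm)

theorem dualFlip_ten (Y X : L) :
    dualFlip hH ((dual hH).ten (dual hH) Y X) = H.omul X Y :=
  tlift_ten (M := dual hH) (N := dual hH) H.omul.flip (fun b Y X => (H.omul_bal b X Y).symm) Y X

theorem dualFlip_left (b : B) (x : ((dual hH).tensor (dual hH)).carrier) :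
    dualFlip hH (((dual hH).tensor (dual hH)).left b x)
      = H.omap LinearMap.id (H.tR b) (fun _ _ => rfl) (H.tR_tL' b) (dualFlip hH x) := by
  induction x using ten_ind with
  | ten Y X => rw [left_ten, dualFlip_ten, dualFlip_ten, BalTensor.map_tmul]; rfl
  | add x y hx hy => simp only [map_add, hx, hy]

theorem prod_flip_sL (Y : L) (b : B) (X : L) :
    (Γ.prod hH).flip Y (H.sL b X) = H.sL b ((Γ.prod hH).flip Y X) := Γ.prod_s_mul hH b X Y

/-- `λ` maps the twisting map of the dual comodule to `X₁ ⋄ X₂₊ Y₊ Γ(Y₋, X₂₋)‾`. -/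
theorem galois_dualFlip (X Y : L) :
    H.galois (dualFlip hH (Γ.sharp₀ (dual hH) (dual hH) Y X))
      = H.diamMap ((Γ.prod hH).flip Y) (Γ.prod_flip_sL hH Y) (H.comul X) := by
  have hl : ∀ b x, Γ.prodOp hH Y ((opCom H).left b x) = H.sL b (Γ.prodOp hH Y x) := fun b x => by
    induction x using BalTensor.ind with
    | tmul A C =>
      refine (congrArg (Γ.prodOp hH Y) (btLeft_tmul _ _ isMor_tR _ _ A C)).trans ?_
      refine (Γ.prodOp_contract hH _ C Y).trans ?_
      refine (mul_assoc (H.s b) A _).trans ?_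
      exact congrArg (H.sL b) (Γ.prodOp_contract hH A C Y).symm
    | add x y hx hy => simp only [map_add, hx, hy]
  have h1 : ∀ x, H.galois (dualFlip hH ((Γ.sharp_balanced (dual hH) (dual hH)).pair Y (opFlip H x)))
      = H.diamMap (Γ.prodOp hH Y) hl ((opCom H).coact x) := fun x => by
    induction x using BalTensor.ind with
    | tmul A C =>
      have h2 : dualFlip hH ((Γ.sharp_balanced (dual hH) (dual hH)).pair Y
          (opFlip H (H.omul A C))) = H.omul A (Γ.contract hH C Y) := by
        rw [opFlip_omul, Balanced.pair_dmul]
        change dualFlip hH ((Γ.sharp_balanced (dual hH) (dual hH)).fst C A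
          (opFlip H (H.transl hH Y))) = H.omul A (Γ.prodAux 1 C (H.transl hH Y))
        generalize H.transl hH Y = y
        induction y using BalTensor.ind with
        | tmul D E =>
          rw [opFlip_omul, Balanced.fst_dmul, AlgHom.toLinearMap_apply, dualFlip_left,
            dualFlip_ten, BalTensor.map_tmul, prodAux_omul, one_mul]
          rfl
        | add x y hx hy => simp only [map_add, hx, hy]
      rw [h2, galois_omul]
      refine Eq.trans ?_ (congrArg (H.diamMap (Γ.prodOp hH Y) hl)
        (btCoact_tmul _ _ isMor_tR _ A C)).symm
      change H.diamMulRight (H.comul A) _ = H.diamMap _ _ (H.diamMap _ _ (H.comul A))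
      generalize H.comul A = w
      induction w using BalTensor.ind with
      | tmul P Q =>
        rw [diamMulRight_dmul]
        refine Eq.trans ?_ (congrArg _ (H.diamMap_dmul _ _ P Q)).symm
        refine Eq.trans ?_ (H.diamMap_dmul _ hl P _).symm
        exact congrArg _ (Γ.prodOp_contract hH Q C Y).symm
      | add x y hx hy => simp only [map_add, LinearMap.add_apply, hx, hy]
    | add x y hx hy => simp only [map_add, hx, hy]
  refine (h1 (H.transl hH X)).trans ?_
  refine (congrArg _ ((isMor_transl hH).coact X)).trans ?_
  exact H.diamMap_diamMap _ _ _ _ _ _ (fun X => rfl) _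

end LeftCocycle

end LeftBialgebroid

namespace LeftBialgebroid

variable {k : Type v} {B L : Type u} [CommRing k] [Ring B] [Algebra k B] [Ring L] [Algebra k L]
  {H : LeftBialgebroid k B L}

open Comodule

namespace Comodule

variable {M N Q : H.Comodule}

/-- The map `n ↦ q ⊗ n` is a morphism if `q` is central and coinvariant. -/
theorem isMor_ten_central {q : Q.carrier} (hq : IsCentral Q q) :
    IsMor N (Q.tensor N) (Q.ten N q) := by
  obtain ⟨f, hf⟩ := hq.isMor
  have h : IsMor N ((unit H).tensor N) ((unit H).ten N (ofB H 1)) := ⟨N.leftUnitIso.inv, rfl⟩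
  refine ((isMor_tensorHom f (𝟙 N)).comp h).of_eq fun n => ?_
  rw [LinearMap.comp_apply, lin_tensorHom_ten, hf, centralMap_apply, lin_id, map_one,
    Module.End.one_apply]

theorem isMor_assocLin (M N P : H.Comodule) :
    IsMor ((M.tensor N).tensor P) (M.tensor (N.tensor P)) (M.assocLin N P) :=
  ⟨M.assocHom N P, rfl⟩

end Comodule

namespace LeftCocycle

variable (Γ : H.LeftCocycle) (hH : H.IsLeftHopf) {M N Q : H.Comodule}

/-! ### The cofree comodules of the cotwist -/

/-- The twisted right action on the dual comodule is `X ·_Γ b = X₊ Γ(X₋, s(b))‾`. -/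
theorem twR_dual (b : B) (X : L) : Γ.twR (dual hH) b X = Γ.contract hH (H.s b) X := by
  rw [twR_apply]
  change H.counitDiam _ _ (dualLeft H) (opFlip H (H.transl hH X))
    = Γ.prodAux 1 (H.s b) (H.transl hH X)
  generalize H.transl hH X = x
  induction x using BalTensor.ind with
  | tmul A C =>
    rw [opFlip_omul, prodAux_omul, EnvRing.counitDiam_dmul, one_mul]; rfl
  | add x y hx hy => simp only [map_add, hx, hy]

theorem isMor_twR_dual (b : B) : IsMor (regular H) (regular H) (Γ.twR (dual hH) b) :=
  (Γ.isMor_contract hH (H.s b)).of_eq fun X => (Γ.twR_dual hH b X).symm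

/-- The comodule `L^Γ ⋄_{B^Γ} M`, the coaction being that of the regular comodule. -/
noncomputable abbrev twCofree (M : H.Comodule) : H.Comodule :=
  (regular H).btensor (Γ.twR (dual hH)) (Γ.isMor_twR_dual hH) (Γ.twL M)

/-- `X ⋄ m`, as an element of `L^Γ ⋄_{B^Γ} M`. -/
noncomputable def gmul (M : H.Comodule) :
    L →ₗ[k] M.carrier →ₗ[k] (Γ.twCofree hH M).carrier :=
  BalTensor.tmul (Γ.twR (dual hH)) (Γ.twL M)

theorem isMor_gmul (m : M.carrier) :
    IsMor (regular H) (Γ.twCofree hH M) ((Γ.gmul hH M).flip m) :=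
  isMor_btIncl _ _ _ _ m

theorem gmul_ind {p : (Γ.twCofree hH M).carrier → Prop} (gmul : ∀ X m, p (Γ.gmul hH M X m))
    (add : ∀ x y, p x → p y → p (x + y)) (x : (Γ.twCofree hH M).carrier) : p x :=
  BalTensor.ind gmul add x

/-- The map `Γ^# : L^Γ ⋄_{B^Γ} M → L ⋄_B M`. -/
noncomputable def sharpCofree (M : H.Comodule) :
    (Γ.twCofree hH M).carrier →ₗ[k] (cofree H M.left).carrier := Γ.sharp (dual hH) M

theorem sharpCofree_gmul (X : L) (m : M.carrier) :
    Γ.sharpCofree hH M (Γ.gmul hH M X m) = Γ.sharp₀ (dual hH) M X m :=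
  BalTensor.lift_tmul _ (Γ.sharp₀_bal (dual hH) M) X m

/-- The map `Γ^#` is colinear for the coactions of the first factors. -/
theorem isMor_sharpCofree : IsMor (Γ.twCofree hH M) (cofree H M.left) (Γ.sharpCofree hH M) :=
  btensor_cover _ _ _ _ _ fun m => (Γ.isMor_sharpReg hH m).of_eq fun X =>
    (Γ.sharpCofree_gmul hH X m).symm

/-- This is the invertibility of `Γ` for the dual comodule and `M`. -/
theorem sharpCofree_bijective (hΓ : Γ.IsInvertible) (M : H.Comodule) :
    Function.Bijective (Γ.sharpCofree hH M) :=
  hΓ (dual hH) M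

/-- The inverse of `Γ^# : L^Γ ⋄_{B^Γ} M → L ⋄_B M`. -/
noncomputable def sharpCofreeInv (hΓ : Γ.IsInvertible) (M : H.Comodule) :
    (cofree H M.left).carrier →ₗ[k] (Γ.twCofree hH M).carrier :=
  (LinearEquiv.ofBijective (Γ.sharpCofree hH M)
    (Γ.sharpCofree_bijective hH hΓ M)).symm.toLinearMap

theorem sharpCofree_inv (hΓ : Γ.IsInvertible) (M : H.Comodule) (u : (cofree H M.left).carrier) :
    Γ.sharpCofree hH M (Γ.sharpCofreeInv hH hΓ M u) = u :=
  (LinearEquiv.ofBijective (Γ.sharpCofree hH M)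
    (Γ.sharpCofree_bijective hH hΓ M)).apply_symm_apply u

theorem inv_sharpCofree (hΓ : Γ.IsInvertible) (M : H.Comodule) (x : (Γ.twCofree hH M).carrier) :
    Γ.sharpCofreeInv hH hΓ M (Γ.sharpCofree hH M x) = x :=
  (LinearEquiv.ofBijective (Γ.sharpCofree hH M)
    (Γ.sharpCofree_bijective hH hΓ M)).symm_apply_apply x

/-- The coaction `Γ^#⁻¹ ∘ δ : M → L^Γ ⋄_{B^Γ} M`. -/
noncomputable def twCoact (hΓ : Γ.IsInvertible) (M : H.Comodule) :
    M.carrier →ₗ[k] (Γ.twCofree hH M).carrier :=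
  Γ.sharpCofreeInv hH hΓ M ∘ₗ M.coact

theorem sharpCofree_twCoact (hΓ : Γ.IsInvertible) (m : M.carrier) :
    Γ.sharpCofree hH M (Γ.twCoact hH hΓ M m) = M.coact m :=
  Γ.sharpCofree_inv hH hΓ M (M.coact m)

/-- The twisted coaction is colinear for the coaction of the regular comodule on `L^Γ`. -/
theorem isMor_twCoact (hΓ : Γ.IsInvertible) (M : H.Comodule) :
    IsMor M (Γ.twCofree hH M) (Γ.twCoact hH hΓ M) :=
  IsMor.comp (M := M) (N := cofree H M.left) (P := Γ.twCofree hH M)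
    ((Γ.isMor_sharpCofree hH).symm (Γ.inv_sharpCofree hH hΓ M) (Γ.sharpCofree_inv hH hΓ M))
    (isMor_coact M)

/-! ### Compatibility of the coactions with the twisting maps -/

theorem sharp_prod_bal (n : N.carrier) (b : B) (X : L) (m : M.carrier) :
    Γ.sharpReg hH (Γ.sharp₀ M N m n) ∘ₗ Γ.prod hH (Γ.twR (dual hH) b X)
      = Γ.sharpReg hH (Γ.sharp₀ M N (Γ.twL M b m) n) ∘ₗ Γ.prod hH X := LinearMap.ext fun Z => by
  rw [LinearMap.comp_apply, LinearMap.comp_apply, sharpReg_apply, sharpReg_apply, sharp₀_twL,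
    ← sharp₀_bal, ← prod_t_left, ← prod_t_left, prod_assoc]

/-- `(X ⋄ m, Z) ↦ Γ^#(X₊ Z₊ Γ(Z₋, X₋)‾ ⋄ Γ^#(m ⊗ n))`. -/
noncomputable def sharpProdAux (M : H.Comodule) (n : N.carrier) :
    (Γ.twCofree hH M).carrier →ₗ[k] L →ₗ[k] H.Diam (M.tensor N).left :=
  BalTensor.lift
    (LinearMap.mk₂ k (fun X m => Γ.sharpReg hH (Γ.sharp₀ M N m n) ∘ₗ Γ.prod hH X)
      (fun X X' m => LinearMap.ext fun Z => by simp only [LinearMap.comp_apply,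
        LinearMap.add_apply, map_add])
      (fun c X m => LinearMap.ext fun Z => by simp only [LinearMap.comp_apply,
        LinearMap.smul_apply, map_smul])
      (fun X m m' => LinearMap.ext fun Z => by
        simp only [LinearMap.comp_apply, sharpReg_apply, LinearMap.add_apply, map_add]; rfl)
      (fun c X m => LinearMap.ext fun Z => by
        simp only [LinearMap.comp_apply, sharpReg_apply, LinearMap.smul_apply, map_smul]; rfl))
    (fun b X m => Γ.sharp_prod_bal hH n b X m)

theorem sharpProdAux_gmul (n : N.carrier) (X Z : L) (m : M.carrier) :
    Γ.sharpProdAux hH M n (Γ.gmul hH M X m) Z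
      = Γ.sharp₀ (dual hH) (M.tensor N) (Γ.prod hH X Z) (Γ.sharp₀ M N m n) :=
  LinearMap.congr_fun (BalTensor.lift_tmul (f := Γ.twR (dual hH)) (g := Γ.twL M) _
    (fun b X m => Γ.sharp_prod_bal hH n b X m) X m) Z

theorem sharpProdAux_bal (n : N.carrier) (b : B) (x : (Γ.twCofree hH M).carrier) (Z : L) :
    Γ.sharpProdAux hH M n ((Γ.twCofree hH M).right (op b) x) Z
      = Γ.sharpProdAux hH M n x (H.s b * Z) := by
  induction x using gmul_ind with
  | gmul X m =>
    rw [sharpProdAux_gmul, ← prod_mul_s, ← sharpProdAux_gmul]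
    exact congrArg (fun u => Γ.sharpProdAux hH M n u Z) ((Γ.isMor_gmul hH m).right (op b) X).symm
  | add x y hx hy =>
    rw [map_add, map_add, map_add, LinearMap.add_apply, LinearMap.add_apply, hx, hy]

/-- `(X ⋄ m) ⊗ Z ↦ Γ^#(X₊ Z₊ Γ(Z₋, X₋)‾ ⋄ Γ^#(m ⊗ n))`. -/
noncomputable def sharpProd (M : H.Comodule) (n : N.carrier) :
    ((Γ.twCofree hH M).tensor (regular H)).carrier →ₗ[k] H.Diam (M.tensor N).left :=
  tlift (M := Γ.twCofree hH M) (N := regular H) (Γ.sharpProdAux hH M n)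
    (Γ.sharpProdAux_bal hH n)

theorem sharpProd_ten (n : N.carrier) (x : (Γ.twCofree hH M).carrier) (Z : L) :
    Γ.sharpProd hH M n ((Γ.twCofree hH M).ten (regular H) x Z) = Γ.sharpProdAux hH M n x Z :=
  tlift_ten (M := Γ.twCofree hH M) (N := regular H) (Γ.sharpProdAux hH M n)
    (Γ.sharpProdAux_bal hH n) x Z

/-- `(X ⋄ m) ⊗ Z ↦ Γ^#((X ·_Γ Z) ⋄ Γ^#(m ⊗ n))`. -/
theorem sharpProd_sharp₀ (n : N.carrier) (X Z : L) (m : M.carrier) :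
    Γ.sharpProd hH M n (Γ.sharp₀ (Γ.twCofree hH M) (regular H) (Γ.gmul hH M X m) Z)
      = Γ.sharp₀ (dual hH) (M.tensor N) (Γ.twMul hH X Z) (Γ.sharp₀ M N m n) := by
  rw [twMul_eq]
  refine (Γ.sharp₀_natural (Γ.isMor_gmul hH m) isMor_id
    (Γ.sharpReg hH (Γ.sharp₀ M N m n) ∘ₗ Γ.prodLin hH) (Γ.sharpProd hH M n) (fun X Z => ?_)
    X Z).symm
  rw [sharpProd_ten]
  refine (congrArg (Γ.sharpReg hH (Γ.sharp₀ M N m n)) (Γ.prodLin_ten hH X Z)).trans ?_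
  exact (Γ.sharpProdAux_gmul hH n X Z m).symm

/-- `m ⊗ (X ⋄ n) ↦ m₋₁ X ⋄ (m₀ ⊗ n)`. -/
def codLin (M N : H.Comodule) :
    (M.tensor (cofree H N.left)).carrier →ₗ[k] H.Diam (M.tensor N).left :=
  tlift (N := cofree H N.left) (M.cod N).pair (fun b m v => M.pair_codiag_diamSL N b m v)

theorem codLin_ten (m : M.carrier) (v : H.Diam N.left) :
    codLin M N (M.ten (cofree H N.left) m v) = (M.cod N).pair m v :=
  tlift_ten (N := cofree H N.left) (M.cod N).pair (fun b m v => M.pair_codiag_diamSL N b m v) m v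

/-- The coaction on `Γ^#(m ⊗ n)`, by naturality for the coaction of `N`. -/
theorem codLin_coact (m : M.carrier) (n : N.carrier) :
    codLin M N (Γ.sharp₀ M (cofree H N.left) m (N.coact n))
      = (M.tensor N).coact (Γ.sharp₀ M N m n) :=
  (Γ.sharp₀_natural isMor_id (isMor_coact N) (M.tensor N).coact (codLin M N) (fun m n =>
    (coact_ten M N m n).trans (codLin_ten m (N.coact n)).symm) m n).symm

/-- `X ⊗ (Y ⊗ p) ↦ Y X ⋄ p`. -/
noncomputable def dualMulTen (P : H.Comodule) :
    ((dual hH).tensor ((dual hH).tensor P)).carrier →ₗ[k] H.Diam P.left :=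
  lin (tensorHom (isMor_dualMul hH).choose (𝟙 P)) ∘ₗ (dual hH).assocInv (dual hH) P

theorem dualMulTen_ten (P : H.Comodule) (X Y : L) (p : P.carrier) :
    dualMulTen hH P ((dual hH).ten _ X ((dual hH).ten P Y p)) = H.dmul P.left (Y * X) p := by
  refine (congrArg (lin (tensorHom (isMor_dualMul hH).choose (𝟙 P)))
    ((dual hH).assocInv_ten (dual hH) P X Y p)).trans ?_
  refine (lin_tensorHom_ten _ _ _ (𝟙 P) _ p).trans ?_
  exact congrArg (fun U => (dual hH).ten P U p) ((LinearMap.congr_fun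
    (isMor_dualMul hH).choose_spec _).trans (dualMulLin_ten hH X Y))

/-- The sum of `Γ^#(X₊ Z₊ Γ(Z₋, X₋)‾ ⋄ Γ^#(m' ⊗ n))` over `X ⋄ m' = δ^Γ(m)` is the codiagonal
product of `δ(m)` with `Γ^#(Z ⋄ n)`. By associativity the sum depends only on `Γ^#(δ^Γ(m)) = δ(m)`,
on which `Γ^#` is trivial because it is a central coinvariant element of `dual ⊗ M`. -/
theorem sharpProdAux_twCoact (hΓ : Γ.IsInvertible) (n : N.carrier) (m : M.carrier) (Z : L) :
    Γ.sharpProdAux hH M n (Γ.twCoact hH hΓ M m) Z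
      = (M.cod N).pair m (Γ.sharp₀ (dual hH) N Z n) := by
  have h1 : ∀ x : (Γ.twCofree hH M).carrier, Γ.sharpProdAux hH M n x Z
      = dualMulTen hH (M.tensor N) (Γ.sharp₀ (dual hH) ((dual hH).tensor (M.tensor N)) Z
        ((dual hH).assocLin M N
          (Γ.sharp₀ ((dual hH).tensor M) N (Γ.sharpCofree hH M x) n))) := fun x => by
    induction x using gmul_ind with
    | gmul X m =>
      rw [sharpProdAux_gmul, sharpCofree_gmul, assoc_sharp₀, prod_eq]
      refine Γ.sharp₀_assoc (isMor_dualMul hH) isMor_id LinearMap.id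
        (dualMulTen hH (M.tensor N)) (fun Z X p => ?_) Z X _
      refine Eq.trans ?_ (dualMulTen_ten hH (M.tensor N) Z X p).symm
      exact congrArg (fun U => (dual hH).ten (M.tensor N) U p) (dualMulLin_ten hH Z X)
    | add x y hx hy =>
      refine (LinearMap.map_add₂ (Γ.sharpProdAux hH M n) x y Z).trans ?_
      rw [hx, hy, ← map_add, ← map_add, ← map_add]
      refine congrArg (fun u => dualMulTen hH (M.tensor N) (Γ.sharp₀ (dual hH)
        ((dual hH).tensor (M.tensor N)) Z ((dual hH).assocLin M N u))) ?_
      refine Eq.trans ?_ (congrArg (fun u => Γ.sharp₀ ((dual hH).tensor M) N u n)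
        (map_add (Γ.sharpCofree hH M) x y)).symm
      exact (LinearMap.map_add₂ (Γ.sharp₀ ((dual hH).tensor M) N) _ _ n).symm
  have h2 := isCentral_coact hH m
  rw [h1, sharpCofree_twCoact]
  refine (congrArg (fun u => dualMulTen hH (M.tensor N) (Γ.sharp₀ (dual hH)
    ((dual hH).tensor (M.tensor N)) Z ((dual hH).assocLin M N u)))
    (Γ.sharp₀_central_left_one h2 n)).trans ?_
  refine (Γ.sharp₀_natural isMor_id ((isMor_assocLin (dual hH) M N).comp (isMor_ten_central h2))
    ((M.cod N).pair m) (dualMulTen hH (M.tensor N)) (fun Z n => ?_) Z n).symm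
  refine ((M.cod N).pair_dmul m Z n).trans ?_
  rw [LinearMap.comp_apply, LinearMap.id_apply]
  generalize M.coact m = u
  induction u using BalTensor.ind with
  | tmul Y m =>
    rw [fst_cod_dmul]
    refine Eq.symm ((congrArg (fun u => dualMulTen hH (M.tensor N) ((dual hH).ten
      ((dual hH).tensor (M.tensor N)) Z u)) ((dual hH).assocLin_ten M N Y m n)).trans ?_)
    exact dualMulTen_ten hH (M.tensor N) Z Y _
  | add x y hx hy =>
    rw [map_add, hx, hy, ← map_add, ← map_add, ← map_add]
    refine congrArg (fun u => dualMulTen hH (M.tensor N) ((dual hH).ten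
      ((dual hH).tensor (M.tensor N)) Z ((dual hH).assocLin M N u))) ?_
    exact (LinearMap.map_add₂ (((dual hH).tensor M).ten N) x y n).symm

/-- The twisted coaction is compatible with the twisting maps: the sum of
`Γ^#((X ·_Γ Z) ⋄ Γ^#(m' ⊗ n))` over `X ⋄ m' = δ^Γ(m)` is obtained from `Γ^#(m ⊗ Γ^#(Z ⋄ n))` by the
codiagonal coaction. -/
theorem sharpProd_twCoact (hΓ : Γ.IsInvertible) (m : M.carrier) (n : N.carrier) (Z : L) :
    Γ.sharpProd hH M n (Γ.sharp₀ (Γ.twCofree hH M) (regular H) (Γ.twCoact hH hΓ M m) Z)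
      = codLin M N (Γ.sharp₀ M (cofree H N.left) m (Γ.sharp₀ (dual hH) N Z n)) := by
  have h1 := Γ.sharp₀_natural (isMor_twCoact Γ hH hΓ M) (isMor_id (M := regular H))
    (codLin M N ∘ₗ lin (tensorHom (𝟙 M) (Γ.isMor_sharpReg hH n).choose)) (Γ.sharpProd hH M n)
    (fun m Z => by
      rw [LinearMap.comp_apply, lin_tensorHom_ten, (Γ.isMor_sharpReg hH n).choose_spec]
      refine (codLin_ten m _).trans ((Γ.sharpProdAux_twCoact hH hΓ n m Z).symm.trans ?_)
      exact (Γ.sharpProd_ten hH n _ Z).symm) m Z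
  rw [LinearMap.comp_apply, sharp₀_tensorHom, (Γ.isMor_sharpReg hH n).choose_spec] at h1
  exact h1.symm

end LeftCocycle

end LeftBialgebroid

namespace LeftBialgebroid

variable {k : Type v} {B L : Type u} [CommRing k] [Ring B] [Algebra k B] [Ring L] [Algebra k L]
  {H : LeftBialgebroid k B L}

open Comodule

/-! ### The twisted counit -/

variable (H) in
/-- `D ⊗ E ↦ D E`. -/
def mulOp : H.OpTensor →ₗ[k] L :=
  BalTensor.lift (LinearMap.mul k L) (fun b D E => mul_assoc D (H.t b) E)

theorem mulOp_omul (D E : L) : mulOp H (H.omul D E) = D * E :=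
  BalTensor.lift_tmul (LinearMap.mul k L) (fun b D E => mul_assoc D (H.t b) E) D E

/-- `X₊ X₋ = ε(X)`. -/
theorem mulOp_transl (hH : H.IsLeftHopf) (X : L) :
    mulOp H (H.transl hH X) = H.s (H.counit X) := by
  have h : ∀ x, mulOp H x = H.counitDiam H.counit H.counit_target H.sL (H.galois x) := fun x => by
    induction x using BalTensor.ind with
    | tmul D E =>
      rw [mulOp_omul, galois_omul]
      refine (congrArg (· * E) (H.counit_comul D).symm).trans ?_
      generalize H.comul D = u
      induction u using BalTensor.ind with
      | tmul P Q =>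
        rw [diamMulRight_dmul, EnvRing.counitDiam_dmul, EnvRing.counitDiam_dmul]
        exact mul_assoc _ Q E
      | add x y hx hy => simp only [map_add, LinearMap.add_apply, add_mul, hx, hy]
    | add x y hx hy => simp only [map_add, hx, hy]
  rw [h, galois_transl, EnvRing.counitDiam_dmul, EnvRing.sL_apply, mul_one]

namespace LeftCocycle

variable (Γ : H.LeftCocycle) (hH : H.IsLeftHopf) {M N Q : H.Comodule}

theorem tw_tR (b : B) (A C : L) : Γ.tw (H.tR b A) C = Γ.tw A (H.tL b C) := by
  rw [EnvRing.tR_apply, EnvRing.tL_apply, tw_bal]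

/-- `A ⊗ C ↦ Γ(A₁, C₁) A₂ C₂`. -/
def twOp : H.OpTensor →ₗ[k] L := BalTensor.lift (f := H.tR) (g := H.tL) Γ.tw Γ.tw_tR

theorem twOp_omul (A C : L) : Γ.twOp (H.omul A C) = Γ.tw A C :=
  BalTensor.lift_tmul (f := H.tR) (g := H.tL) Γ.tw Γ.tw_tR A C

theorem twEval_bal (C : L) (b : B) (D A : L) :
    Γ.tw_balanced.fst C (H.t b * D) (H.comul A)
      = Γ.tw_balanced.fst C D (H.comul (A * H.t b)) := by
  rw [H.comul_mul_t]
  generalize H.comul A = u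
  induction u using BalTensor.ind with
  | tmul P Q =>
    rw [EnvRing.diamMap_dmul]
    refine (Γ.tw_balanced.fst_dmul C _ P Q).trans (Eq.trans ?_
      (Γ.tw_balanced.fst_dmul C D P _).symm)
    exact congrArg (H.sL _) (mul_assoc Q (H.t b) D).symm
  | add x y hx hy => simp only [map_add, hx, hy]

/-- `(D, A, C) ↦ Γ(A₁, C) A₂ D`. -/
def twEvalAux : L →ₗ[k] L →ₗ[k] L →ₗ[k] L :=
  LinearMap.lflip.toLinearMap ∘ₗ ((H.dmul H.sL).compr₂ Γ.tw_balanced.pair.flip).flip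

theorem twEvalAux_apply (D A C : L) :
    Γ.twEvalAux D A C = Γ.tw_balanced.fst C D (H.comul A) :=
  Γ.tw_balanced.pair_dmul A C D

theorem twEvalAux_bal (b : B) (D A : L) :
    Γ.twEvalAux (H.tL b D) A = Γ.twEvalAux D (dualLeft H b A) := LinearMap.ext fun C => by
  rw [twEvalAux_apply, twEvalAux_apply]
  exact Γ.twEval_bal C b D A

/-- `(C, D ⋄ A) ↦ Γ(A₁, C) A₂ D`. -/
def twEval₀ : L →ₗ[k] H.Diam (dualLeft H) →ₗ[k] L :=
  (BalTensor.lift (f := H.tL) (g := dualLeft H) Γ.twEvalAux Γ.twEvalAux_bal).flip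

theorem twEval₀_dmul (C D A : L) : Γ.twEval₀ C (H.dmul (dualLeft H) D A)
    = Γ.tw_balanced.fst C D (H.comul A) :=
  (LinearMap.congr_fun (BalTensor.lift_tmul (f := H.tL) (g := dualLeft H) Γ.twEvalAux
    Γ.twEvalAux_bal D A) C).trans (Γ.twEvalAux_apply D A C)

theorem twEval₀_diamSL (b : B) (C : L) (w : H.Diam (dualLeft H)) :
    Γ.twEval₀ (H.t b * C) w = Γ.twEval₀ C (H.diamSL (dualLeft H) b w) := by
  induction w using BalTensor.ind with
  | tmul D A =>
    rw [EnvRing.diamSL_dmul, twEval₀_dmul, twEval₀_dmul]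
    exact Γ.tw_balanced.fst_bal A b C D
  | add x y hx hy => simp only [map_add, hx, hy]

/-- `C ⋄ (D ⋄ A) ↦ Γ(A₁, C) A₂ D`. -/
def twEval : H.Diam (H.diamSL (dualLeft H)) →ₗ[k] L :=
  BalTensor.lift (f := H.tL) (g := H.diamSL (dualLeft H)) Γ.twEval₀ Γ.twEval₀_diamSL

theorem twEval_dmul (C : L) (w : H.Diam (dualLeft H)) :
    Γ.twEval (H.dmul (H.diamSL (dualLeft H)) C w) = Γ.twEval₀ C w :=
  BalTensor.lift_tmul (f := H.tL) (g := H.diamSL (dualLeft H)) Γ.twEval₀ Γ.twEval₀_diamSL C w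

theorem twEval_comulDiam (x : H.OpTensor) :
    Γ.twEval (H.comulDiam H.comul H.comul_target (dualLeft H) (opFlip H x)) = Γ.twOp x := by
  induction x using BalTensor.ind with
  | tmul A C =>
    rw [opFlip_omul, EnvRing.comulDiam_dmul, twOp_omul]
    change _ = Γ.tw_balanced.pair A (H.comul C)
    generalize H.comul C = u
    induction u using BalTensor.ind with
    | tmul P Q =>
      rw [EnvRing.diamInsert_dmul, twEval_dmul, twEval₀_dmul]
      exact (Γ.tw_balanced.pair_dmul A P Q).symm
    | add x y hx hy => simp only [map_add, hx, hy]
  | add x y hx hy => simp only [map_add, hx, hy]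

theorem s_counit_sL (b : B) (X : L) :
    (H.s ∘ₗ H.counit) (H.sL b X) = H.sL b ((H.s ∘ₗ H.counit) X) := by
  rw [LinearMap.comp_apply, EnvRing.sL_apply, H.counit_source, H.s_mul]; rfl

theorem flip_form_t (C : L) (b : B) (X : L) :
    Γ.form.flip C (H.t b * X) = Γ.form.flip C X * b := Γ.form_t b X C

/-- `Γ(A₁, C) ε(A₂) = Γ(A, C)`, as elements of `s(B)`. -/
theorem form_comul_counit (A C : L) :
    H.counitDiam (Γ.form.flip C) (Γ.flip_form_t C) H.sL
      (H.diamMap (l := H.sL) (l' := H.sL) (H.s ∘ₗ H.counit) s_counit_sL (H.comul A))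
      = H.s (Γ.form A C) := by
  conv_rhs => rw [← H.comul_counit A]
  generalize H.comul A = u
  induction u using BalTensor.ind with
  | tmul P Q =>
    rw [EnvRing.diamMap_dmul, counitRight_dmul, Γ.form_t, H.s_mul]
    exact EnvRing.counitDiam_dmul _ _ _ H.sL P _
  | add x y hx hy => simp only [map_add, LinearMap.add_apply, hx, hy]

theorem mulOp_left (b : B) (x : (opCom H).carrier) :
    mulOp H ((opCom H).left b x) = H.sL b (mulOp H x) := by
  induction x using BalTensor.ind with
  | tmul A C =>
    refine (congrArg (mulOp H) (btLeft_tmul _ _ isMor_tR _ _ A C)).trans ?_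
    refine (mulOp_omul _ C).trans ((mul_assoc (H.s b) A C).trans ?_)
    exact congrArg (H.sL b) (mulOp_omul A C).symm
  | add x y hx hy => simp only [map_add, hx, hy]

/-- `Γ(D₁, C) D₂ E` as the contraction of `D₁ ⋄ D₂ E` with `Γ(-, C)`. -/
theorem twEval₀_opFlip (C : L) (x : H.OpTensor) : Γ.twEval₀ C (opFlip H x)
    = H.counitDiam (Γ.form.flip C) (Γ.flip_form_t C) H.sL
      (H.diamMap (mulOp H) mulOp_left ((opCom H).coact x)) := by
  induction x using BalTensor.ind with
  | tmul D E =>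
    rw [opFlip_omul, twEval₀_dmul]
    refine Eq.trans ?_ (congrArg (fun u => H.counitDiam (Γ.form.flip C)
      (Γ.flip_form_t C) H.sL (H.diamMap (mulOp H) mulOp_left u))
      (btCoact_tmul _ _ isMor_tR _ D E)).symm
    change _ = H.counitDiam _ _ H.sL (H.diamMap _ _ (H.diamMap _ _ (H.comul D)))
    generalize H.comul D = u
    induction u using BalTensor.ind with
    | tmul P Q =>
      refine (Γ.tw_balanced.fst_dmul C E P Q).trans ?_
      rw [EnvRing.diamMap_dmul, EnvRing.diamMap_dmul, EnvRing.counitDiam_dmul]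
      exact congrArg (H.sL _) (mulOp_omul Q E).symm
    | add x y hx hy => simp only [map_add, hx, hy]
  | add x y hx hy => simp only [map_add, hx, hy]

/-- `Γ(X₊₁, X₋₁) X₊₂ X₋₂ = Γ(X₊, X₋)`. -/
theorem twOp_transl (X : L) : Γ.twOp (H.transl hH X) = H.s (Γ.twCounit hH X) := by
  rw [← twEval_comulDiam, ← transl_coassoc]
  change _ = H.s (Γ.toFun (H.transl hH X))
  generalize H.transl hH X = x
  induction x using BalTensor.ind with
  | tmul A C =>
    rw [opFlip_omul]
    refine (congrArg Γ.twEval (H.diamMap_dmul _ (transl_coact_left hH) C A)).trans ?_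
    rw [twEval_dmul]
    refine (Γ.twEval₀_opFlip C (H.transl hH A)).trans (Eq.trans ?_ (Γ.form_comul_counit A C))
    refine congrArg _ ?_
    refine (congrArg _ ((isMor_transl hH).coact A)).trans ?_
    exact H.diamMap_diamMap _ _ _ _ _ _ (fun X => mulOp_transl hH X) _
  | add x y hx hy => simp only [map_add, hx, hy]

theorem twCounit_s (b : B) : Γ.twCounit hH (H.s b) = b := by
  change Γ.toFun (H.transl hH (H.s b)) = b
  rw [transl_s]
  exact (Γ.one_right _).trans (counit_s b)

theorem twCounit_t (b : B) : Γ.twCounit hH (H.t b) = b := by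
  change Γ.toFun (H.transl hH (H.t b)) = b
  rw [transl_t]
  exact (Γ.one_left _).trans (counit_s b)

theorem twL_regular (b : B) (X : L) : Γ.twL (regular H) b X = Γ.tw (H.s b) X := Γ.conv_left b X

/-- `ε^Γ` is left linear for `s`. -/
theorem twCounit_twL (b : B) (X : L) : Γ.twCounit hH (Γ.twL (regular H) b X)
    = Γ.form (H.s b) (H.s (Γ.twCounit hH X)) := by
  rw [← twOp_transl]
  change Γ.toFun (H.transl hH (Γ.twL (regular H) b X)) = _
  rw [Γ.twL_natural (isMor_transl hH)]
  generalize H.transl hH X = x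
  induction x using BalTensor.ind with
  | tmul A C =>
    rw [twOp_omul, Γ.cocycle, ← twL_regular]
    exact congrArg Γ.toFun (Γ.twL_natural (isMor_btIncl (regular H) H.tR isMor_tR H.tL C) b A).symm
  | add x y hx hy => simp only [map_add, hx, hy]

/-- `ε^Γ(b̄ ·_Γ X) = ε^Γ(X) ·_Γ b`. -/
theorem twCounit_twR_dual (b : B) (X : L) : Γ.twCounit hH (Γ.twR (dual hH) b X)
    = Γ.form (H.s (Γ.twCounit hH X)) (H.s b) := by
  have h0 : ∀ y, Γ.toFun y = Γ.toFun (opUnflip H (opFlip H y)) := fun y => by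
    rw [opUnflip_opFlip]
  have h1 : opFlip H (H.transl hH (Γ.twR (dual hH) b X))
      = convDiam (Γ.form.flip (H.s b)) (Γ.form_flip_t b) (dual hH) (opFlip H (H.transl hH X)) :=
    coact_act (Γ.form.flip (H.s b)) (Γ.form_flip_t b) (dual hH) X
  rw [← twOp_transl]
  change Γ.toFun (H.transl hH (Γ.twR (dual hH) b X)) = _
  rw [h0, h1]
  generalize H.transl hH X = x
  induction x using BalTensor.ind with
  | tmul A C =>
    rw [twOp_omul, opFlip_omul, ← Γ.cocycle, convDiam_dmul, opUnflip_dmul, conv_right]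
    rfl
  | add x y hx hy => simp only [map_add, LinearMap.add_apply, hx, hy]

end LeftCocycle

end LeftBialgebroid

namespace LeftBialgebroid

variable {k : Type v} {B L : Type u} [CommRing k] [Ring B] [Algebra k B] [Ring L] [Algebra k L]
  {H : LeftBialgebroid k B L}

open Comodule

namespace LeftCocycle

variable (Γ : H.LeftCocycle) (hH : H.IsLeftHopf) {M N Q : H.Comodule}

/-- `(A, n, C) ↦ Γ(A, C) n`. -/
def formAct (N : H.Comodule) : (dual hH).carrier →ₗ[k] N.carrier →ₗ[k] L →ₗ[k] N.carrier :=
  LinearMap.lflip.toLinearMap ∘ₗ Γ.form.compr₂ N.left.toLinearMap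

theorem formAct_bal (b : B) (A : (dual hH).carrier) (n : N.carrier) :
    Γ.formAct hH N ((dual hH).right (op b) A) n = Γ.formAct hH N A (N.left b n) :=
  LinearMap.ext fun C => by
    refine (congrArg (fun c => N.left c n) (Γ.form_t b A C)).trans ?_
    rw [map_mul, Module.End.mul_apply]
    rfl

/-- `(C, A ⊗ n) ↦ Γ(A, C) n`. -/
noncomputable def formActTen (N : H.Comodule) :
    L →ₗ[k] ((dual hH).tensor N).carrier →ₗ[k] N.carrier :=
  (tlift (M := dual hH) (Γ.formAct hH N) (Γ.formAct_bal hH)).flip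

theorem formActTen_ten (A C : L) (n : N.carrier) :
    Γ.formActTen hH N C ((dual hH).ten N A n) = N.left (Γ.form A C) n :=
  LinearMap.congr_fun (tlift_ten (M := dual hH) (Γ.formAct hH N) (Γ.formAct_bal hH) A n) C

theorem formActTen_left (b : B) (C : L) (x : ((dual hH).tensor N).carrier) :
    Γ.formActTen hH N (H.tL b C) x
      = Γ.formActTen hH N C (((dual hH).tensor N).left b x) := by
  induction x using ten_ind with
  | ten A n =>
    rw [left_ten, formActTen_ten, EnvRing.tL_apply, ← Γ.form_bal]
    exact (Γ.formActTen_ten hH _ C n).symm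
  | add x y hx hy => simp only [map_add, hx, hy]

/-- `C ⋄ (A ⊗ n) ↦ Γ(A, C) n`. -/
noncomputable def formEval (N : H.Comodule) : H.Diam ((dual hH).tensor N).left →ₗ[k] N.carrier :=
  BalTensor.lift (f := H.tL) (g := ((dual hH).tensor N).left) (Γ.formActTen hH N)
    (Γ.formActTen_left hH)

theorem formEval_dmul (C : L) (x : ((dual hH).tensor N).carrier) :
    Γ.formEval hH N (H.dmul ((dual hH).tensor N).left C x) = Γ.formActTen hH N C x :=
  BalTensor.lift_tmul (f := H.tL) (g := ((dual hH).tensor N).left) (Γ.formActTen hH N)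
    (Γ.formActTen_left hH) C x

/-- The map `Γ^#` determines `ε^Γ(X) ·_Γ n`. -/
theorem formEval_coact_sharp₀ (X : L) (n : N.carrier) :
    Γ.formEval hH N (((dual hH).tensor N).coact (Γ.sharp₀ (dual hH) N X n))
      = Γ.twL N (Γ.twCounit hH X) n := by
  rw [coact_sharp₀, twL_apply]
  generalize N.coact n = v
  induction v using BalTensor.ind with
  | tmul Y n =>
    rw [Balanced.pair_dmul, EnvRing.counitDiam_dmul, ← twOp_transl]
    change Γ.formEval hH N ((Γ.twCod (dual hH) N).fst Y n (opFlip H (H.transl hH X))) = _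
    generalize H.transl hH X = x
    induction x using BalTensor.ind with
    | tmul A C =>
      rw [opFlip_omul, Balanced.fst_dmul, formEval_dmul, formActTen_ten, twOp_omul, Γ.cocycle]
    | add x y hx hy => simp only [map_add, LinearMap.add_apply, hx, hy]
  | add x y hx hy => simp only [map_add, hx, hy]

/-- The element `δ(n)` being coinvariant, this reduces to the counit axiom and `Γ(A, 1) = ε(A)`. -/
theorem formEval_coact_coact (n : N.carrier) :
    Γ.formEval hH N (((dual hH).tensor N).coact (N.coact n)) = n := by
  rw [(isCentral_coact hH n).coact_eq]
  refine (Γ.formEval_dmul hH 1 (N.coact n)).trans ?_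
  refine Eq.trans ?_ (N.counit_coact n)
  generalize N.coact n = v
  induction v using BalTensor.ind with
  | tmul A n => rw [EnvRing.counitDiam_dmul, ← Γ.one_right]; exact Γ.formActTen_ten hH A 1 n
  | add x y hx hy => rw [map_add, ← hx, ← hy]; exact map_add _ x y

/-- `X ⋄ n ↦ Γ(X₊, X₋) ·_Γ n`. -/
noncomputable def twCounitDiam (N : H.Comodule) : (Γ.twCofree hH N).carrier →ₗ[k] N.carrier :=
  Γ.formEval hH N ∘ₗ ((dual hH).tensor N).coact ∘ₗ Γ.sharpCofree hH N

theorem twCounitDiam_gmul (X : L) (n : N.carrier) :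
    Γ.twCounitDiam hH N (Γ.gmul hH N X n) = Γ.twL N (Γ.twCounit hH X) n := by
  rw [← formEval_coact_sharp₀, ← sharpCofree_gmul]; rfl

/-- The counit axiom for the twisted coaction. -/
theorem twCounitDiam_twCoact (hΓ : Γ.IsInvertible) (n : N.carrier) :
    Γ.twCounitDiam hH N (Γ.twCoact hH hΓ N n) = n := by
  refine Eq.trans ?_ (Γ.formEval_coact_coact hH n)
  rw [← Γ.sharpCofree_twCoact hH hΓ]; rfl

/-! ### The twisted counit of a product -/

theorem tw_assoc (X Y Z : L) : Γ.tw (Γ.tw X Y) Z = Γ.tw X (Γ.tw Y Z) := by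
  rw [tw_eq, tw_eq, tw_eq, tw_eq]
  refine Γ.sharp₀_assoc isMor_regMul isMor_regMul (regMulLin H) (regMulLin H)
    (fun X Y Z => ?_) X Y Z
  rw [regMulLin_ten, regMulLin_ten, regMulLin_ten, regMulLin_ten, mul_assoc]

theorem twPair_bal (A C : L) (b : B) (D E : L) :
    Γ.tw (A * H.tR b D) (Γ.tw E C) = Γ.tw (A * D) (Γ.tw (H.tL b E) C) := by
  rw [EnvRing.tR_apply, EnvRing.tL_apply, ← mul_assoc, ← tw_bal, ← tw_t_mul]

/-- `D ⊗ E ↦ Γ(A₁ D₁, F₁) A₂ D₂ F₂`, where `F = Γ(E₁, C₁) E₂ C₂`. -/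
def twPair (A C : L) : H.OpTensor →ₗ[k] L :=
  BalTensor.lift (f := H.tR) (g := H.tL)
    (Γ.tw.compl₁₂ (LinearMap.mulLeft k A) (Γ.tw.flip C)) (Γ.twPair_bal A C)

theorem twPair_omul (A C D E : L) :
    Γ.twPair A C (H.omul D E) = Γ.tw (A * D) (Γ.tw E C) :=
  BalTensor.lift_tmul (f := H.tR) (g := H.tL)
    (Γ.tw.compl₁₂ (LinearMap.mulLeft k A) (Γ.tw.flip C)) (Γ.twPair_bal A C) D E

/-- `(A ⊗ C, Y) ↦ Γ(A₁ Y₊₁, F₁) A₂ Y₊₂ F₂`, where `F = Γ(Y₋₁, C₁) Y₋₂ C₂`. -/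
noncomputable def twProdAux : H.OpTensor →ₗ[k] L →ₗ[k] L :=
  (((Γ.twCod (dual hH) (dual hH)).pair.compl₂ (opFlip H)).compr₂
    (Γ.twOp ∘ₗ opUnflip H ∘ₗ H.diamMap (dualMulLin hH) (dualMulLin_left hH))).flip

theorem twProdAux_apply (x : H.OpTensor) (Y : L) : Γ.twProdAux hH x Y
    = Γ.twOp (opUnflip H (H.diamMap (dualMulLin hH) (dualMulLin_left hH)
      ((Γ.twCod (dual hH) (dual hH)).pair Y (opFlip H x)))) := rfl

theorem twCod_dual_fst (A C : L) (y : H.OpTensor) :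
    Γ.twOp (opUnflip H (H.diamMap (dualMulLin hH) (dualMulLin_left hH)
      ((Γ.twCod (dual hH) (dual hH)).fst C A (opFlip H y)))) = Γ.twPair A C y := by
  induction y using BalTensor.ind with
  | tmul D E =>
    rw [opFlip_omul, Balanced.fst_dmul, EnvRing.diamMap_dmul, dualMulLin_ten, twPair_omul]
    exact (congrArg Γ.twOp (opUnflip_dmul (A * D) (Γ.tw E C))).trans (Γ.twOp_omul _ _)
  | add x y hx hy => simp only [map_add, hx, hy]

theorem twProdAux_omul (A C Y : L) :
    Γ.twProdAux hH (H.omul A C) Y = Γ.twPair A C (H.transl hH Y) := by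
  rw [twProdAux_apply, opFlip_omul, Balanced.pair_dmul]
  exact Γ.twCod_dual_fst hH A C (H.transl hH Y)

theorem twProdAux_transl (X Y : L) :
    Γ.twProdAux hH (H.transl hH X) Y = H.s (Γ.twCounit hH (Γ.prod hH X Y)) := by
  rw [← twOp_transl]
  refine congrArg Γ.twOp (Eq.trans ?_ (opUnflip_opFlip _))
  refine congrArg (opUnflip H) ?_
  rw [prod_eq]
  refine Eq.trans ?_ ((isMor_dualMul hH).coact (Γ.sharp₀ (dual hH) (dual hH) Y X)).symm
  rw [coact_sharp₀]
  rfl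

theorem twPair_mul_s (A C : L) (b : B) (y : H.OpTensor) : Γ.twPair (A * H.s b) C y
    = Γ.twPair A C (H.omap (H.sL b) LinearMap.id (H.sL_tR b) (fun _ _ => rfl) y) := by
  induction y using BalTensor.ind with
  | tmul D E =>
    rw [BalTensor.map_tmul, twPair_omul, twPair_omul, EnvRing.sL_apply, mul_assoc]; rfl
  | add x y hx hy => simp only [map_add, hx, hy]

theorem twProdAux_bal (b : B) (x : (opCom H).carrier) (Y : L) :
    Γ.twProdAux hH ((opCom H).right (op b) x) Y = Γ.twProdAux hH x (H.s b * Y) := by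
  induction x using BalTensor.ind with
  | tmul A C =>
    refine (congrArg (fun z => Γ.twProdAux hH z Y)
      (btRight_tmul _ _ isMor_tR _ _ A C)).trans ?_
    refine (Γ.twProdAux_omul hH (A * H.s b) C Y).trans ?_
    rw [twPair_mul_s, ← H.transl_s_mul]
    exact (Γ.twProdAux_omul hH A C _).symm
  | add x y hx hy =>
    rw [map_add, map_add, map_add, LinearMap.add_apply, LinearMap.add_apply, hx, hy]

/-- `(A ⊗ C) ⊗ Y ↦ Γ(A₁ Y₊₁, F₁) A₂ Y₊₂ F₂`, where `F = Γ(Y₋₁, C₁) Y₋₂ C₂`. -/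
noncomputable def twProd : ((opCom H).tensor (regular H)).carrier →ₗ[k] L :=
  tlift (M := opCom H) (N := regular H) (Γ.twProdAux hH) (Γ.twProdAux_bal hH)

theorem twProd_ten (x : H.OpTensor) (Y : L) :
    Γ.twProd hH ((opCom H).ten (regular H) x Y) = Γ.twProdAux hH x Y :=
  tlift_ten (M := opCom H) (N := regular H) (Γ.twProdAux hH) (Γ.twProdAux_bal hH) x Y

/-- `ε^Γ(X ·_Γ Y)`, computed from `X₊ ⊗ X₋` and `Y`. -/
theorem twProd_sharp₀_transl (X Y : L) :
    Γ.twProd hH (Γ.sharp₀ (opCom H) (regular H) (H.transl hH X) Y)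
      = H.s (Γ.twCounit hH (Γ.twMul hH X Y)) := by
  rw [twMul_eq]
  refine (Γ.sharp₀_natural (isMor_transl hH) isMor_id
    ((H.s ∘ₗ Γ.twCounit hH) ∘ₗ Γ.prodLin hH) (Γ.twProd hH) (fun X Y => ?_) X Y).symm
  refine Eq.trans ?_ (Γ.twProd_ten hH _ _).symm
  refine Eq.trans ?_ (Γ.twProdAux_transl hH X Y).symm
  exact congrArg (H.s ∘ₗ Γ.twCounit hH) (Γ.prodLin_ten hH X Y)

/-- `(A, D ⊗ E) ↦ Γ(A₁ D₁, F₁) A₂ D₂ F₂`, where `F = Γ(E₁, C₁) E₂ C₂`. -/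
def twPairAux (C : L) : L →ₗ[k] H.OpTensor →ₗ[k] L :=
  LinearMap.mk₂ k (fun A y => Γ.twPair A C y)
    (fun A A' y => BalTensor.hom_ext_apply (ψ := _ + _) (fun D E => by
      rw [LinearMap.add_apply, twPair_omul, twPair_omul, twPair_omul, add_mul, map_add,
        LinearMap.add_apply]) y)
    (fun c A y => BalTensor.hom_ext_apply (ψ := c • _) (fun D E => by
      rw [LinearMap.smul_apply, twPair_omul, twPair_omul, smul_mul_assoc, map_smul,
        LinearMap.smul_apply]) y)
    (fun A y y' => map_add _ y y') (fun c A y => map_smul _ c y)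

theorem twPairAux_bal (C : L) (b : B) (A : L) (y : (opCom H).carrier) :
    Γ.twPairAux C (A * H.s b) y = Γ.twPairAux C A ((opCom H).left b y) := by
  refine (Γ.twPair_mul_s A C b y).trans (congrArg (Γ.twPair A C) ?_)
  induction y using BalTensor.ind with
  | tmul D E => rw [BalTensor.map_tmul]; exact (btLeft_tmul _ _ isMor_tR _ _ D E).symm
  | add x y hx hy => simp only [map_add, hx, hy]

/-- `A ⊗ (D ⊗ E) ↦ Γ(A₁ D₁, F₁) A₂ D₂ F₂`, where `F = Γ(E₁, C₁) E₂ C₂`. -/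
def twPairLin (C : L) : ((regular H).tensor (opCom H)).carrier →ₗ[k] L :=
  tlift (M := regular H) (N := opCom H) (Γ.twPairAux C) (Γ.twPairAux_bal C)

theorem twPairLin_ten (C A : L) (y : H.OpTensor) :
    Γ.twPairLin C ((regular H).ten (opCom H) A y) = Γ.twPair A C y :=
  tlift_ten (M := regular H) (N := opCom H) (Γ.twPairAux C) (Γ.twPairAux_bal C) A y

theorem twPairLin_ten_omul (C E A D : L) :
    (Γ.tw.flip (Γ.tw E C) ∘ₗ regMulLin H) ((regular H).ten (regular H) A D)
      = Γ.twPairLin C ((regular H).ten (opCom H) A (H.omul D E)) := by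
  rw [twPairLin_ten, twPair_omul, LinearMap.comp_apply, regMulLin_ten, LinearMap.flip_apply]

theorem twPairLin_sharp₀ (C A : L) (y : H.OpTensor) :
    Γ.twPairLin C (Γ.sharp₀ (regular H) (opCom H) A y) = Γ.tw A (Γ.tw (Γ.twOp y) C) := by
  induction y using BalTensor.ind with
  | tmul D E =>
    have h := Γ.sharp₀_natural isMor_id (isMor_btIncl (regular H) H.tR isMor_tR H.tL E)
      (Γ.tw.flip (Γ.tw E C) ∘ₗ regMulLin H) (Γ.twPairLin C) (Γ.twPairLin_ten_omul C E) A D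
    rw [LinearMap.comp_apply, ← tw_eq, LinearMap.flip_apply, tw_assoc] at h
    rw [twOp_omul, tw_assoc]
    exact h.symm
  | add x y hx hy => simp only [map_add, LinearMap.add_apply, hx, hy]

/-- The sum that computes `ε^Γ(X ·_Γ Y)` for `X₊ ⊗ X₋ = A ⊗ C` involves `Y` only through
`ε^Γ(Y)`. -/
theorem twProd_sharp₀ (A C Y : L) :
    Γ.twProd hH (Γ.sharp₀ (opCom H) (regular H) (H.omul A C) Y)
      = Γ.tw A (Γ.tw (H.s (Γ.twCounit hH Y)) C) := by
  obtain ⟨j, hj⟩ := isMor_btIncl (regular H) H.tR isMor_tR H.tL C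
  have e : ∀ A : L, lin j A = H.omul A C := fun A => LinearMap.congr_fun hj A
  have h1 := Γ.sharp₀_tensorHom j (𝟙 (regular H)) A Y
  rw [lin_id] at h1
  refine (congrArg (fun x => Γ.twProd hH (Γ.sharp₀ (opCom H) (regular H) x Y)) (e A).symm).trans ?_
  rw [← h1, ← twOp_transl, ← twPairLin_sharp₀]
  refine Γ.sharp₀_natural isMor_id (isMor_transl hH)
    (Γ.twProd hH ∘ₗ lin (tensorHom j (𝟙 (regular H)))) (Γ.twPairLin C) (fun A Y => ?_) A Y
  rw [LinearMap.comp_apply, lin_tensorHom_ten, lin_id]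
  refine (Γ.twProd_ten hH _ Y).trans (Eq.trans ?_ (Γ.twPairLin_ten C A _).symm)
  exact (congrArg (fun x => Γ.twProdAux hH x Y) (e A)).trans (Γ.twProdAux_omul hH A C Y)

/-- The twisted counit of a product depends only on the counit of the second factor. -/
theorem twCounit_twMul_congr {Y Y' : L} (h : Γ.twCounit hH Y = Γ.twCounit hH Y') (X : L) :
    Γ.twCounit hH (Γ.twMul hH X Y) = Γ.twCounit hH (Γ.twMul hH X Y') := by
  have e : H.s (Γ.twCounit hH (Γ.twMul hH X Y)) = H.s (Γ.twCounit hH (Γ.twMul hH X Y')) := by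
    rw [← twProd_sharp₀_transl, ← twProd_sharp₀_transl]
    generalize H.transl hH X = x
    induction x using BalTensor.ind with
    | tmul A C => rw [twProd_sharp₀, twProd_sharp₀, h]
    | add x y hx hy =>
      refine (congrArg (Γ.twProd hH)
        (LinearMap.map_add₂ (Γ.sharp₀ (opCom H) (regular H)) x y Y)).trans ?_
      rw [map_add, hx, hy, ← map_add]
      exact congrArg (Γ.twProd hH)
        (LinearMap.map_add₂ (Γ.sharp₀ (opCom H) (regular H)) x y Y').symm
  simpa only [counit_s] using congrArg H.counit e

end LeftCocycle

end LeftBialgebroid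

namespace LeftBialgebroid

variable {k : Type v} {B L : Type u} [CommRing k] [Ring B] [Algebra k B] [Ring L] [Algebra k L]
  {H : LeftBialgebroid k B L}

open Comodule

namespace LeftCocycle

variable (Γ : H.LeftCocycle) (hH : H.IsLeftHopf) {M N Q : H.Comodule}

/-! ### Twisted actions over a copy of `B^Γ` and `L^Γ` -/

/-- `b ↦ (m ↦ b ·_Γ m)`. -/
def twLLin (M : H.Comodule) : B →ₗ[k] Module.End k M.carrier :=
  (Γ.sharp₀ (unit H) M ∘ₗ ofB H).compr₂ M.leftUnit

theorem twLLin_apply (b : B) (m : M.carrier) : Γ.twLLin M b m = Γ.twL M b m :=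
  Γ.leftUnit_sharp₀ b m

/-- `b ↦ (m ↦ m ·_Γ b)`. -/
def twRLin (M : H.Comodule) : B →ₗ[k] Module.End k M.carrier :=
  ((Γ.sharp₀ M (unit H)).compr₂ M.rightUnit).flip ∘ₗ ofB H

theorem twRLin_apply (b : B) (m : M.carrier) : Γ.twRLin M b m = Γ.twR M b m :=
  Γ.rightUnit_sharp₀ b m

/-- Naturality of `Γ^# : L^Γ ⋄_{B^Γ} M → L ⋄_B M` in the comodule `M`. -/
theorem diamMap_sharp₀ {φ : M.carrier →ₗ[k] N.carrier} (hφ : IsMor M N φ) (X : L)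
    (m : M.carrier) :
    H.diamMap φ hφ.left (Γ.sharp₀ (dual hH) M X m) = Γ.sharp₀ (dual hH) N X (φ m) := by
  let μ : ((dual hH).tensor M).carrier →ₗ[k] ((dual hH).tensor N).carrier := H.diamMap φ hφ.left
  have hμ : ∀ (X : (dual hH).carrier) (m : M.carrier),
      μ ((dual hH).ten M X m) = (dual hH).ten N X (φ m) :=
    fun X m => H.diamMap_dmul φ hφ.left X m
  exact Γ.sharp₀_natural (M := dual hH) (M' := dual hH) (N := M) (N' := N)
    (isMor_id (M := dual hH)) hφ μ LinearMap.id hμ X m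

/-- A `B^Γ ⊗ (B^Γ)ᵒᵖ`-ring whose underlying modules, products, source and target are identified with
those of the cotwist by `eB` and `eL`. -/
structure TwistedEnv (B' L' : Type u) [Ring B'] [Algebra k B'] [Ring L'] [Algebra k L'] where
  env : EnvRing k B' L'
  eB : B ≃ₗ[k] B'
  eL : L ≃ₗ[k] L'
  eB_mul : ∀ a b, eB a * eB b = eB (Γ.form (H.s a) (H.s b))
  eB_one : eB 1 = 1
  eL_mul : ∀ X Y, eL X * eL Y = eL (Γ.twMul hH X Y)
  eL_one : eL 1 = 1
  source_eB : ∀ b, env.s (eB b) = eL (H.s b)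
  target_eB : ∀ b, env.t (eB b) = eL (H.t b)

variable {Γ hH}

namespace TwistedEnv

variable {B' L' : Type u} [Ring B'] [Algebra k B'] [Ring L'] [Algebra k L']
  (T : Γ.TwistedEnv hH B' L')

theorem s_mul_eL (b : B) (X : L) :
    T.env.s (T.eB b) * T.eL X = T.eL (Γ.twL (regular H) b X) := by
  rw [source_eB, eL_mul, twMul_s_left]

theorem eL_mul_s (b : B) (X : L) :
    T.eL X * T.env.s (T.eB b) = T.eL (Γ.twR (regular H) b X) := by
  rw [source_eB, eL_mul, twMul_s_right]

theorem t_mul_eL (b : B) (X : L) :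
    T.env.t (T.eB b) * T.eL X = T.eL (Γ.twR (dual hH) b X) := by
  rw [target_eB, eL_mul, twMul_t_left]

theorem eL_mul_t (b : B) (X : L) :
    T.eL X * T.env.t (T.eB b) = T.eL (Γ.twL (dual hH) b X) := by
  rw [target_eB, eL_mul, twMul_t_right]

theorem eB_symm_mul (a b : B') : T.eB.symm (a * b)
    = Γ.form (H.s (T.eB.symm a)) (H.s (T.eB.symm b)) := by
  rw [LinearEquiv.symm_apply_eq, ← eB_mul, LinearEquiv.apply_symm_apply,
    LinearEquiv.apply_symm_apply]

theorem eB_symm_one : T.eB.symm 1 = 1 := by rw [LinearEquiv.symm_apply_eq, eB_one]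

/-- The left action of `B^Γ` on a comodule. -/
def left (M : H.Comodule) : B' →ₐ[k] Module.End k M.carrier :=
  AlgHom.ofLinearMap (Γ.twLLin M ∘ₗ T.eB.symm.toLinearMap)
    (LinearMap.ext fun m => (Γ.twLLin_apply _ m).trans (by
      rw [LinearEquiv.coe_coe, eB_symm_one, twL_one]; rfl))
    (fun a b => LinearMap.ext fun m => (Γ.twLLin_apply _ m).trans (by
      rw [LinearEquiv.coe_coe, eB_symm_mul, twL_form, ← twLLin_apply, ← twLLin_apply]; rfl))

theorem left_eB (b : B) (m : M.carrier) : T.left M (T.eB b) m = Γ.twL M b m :=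
  (Γ.twLLin_apply _ m).trans (by rw [LinearEquiv.coe_coe, LinearEquiv.symm_apply_apply])

/-- The right action of `B^Γ` on a comodule. -/
def right (M : H.Comodule) : B'ᵐᵒᵖ →ₐ[k] Module.End k M.carrier :=
  AlgHom.ofLinearMap (Γ.twRLin M ∘ₗ T.eB.symm.toLinearMap ∘ₗ (opLinearEquiv k).symm.toLinearMap)
    (LinearMap.ext fun m => (Γ.twRLin_apply _ m).trans (by
      change Γ.twR M (T.eB.symm 1) m = m
      rw [eB_symm_one, twR_one]))
    (fun a b => LinearMap.ext fun m => (Γ.twRLin_apply _ m).trans (by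
      change Γ.twR M (T.eB.symm (unop b * unop a)) m = Γ.twRLin M _ (Γ.twRLin M _ m)
      rw [eB_symm_mul, twR_form, ← twRLin_apply, ← twRLin_apply]; rfl))

theorem right_eB (b : B) (m : M.carrier) : T.right M (op (T.eB b)) m = Γ.twR M b m :=
  (Γ.twRLin_apply _ m).trans (by
    change Γ.twR M (T.eB.symm (T.eB b)) m = _
    rw [LinearEquiv.symm_apply_apply])

theorem left_natural {φ : M.carrier →ₗ[k] N.carrier} (hφ : IsMor M N φ) (b : B') (m : M.carrier) :
    φ (T.left M b m) = T.left N b (φ m) := by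
  obtain ⟨b, rfl⟩ := T.eB.surjective b
  rw [left_eB, left_eB, Γ.twL_natural hφ]

theorem right_natural {φ : M.carrier →ₗ[k] N.carrier} (hφ : IsMor M N φ) (b : B'ᵐᵒᵖ)
    (m : M.carrier) : φ (T.right M b m) = T.right N b (φ m) := by
  obtain ⟨b, rfl⟩ := opEquiv.surjective b
  obtain ⟨b, rfl⟩ := T.eB.surjective b
  exact (congrArg φ (T.right_eB b m)).trans ((Γ.twR_natural hφ b m).trans (T.right_eB b _).symm)

theorem right_left (a : B'ᵐᵒᵖ) (b : B') (m : M.carrier) :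
    T.right M a (T.left M b m) = T.left M b (T.right M a m) := by
  obtain ⟨a, rfl⟩ := opEquiv.surjective a
  obtain ⟨a, rfl⟩ := T.eB.surjective a
  obtain ⟨b, rfl⟩ := T.eB.surjective b
  change T.right M (op (T.eB a)) _ = T.left M _ (T.right M (op (T.eB a)) m)
  rw [left_eB, left_eB, right_eB, right_eB, twR_twL]

/-! ### The map `Γ^#` and the coaction -/

theorem diam_ind {V : Type*} [AddCommGroup V] [Module k V] {l : B' → Module.End k V}
    {p : T.env.Diam l → Prop} (dmul : ∀ X v, p (T.env.dmul l (T.eL X) v))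
    (add : ∀ x y, p x → p y → p (x + y)) (x : T.env.Diam l) : p x :=
  BalTensor.ind (fun x v => by simpa using dmul (T.eL.symm x) v) add x

theorem sharp₀_eL (b : B') (x : L') (m : M.carrier) :
    (Γ.sharp₀ (dual hH) M ∘ₗ T.eL.symm.toLinearMap) (T.env.tL b x) m
      = (Γ.sharp₀ (dual hH) M ∘ₗ T.eL.symm.toLinearMap) x (T.left M b m) := by
  obtain ⟨b, rfl⟩ := T.eB.surjective b
  obtain ⟨X, rfl⟩ := T.eL.surjective x
  rw [EnvRing.tL_apply, t_mul_eL, left_eB]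
  simp only [LinearMap.comp_apply, LinearEquiv.coe_coe, LinearEquiv.symm_apply_apply]
  exact Γ.sharp₀_bal (dual hH) M b X m

/-- The map `Γ^# : L^Γ ⋄_{B^Γ} M → L ⋄_B M`. -/
noncomputable def sh (M : H.Comodule) : T.env.Diam (T.left M) →ₗ[k] H.Diam M.left :=
  BalTensor.lift (f := T.env.tL) (g := T.left M)
    (Γ.sharp₀ (dual hH) M ∘ₗ T.eL.symm.toLinearMap) T.sharp₀_eL

theorem sh_dmul (X : L) (m : M.carrier) :
    T.sh M (T.env.dmul (T.left M) (T.eL X) m) = Γ.sharp₀ (dual hH) M X m :=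
  (BalTensor.lift_tmul (f := T.env.tL) (g := T.left M)
    (Γ.sharp₀ (dual hH) M ∘ₗ T.eL.symm.toLinearMap) T.sharp₀_eL (T.eL X) m).trans (by
      simp only [LinearMap.comp_apply, LinearEquiv.coe_coe, LinearEquiv.symm_apply_apply])

theorem dmul_eL (b : B) (X : L) (m : M.carrier) :
    (T.env.dmul (T.left M) ∘ₗ T.eL.toLinearMap) (Γ.twR (dual hH) b X) m
      = (T.env.dmul (T.left M) ∘ₗ T.eL.toLinearMap) X (Γ.twL M b m) := by
  rw [LinearMap.comp_apply, LinearMap.comp_apply, LinearEquiv.coe_coe, ← T.t_mul_eL,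
    ← T.left_eB, T.env.dmul_bal]

/-- The identification of `L^Γ ⋄_{B^Γ} M` with the underlying module of `twCofree`. -/
noncomputable def toDiam (M : H.Comodule) :
    (Γ.twCofree hH M).carrier →ₗ[k] T.env.Diam (T.left M) :=
  BalTensor.lift (f := Γ.twR (dual hH)) (g := Γ.twL M)
    (T.env.dmul (T.left M) ∘ₗ T.eL.toLinearMap) T.dmul_eL

theorem toDiam_gmul (X : L) (m : M.carrier) :
    T.toDiam M (Γ.gmul hH M X m) = T.env.dmul (T.left M) (T.eL X) m :=
  BalTensor.lift_tmul (f := Γ.twR (dual hH)) (g := Γ.twL M)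
    (T.env.dmul (T.left M) ∘ₗ T.eL.toLinearMap) T.dmul_eL X m

theorem sh_toDiam (x : (Γ.twCofree hH M).carrier) :
    T.sh M (T.toDiam M x) = Γ.sharpCofree hH M x := by
  induction x using gmul_ind with
  | gmul X m => rw [toDiam_gmul, sh_dmul, sharpCofree_gmul]
  | add x y hx hy => rw [map_add, map_add, hx, hy]; exact (map_add _ x y).symm

theorem toDiam_surjective : Function.Surjective (T.toDiam M) := fun u => by
  induction u using T.diam_ind with
  | dmul X m => exact ⟨_, T.toDiam_gmul X m⟩
  | add x y hx hy =>
    obtain ⟨x, rfl⟩ := hx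
    obtain ⟨y, rfl⟩ := hy
    exact ⟨x + y, map_add _ x y⟩

/-- Composed with the identification `toDiam`, the map `Γ^#` is `sharpCofree`. -/
theorem sh_bijective (hΓ : Γ.IsInvertible) (M : H.Comodule) : Function.Bijective (T.sh M) := by
  refine ⟨fun u v h => ?_, fun w => ?_⟩
  · obtain ⟨x, rfl⟩ := T.toDiam_surjective u
    obtain ⟨y, rfl⟩ := T.toDiam_surjective v
    rw [sh_toDiam, sh_toDiam] at h
    rw [(Γ.sharpCofree_bijective hH hΓ M).1 h]
  · obtain ⟨x, rfl⟩ := (Γ.sharpCofree_bijective hH hΓ M).2 w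
    exact ⟨_, T.sh_toDiam x⟩

/-- The coaction `Γ^#⁻¹ ∘ δ` of the cotwist. -/
noncomputable def coact (hΓ : Γ.IsInvertible) (M : H.Comodule) :
    M.carrier →ₗ[k] T.env.Diam (T.left M) := T.toDiam M ∘ₗ Γ.twCoact hH hΓ M

theorem sh_coact (hΓ : Γ.IsInvertible) (m : M.carrier) :
    T.sh M (T.coact hΓ M m) = M.coact m :=
  (T.sh_toDiam _).trans (Γ.sharpCofree_twCoact hH hΓ m)

theorem sh_diamMap {φ : M.carrier →ₗ[k] N.carrier} (hφ : IsMor M N φ)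
    (u : T.env.Diam (T.left M)) :
    T.sh N (T.env.diamMap φ (T.left_natural hφ) u) = H.diamMap φ hφ.left (T.sh M u) := by
  induction u using T.diam_ind with
  | dmul X m =>
    rw [EnvRing.diamMap_dmul, sh_dmul, sh_dmul]
    exact (Γ.diamMap_sharp₀ hH hφ X m).symm
  | add x y hx hy => simp only [map_add, hx, hy]

theorem coact_natural (hΓ : Γ.IsInvertible) {φ : M.carrier →ₗ[k] N.carrier} (hφ : IsMor M N φ)
    (m : M.carrier) :
    T.coact hΓ N (φ m) = T.env.diamMap φ (T.left_natural hφ) (T.coact hΓ M m) :=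
  (T.sh_bijective hΓ N).1 (by rw [T.sh_diamMap hφ, sh_coact, sh_coact, hφ.coact])

theorem sh_diamSL (b : B) (u : T.env.Diam (T.left M)) :
    T.sh M (T.env.diamSL (T.left M) (T.eB b) u) = Γ.twL (cofree H M.left) b (T.sh M u) := by
  induction u using T.diam_ind with
  | dmul X m =>
    rw [EnvRing.diamSL_dmul, s_mul_eL, sh_dmul, sh_dmul]
    exact Γ.twL_natural (Γ.isMor_sharpReg hH m) b X
  | add x y hx hy => simp only [map_add, hx, hy]

theorem sh_diamSR (b : B) (u : T.env.Diam (T.left M)) :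
    T.sh M (T.env.diamSR (T.left M) (T.eB b) u) = Γ.twR (cofree H M.left) b (T.sh M u) := by
  induction u using T.diam_ind with
  | dmul X m =>
    rw [EnvRing.diamSR_dmul, eL_mul_s, sh_dmul, sh_dmul]
    exact Γ.twR_natural (Γ.isMor_sharpReg hH m) b X
  | add x y hx hy => simp only [map_add, hx, hy]

/-- `sh`, with values in `dual ⊗_B M`, which has the same underlying module as `L ⋄_B M`. -/
noncomputable def shDual (M : H.Comodule) :
    T.env.Diam (T.left M) →ₗ[k] ((dual hH).tensor M).carrier := T.sh M

theorem shDual_dmul (X : L) (m : M.carrier) :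
    T.shDual M (T.env.dmul (T.left M) (T.eL X) m) = Γ.sharp₀ (dual hH) M X m := T.sh_dmul X m

theorem shDual_coact (hΓ : Γ.IsInvertible) (m : M.carrier) :
    T.shDual M (T.coact hΓ M m) = M.coact m := T.sh_coact hΓ m

theorem sh_diamTR (b : B) (u : T.env.Diam (T.left M)) :
    T.shDual M (T.env.diamTR (T.left M) (T.eB b) u)
      = Γ.twL ((dual hH).tensor M) b (T.shDual M u) := by
  induction u using T.diam_ind with
  | dmul X m =>
    rw [EnvRing.diamTR_dmul, eL_mul_t, shDual_dmul, shDual_dmul]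
    exact Γ.sharp₀_twL (M := dual hH) (N := M) b X m
  | add x y hx hy => simp only [map_add, hx, hy]

theorem sh_right (b : B) (u : T.env.Diam (T.left M)) :
    T.shDual M (T.env.diamMap (T.right M (op (T.eB b))) (T.right_left _) u)
      = Γ.twR ((dual hH).tensor M) b (T.shDual M u) := by
  induction u using T.diam_ind with
  | dmul X m =>
    rw [EnvRing.diamMap_dmul, right_eB, shDual_dmul, shDual_dmul]
    exact Γ.sharp₀_twR (M := dual hH) (N := M) b X m
  | add x y hx hy => simp only [map_add, hx, hy]

theorem coact_left (hΓ : Γ.IsInvertible) (b : B') (m : M.carrier) :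
    T.coact hΓ M (T.left M b m) = T.env.diamSL (T.left M) b (T.coact hΓ M m) := by
  obtain ⟨b, rfl⟩ := T.eB.surjective b
  refine (T.sh_bijective hΓ M).1 ?_
  rw [sh_diamSL, sh_coact, sh_coact, left_eB]
  exact Γ.twL_natural (isMor_coact M) b m

theorem coact_right (hΓ : Γ.IsInvertible) (b : B') (m : M.carrier) :
    T.coact hΓ M (T.right M (op b) m) = T.env.diamSR (T.left M) b (T.coact hΓ M m) := by
  obtain ⟨b, rfl⟩ := T.eB.surjective b
  refine (T.sh_bijective hΓ M).1 ?_
  rw [sh_diamSR, sh_coact, sh_coact, right_eB]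
  exact Γ.twR_natural (isMor_coact M) b m

theorem coact_takeuchi (hΓ : Γ.IsInvertible) (b : B') (m : M.carrier) :
    T.env.diamTR (T.left M) b (T.coact hΓ M m)
      = T.env.diamMap (T.right M (op b)) (T.right_left (op b)) (T.coact hΓ M m) := by
  -- On the central coinvariant element `δ(m)` of `dual ⊗ M` both twisted actions of `b` are the
  -- untwisted one.
  obtain ⟨b, rfl⟩ := T.eB.surjective b
  refine (T.sh_bijective hΓ M).1 ?_
  change T.shDual M _ = T.shDual M _
  rw [sh_diamTR, sh_right, shDual_coact]
  exact (Γ.twL_central_one (isCentral_coact hH m) b).trans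
    (Γ.twR_central_one (isCentral_coact hH m) b).symm

end TwistedEnv

end LeftCocycle

end LeftBialgebroid

namespace LeftBialgebroid

variable {k : Type v} {B L : Type u} [CommRing k] [Ring B] [Algebra k B] [Ring L] [Algebra k L]
  {H : LeftBialgebroid k B L}

open Comodule

namespace LeftCocycle

variable {Γ : H.LeftCocycle} {hH : H.IsLeftHopf} {M N Q : H.Comodule}

namespace TwistedEnv

variable {B' L' : Type u} [Ring B'] [Algebra k B'] [Ring L'] [Algebra k L']
  (T : Γ.TwistedEnv hH B' L')

/-! ### The coproduct of the cotwist -/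

theorem eL_left (b : B') (X : (regular H).carrier) :
    T.eL.toLinearMap (T.left (regular H) b X) = T.env.sL b (T.eL.toLinearMap X) := by
  obtain ⟨b, rfl⟩ := T.eB.surjective b
  rw [left_eB]
  exact (T.s_mul_eL b X).symm

theorem eL_right (b : B') (X : (regular H).carrier) :
    T.eL.toLinearMap (T.right (regular H) (op b) X) = T.env.sR b (T.eL.toLinearMap X) := by
  obtain ⟨b, rfl⟩ := T.eB.surjective b
  rw [right_eB]
  exact (T.eL_mul_s b X).symm

theorem eL_symm_left (b : B') (x : L') :
    T.eL.symm.toLinearMap (T.env.sL b x) = T.left (regular H) b (T.eL.symm.toLinearMap x) := by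
  obtain ⟨X, rfl⟩ := T.eL.surjective x
  refine (LinearEquiv.symm_apply_eq _).2 ?_
  exact ((T.eL_left b _).trans (congrArg (T.env.sL b) (T.eL.apply_symm_apply _))).symm

/-- The coproduct of the cotwist. -/
noncomputable def comul (hΓ : Γ.IsInvertible) : L' →ₗ[k] T.env.Diam T.env.sL :=
  T.env.diamMap T.eL.toLinearMap T.eL_left ∘ₗ T.coact hΓ (regular H) ∘ₗ T.eL.symm.toLinearMap

variable (hΓ : Γ.IsInvertible)

theorem comul_eL (X : L) : T.comul hΓ (T.eL X)
    = T.env.diamMap T.eL.toLinearMap T.eL_left (T.coact hΓ (regular H) X) := by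
  rw [comul, LinearMap.comp_apply, LinearMap.comp_apply, LinearEquiv.coe_coe,
    LinearEquiv.symm_apply_apply]

theorem comul_source (b : B') (x : L') :
    T.comul hΓ (T.env.s b * x) = T.env.diamSL T.env.sL b (T.comul hΓ x) := by
  obtain ⟨X, rfl⟩ := T.eL.surjective x
  rw [← EnvRing.sL_apply]
  refine (congrArg (T.comul hΓ) (T.eL_left b X).symm).trans ?_
  refine (T.comul_eL hΓ _).trans ?_
  rw [T.coact_left, EnvRing.diamMap_diamSL, comul_eL]

theorem comul_target (b : B') (x : L') :
    T.comul hΓ (T.env.t b * x) = T.env.diamMap (T.env.tL b) (T.env.tL_sL b) (T.comul hΓ x) := by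
  obtain ⟨X, rfl⟩ := T.eL.surjective x
  obtain ⟨b, rfl⟩ := T.eB.surjective b
  rw [t_mul_eL, comul_eL, comul_eL, T.coact_natural hΓ (Γ.isMor_twR_dual hH b)]
  exact T.env.diamMap_comm (fun X => (T.t_mul_eL b X).symm) _

theorem comul_takeuchi (b : B') (x : L') :
    T.env.diamTR T.env.sL b (T.comul hΓ x)
      = T.env.diamMap (T.env.sR b) (T.env.sR_sL b) (T.comul hΓ x) := by
  obtain ⟨X, rfl⟩ := T.eL.surjective x
  rw [comul_eL, ← EnvRing.diamMap_diamTR, coact_takeuchi]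
  exact T.env.diamMap_comm (fun X => T.eL_right b X) _

/-- The map `Γ^#` for the regular comodule, on `L^Γ ⋄_{B^Γ} L^Γ`. -/
noncomputable def shReg : T.env.Diam T.env.sL →ₗ[k] H.Diam H.sL :=
  T.sh (regular H) ∘ₗ T.env.diamMap T.eL.symm.toLinearMap T.eL_symm_left

theorem shReg_dmul (X Y : L) : T.shReg (T.env.dmul T.env.sL (T.eL X) (T.eL Y))
    = Γ.sharp₀ (dual hH) (regular H) X Y := by
  refine (congrArg (T.sh (regular H))
    (T.env.diamMap_dmul T.eL.symm.toLinearMap T.eL_symm_left (T.eL X) (T.eL Y))).trans ?_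
  rw [LinearEquiv.coe_coe, LinearEquiv.symm_apply_apply, sh_dmul]

theorem shReg_diamMap (u : T.env.Diam (T.left (regular H))) :
    T.shReg (T.env.diamMap T.eL.toLinearMap T.eL_left u) = T.sh (regular H) u :=
  congrArg (T.sh (regular H)) (T.env.diamMap_leftInverse (fun X => T.eL.symm_apply_apply X) u)

theorem shReg_injective (hΓ : Γ.IsInvertible) : Function.Injective T.shReg := by
  refine (T.sh_bijective hΓ (regular H)).1.comp ?_
  exact Function.LeftInverse.injective
    (g := T.env.diamMap T.eL.toLinearMap T.eL_left)
    (fun u => T.env.diamMap_leftInverse (fun x => T.eL.apply_symm_apply x) u)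

theorem shReg_comul (X : L) : T.shReg (T.comul hΓ (T.eL X)) = H.comul X := by
  rw [comul_eL, shReg_diamMap]
  exact T.sh_coact hΓ (M := regular H) X

/-! ### Coassociativity -/

theorem sh_left (b : B') (u : T.env.Diam (T.left M)) :
    T.sh M (T.env.diamSL (T.left M) b u) = T.left (cofree H M.left) b (T.sh M u) := by
  obtain ⟨b, rfl⟩ := T.eB.surjective b
  rw [sh_diamSL]
  exact (T.left_eB (M := cofree H M.left) b (T.sh M u)).symm

/-- The map `Γ^# ∘ (id ⋄ Γ^#) : L^Γ ⋄ (L^Γ ⋄ M) → L ⋄ (L ⋄ M)`. -/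
noncomputable def sh₂ (M : H.Comodule) :
    T.env.Diam (T.env.diamSL (T.left M)) →ₗ[k] H.Diam (cofree H M.left).left :=
  T.sh (cofree H M.left) ∘ₗ T.env.diamMap (T.sh M) T.sh_left

theorem sh₂_injective (hΓ : Γ.IsInvertible) : Function.Injective (T.sh₂ M) := by
  refine (T.sh_bijective hΓ (cofree H M.left)).1.comp ?_
  let e := LinearEquiv.ofBijective (T.sh M) (T.sh_bijective hΓ M)
  have he : ∀ b u, e.symm.toLinearMap (T.left (cofree H M.left) b u)
      = T.env.diamSL (T.left M) b (e.symm.toLinearMap u) := fun b u => by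
    refine (LinearEquiv.symm_apply_eq _).2 ?_
    exact ((T.sh_left b _).trans (congrArg (T.left (cofree H M.left) b)
      (e.apply_symm_apply u))).symm
  exact Function.LeftInverse.injective (g := T.env.diamMap e.symm.toLinearMap he)
    (fun u => T.env.diamMap_leftInverse (fun x => e.symm_apply_apply x) u)

theorem sh₂_coact (m : M.carrier) :
    T.sh₂ M (T.env.diamMap (T.coact hΓ M) (T.coact_left hΓ) (T.coact hΓ M m))
      = (cofree H M.left).coact (M.coact m) := by
  refine (congrArg (T.sh (cofree H M.left)) (T.env.diamMap_diamMap (T.coact hΓ M)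
    (T.coact_left hΓ) (T.sh M) T.sh_left M.coact (T.left_natural (isMor_coact M))
    (fun m => T.sh_coact hΓ m) _)).trans ?_
  rw [T.sh_diamMap (isMor_coact M), sh_coact]
  exact ((isMor_coact M).coact m).symm

theorem sharpReg_left (m : M.carrier) (b : B') (X : (regular H).carrier) :
    Γ.sharpReg hH m (T.left (regular H) b X)
      = T.left (cofree H M.left) b (Γ.sharpReg hH m X) :=
  T.left_natural (Γ.isMor_sharpReg hH m) b X

theorem sh₂_diamInsert (m : M.carrier) (u : T.env.Diam (T.left (regular H))) :
    T.sh₂ M (T.env.diamInsert (T.left M) m (T.env.diamMap T.eL.toLinearMap T.eL_left u))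
      = T.sh (cofree H M.left) (T.env.diamMap (Γ.sharpReg hH m) (T.sharpReg_left m) u) := by
  refine congrArg (T.sh (cofree H M.left)) ?_
  induction u using T.diam_ind with
  | dmul X Y =>
    rw [EnvRing.diamMap_dmul, EnvRing.diamInsert_dmul, EnvRing.diamMap_dmul, EnvRing.diamMap_dmul]
    exact congrArg (T.env.dmul (T.left (cofree H M.left)) (T.eL X)) (T.sh_dmul Y m)
  | add x y hx hy => simp only [map_add, hx, hy]

theorem sh₂_comulDiam (u : T.env.Diam (T.left M)) :
    T.sh₂ M (T.env.comulDiam (T.comul hΓ) (T.comul_target hΓ) (T.left M) u)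
      = (cofree H M.left).coact (T.sh M u) := by
  induction u using T.diam_ind with
  | dmul X m =>
    rw [EnvRing.comulDiam_dmul, comul_eL, sh₂_diamInsert, T.sh_diamMap (Γ.isMor_sharpReg hH m),
      sh_dmul]
    refine (congrArg _ (T.sh_coact hΓ (M := regular H) X)).trans ?_
    exact ((Γ.isMor_sharpReg hH m).coact X).symm
  | add x y hx hy =>
    simp only [map_add, hx, hy]

/-- The twisted coaction is coassociative. -/
theorem coact_coassoc (m : M.carrier) :
    T.env.diamMap (T.coact hΓ M) (T.coact_left hΓ) (T.coact hΓ M m)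
      = T.env.comulDiam (T.comul hΓ) (T.comul_target hΓ) (T.left M) (T.coact hΓ M m) :=
  T.sh₂_injective hΓ (by rw [sh₂_coact, sh₂_comulDiam, sh_coact])

theorem comul_sL (b : B') (x : L') :
    T.comul hΓ (T.env.sL b x) = T.env.diamSL T.env.sL b (T.comul hΓ x) := by
  rw [EnvRing.sL_apply, comul_source]

theorem comul_coassoc (x : L') :
    T.env.diamMap (T.comul hΓ) (T.comul_sL hΓ) (T.comul hΓ x)
      = T.env.comulDiam (T.comul hΓ) (T.comul_target hΓ) T.env.sL (T.comul hΓ x) := by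
  obtain ⟨X, rfl⟩ := T.eL.surjective x
  rw [comul_eL]
  refine Eq.trans ?_ (T.env.comulDiam_diamMap (T.comul hΓ) (T.comul_target hΓ) T.eL.toLinearMap
    T.eL_left (T.coact hΓ (regular H) X)).symm
  refine Eq.trans ?_ (congrArg (T.env.diamMap (T.env.diamMap T.eL.toLinearMap T.eL_left)
    (T.env.diamMap_diamSL T.eL.toLinearMap T.eL_left))
    (T.coact_coassoc hΓ (M := regular H) X))
  exact T.env.diamMap_comm (fun X => T.comul_eL hΓ X) _

/-! ### The counit of the cotwist -/

/-- The counit of the cotwist. -/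
noncomputable def counit : L' →ₗ[k] B' :=
  T.eB.toLinearMap ∘ₗ Γ.twCounit hH ∘ₗ T.eL.symm.toLinearMap

theorem counit_eL (X : L) : T.counit (T.eL X) = T.eB (Γ.twCounit hH X) := by
  rw [counit, LinearMap.comp_apply, LinearMap.comp_apply, LinearEquiv.coe_coe, LinearEquiv.coe_coe,
    LinearEquiv.symm_apply_apply]

theorem counit_source (b : B') (x : L') : T.counit (T.env.s b * x) = b * T.counit x := by
  obtain ⟨X, rfl⟩ := T.eL.surjective x
  obtain ⟨b, rfl⟩ := T.eB.surjective b
  rw [s_mul_eL, counit_eL, counit_eL, eB_mul, Γ.twCounit_twL]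

theorem counit_target (b : B') (x : L') : T.counit (T.env.t b * x) = T.counit x * b := by
  obtain ⟨X, rfl⟩ := T.eL.surjective x
  obtain ⟨b, rfl⟩ := T.eB.surjective b
  rw [t_mul_eL, counit_eL, counit_eL, eB_mul, Γ.twCounit_twR_dual]

theorem counitDiam_toDiam (x : (Γ.twCofree hH M).carrier) :
    T.env.counitDiam T.counit T.counit_target (T.left M) (T.toDiam M x)
      = Γ.twCounitDiam hH M x := by
  induction x using gmul_ind with
  | gmul X m =>
    rw [toDiam_gmul, EnvRing.counitDiam_dmul, counit_eL, left_eB, twCounitDiam_gmul]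
  | add x y hx hy =>
    exact (congrArg _ (map_add (T.toDiam M) x y)).trans ((map_add _ _ _).trans
      ((congrArg₂ _ hx hy).trans (map_add (Γ.twCounitDiam hH M) x y).symm))

/-- The twisted coaction is counital. -/
theorem counit_coact (m : M.carrier) :
    T.env.counitDiam T.counit T.counit_target (T.left M) (T.coact hΓ M m) = m :=
  (T.counitDiam_toDiam _).trans (Γ.twCounitDiam_twCoact hH hΓ m)

theorem counit_comul (x : L') :
    T.env.counitDiam T.counit T.counit_target T.env.sL (T.comul hΓ x) = x := by
  obtain ⟨X, rfl⟩ := T.eL.surjective x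
  rw [comul_eL, EnvRing.counitDiam_diamMap]
  exact congrArg T.eL (T.counit_coact hΓ (M := regular H) X)

theorem counit_one : T.counit 1 = 1 := by
  rw [← T.eL_one, counit_eL, ← H.s_one, twCounit_s, eB_one]

theorem counit_mul_source (x y : L') :
    T.counit (x * T.env.s (T.counit y)) = T.counit (x * y) := by
  obtain ⟨X, rfl⟩ := T.eL.surjective x
  obtain ⟨Y, rfl⟩ := T.eL.surjective y
  rw [counit_eL, source_eB, eL_mul, eL_mul, counit_eL, counit_eL,
    Γ.twCounit_twMul_congr hH (Γ.twCounit_s hH _)]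

theorem counit_mul_target (x y : L') :
    T.counit (x * T.env.t (T.counit y)) = T.counit (x * y) := by
  obtain ⟨X, rfl⟩ := T.eL.surjective x
  obtain ⟨Y, rfl⟩ := T.eL.surjective y
  rw [counit_eL, target_eB, eL_mul, eL_mul, counit_eL, counit_eL,
    Γ.twCounit_twMul_congr hH (Γ.twCounit_t hH _)]

end TwistedEnv

end LeftCocycle

end LeftBialgebroid

namespace EnvRing

variable {k : Type v} {B L : Type u} [CommRing k] [Ring B] [Algebra k B] [Ring L] [Algebra k L]
  (R : EnvRing k B L) {M N : Type*} [AddCommGroup M] [Module k M] [AddCommGroup N] [Module k N]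

theorem counitDiam_diamSL (ε : L →ₗ[k] B) (hs : ∀ b X, ε (R.s b * X) = b * ε X)
    (ht : ∀ b X, ε (R.t b * X) = ε X * b) (l : B →ₐ[k] Module.End k M) (b : B) (u : R.Diam l) :
    R.counitDiam ε ht l (R.diamSL l b u) = l b (R.counitDiam ε ht l u) :=
  BalTensor.hom_ext_apply (φ := R.counitDiam ε ht l ∘ₗ R.diamSL l b)
    (ψ := l b ∘ₗ R.counitDiam ε ht l) (fun X m => by simp [hs]) u

theorem counitRight_dmul (ε : L →ₗ[k] B) (hs : ∀ b X, ε (R.s b * X) = b * ε X) (X Y : L) :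
    R.counitRight ε hs (R.dmul R.sL X Y) = R.t (ε Y) * X :=
  BalTensor.lift_tmul (f := R.tL) (g := R.sL) (LinearMap.flip _) _ X Y

/-- `(id ⋄ ε ⋄ id) (u ⋄ m) = (id ⋄ ε) (u) ⋄ m`. -/
theorem diamMap_counitDiam_diamInsert (ε : L →ₗ[k] B) (hs : ∀ b X, ε (R.s b * X) = b * ε X)
    (ht : ∀ b X, ε (R.t b * X) = ε X * b) (l : B →ₐ[k] Module.End k M) (m : M)
    (u : R.Diam R.sL) :
    R.diamMap (R.counitDiam ε ht l) (R.counitDiam_diamSL ε hs ht l) (R.diamInsert l m u)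
      = R.dmul l (R.counitRight ε hs u) m :=
  BalTensor.hom_ext_apply (φ := R.diamMap (R.counitDiam ε ht l) (R.counitDiam_diamSL ε hs ht l)
      ∘ₗ R.diamInsert l m) (ψ := (R.dmul l).flip m ∘ₗ R.counitRight ε hs)
    (fun X Y => by
      rw [LinearMap.comp_apply, LinearMap.comp_apply, diamInsert_dmul, diamMap_dmul,
        counitDiam_dmul, counitRight_dmul, LinearMap.flip_apply, dmul_bal]) u

end EnvRing

namespace LeftBialgebroid

variable {k : Type v} {B L : Type u} [CommRing k] [Ring B] [Algebra k B] [Ring L] [Algebra k L]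
  {H : LeftBialgebroid k B L}

open Comodule

theorem diamMulRight_eq (Y : L) (u : H.Diam H.sL) :
    H.diamMulRight u Y = H.diamMap (LinearMap.mulRight k Y) (H.mulRight_sL Y) u := rfl

namespace LeftCocycle

variable {Γ : H.LeftCocycle} {hH : H.IsLeftHopf} {M N Q : H.Comodule}

/-! ### The coproduct of a twisted product -/

/-- `sharpProd`, followed by the product `X₊ Y₊ Γ(Y₋, X₋)‾` of the second factors, computes
`Γ^#((X ·_Γ Y) ⋄ (X' ·_Γ Y'))`. -/
theorem diamMap_prodLin_sharpProd (X X' Y Y' : L) :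
    H.diamMap (Γ.prodLin hH) (Γ.isMor_prodLin hH).left
        (Γ.sharpProd hH (regular H) (N := regular H) Y' (Γ.sharp₀ (Γ.twCofree hH (regular H))
          (regular H) (Γ.gmul hH (regular H) X X') Y))
      = Γ.sharp₀ (dual hH) (regular H) (Γ.twMul hH X Y) (Γ.twMul hH X' Y') := by
  rw [sharpProd_sharp₀, Γ.diamMap_sharp₀ hH (Γ.isMor_prodLin hH), ← Γ.twMul_eq hH X' Y']

/-- The coproduct of `X ·_Γ Y`, in terms of representatives of the twisted coproducts of `X`
and `Y`. -/
theorem comul_twMul (hΓ : Γ.IsInvertible) {ι κ : Type*} (S : Finset ι) (U : Finset κ)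
    (f f' : ι → L) (g g' : κ → L) {X Y : L}
    (hX : ∑ i ∈ S, Γ.sharp₀ (dual hH) (regular H) (f i) (f' i) = H.comul X)
    (hY : ∑ j ∈ U, Γ.sharp₀ (dual hH) (regular H) (g j) (g' j) = H.comul Y) :
    H.comul (Γ.twMul hH X Y) = ∑ i ∈ S, ∑ j ∈ U,
      Γ.sharp₀ (dual hH) (regular H) (Γ.twMul hH (f i) (g j)) (Γ.twMul hH (f' i) (g' j)) := by
  have hX' : Γ.twCoact hH hΓ (regular H) X = ∑ i ∈ S, Γ.gmul hH (regular H) (f i) (f' i) := by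
    refine (Γ.sharpCofree_bijective hH hΓ (regular H)).1 ?_
    refine (Γ.sharpCofree_twCoact hH hΓ (M := regular H) X).trans (hX.symm.trans ?_)
    refine Eq.trans ?_ (map_sum (Γ.sharpCofree hH (regular H)) _ _).symm
    exact Finset.sum_congr rfl fun i _ => (Γ.sharpCofree_gmul hH (M := regular H) _ _).symm
  have h1 : ∀ j, ∑ i ∈ S, Γ.sharp₀ (dual hH) (regular H) (Γ.twMul hH (f i) (g j))
      (Γ.twMul hH (f' i) (g' j))
      = H.diamMap (Γ.prodLin hH) (Γ.isMor_prodLin hH).left (codLin (regular H) (regular H)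
          (Γ.sharp₀ (regular H) (cofree H (regular H).left) X
            (Γ.sharp₀ (dual hH) (regular H) (g j) (g' j)))) := fun j => by
    have h := Γ.sharpProd_twCoact hH hΓ (M := regular H) (N := regular H) X (g' j) (g j)
    rw [← h, hX', map_sum, LinearMap.sum_apply, map_sum, map_sum]
    exact Finset.sum_congr rfl fun i _ => (diamMap_prodLin_sharpProd _ _ _ _).symm
  rw [Finset.sum_comm, Finset.sum_congr rfl fun j _ => h1 j]
  have h2 := Γ.codLin_coact (M := regular H) (N := regular H) X Y
  have h3 := (Γ.isMor_prodLin hH).coact (Γ.sharp₀ (regular H) (regular H) X Y)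
  rw [← h2, ← twMul_eq] at h3
  have h4 : (regular H).coact Y = ∑ j ∈ U, Γ.sharpReg hH (N := regular H) (g' j) (g j) := hY.symm
  let F : (cofree H (regular H).left).carrier →ₗ[k] H.Diam (regular H).left :=
    H.diamMap (Γ.prodLin hH) (Γ.isMor_prodLin hH).left ∘ₗ codLin (regular H) (regular H)
      ∘ₗ Γ.sharp₀ (regular H) (cofree H (regular H).left) X
  exact h3.trans ((congrArg F h4).trans (map_sum F _ _))

/-! ### The Galois map of the cotwist -/

/-- `(w ⋄ v) ⊗ y ↦ w ⋄ v₊ y₊ Γ(y₋, v₋)‾`. -/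
noncomputable def dualProd (hH : H.IsLeftHopf) (Γ : H.LeftCocycle) :
    (((dual hH).tensor (regular H)).tensor (regular H)).carrier →ₗ[k] H.Diam H.sL :=
  lin (tensorHom (𝟙 (dual hH)) (Γ.isMor_prodLin hH).choose)
    ∘ₗ (dual hH).assocLin (regular H) (regular H)

theorem dualProd_ten (w : L) (v y : L) :
    dualProd hH Γ (((dual hH).tensor (regular H)).ten (regular H)
      ((dual hH).ten (regular H) w v) y) = (dual hH).ten (regular H) w (Γ.prod hH v y) := by
  refine (congrArg (lin (tensorHom (𝟙 (dual hH)) (Γ.isMor_prodLin hH).choose))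
    ((dual hH).assocLin_ten (regular H) (regular H) w v y)).trans ?_
  rw [lin_tensorHom_ten, (Γ.isMor_prodLin hH).choose_spec]
  exact congrArg ((dual hH).ten (regular H) w) (Γ.prodLin_ten hH v y)

theorem dualProd_sharp₀ (X Z Y : L) :
    dualProd hH Γ (Γ.sharp₀ ((dual hH).tensor (regular H)) (regular H)
      (Γ.sharp₀ (dual hH) (regular H) X Z) Y)
      = Γ.sharp₀ (dual hH) (regular H) X (Γ.twMul hH Z Y) := by
  rw [twMul_eq]
  exact Γ.sharp₀_assoc (isMor_id (M := (dual hH).tensor (regular H))) (Γ.isMor_prodLin hH)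
    (dualProd hH Γ) LinearMap.id (fun w v y => (dualProd_ten w v y).trans
      (congrArg ((dual hH).ten (regular H) w) (Γ.prodLin_ten hH v y).symm)) X Z Y

/-- The twisting map is trivial on `Δ(X)`, a central coinvariant element of `dual ⊗ regular`. -/
theorem dualProd_comul (X Y : L) :
    dualProd hH Γ (Γ.sharp₀ ((dual hH).tensor (regular H)) (regular H) (H.comul X) Y)
      = H.diamMap ((Γ.prod hH).flip Y) (Γ.prod_flip_sL hH Y) (H.comul X) := by
  refine (congrArg (dualProd hH Γ) (Γ.sharp₀_central_left_one
    (isCentral_coact hH (M := regular H) X) (M := regular H) Y)).trans ?_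
  generalize H.comul X = w
  induction w using BalTensor.ind with
  | tmul A C =>
    exact (dualProd_ten A C Y).trans
      (H.diamMap_dmul ((Γ.prod hH).flip Y) (Γ.prod_flip_sL hH Y) A C).symm
  | add x y hx hy =>
    refine Eq.trans ?_ (map_add _ x y).symm
    rw [← hx, ← hy, ← map_add]
    exact congrArg (dualProd hH Γ)
      (LinearMap.map_add₂ (((dual hH).tensor (regular H)).ten (regular H)) x y Y)

theorem dualFlip_bijective : Function.Bijective (dualFlip hH) := by
  let g : H.OpTensor →ₗ[k] ((dual hH).tensor (dual hH)).carrier :=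
    BalTensor.lift (f := H.tR) (g := H.tL) ((dual hH).ten (dual hH)).flip
      (fun b X Y => ((dual hH).tmul_bal (dual hH) b Y X).symm)
  have hg : ∀ X Y, g (H.omul X Y) = (dual hH).ten (dual hH) Y X := fun X Y =>
    BalTensor.lift_tmul (f := H.tR) (g := H.tL) ((dual hH).ten (dual hH)).flip
      (fun b X Y => ((dual hH).tmul_bal (dual hH) b Y X).symm) X Y
  refine Function.bijective_iff_has_inverse.2 ⟨g, fun x => ?_, fun x => ?_⟩
  · induction x using ten_ind with
    | ten Y X => exact (congrArg g (dualFlip_ten hH Y X)).trans (hg X Y)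
    | add x y hx hy => rw [map_add, map_add, hx, hy]
  · induction x using BalTensor.ind with
    | tmul X Y => exact (congrArg (dualFlip hH) (hg X Y)).trans (dualFlip_ten hH Y X)
    | add x y hx hy => rw [map_add, map_add, hx, hy]

/-- `λ ∘ (Y ⊗ X ↦ X ⊗ Y) ∘ Γ^#`, for two copies of the dual comodule. -/
noncomputable def galoisSharp (hH : H.IsLeftHopf) (Γ : H.LeftCocycle) :
    BalTensor (Γ.twR (dual hH)) (Γ.twL (dual hH)) →ₗ[k] H.Diam H.sL :=
  H.galois ∘ₗ dualFlip hH ∘ₗ Γ.sharp (dual hH) (dual hH)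

theorem galoisSharp_bijective (hΓ : Γ.IsInvertible) : Function.Bijective (galoisSharp hH Γ) :=
  hH.comp ((dualFlip_bijective (hH := hH)).comp (hΓ (dual hH) (dual hH)))

/-- `Y ⊗ X` is sent to `X₁ ⋄ X₂₊ Y₊ Γ(Y₋, X₂₋)‾`. -/
theorem galoisSharp_tmul (Y X : L) :
    galoisSharp hH Γ (BalTensor.tmul (Γ.twR (dual hH)) (Γ.twL (dual hH)) Y X)
      = H.diamMap ((Γ.prod hH).flip Y) (Γ.prod_flip_sL hH Y) (H.comul X) :=
  (congrArg (fun z => H.galois (dualFlip hH z)) (BalTensor.lift_tmul (f := Γ.twR (dual hH))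
    (g := Γ.twL (dual hH)) (Γ.sharp₀ (dual hH) (dual hH)) (Γ.sharp₀_bal (dual hH) (dual hH))
    Y X)).trans (Γ.galois_dualFlip hH X Y)

namespace TwistedEnv

variable {B' L' : Type u} [Ring B'] [Algebra k B'] [Ring L'] [Algebra k L']
  (T : Γ.TwistedEnv hH B' L') (hΓ : Γ.IsInvertible)

theorem comul_one : T.comul hΓ 1 = T.env.dmul T.env.sL 1 1 := by
  refine T.shReg_injective hΓ ?_
  rw [← T.eL_one, shReg_comul, shReg_dmul, H.comul_one]
  exact (Γ.sharp₀_central_left_one (isCentral_dual_one hH) (M := regular H) (1 : L)).symm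

theorem shReg_proj_sum {ι : Type*} (S : Finset ι) (f f' : ι → L) :
    T.shReg (BalTensor.proj T.env.tL T.env.sL (∑ i ∈ S, T.eL (f i) ⊗ₜ[k] T.eL (f' i)))
      = ∑ i ∈ S, Γ.sharp₀ (dual hH) (regular H) (f i) (f' i) := by
  rw [map_sum, map_sum]
  exact Finset.sum_congr rfl fun i _ => T.shReg_dmul _ _

theorem exists_sum (x : L' ⊗[k] L') : ∃ S : Finset (L' × L'),
    x = ∑ i ∈ S, T.eL (T.eL.symm i.1) ⊗ₜ[k] T.eL (T.eL.symm i.2) := by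
  obtain ⟨S, rfl⟩ := TensorProduct.exists_finset x
  exact ⟨S, by simp only [LinearEquiv.apply_symm_apply]⟩

/-- Multiplicativity of the twisted coproduct, for arbitrary representatives in `L^Γ ⊗ L^Γ`. -/
theorem comul_mul (X Y : L') (x y : L' ⊗[k] L')
    (hx : BalTensor.proj T.env.tL T.env.sL x = T.comul hΓ X)
    (hy : BalTensor.proj T.env.tL T.env.sL y = T.comul hΓ Y) :
    T.comul hΓ (X * Y) = BalTensor.proj T.env.tL T.env.sL (x * y) := by
  obtain ⟨X, rfl⟩ := T.eL.surjective X
  obtain ⟨Y, rfl⟩ := T.eL.surjective Y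
  obtain ⟨S, rfl⟩ := T.exists_sum x
  obtain ⟨U, rfl⟩ := T.exists_sum y
  refine T.shReg_injective hΓ ?_
  have hX := congrArg T.shReg hx
  have hY := congrArg T.shReg hy
  rw [shReg_proj_sum, shReg_comul] at hX hY
  rw [eL_mul, shReg_comul, comul_twMul hΓ S U _ _ _ _ hX hY, Finset.sum_mul_sum]
  simp only [Algebra.TensorProduct.tmul_mul_tmul, eL_mul, map_sum]
  exact Finset.sum_congr rfl fun i _ => Finset.sum_congr rfl fun j _ => (T.shReg_dmul _ _).symm

theorem mulRight_sL (y : L') (b : B') (x : L') :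
    LinearMap.mulRight k y (T.env.sL b x) = T.env.sL b (LinearMap.mulRight k y x) :=
  mul_assoc _ _ _

theorem twMul_flip_left (Y : L) (b : B') (X : (regular H).carrier) :
    (Γ.twMul hH).flip Y (T.left (regular H) b X)
      = T.left (regular H) b ((Γ.twMul hH).flip Y X) := by
  obtain ⟨b, rfl⟩ := T.eB.surjective b
  rw [left_eB, left_eB]
  refine (congrArg ((Γ.twMul hH).flip Y) (Γ.twMul_s_left hH b X).symm).trans ?_
  exact (Γ.twMul_assoc hH (H.s b) X Y).trans (Γ.twMul_s_left hH b (Γ.twMul hH X Y))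

/-- `Γ^# ∘ (id ⋄ (· Y))` in terms of `Γ^#`. -/
theorem sh_twMul_flip (Y : L) (u : T.env.Diam (T.left (regular H))) :
    T.sh (regular H) (T.env.diamMap ((Γ.twMul hH).flip Y) (T.twMul_flip_left Y) u)
      = dualProd hH Γ (Γ.sharp₀ ((dual hH).tensor (regular H)) (regular H)
          (T.shDual (regular H) u) Y) := by
  induction u using T.diam_ind with
  | dmul X Z =>
    rw [EnvRing.diamMap_dmul, sh_dmul, shDual_dmul]
    exact (dualProd_sharp₀ X Z Y).symm
  | add x y hx hy => simp only [map_add, LinearMap.add_apply, hx, hy]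

/-- `Γ^#` sends the image of `X ⊗ Y` under the Galois map of the cotwist to the value of
`galoisSharp`. -/
theorem shReg_comul_mulRight (X Y : L) :
    T.shReg (T.env.diamMap (LinearMap.mulRight k (T.eL Y)) (T.mulRight_sL (T.eL Y))
      (T.comul hΓ (T.eL X)))
      = galoisSharp hH Γ (BalTensor.tmul (Γ.twR (dual hH)) (Γ.twL (dual hH)) Y X) := by
  rw [galoisSharp_tmul, ← dualProd_comul, comul_eL]
  refine (congrArg T.shReg (T.env.diamMap_comm (ψ' := T.eL.toLinearMap) (i' := T.eL_left)
    (φ' := (Γ.twMul hH).flip Y) (i := T.twMul_flip_left Y) (fun X => T.eL_mul X Y) _)).trans ?_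
  rw [shReg_diamMap, sh_twMul_flip]
  exact congrArg (fun w => dualProd hH Γ (Γ.sharp₀ ((dual hH).tensor (regular H)) (regular H) w Y))
    (T.shDual_coact hΓ (M := regular H) X)

/-- The Galois map of the cotwist is surjective, as an induction principle. -/
theorem galois_ind {p : T.env.Diam T.env.sL → Prop}
    (gal : ∀ x y, p (T.env.diamMap (LinearMap.mulRight k y) (T.mulRight_sL y) (T.comul hΓ x)))
    (add : ∀ u v, p u → p v → p (u + v)) (u : T.env.Diam T.env.sL) : p u := by
  obtain ⟨z, hz⟩ := (galoisSharp_bijective (hH := hH) hΓ).2 (T.shReg u)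
  have key : ∀ z, ∃ u, p u ∧ galoisSharp hH Γ z = T.shReg u := by
    intro z
    induction z using BalTensor.ind with
    | tmul Y X => exact ⟨_, gal (T.eL X) (T.eL Y), (T.shReg_comul_mulRight hΓ X Y).symm⟩
    | add x y hx hy =>
      obtain ⟨u, hu, hu'⟩ := hx
      obtain ⟨v, hv, hv'⟩ := hy
      exact ⟨u + v, add u v hu hv, by rw [map_add, map_add, hu', hv']⟩
  obtain ⟨v, hv, hv'⟩ := key z
  rwa [T.shReg_injective hΓ (hz.symm.trans hv')]

theorem dmul_one_injective {x y : L'}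
    (h : T.env.dmul T.env.sL x 1 = T.env.dmul T.env.sL y 1) : x = y := by
  obtain ⟨X, rfl⟩ := T.eL.surjective x
  obtain ⟨Y, rfl⟩ := T.eL.surjective y
  have h1 : ∀ X : L, Γ.sharp₀ (dual hH) (regular H) X 1 = H.dmul H.sL X 1 := fun X =>
    Γ.sharp₀_central_right_one (M := dual hH) isCentral_one X
  have h2 : ∀ X : L, H.counitRight H.counit H.counit_source (H.dmul H.sL X 1) = X := fun X => by
    rw [EnvRing.counitRight_dmul, H.counit_one, H.t_one, one_mul]
  have h3 := congrArg T.shReg h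
  rw [← T.eL_one, shReg_dmul, shReg_dmul, h1, h1] at h3
  rw [← h2 X, h3, h2]

/-- The map `(id ⋄ ε ⋄ id) ∘ (Δ ⋄ id)`, which sends `X ⋄ Y` to `ε(X₂)‾ X₁ ⋄ Y`. -/
noncomputable def counitMid : T.env.Diam T.env.sL →ₗ[k] T.env.Diam T.env.sL :=
  T.env.diamMap (T.env.counitDiam T.counit T.counit_target T.env.sL)
    (T.env.counitDiam_diamSL T.counit T.counit_source T.counit_target T.env.sL)
  ∘ₗ T.env.comulDiam (T.comul hΓ) (T.comul_target hΓ) T.env.sL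

theorem counitMid_dmul (x y : L') : T.counitMid hΓ (T.env.dmul T.env.sL x y)
    = T.env.dmul T.env.sL (T.env.counitRight T.counit T.counit_source (T.comul hΓ x)) y := by
  rw [counitMid, LinearMap.comp_apply, EnvRing.comulDiam_dmul]
  exact T.env.diamMap_counitDiam_diamInsert T.counit T.counit_source T.counit_target T.env.sL y _

theorem counitMid_mulRight (y : L') (u : T.env.Diam T.env.sL) :
    T.counitMid hΓ (T.env.diamMap (LinearMap.mulRight k y) (T.mulRight_sL y) u)
      = T.env.diamMap (LinearMap.mulRight k y) (T.mulRight_sL y) (T.counitMid hΓ u) := by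
  induction u using BalTensor.ind with
  | tmul A C => rw [EnvRing.diamMap_dmul, counitMid_dmul, counitMid_dmul, EnvRing.diamMap_dmul]
  | add u v hu hv => simp only [map_add, hu, hv]

theorem counitMid_comul (x : L') : T.counitMid hΓ (T.comul hΓ x) = T.comul hΓ x := by
  rw [counitMid, LinearMap.comp_apply, ← comul_coassoc]
  exact T.env.diamMap_leftInverse (fun x => T.counit_comul hΓ x) _

/-- The right counit axiom follows from the left one, since the Galois map is surjective. -/
theorem comul_counit (x : L') :
    T.env.counitRight T.counit T.counit_source (T.comul hΓ x) = x := by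
  refine T.dmul_one_injective ?_
  rw [← counitMid_dmul]
  generalize T.env.dmul T.env.sL x 1 = u
  induction u using T.galois_ind hΓ with
  | gal x y => rw [counitMid_mulRight, counitMid_comul]
  | add u v hu hv => rw [map_add, hu, hv]

/-- The left bialgebroid `L^Γ`. -/
noncomputable def bialgebroid : LeftBialgebroid k B' L' where
  toEnvRing := T.env
  comul := T.comul hΓ
  counit := T.counit
  comul_source := T.comul_source hΓ
  comul_target := T.comul_target hΓ
  counit_source := T.counit_source
  counit_target := T.counit_target
  coassoc := T.comul_coassoc hΓ
  counit_comul := T.counit_comul hΓ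
  comul_counit := T.comul_counit hΓ
  comul_takeuchi := T.comul_takeuchi hΓ
  comul_one := T.comul_one hΓ
  comul_mul := T.comul_mul hΓ
  counit_one := T.counit_one
  counit_mul_source := T.counit_mul_source
  counit_mul_target := T.counit_mul_target

theorem opFlip_bal (b : B) (Y X : L) :
    ((T.bialgebroid hΓ).omul.flip.compl₁₂ T.eL.toLinearMap T.eL.toLinearMap)
        (Γ.twR (dual hH) b Y) X
      = ((T.bialgebroid hΓ).omul.flip.compl₁₂ T.eL.toLinearMap T.eL.toLinearMap) Y
          (Γ.twL (dual hH) b X) := by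
  refine Eq.trans ?_ (((T.bialgebroid hΓ).omul_bal (T.eB b) (T.eL X) (T.eL Y)).symm.trans ?_)
  · exact congrArg ((T.bialgebroid hΓ).omul (T.eL X)) (T.t_mul_eL b Y).symm
  · exact congrArg (fun z => (T.bialgebroid hΓ).omul z (T.eL Y)) (T.eL_mul_t b X)

/-- `Y ⊗ X ↦ X ⊗ Y`, from the domain of `Γ^#` for two copies of the dual comodule. -/
noncomputable def opFlip :
    BalTensor (Γ.twR (dual hH)) (Γ.twL (dual hH)) →ₗ[k] (T.bialgebroid hΓ).OpTensor :=
  BalTensor.lift (f := Γ.twR (dual hH)) (g := Γ.twL (dual hH))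
    ((T.bialgebroid hΓ).omul.flip.compl₁₂ T.eL.toLinearMap T.eL.toLinearMap)
    (T.opFlip_bal hΓ)

theorem opFlip_tmul (X Y : L) :
    T.opFlip hΓ (BalTensor.tmul (Γ.twR (dual hH)) (Γ.twL (dual hH)) Y X)
      = (T.bialgebroid hΓ).omul (T.eL X) (T.eL Y) :=
  BalTensor.lift_tmul (f := Γ.twR (dual hH)) (g := Γ.twL (dual hH))
    ((T.bialgebroid hΓ).omul.flip.compl₁₂ T.eL.toLinearMap T.eL.toLinearMap)
    (T.opFlip_bal hΓ) Y X

theorem opFlip_surjective : Function.Surjective (T.opFlip hΓ) := fun x => by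
  induction x using BalTensor.ind with
  | tmul x y =>
    obtain ⟨X, rfl⟩ := T.eL.surjective x
    obtain ⟨Y, rfl⟩ := T.eL.surjective y
    exact ⟨_, T.opFlip_tmul hΓ X Y⟩
  | add x y hx hy =>
    obtain ⟨x, rfl⟩ := hx
    obtain ⟨y, rfl⟩ := hy
    exact ⟨x + y, map_add _ x y⟩

/-- The Galois map of the cotwist corresponds to that of `L` under the maps `Γ^#`. -/
theorem galois_opFlip (z : BalTensor (Γ.twR (dual hH)) (Γ.twL (dual hH))) :
    T.shReg ((T.bialgebroid hΓ).galois (T.opFlip hΓ z))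
      = galoisSharp hH Γ z := by
  induction z using BalTensor.ind with
  | tmul Y X =>
    refine Eq.trans ?_ (T.shReg_comul_mulRight hΓ X Y)
    refine congrArg T.shReg ?_
    refine (congrArg (T.bialgebroid hΓ).galois (T.opFlip_tmul hΓ X Y)).trans ?_
    exact ((T.bialgebroid hΓ).galois_omul (T.eL X) (T.eL Y)).trans
      ((T.bialgebroid hΓ).diamMulRight_eq (T.eL Y) (T.comul hΓ (T.eL X)))
  | add x y hx hy =>
    refine (congrArg T.shReg (map_add ((T.bialgebroid hΓ).galois ∘ₗ T.opFlip hΓ) x y)).trans ?_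
    refine (map_add T.shReg _ _).trans ?_
    exact (congrArg₂ _ hx hy).trans (map_add _ x y).symm

theorem isLeftHopf : (T.bialgebroid hΓ).IsLeftHopf := by
  refine ⟨fun x y h => ?_, fun u => ?_⟩
  · obtain ⟨x, rfl⟩ := T.opFlip_surjective hΓ x
    obtain ⟨y, rfl⟩ := T.opFlip_surjective hΓ y
    refine congrArg _ ((galoisSharp_bijective (hH := hH) hΓ).1 ?_)
    exact (T.galois_opFlip hΓ x).symm.trans ((congrArg T.shReg h).trans (T.galois_opFlip hΓ y))
  · obtain ⟨z, hz⟩ := (galoisSharp_bijective (hH := hH) hΓ).2 (T.shReg u)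
    exact ⟨T.opFlip hΓ z, T.shReg_injective hΓ ((T.galois_opFlip hΓ z).trans hz)⟩

end TwistedEnv

end LeftCocycle

end LeftBialgebroid

namespace EnvRing

variable {k : Type v} {B L : Type u} [CommRing k] [Ring B] [Algebra k B] [Ring L] [Algebra k L]
  (R : EnvRing k B L) {M : Type*} [AddCommGroup M] [Module k M]

theorem comulDiam_congr {Δ Δ' : L →ₗ[k] R.Diam R.sL}
    (hΔ : ∀ b X, Δ (R.t b * X) = R.diamMap (R.tL b) (R.tL_sL b) (Δ X))
    (hΔ' : ∀ b X, Δ' (R.t b * X) = R.diamMap (R.tL b) (R.tL_sL b) (Δ' X)) (e : ∀ X, Δ X = Δ' X)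
    (l : B → Module.End k M) (u : R.Diam l) : R.comulDiam Δ hΔ l u = R.comulDiam Δ' hΔ' l u := by
  obtain rfl : Δ = Δ' := LinearMap.ext e
  rfl

theorem counitDiam_congr {ε ε' : L →ₗ[k] B} (hε : ∀ b X, ε (R.t b * X) = ε X * b)
    (hε' : ∀ b X, ε' (R.t b * X) = ε' X * b) (e : ∀ X, ε X = ε' X) (l : B →ₐ[k] Module.End k M)
    (u : R.Diam l) : R.counitDiam ε hε l u = R.counitDiam ε' hε' l u := by
  obtain rfl : ε = ε' := LinearMap.ext e
  rfl

end EnvRing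

namespace LeftBialgebroid

variable {k : Type v} {B L : Type u} [CommRing k] [Ring B] [Algebra k B] [Ring L] [Algebra k L]
  {H : LeftBialgebroid k B L}

open Comodule

namespace LeftCocycle

/-! ### The algebras `B^Γ` and `L^Γ` -/

theorem s_injective : Function.Injective H.s :=
  Function.LeftInverse.injective (g := H.counit) counit_s

theorem form_s_assoc (Γ : H.LeftCocycle) (hH : H.IsLeftHopf) (a b c : B) :
    Γ.form (H.s (Γ.form (H.s a) (H.s b))) (H.s c)
      = Γ.form (H.s a) (H.s (Γ.form (H.s b) (H.s c))) :=
  s_injective (by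
    rw [← Γ.twMul_s_s hH, ← Γ.twMul_s_s hH, ← Γ.twMul_s_s hH, ← Γ.twMul_s_s hH, Γ.twMul_assoc])

theorem form_s_one_left (Γ : H.LeftCocycle) (hH : H.IsLeftHopf) (b : B) :
    Γ.form (H.s 1) (H.s b) = b :=
  s_injective (by rw [← Γ.twMul_s_s hH, H.s_one, Γ.twMul_one_left])

theorem form_s_one_right (Γ : H.LeftCocycle) (hH : H.IsLeftHopf) (b : B) :
    Γ.form (H.s b) (H.s 1) = b :=
  s_injective (by rw [← Γ.twMul_s_s hH, H.s_one, Γ.twMul_one_right])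

/-- The underlying module of `B^Γ`. The translation map is not needed to define the product, but the
proof that it is associative passes through `L^Γ`. -/
@[nolint unusedArguments]
def TwBase (_ : H.LeftCocycle) (_ : H.IsLeftHopf) : Type u := B

/-- The underlying module of `L^Γ`. -/
@[nolint unusedArguments]
def TwRing (_ : H.LeftCocycle) (_ : H.IsLeftHopf) : Type u := L

variable (Γ : H.LeftCocycle) (hH : H.IsLeftHopf)

instance : AddCommGroup (Γ.TwBase hH) := inferInstanceAs (AddCommGroup B)
instance : Module k (Γ.TwBase hH) := inferInstanceAs (Module k B)
instance : AddCommGroup (Γ.TwRing hH) := inferInstanceAs (AddCommGroup L)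
instance : Module k (Γ.TwRing hH) := inferInstanceAs (Module k L)

/-- The identity map `B → B^Γ`. -/
def toTwBase : B ≃ₗ[k] Γ.TwBase hH := LinearEquiv.refl k B

/-- The identity map `L → L^Γ`. -/
def toTwRing : L ≃ₗ[k] Γ.TwRing hH := LinearEquiv.refl k L

/-- The product of `B^Γ`. -/
def baseMul : Γ.TwBase hH →ₗ[k] Γ.TwBase hH →ₗ[k] Γ.TwBase hH := Γ.form.compl₁₂ H.s H.s

/-- The product of `L^Γ`. -/
noncomputable def ringMul : Γ.TwRing hH →ₗ[k] Γ.TwRing hH →ₗ[k] Γ.TwRing hH := Γ.twMul hH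

instance : Ring (Γ.TwBase hH) :=
  { (inferInstance : AddCommGroup (Γ.TwBase hH)) with
    mul := fun a b => Γ.baseMul hH a b
    one := Γ.toTwBase hH 1
    left_distrib := fun a b c => map_add (Γ.baseMul hH a) b c
    right_distrib := fun a b c => LinearMap.map_add₂ (Γ.baseMul hH) a b c
    zero_mul := fun a => LinearMap.map_zero₂ (Γ.baseMul hH) a
    mul_zero := fun a => map_zero (Γ.baseMul hH a)
    mul_assoc := Γ.form_s_assoc hH
    one_mul := Γ.form_s_one_left hH
    mul_one := Γ.form_s_one_right hH }

noncomputable instance : Ring (Γ.TwRing hH) :=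
  { (inferInstance : AddCommGroup (Γ.TwRing hH)) with
    mul := fun X Y => Γ.ringMul hH X Y
    one := Γ.toTwRing hH 1
    left_distrib := fun a b c => map_add (Γ.ringMul hH a) b c
    right_distrib := fun a b c => LinearMap.map_add₂ (Γ.ringMul hH) a b c
    zero_mul := fun a => LinearMap.map_zero₂ (Γ.ringMul hH) a
    mul_zero := fun a => map_zero (Γ.ringMul hH a)
    mul_assoc := Γ.twMul_assoc hH
    one_mul := Γ.twMul_one_left hH
    mul_one := Γ.twMul_one_right hH }

instance : Algebra k (Γ.TwBase hH) :=
  Algebra.ofModule (fun c a b => LinearMap.map_smul₂ (Γ.baseMul hH) c a b)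
    (fun c a b => map_smul (Γ.baseMul hH a) c b)

noncomputable instance : Algebra k (Γ.TwRing hH) :=
  Algebra.ofModule (fun c a b => LinearMap.map_smul₂ (Γ.ringMul hH) c a b)
    (fun c a b => map_smul (Γ.ringMul hH a) c b)

/-- The source map of `L^Γ`. -/
noncomputable def twSource : Γ.TwBase hH →ₐ[k] Γ.TwRing hH :=
  AlgHom.ofLinearMap ((Γ.toTwRing hH).toLinearMap ∘ₗ H.s ∘ₗ (Γ.toTwBase hH).symm.toLinearMap)
    H.s_one (fun a b => (Γ.twMul_s_s hH a b).symm)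

/-- The target map of `L^Γ`. -/
noncomputable def twTarget : (Γ.TwBase hH)ᵐᵒᵖ →ₐ[k] Γ.TwRing hH :=
  AlgHom.ofLinearMap ((Γ.toTwRing hH).toLinearMap ∘ₗ H.t ∘ₗ (Γ.toTwBase hH).symm.toLinearMap
      ∘ₗ (opLinearEquiv k).symm.toLinearMap)
    H.t_one (fun a b => (Γ.twMul_t_t hH (unop a) (unop b)).symm)

/-- The `B^Γ ⊗ (B^Γ)ᵒᵖ`-ring `L^Γ`. -/
noncomputable def twistedEnv : Γ.TwistedEnv hH (Γ.TwBase hH) (Γ.TwRing hH) where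
  env :=
    { source := Γ.twSource hH
      target := Γ.twTarget hH
      source_target := fun a b => Γ.twMul_s_t hH a (unop b) }
  eB := Γ.toTwBase hH
  eL := Γ.toTwRing hH
  eB_mul _ _ := rfl
  eB_one := rfl
  eL_mul _ _ := rfl
  eL_one := rfl
  source_eB _ := rfl
  target_eB _ := rfl

variable {Γ hH}

theorem TwistedEnv.shReg_proj {B' L' : Type u} [Ring B'] [Algebra k B'] [Ring L'] [Algebra k L']
    (T : Γ.TwistedEnv hH B' L') (w : L ⊗[k] L) :
    T.shReg (BalTensor.proj T.env.tL T.env.sL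
      (TensorProduct.map T.eL.toLinearMap T.eL.toLinearMap w))
      = Γ.sharpDiam hH (regular H) w := by
  induction w using TensorProduct.induction_on with
  | zero => simp only [map_zero]
  | tmul X Y =>
    rw [TensorProduct.map_tmul, BalTensor.proj_tmul]
    exact (T.shReg_dmul X Y).trans (Γ.sharpDiam_tmul hH (M := regular H) X Y).symm
  | add x y hx hy => simp only [map_add, hx, hy]

/-- The cotwist exists. -/
theorem nonempty_cotwist (hΓ : Γ.IsInvertible) : Nonempty (Γ.Cotwist hH) :=
  ⟨{B' := Γ.TwBase hH
    L' := Γ.TwRing hH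
    hopf := (Γ.twistedEnv hH).bialgebroid hΓ
    isLeftHopf := (Γ.twistedEnv hH).isLeftHopf hΓ
    eB := (Γ.twistedEnv hH).eB
    eL := (Γ.twistedEnv hH).eL
    eB_mul := (Γ.twistedEnv hH).eB_mul
    eB_one := (Γ.twistedEnv hH).eB_one
    eL_mul := (Γ.twistedEnv hH).eL_mul
    eL_one := (Γ.twistedEnv hH).eL_one
    source_eB := (Γ.twistedEnv hH).source_eB
    target_eB := (Γ.twistedEnv hH).target_eB
    comul_eL := fun X w h => ((Γ.twistedEnv hH).shReg_proj w).symm.trans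
      ((congrArg (Γ.twistedEnv hH).shReg h).trans ((Γ.twistedEnv hH).shReg_comul hΓ X))
    counit_eL := (Γ.twistedEnv hH).counit_eL }⟩

/-! ### The twisted comodules over a given cotwist -/

namespace Cotwist

variable (C : Γ.Cotwist hH)

/-- The twisted environment underlying a cotwist. -/
abbrev toTwistedEnv : Γ.TwistedEnv hH C.B' C.L' where
  env := C.hopf.toEnvRing
  eB := C.eB
  eL := C.eL
  eB_mul := C.eB_mul
  eB_one := C.eB_one
  eL_mul := C.eL_mul
  eL_one := C.eL_one
  source_eB := C.source_eB
  target_eB := C.target_eB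

theorem comul_eq (hΓ : Γ.IsInvertible) (x : C.L') :
    C.hopf.comul x = C.toTwistedEnv.comul hΓ x := by
  obtain ⟨X, rfl⟩ := C.eL.surjective x
  obtain ⟨w, hw⟩ := BalTensor.proj_surjective C.hopf.tL C.hopf.sL (C.hopf.comul (C.eL X))
  obtain ⟨w, rfl⟩ := (TensorProduct.congr C.eL C.eL).surjective w
  have h := C.comul_eL X w hw
  refine C.toTwistedEnv.shReg_injective hΓ ?_
  rw [← hw]
  exact (C.toTwistedEnv.shReg_proj w).trans (h.trans (C.toTwistedEnv.shReg_comul hΓ X).symm)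

theorem counit_eq (x : C.L') : C.hopf.counit x = C.toTwistedEnv.counit x := by
  obtain ⟨X, rfl⟩ := C.eL.surjective x
  rw [C.counit_eL]
  exact (C.toTwistedEnv.counit_eL X).symm

/-- The twist of a comodule: the coaction is `Γ^#⁻¹ ∘ δ`. -/
noncomputable abbrev twist (hΓ : Γ.IsInvertible) (M : H.Comodule) : C.hopf.Comodule where
  carrier := M.carrier
  left := C.toTwistedEnv.left M
  right := C.toTwistedEnv.right M
  right_left := C.toTwistedEnv.right_left
  coact := C.toTwistedEnv.coact hΓ M
  coact_left := C.toTwistedEnv.coact_left hΓ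
  coact_right := C.toTwistedEnv.coact_right hΓ
  coact_takeuchi := C.toTwistedEnv.coact_takeuchi hΓ
  coassoc m := (C.toTwistedEnv.coact_coassoc hΓ m).trans
    (C.hopf.comulDiam_congr (C.toTwistedEnv.comul_target hΓ) C.hopf.comul_target
      (fun x => (C.comul_eq hΓ x).symm) _ _)
  counit_coact m := (C.hopf.counitDiam_congr C.hopf.counit_target C.toTwistedEnv.counit_target
    C.counit_eq _ _).trans (C.toTwistedEnv.counit_coact hΓ m)

/-- The twist of a morphism of comodules. -/
noncomputable def twistMap (hΓ : Γ.IsInvertible) {M N : H.Comodule} (f : M ⟶ N) :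
    C.twist hΓ M ⟶ C.twist hΓ N :=
  (⟨lin (H := H) (M := M) (N := N) f, C.toTwistedEnv.left_natural (isMor_lin f),
    C.toTwistedEnv.right_natural (isMor_lin f),
    C.toTwistedEnv.coact_natural hΓ (isMor_lin f)⟩ : Hom (C.twist hΓ M) (C.twist hΓ N))

/-- The functor from the comodules of `L` to the comodules of `L^Γ`. -/
noncomputable def twistFunctor (hΓ : Γ.IsInvertible) : H.Comodule ⥤ C.hopf.Comodule where
  obj := C.twist hΓ
  map := C.twistMap hΓ
  map_id _ := rfl
  map_comp _ _ := rfl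

instance (hΓ : Γ.IsInvertible) : (C.twistFunctor hΓ).Faithful where
  map_injective h := hom_ext fun m =>
    congrArg (fun g : C.twist hΓ _ ⟶ C.twist hΓ _ => lin g m) h

end Cotwist

end LeftCocycle

end LeftBialgebroid

namespace LeftBialgebroid

variable {k : Type v} {B L : Type u} [CommRing k] [Ring B] [Algebra k B] [Ring L] [Algebra k L]
  {H : LeftBialgebroid k B L}

open Comodule

namespace Comodule

/-- A bijective morphism of comodules is an isomorphism. -/
noncomputable def isoOfBijective {M N : H.Comodule} (f : M ⟶ N) (hf : Function.Bijective (lin f)) :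
    M ≅ N :=
  isoOfInv f (LinearEquiv.ofBijective (lin f) hf).symm.toLinearMap
    (fun m => (LinearEquiv.ofBijective (lin f) hf).symm_apply_apply m)
    (fun n => (LinearEquiv.ofBijective (lin f) hf).apply_symm_apply n)

theorem isCentral_unit : IsCentral (unit H) (ofB H 1) where
  coact_eq := (unit_coact (ofB H 1)).trans (by rw [toB_ofB, H.s_one])
  comm b := by rw [left_ofB, right_ofB, mul_one, unop_op, one_mul]

end Comodule

namespace LeftCocycle

variable {Γ : H.LeftCocycle} {hH : H.IsLeftHopf}

namespace Cotwist

variable (C : Γ.Cotwist hH) (hΓ : Γ.IsInvertible) (M N P : H.Comodule)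

/-! ### The monoidal structure of the twisting functor -/

variable {M N} in
theorem sharp₀_twist_bal (b : C.B') (m : M.carrier) (n : N.carrier) :
    Γ.sharp₀ M N (C.toTwistedEnv.right M (op b) m) n
      = Γ.sharp₀ M N m (C.toTwistedEnv.left N b n) := by
  obtain ⟨b, rfl⟩ := C.eB.surjective b
  exact (congrArg (fun z => Γ.sharp₀ M N z n) (C.toTwistedEnv.right_eB b m)).trans
    ((Γ.sharp₀_bal M N b m n).trans
      (congrArg (Γ.sharp₀ M N m) (C.toTwistedEnv.left_eB b n)).symm)

/-- The map `Γ^#` on `M ⊗_{B^Γ} N`. -/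
noncomputable def muLin : ((C.twist hΓ M).tensor (C.twist hΓ N)).carrier →ₗ[k]
    (M.tensor N).carrier :=
  tlift (M := C.twist hΓ M) (N := C.twist hΓ N) (Γ.sharp₀ M N) C.sharp₀_twist_bal

variable {M N P}

theorem muLin_ten (m : M.carrier) (n : N.carrier) :
    C.muLin hΓ M N ((C.twist hΓ M).ten (C.twist hΓ N) m n) = Γ.sharp₀ M N m n :=
  tlift_ten (M := C.twist hΓ M) (N := C.twist hΓ N) (Γ.sharp₀ M N) C.sharp₀_twist_bal m n

theorem muLin_left (b : C.B') (x : ((C.twist hΓ M).tensor (C.twist hΓ N)).carrier) :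
    C.muLin hΓ M N (((C.twist hΓ M).tensor (C.twist hΓ N)).left b x)
      = C.toTwistedEnv.left (M.tensor N) b (C.muLin hΓ M N x) := by
  obtain ⟨b, rfl⟩ := C.eB.surjective b
  induction x using ten_ind with
  | ten m n =>
    rw [left_ten, muLin_ten, muLin_ten, C.toTwistedEnv.left_eB]
    exact (Γ.sharp₀_twL b m n).trans (C.toTwistedEnv.left_eB b _).symm
  | add x y hx hy => simp only [map_add, hx, hy]

theorem muLin_right (b : C.B'ᵐᵒᵖ) (x : ((C.twist hΓ M).tensor (C.twist hΓ N)).carrier) :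
    C.muLin hΓ M N (((C.twist hΓ M).tensor (C.twist hΓ N)).right b x)
      = C.toTwistedEnv.right (M.tensor N) b (C.muLin hΓ M N x) := by
  obtain ⟨b, rfl⟩ := opEquiv.surjective b
  obtain ⟨b, rfl⟩ := C.eB.surjective b
  induction x using ten_ind with
  | ten m n =>
    rw [right_ten, muLin_ten]
    refine Eq.trans ?_ (C.toTwistedEnv.right_eB b (Γ.sharp₀ M N m n)).symm
    rw [← sharp₀_twR]
    exact (C.muLin_ten hΓ m _).trans
      (congrArg (Γ.sharp₀ M N m) (C.toTwistedEnv.right_eB b n))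
  | add x y hx hy => simp only [map_add, hx, hy]

/-- The codiagonal coaction of `L^Γ` on `M ⊗_{B^Γ} N` is given by the products `X ·_Γ Z`, hence its
image under `Γ^#` by `sharpProd`. -/
theorem sh_muLin_fst (Z : L) (n : N.carrier) (x : (Γ.twCofree hH M).carrier) :
    C.toTwistedEnv.sh (M.tensor N) (C.hopf.diamMap (C.muLin hΓ M N) (C.muLin_left hΓ)
      (((C.twist hΓ M).cod (C.twist hΓ N)).fst (C.eL Z) n (C.toTwistedEnv.toDiam M x)))
      = Γ.sharpProd hH M n (Γ.sharp₀ (Γ.twCofree hH M) (regular H) x Z) := by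
  induction x using gmul_ind with
  | gmul X m =>
    rw [sharpProd_sharp₀, C.toTwistedEnv.toDiam_gmul]
    refine (congrArg (fun z => C.toTwistedEnv.sh (M.tensor N)
      (C.hopf.diamMap (C.muLin hΓ M N) (C.muLin_left hΓ) z))
      ((C.twist hΓ M).fst_cod_dmul (C.twist hΓ N) (C.eL Z) n (C.eL X) m)).trans ?_
    refine (congrArg (C.toTwistedEnv.sh (M.tensor N)) (C.hopf.diamMap_dmul (C.muLin hΓ M N)
      (C.muLin_left hΓ) _ _)).trans ?_
    rw [C.eL_mul, muLin_ten]
    exact C.toTwistedEnv.sh_dmul _ _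
  | add x y hx hy => simp only [map_add, LinearMap.add_apply, hx, hy]

theorem sh_muLin_pair (m : M.carrier) (v : C.hopf.Diam (C.toTwistedEnv.left N)) :
    C.toTwistedEnv.sh (M.tensor N) (C.hopf.diamMap (C.muLin hΓ M N) (C.muLin_left hΓ)
      (((C.twist hΓ M).cod (C.twist hΓ N)).pair m v))
      = codLin M N (Γ.sharp₀ M (cofree H N.left) m (C.toTwistedEnv.sh N v)) := by
  induction v using C.toTwistedEnv.diam_ind with
  | dmul Z n =>
    rw [C.toTwistedEnv.sh_dmul]
    refine (congrArg (fun z => C.toTwistedEnv.sh (M.tensor N)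
      (C.hopf.diamMap (C.muLin hΓ M N) (C.muLin_left hΓ) z))
      (((C.twist hΓ M).cod (C.twist hΓ N)).pair_dmul m (C.eL Z) n)).trans ?_
    exact (C.sh_muLin_fst hΓ Z n (Γ.twCoact hH hΓ M m)).trans
      (Γ.sharpProd_twCoact hH hΓ m n Z)
  | add x y hx hy => simp only [map_add, hx, hy]

/-- The map `Γ^#_{M,N}` is colinear. -/
theorem muLin_coact (x : ((C.twist hΓ M).tensor (C.twist hΓ N)).carrier) :
    C.toTwistedEnv.coact hΓ (M.tensor N) (C.muLin hΓ M N x)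
      = C.hopf.diamMap (C.muLin hΓ M N) (C.muLin_left hΓ)
        (((C.twist hΓ M).tensor (C.twist hΓ N)).coact x) := by
  refine (C.toTwistedEnv.sh_bijective hΓ (M.tensor N)).1 ?_
  rw [C.toTwistedEnv.sh_coact]
  induction x using ten_ind with
  | ten m n =>
    rw [coact_ten]
    refine Eq.trans ?_ (C.sh_muLin_pair hΓ m (C.toTwistedEnv.coact hΓ N n)).symm
    rw [C.toTwistedEnv.sh_coact, codLin_coact]
    exact congrArg _ (C.muLin_ten hΓ m n)
  | add x y hx hy => simp only [map_add, hx, hy]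

theorem muLin_bijective : Function.Bijective (C.muLin hΓ M N) := by
  have hbal : ∀ b m n, (C.twist hΓ M).ten (C.twist hΓ N) (Γ.twR M b m) n
      = (C.twist hΓ M).ten (C.twist hΓ N) m (Γ.twL N b n) := fun b m n => by
    rw [← C.toTwistedEnv.right_eB, ← C.toTwistedEnv.left_eB]
    exact (C.twist hΓ M).ten_bal (C.twist hΓ N) (C.eB b) m n
  let p : BalTensor (Γ.twR M) (Γ.twL N) →ₗ[k] ((C.twist hΓ M).tensor (C.twist hΓ N)).carrier :=
    BalTensor.lift (f := Γ.twR M) (g := Γ.twL N) ((C.twist hΓ M).ten (C.twist hΓ N)) hbal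
  have hp : Function.Surjective p := fun x => by
    induction x using ten_ind with
    | ten m n => exact ⟨_, BalTensor.lift_tmul (f := Γ.twR M) (g := Γ.twL N) _ hbal m n⟩
    | add x y hx hy =>
      obtain ⟨x, rfl⟩ := hx
      obtain ⟨y, rfl⟩ := hy
      exact ⟨x + y, map_add _ x y⟩
  have h : ∀ z, C.muLin hΓ M N (p z) = Γ.sharp M N z := fun z =>
    BalTensor.hom_ext_apply (φ := C.muLin hΓ M N ∘ₗ p) (ψ := Γ.sharp M N) (fun m n => by
      refine (congrArg (C.muLin hΓ M N)
        (BalTensor.lift_tmul (f := Γ.twR M) (g := Γ.twL N) _ hbal m n)).trans ?_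
      exact (C.muLin_ten hΓ m n).trans (BalTensor.lift_tmul (f := Γ.twR M) (g := Γ.twL N)
        (Γ.sharp₀ M N) (Γ.sharp₀_bal M N) m n).symm) z
  have h' : C.muLin hΓ M N ∘ p = Γ.sharp M N := funext h
  refine ⟨fun x y hxy => ?_, Function.Surjective.of_comp (g := p) (h' ▸ (hΓ M N).2)⟩
  obtain ⟨x, rfl⟩ := hp x
  obtain ⟨y, rfl⟩ := hp y
  rw [h, h] at hxy
  rw [(hΓ M N).1 hxy]

variable (M N) in
/-- The structure map `M ⊗_{B^Γ} N → M ⊗_B N` of the twisting functor. -/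
noncomputable def mu : (C.twist hΓ M).tensor (C.twist hΓ N) ⟶ C.twist hΓ (M.tensor N) :=
  (⟨C.muLin hΓ M N, C.muLin_left hΓ, C.muLin_right hΓ, C.muLin_coact hΓ⟩ :
    Hom ((C.twist hΓ M).tensor (C.twist hΓ N)) (C.twist hΓ (M.tensor N)))

theorem lin_mu (m : M.carrier) (n : N.carrier) :
    lin (C.mu hΓ M N) ((C.twist hΓ M).ten (C.twist hΓ N) m n) = Γ.sharp₀ M N m n :=
  C.muLin_ten hΓ m n

theorem unit_coact_twist (b : (unit C.hopf).carrier) :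
    C.toTwistedEnv.coact hΓ (unit H) (ofB H (C.eB.symm (toB C.hopf b)))
      = C.hopf.dmul (C.toTwistedEnv.left (unit H)) (C.hopf.s (toB C.hopf b)) (ofB H 1) := by
  obtain ⟨b, rfl⟩ : ∃ a, ofB C.hopf (C.eB a) = b := C.eB.surjective b
  refine (C.toTwistedEnv.sh_bijective hΓ (unit H)).1 ?_
  rw [C.toTwistedEnv.sh_coact, toB_ofB, LinearEquiv.symm_apply_apply, C.source_eB, unit_coact]
  refine Eq.trans ?_ (C.toTwistedEnv.sh_dmul (M := unit H) (H.s b) (ofB H 1)).symm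
  exact (Γ.sharp₀_central_right_one (M := dual hH) isCentral_unit (H.s b)).symm

/-- The structure map `B^Γ → B` of the twisting functor. -/
noncomputable def epsilon : unit C.hopf ⟶ C.twist hΓ (unit H) :=
  (⟨ofB H ∘ₗ C.eB.symm.toLinearMap ∘ₗ toB C.hopf,
    fun b x => by
      obtain ⟨x, rfl⟩ : ∃ a, ofB C.hopf (C.eB a) = x := C.eB.surjective x
      obtain ⟨b, rfl⟩ := C.eB.surjective b
      refine Eq.trans ?_ ((C.toTwistedEnv.left_eB b (M := unit H) _).trans (Γ.twL_unit b _)).symm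
      change ofB H (C.eB.symm (C.eB b * C.eB x)) = _
      rw [C.eB_mul, LinearEquiv.symm_apply_apply]
      change _ = ofB H (Γ.form (H.s b) (H.s (C.eB.symm (C.eB x))))
      rw [LinearEquiv.symm_apply_apply],
    fun b x => by
      obtain ⟨x, rfl⟩ : ∃ a, ofB C.hopf (C.eB a) = x := C.eB.surjective x
      obtain ⟨b, rfl⟩ := opEquiv.surjective b
      obtain ⟨b, rfl⟩ := C.eB.surjective b
      refine Eq.trans ?_ ((C.toTwistedEnv.right_eB b (M := unit H) _).trans (Γ.twR_unit _ b)).symm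
      change ofB H (C.eB.symm (C.eB x * C.eB b)) = _
      rw [C.eB_mul, LinearEquiv.symm_apply_apply]
      change _ = ofB H (Γ.form (H.s (C.eB.symm (C.eB x))) (H.s b))
      rw [LinearEquiv.symm_apply_apply],
    fun b => by
      refine (C.unit_coact_twist hΓ b).trans ?_
      rw [unit_coact, EnvRing.diamMap_dmul]
      congr 1
      exact (congrArg (ofB H) C.toTwistedEnv.eB_symm_one).symm⟩ :
    Hom (unit C.hopf) (C.twist hΓ (unit H)))

theorem lin_epsilon (b : B) : lin (C.epsilon hΓ) (ofB C.hopf (C.eB b)) = ofB H b :=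
  congrArg (ofB H) (C.eB.symm_apply_apply b)

theorem epsilon_bijective : Function.Bijective (lin (C.epsilon hΓ)) := C.eB.symm.bijective

theorem mu_natural {M' N' : H.Comodule} (f : M ⟶ M') (g : N ⟶ N') :
    tensorHom (C.twistMap hΓ f) (C.twistMap hΓ g) ≫ C.mu hΓ M' N'
      = C.mu hΓ M N ≫ C.twistMap hΓ (tensorHom f g) :=
  hom_ten_ext fun m n => by
    refine (congrArg (lin (C.mu hΓ M' N')) (lin_tensorHom_ten _ _ _ _ m n)).trans ?_
    refine (C.lin_mu hΓ (lin f m) (lin g n)).trans ?_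
    refine (Γ.sharp₀_tensorHom f g m n).symm.trans ?_
    exact (congrArg (lin (tensorHom f g)) (C.lin_mu hΓ m n)).symm

theorem mu_assoc :
    tensorHom (C.mu hΓ M N) (𝟙 (C.twist hΓ P)) ≫ C.mu hΓ (M.tensor N) P
        ≫ C.twistMap hΓ (M.assocIso N P).hom
      = ((C.twist hΓ M).assocIso (C.twist hΓ N) (C.twist hΓ P)).hom
        ≫ tensorHom (𝟙 (C.twist hΓ M)) (C.mu hΓ N P) ≫ C.mu hΓ M (N.tensor P) :=
  hom_ext (ten_ext₃ fun m n p => by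
    have h1 := (congrArg (lin (C.mu hΓ (M.tensor N) P ≫ C.twistMap hΓ (M.assocIso N P).hom))
      ((lin_tensorHom_ten _ _ (C.mu hΓ M N) (𝟙 (C.twist hΓ P)) _ p).trans
        (congrArg (fun z => ((C.twist hΓ (M.tensor N)).ten (C.twist hΓ P) z p))
          (C.lin_mu hΓ m n)))).trans
      (congrArg (M.assocLin N P) (C.lin_mu hΓ (Γ.sharp₀ M N m n) p))
    have h2 := (congrArg (lin (tensorHom (𝟙 (C.twist hΓ M)) (C.mu hΓ N P)
        ≫ C.mu hΓ M (N.tensor P)))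
      (lin_assocIso (C.twist hΓ M) (C.twist hΓ N) (C.twist hΓ P) m n p)).trans
      ((congrArg (lin (C.mu hΓ M (N.tensor P)))
        ((lin_tensorHom_ten _ _ (𝟙 (C.twist hΓ M)) (C.mu hΓ N P) m _).trans
          (congrArg ((C.twist hΓ M).ten (C.twist hΓ (N.tensor P)) m)
            (C.lin_mu hΓ n p)))).trans
      (C.lin_mu hΓ m (Γ.sharp₀ N P n p)))
    exact h1.trans ((Γ.assoc_sharp₀ m n p).trans h2.symm))

theorem epsilon_mu_left :
    (C.twist hΓ M).leftUnitIso.hom = tensorHom (C.epsilon hΓ) (𝟙 (C.twist hΓ M))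
      ≫ C.mu hΓ (unit H) M ≫ C.twistMap hΓ M.leftUnitIso.hom :=
  hom_ten_ext (M := unit C.hopf) fun b m => by
    obtain ⟨b, rfl⟩ : ∃ a, ofB C.hopf (C.eB a) = b := C.eB.surjective b
    refine (lin_leftUnitIso (C.twist hΓ M) (ofB C.hopf (C.eB b)) m).trans ?_
    refine (C.toTwistedEnv.left_eB b m).trans ((Γ.leftUnit_sharp₀ b m).symm.trans ?_)
    refine Eq.symm ((congrArg (lin (C.mu hΓ (unit H) M ≫ C.twistMap hΓ M.leftUnitIso.hom))
      ((lin_tensorHom_ten _ _ (C.epsilon hΓ) (𝟙 (C.twist hΓ M)) _ m).trans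
        (congrArg (fun z => (C.twist hΓ (unit H)).ten (C.twist hΓ M) z m)
          (C.lin_epsilon hΓ b)))).trans ?_)
    exact congrArg M.leftUnit (C.lin_mu hΓ (ofB H b) m)

theorem epsilon_mu_right :
    (C.twist hΓ M).rightUnitIso.hom = tensorHom (𝟙 (C.twist hΓ M)) (C.epsilon hΓ)
      ≫ C.mu hΓ M (unit H) ≫ C.twistMap hΓ M.rightUnitIso.hom :=
  hom_ten_ext (N := unit C.hopf) fun m b => by
    obtain ⟨b, rfl⟩ : ∃ a, ofB C.hopf (C.eB a) = b := C.eB.surjective b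
    refine (lin_rightUnitIso (C.twist hΓ M) m (ofB C.hopf (C.eB b))).trans ?_
    refine (C.toTwistedEnv.right_eB b m).trans ((Γ.rightUnit_sharp₀ b m).symm.trans ?_)
    refine Eq.symm ((congrArg (lin (C.mu hΓ M (unit H) ≫ C.twistMap hΓ M.rightUnitIso.hom))
      ((lin_tensorHom_ten _ _ (𝟙 (C.twist hΓ M)) (C.epsilon hΓ) m _).trans
        (congrArg ((C.twist hΓ M).ten (C.twist hΓ (unit H)) m)
          (C.lin_epsilon hΓ b)))).trans ?_)
    exact congrArg M.rightUnit (C.lin_mu hΓ m (ofB H b))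

/-- The monoidal structure of the twisting functor. -/
noncomputable def coreMonoidal : (C.twistFunctor hΓ).CoreMonoidal where
  εIso := isoOfBijective (C.epsilon hΓ) (C.epsilon_bijective hΓ)
  μIso M N := isoOfBijective (C.mu hΓ M N) (C.muLin_bijective hΓ)
  μIso_hom_natural_left f N := C.mu_natural hΓ f (𝟙 N)
  μIso_hom_natural_right N f := C.mu_natural hΓ (𝟙 N) f
  associativity _ _ _ := C.mu_assoc hΓ
  left_unitality _ := C.epsilon_mu_left hΓ
  right_unitality _ := C.epsilon_mu_right hΓ

end Cotwist

end LeftCocycle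

end LeftBialgebroid

namespace LeftBialgebroid

variable {k : Type v} {B L : Type u} [CommRing k] [Ring B] [Algebra k B] [Ring L] [Algebra k L]
  {H : LeftBialgebroid k B L}

open Comodule

namespace Comodule

/-! ### Equalizers of comodules -/

section Retract

variable (P : H.Comodule) {I : Type u} [AddCommGroup I] [Module k I]
  (l : B →ₐ[k] Module.End k I) (r : Bᵐᵒᵖ →ₐ[k] Module.End k I)
  (j : I →ₗ[k] P.carrier) (hjl : ∀ b x, j (l b x) = P.left b (j x))
  (hjr : ∀ b x, j (r b x) = P.right b (j x))
  (p : P.carrier →ₗ[k] I) (hp : ∀ b y, p (P.left b y) = l b (p y))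

/-- The coaction `(id ⋄ p) ∘ δ ∘ j` on a retract. -/
def retractCoact : I →ₗ[k] H.Diam l := H.diamMap p hp ∘ₗ P.coact ∘ₗ j

variable (hpj : ∀ x, p (j x) = x)
  (hc : ∀ x, H.diamMap j hjl (P.retractCoact l j p hp x) = P.coact (j x))

variable {P l j p} in
theorem diamMap_retract_injective (hjl : ∀ b x, j (l b x) = P.left b (j x))
    (hp : ∀ b y, p (P.left b y) = l b (p y)) (hpj : ∀ x, p (j x) = x) :
    Function.Injective (H.diamMap j hjl) :=
  Function.LeftInverse.injective (g := H.diamMap p hp) (fun u => H.diamMap_leftInverse hpj u)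

/-- The comodule structure on a sub-bimodule `j : I → P` that has a left `B`-linear projection
`p : P → I`, provided that `(id ⋄ j p) ∘ δ = δ` on `I`. -/
abbrev retract : H.Comodule where
  carrier := I
  left := l
  right := r
  right_left a b x := Function.LeftInverse.injective hpj (by rw [hjr, hjl, hjl, hjr, P.right_left])
  coact := P.retractCoact l j p hp
  coact_left b x := diamMap_retract_injective hjl hp hpj (by
    rw [H.diamMap_diamSL, hc, hc, hjl, P.coact_left])
  coact_right b x := diamMap_retract_injective hjl hp hpj (by
    rw [H.diamMap_diamSR, hc, hc, hjr, P.coact_right])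
  coact_takeuchi b x := diamMap_retract_injective hjl hp hpj (by
    rw [H.diamMap_diamTR, hc, P.coact_takeuchi, ← hc]
    exact H.diamMap_comm (fun x => (hjr (op b) x).symm) _)
  coassoc x := by
    refine diamMap_retract_injective (j := H.diamMap j hjl) (p := H.diamMap p hp)
      (P := cofree H P.left) (l := (cofree H l).left) (H.diamMap_diamSL j hjl)
      (H.diamMap_diamSL p hp) (fun u => H.diamMap_leftInverse hpj u) ?_
    refine Eq.trans ?_ (H.comulDiam_diamMap H.comul H.comul_target j hjl _)
    rw [hc, ← P.coassoc, ← hc]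
    exact H.diamMap_comm hc _
  counit_coact x := Function.LeftInverse.injective hpj (by
    rw [← H.counitDiam_diamMap H.counit H.counit_target j hjl, hc, P.counit_coact])

theorem isMor_retract : IsMor (P.retract l r j hjl hjr p hp hpj hc) P j :=
  IsMor.mk hjl (fun b => hjr (op b)) (fun x => (hc x).symm)

end Retract

section Equalizer

variable {P Q : H.Comodule} {f₀ f₁ : P.carrier →ₗ[k] Q.carrier}

/-- The restriction to a stable submodule of an action of an algebra. -/
def restrictAction {A V : Type*} [Ring A] [Algebra k A] [AddCommGroup V] [Module k V]
    (l : A →ₐ[k] Module.End k V) (S : Submodule k V) (h : ∀ a, ∀ v ∈ S, l a v ∈ S) :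
    A →ₐ[k] Module.End k S :=
  AlgHom.ofLinearMap
    { toFun := fun a => (l a).restrict (h a)
      map_add' := fun a b => LinearMap.ext fun x => Subtype.ext (by simp)
      map_smul' := fun c b => LinearMap.ext fun x => Subtype.ext (by simp) }
    (LinearMap.ext fun x => Subtype.ext (by simp))
    (fun a b => LinearMap.ext fun x => Subtype.ext (by simp))

/-- If `ρ` is a retraction of `f₀` and `j ∘ p = ρ ∘ f₁`, then the coaction of `P` is determined on
the equalizer of `f₀` and `f₁` by its composite with `p`. -/
theorem equalizer_coact (h₀ : IsMor P Q f₀) (h₁ : IsMor P Q f₁) {I : Type u} [AddCommGroup I]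
    [Module k I] (l : B →ₐ[k] Module.End k I) (j : I →ₗ[k] P.carrier)
    (hjl : ∀ b x, j (l b x) = P.left b (j x)) (p : P.carrier →ₗ[k] I)
    (hp : ∀ b y, p (P.left b y) = l b (p y))
    (ρ : Q.carrier →ₗ[k] P.carrier) (hρ : ∀ b q, ρ (Q.left b q) = P.left b (ρ q))
    (hρ₀ : ∀ p, ρ (f₀ p) = p) (hjp : ∀ y, j (p y) = ρ (f₁ y)) (x : I)
    (hx : f₀ (j x) = f₁ (j x)) :
    H.diamMap j hjl (P.retractCoact l j p hp x) = P.coact (j x) := by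
  refine (H.diamMap_comm (h := hp) (h' := hjl) (i := h₁.left) (i' := hρ) hjp
    (P.coact (j x))).trans ?_
  rw [← h₁.coact, ← hx, h₀.coact]
  exact H.diamMap_leftInverse hρ₀ _

/-- The equalizer of two morphisms `f₀, f₁ : P → Q` is a comodule if it is split as a left
`B`-module, by a retraction `ρ` of `f₀` such that `f₀ ∘ ρ ∘ f₁ = f₁ ∘ ρ ∘ f₁`. -/
theorem exists_equalizer (h₀ : IsMor P Q f₀) (h₁ : IsMor P Q f₁)
    (ρ : Q.carrier →ₗ[k] P.carrier) (hρ : ∀ b q, ρ (Q.left b q) = P.left b (ρ q))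
    (hρ₀ : ∀ p, ρ (f₀ p) = p) (hρ₁ : ∀ p, f₀ (ρ (f₁ p)) = f₁ (ρ (f₁ p))) :
    ∃ (I : H.Comodule) (j : I ⟶ P), Function.Injective (lin j) ∧
      (∀ x, f₀ (lin j x) = f₁ (lin j x)) ∧
      ∀ p, f₀ p = f₁ p → ∃ x, lin j x = p := by
  obtain ⟨S, hS⟩ : ∃ S : Submodule k P.carrier, ∀ p, p ∈ S ↔ f₀ p = f₁ p :=
    ⟨LinearMap.eqLocus f₀ f₁, fun p => Iff.rfl⟩
  have hl : ∀ b, ∀ p ∈ S, P.left b p ∈ S := fun b p hp => by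
    rw [hS] at hp ⊢; rw [h₀.left, h₁.left, hp]
  have hr : ∀ b, ∀ p ∈ S, P.right b p ∈ S := fun b p hp => by
    rw [hS] at hp ⊢; rw [h₀.right, h₁.right, hp]
  let r : P.carrier →ₗ[k] S := (ρ ∘ₗ f₁).codRestrict S (fun p => (hS _).2 (hρ₁ p))
  have hrl : ∀ b p, r (P.left b p) = restrictAction P.left S hl b (r p) := fun b p => Subtype.ext
    ((congrArg ρ (h₁.left b p)).trans (hρ b _))
  have hrs : ∀ x : S, r (S.subtype x) = x := fun x => Subtype.ext
    ((congrArg ρ ((hS x).1 x.2).symm).trans (hρ₀ x))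
  have hc := fun x : S => equalizer_coact h₀ h₁ (restrictAction P.left S hl) S.subtype
    (fun _ _ => rfl) r hrl ρ hρ hρ₀ (fun _ => rfl) x ((hS x).1 x.2)
  obtain ⟨j, hj⟩ := P.isMor_retract (restrictAction P.left S hl) (restrictAction P.right S hr)
    S.subtype (fun _ _ => rfl) (fun _ _ => rfl) r hrl hrs hc
  refine ⟨_, j, ?_, fun x => ?_, fun p hp => ⟨⟨p, (hS p).2 hp⟩, ?_⟩⟩
  · rw [hj]; exact Subtype.val_injective
  · rw [hj]; exact (hS _).1 x.2
  · rw [hj]; rfl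

end Equalizer

section BTensor

variable (P : H.Comodule) {S : Type*} {V W : Type u} [AddCommGroup V] [Module k V]
  [AddCommGroup W] [Module k W] (f : S → Module.End k P.carrier) (hf : ∀ c, IsMor P P (f c))
  (l : S → Module.End k V) (l' : S → Module.End k W)

/-- The functoriality of `P ⊗_S V` in `V`. -/
theorem isMor_btMap (φ : V →ₗ[k] W) (h : ∀ c v, φ (l c v) = l' c (φ v)) :
    IsMor (P.btensor f hf l) (P.btensor f hf l')
      (BalTensor.map (f := f) (g := l) (f' := f) (g' := l') LinearMap.id φ (fun _ _ => rfl) h) :=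
  P.btensor_cover f hf l _ fun v => (P.isMor_btIncl f hf l' (φ v)).of_eq fun p =>
    (BalTensor.map_tmul (f := f) (g := l) (f' := f) (g' := l') LinearMap.id φ (fun _ _ => rfl) h
      p v).symm

end BTensor

end Comodule

namespace LeftCocycle

variable {Γ : H.LeftCocycle} {hH : H.IsLeftHopf} {M N : H.Comodule}

theorem TwistedEnv.sh_proj {B' L' : Type u} [Ring B'] [Algebra k B'] [Ring L'] [Algebra k L']
    (T : Γ.TwistedEnv hH B' L') (w : L ⊗[k] M.carrier) :
    T.sh M (BalTensor.proj T.env.tL (T.left M)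
      (TensorProduct.map T.eL.toLinearMap (LinearEquiv.refl k M.carrier).toLinearMap w))
      = Γ.sharpDiam hH M w := by
  induction w using TensorProduct.induction_on with
  | zero => simp only [map_zero]
  | tmul X m =>
    rw [TensorProduct.map_tmul, BalTensor.proj_tmul]
    exact (T.sh_dmul X m).trans (Γ.sharpDiam_tmul hH X m).symm
  | add x y hx hy => simp only [map_add, hx, hy]

namespace Cotwist

variable (C : Γ.Cotwist hH) (hΓ : Γ.IsInvertible)

/-! ### The twisting functor is full -/

/-- A morphism `φ` between twists is colinear: `δ ∘ φ = Γ^# ∘ (id ⋄ φ) ∘ δ^Γ` is a composite of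
colinear maps, and `δ` is an embedding with a left `B`-linear retraction. -/
theorem isMor_of_twist (f : C.twist hΓ M ⟶ C.twist hΓ N) :
    IsMor M N (lin (H := C.hopf) (M := C.twist hΓ M) (N := C.twist hΓ N) f) := by
  let φ : M.carrier →ₗ[k] N.carrier := lin (H := C.hopf) (M := C.twist hΓ M) (N := C.twist hΓ N) f
  have hfl : ∀ b m, φ (C.toTwistedEnv.left M b m) = C.toTwistedEnv.left N b (φ m) :=
    lin_left (H := C.hopf) (M := C.twist hΓ M) (N := C.twist hΓ N) f
  have hφ : ∀ b m, φ (Γ.twL M b m) = Γ.twL N b (φ m) := fun b m =>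
    (congrArg φ (C.toTwistedEnv.left_eB b m).symm).trans
      ((hfl (C.eB b) m).trans (C.toTwistedEnv.left_eB b (φ m)))
  let ψ : (Γ.twCofree hH M).carrier →ₗ[k] (Γ.twCofree hH N).carrier :=
    BalTensor.map (f := Γ.twR (dual hH)) (g := Γ.twL M) (f' := Γ.twR (dual hH)) (g' := Γ.twL N)
      LinearMap.id φ (fun _ _ => rfl) hφ
  have hψ : IsMor (Γ.twCofree hH M) (Γ.twCofree hH N) ψ :=
    (regular H).isMor_btMap _ _ _ _ φ hφ
  have h1 : ∀ x, C.hopf.diamMap φ hfl (C.toTwistedEnv.toDiam M x)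
      = C.toTwistedEnv.toDiam N (ψ x) := fun x => by
    induction x using gmul_ind with
    | gmul X m =>
      refine (congrArg (C.hopf.diamMap φ _) (C.toTwistedEnv.toDiam_gmul X m)).trans ?_
      refine (C.hopf.diamMap_dmul φ _ (C.eL X) m).trans ?_
      refine Eq.trans (C.toTwistedEnv.toDiam_gmul X (φ m)).symm ?_
      exact congrArg (C.toTwistedEnv.toDiam N) (BalTensor.map_tmul (f := Γ.twR (dual hH))
        (g := Γ.twL M) (f' := Γ.twR (dual hH)) (g' := Γ.twL N) LinearMap.id φ (fun _ _ => rfl) hφ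
        X m).symm
    | add x y hx hy => simp only [map_add, hx, hy]
  refine (isMor_coact N).of_comp (H.counitDiam H.counit H.counit_target N.left)
    (H.counitDiam_diamSL H.counit H.counit_source H.counit_target N.left) N.counit_coact ?_
  refine IsMor.of_eq (((Γ.isMor_sharpCofree hH (M := N)).comp hψ).comp (isMor_twCoact Γ hH hΓ M))
    fun m => ?_
  refine (C.toTwistedEnv.sh_toDiam _).symm.trans ?_
  refine Eq.trans ?_ (C.toTwistedEnv.sh_coact hΓ (φ m))
  refine congrArg (C.toTwistedEnv.sh N) ?_
  exact (h1 _).symm.trans (lin_coact (H := C.hopf) (M := C.twist hΓ M) (N := C.twist hΓ N) f m).symm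

instance : (C.twistFunctor hΓ).Full where
  map_surjective f := by
    obtain ⟨g, hg⟩ := C.isMor_of_twist hΓ f
    exact ⟨g, hom_ext fun m => LinearMap.congr_fun hg m⟩

end Cotwist

end LeftCocycle

end LeftBialgebroid

namespace LeftBialgebroid

variable {k : Type v} {B L : Type u} [CommRing k] [Ring B] [Algebra k B] [Ring L] [Algebra k L]
  {H : LeftBialgebroid k B L}

open Comodule

namespace LeftCocycle

section SharpCounit

variable (Γ : H.LeftCocycle) (hH : H.IsLeftHopf) {M N : H.Comodule}

/-! ### The twisting functor is essentially surjective -/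

/-- The map `(ε ⋄ id) ∘ Γ^# : L^Γ ⋄_{B^Γ} M → M`. It is a retraction of the twisted coaction that is
linear for the untwisted left action of `B`. -/
noncomputable def sharpCounit (M : H.Comodule) : (Γ.twCofree hH M).carrier →ₗ[k] M.carrier :=
  H.counitDiam H.counit H.counit_target M.left ∘ₗ Γ.sharpCofree hH M

theorem sharpCounit_left (b : B) (x : (Γ.twCofree hH M).carrier) :
    Γ.sharpCounit hH M ((Γ.twCofree hH M).left b x) = M.left b (Γ.sharpCounit hH M x) :=
  (congrArg (H.counitDiam H.counit H.counit_target M.left)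
    ((Γ.isMor_sharpCofree hH (M := M)).left b x)).trans
    (H.counitDiam_diamSL H.counit H.counit_source H.counit_target M.left b _)

theorem sharpCounit_twCoact (hΓ : Γ.IsInvertible) (m : M.carrier) :
    Γ.sharpCounit hH M (Γ.twCoact hH hΓ M m) = m :=
  (congrArg (H.counitDiam H.counit H.counit_target M.left)
    (Γ.sharpCofree_twCoact hH hΓ m)).trans (M.counit_coact m)

theorem sharpCounit_natural {φ : M.carrier →ₗ[k] N.carrier} (hφ : IsMor M N φ) (X : L)
    (m : M.carrier) :
    φ (Γ.sharpCounit hH M (Γ.gmul hH M X m)) = Γ.sharpCounit hH N (Γ.gmul hH N X (φ m)) := by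
  rw [sharpCounit, sharpCounit, LinearMap.comp_apply, LinearMap.comp_apply, sharpCofree_gmul,
    sharpCofree_gmul]
  refine (H.counitDiam_diamMap H.counit H.counit_target φ hφ.left _).symm.trans ?_
  exact congrArg (H.counitDiam H.counit H.counit_target N.left) (Γ.diamMap_sharp₀ hH hφ X m)

end SharpCounit

variable {Γ : H.LeftCocycle} {hH : H.IsLeftHopf}

namespace TwistedEnv

variable {B' L' : Type u} [Ring B'] [Algebra k B'] [Ring L'] [Algebra k L']
  (T : Γ.TwistedEnv hH B' L') {V : Type u} [AddCommGroup V] [Module k V]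
  (l : B' →ₐ[k] Module.End k V)

/-- The `L`-comodule `L^Γ ⋄_{B^Γ} V`, for a left `B^Γ`-module `V`; the coaction is that of the
regular comodule. -/
noncomputable abbrev induced : H.Comodule :=
  (regular H).btensor (Γ.twR (dual hH)) (Γ.isMor_twR_dual hH) (fun b => l (T.eB b))

/-- `X ⋄ v`, as an element of `induced`. -/
noncomputable def imul : L →ₗ[k] V →ₗ[k] (T.induced l).carrier :=
  BalTensor.tmul (Γ.twR (dual hH)) (fun b => l (T.eB b))

theorem isMor_imul (v : V) : IsMor (regular H) (T.induced l) ((T.imul l).flip v) :=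
  isMor_btIncl _ _ _ _ v

variable {l} in
theorem imul_ind {p : (T.induced l).carrier → Prop} (imul : ∀ X v, p (T.imul l X v))
    (add : ∀ x y, p x → p y → p (x + y)) (x : (T.induced l).carrier) : p x :=
  BalTensor.ind imul add x

theorem imul_eL (b : B') (x : L') (v : V) :
    (T.imul l ∘ₗ T.eL.symm.toLinearMap) (T.env.tL b x) v
      = (T.imul l ∘ₗ T.eL.symm.toLinearMap) x (l b v) := by
  obtain ⟨b, rfl⟩ := T.eB.surjective b
  obtain ⟨X, rfl⟩ := T.eL.surjective x
  rw [EnvRing.tL_apply, t_mul_eL]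
  simp only [LinearMap.comp_apply, LinearEquiv.coe_coe, LinearEquiv.symm_apply_apply]
  exact BalTensor.tmul_bal (Γ.twR (dual hH)) (fun b => l (T.eB b)) b X v

/-- The identification of `L^Γ ⋄_{B^Γ} V` with the underlying module of `induced`. -/
noncomputable def ofDiam : T.env.Diam l →ₗ[k] (T.induced l).carrier :=
  BalTensor.lift (f := T.env.tL) (g := l) (T.imul l ∘ₗ T.eL.symm.toLinearMap) (T.imul_eL l)

theorem ofDiam_dmul (X : L) (v : V) : T.ofDiam l (T.env.dmul l (T.eL X) v) = T.imul l X v :=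
  (BalTensor.lift_tmul (f := T.env.tL) (g := l) (T.imul l ∘ₗ T.eL.symm.toLinearMap)
    (T.imul_eL l) (T.eL X) v).trans (by
      simp only [LinearMap.comp_apply, LinearEquiv.coe_coe, LinearEquiv.symm_apply_apply])

theorem left_imul (b : B) (X : L) (v : V) : T.left (T.induced l) (T.eB b) (T.imul l X v)
    = T.imul l (Γ.twL (regular H) b X) v :=
  (T.left_eB b _).trans (Γ.twL_natural (T.isMor_imul l v) b X).symm

theorem right_imul (b : B) (X : L) (v : V) : T.right (T.induced l) (op (T.eB b)) (T.imul l X v)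
    = T.imul l (Γ.twR (regular H) b X) v :=
  (T.right_eB b _).trans (Γ.twR_natural (T.isMor_imul l v) b X).symm

theorem ofDiam_diamSL (b : B') (w : T.env.Diam l) :
    T.ofDiam l (T.env.diamSL l b w) = T.left (T.induced l) b (T.ofDiam l w) := by
  obtain ⟨b, rfl⟩ := T.eB.surjective b
  induction w using T.diam_ind with
  | dmul X v => rw [EnvRing.diamSL_dmul, s_mul_eL, ofDiam_dmul, ofDiam_dmul, left_imul]
  | add x y hx hy => simp only [map_add, hx, hy]

theorem ofDiam_diamSR (b : B') (w : T.env.Diam l) :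
    T.ofDiam l (T.env.diamSR l b w) = T.right (T.induced l) (op b) (T.ofDiam l w) := by
  obtain ⟨b, rfl⟩ := T.eB.surjective b
  induction w using T.diam_ind with
  | dmul X v => rw [EnvRing.diamSR_dmul, eL_mul_s, ofDiam_dmul, ofDiam_dmul, right_imul]
  | add x y hx hy => simp only [map_add, hx, hy]

/-- The twisted coaction of `L^Γ ⋄_{B^Γ} V` is `Δ^Γ ⋄ id`. -/
theorem coact_ofDiam (hΓ : Γ.IsInvertible) (w : T.env.Diam l) :
    T.coact hΓ (T.induced l) (T.ofDiam l w)
      = T.env.diamMap (T.ofDiam l) (T.ofDiam_diamSL l)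
        (T.env.comulDiam (T.comul hΓ) (T.comul_target hΓ) l w) := by
  induction w using T.diam_ind with
  | dmul X v =>
    rw [ofDiam_dmul, EnvRing.comulDiam_dmul, comul_eL]
    refine (T.coact_natural hΓ (T.isMor_imul l v) X).trans ?_
    generalize T.coact hΓ (regular H) X = u
    induction u using T.diam_ind with
    | dmul Y Z =>
      rw [EnvRing.diamMap_dmul, EnvRing.diamMap_dmul, EnvRing.diamInsert_dmul,
        EnvRing.diamMap_dmul]
      exact congrArg (T.env.dmul (T.left (T.induced l)) (T.eL Y)) (T.ofDiam_dmul l Z v).symm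
    | add x y hx hy => simp only [map_add, hx, hy]
  | add x y hx hy => simp only [map_add, hx, hy]

theorem inducedCounit_bal (b : B) (X : L) (v : V) :
    (l.toLinearMap ∘ₗ T.eB.toLinearMap ∘ₗ Γ.twCounit hH) (Γ.twR (dual hH) b X) v
      = (l.toLinearMap ∘ₗ T.eB.toLinearMap ∘ₗ Γ.twCounit hH) X (l (T.eB b) v) := by
  simp only [LinearMap.comp_apply, LinearEquiv.coe_coe, AlgHom.toLinearMap_apply]
  rw [twCounit_twR_dual, ← eB_mul, map_mul]; rfl

/-- `X ⋄ v ↦ ε^Γ(X) v`. -/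
noncomputable def inducedCounit : (T.induced l).carrier →ₗ[k] V :=
  BalTensor.lift (f := Γ.twR (dual hH)) (g := fun b => l (T.eB b))
    (l.toLinearMap ∘ₗ T.eB.toLinearMap ∘ₗ Γ.twCounit hH) (T.inducedCounit_bal l)

theorem inducedCounit_imul (X : L) (v : V) :
    T.inducedCounit l (T.imul l X v) = l (T.eB (Γ.twCounit hH X)) v :=
  BalTensor.lift_tmul (f := Γ.twR (dual hH)) (g := fun b => l (T.eB b))
    (l.toLinearMap ∘ₗ T.eB.toLinearMap ∘ₗ Γ.twCounit hH) (T.inducedCounit_bal l) X v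

theorem inducedCounit_left (b : B') (x : (T.induced l).carrier) :
    T.inducedCounit l (T.left (T.induced l) b x) = l b (T.inducedCounit l x) := by
  obtain ⟨b, rfl⟩ := T.eB.surjective b
  induction x using T.imul_ind with
  | imul X v =>
    rw [left_imul, inducedCounit_imul, inducedCounit_imul, twCounit_twL, ← eB_mul, map_mul]; rfl
  | add x y hx hy => simp only [map_add, hx, hy]

theorem inducedCounit_ofDiam (w : T.env.Diam l) :
    T.inducedCounit l (T.ofDiam l w) = T.env.counitDiam T.counit T.counit_target l w := by
  induction w using T.diam_ind with
  | dmul X v => rw [ofDiam_dmul, inducedCounit_imul, EnvRing.counitDiam_dmul, counit_eL]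
  | add x y hx hy => simp only [map_add, hx, hy]

theorem toDiam_injective (hΓ : Γ.IsInvertible) (M : H.Comodule) :
    Function.Injective (T.toDiam M) := fun x y h => by
  refine (Γ.sharpCofree_bijective hH hΓ M).1 ?_
  rw [← T.sh_toDiam, ← T.sh_toDiam, h]

end TwistedEnv

namespace Cotwist

variable (C : Γ.Cotwist hH) (hΓ : Γ.IsInvertible) (V : C.hopf.Comodule)

/-- The coaction of a comodule over the cotwist, with values in the induced `L`-comodule. -/
noncomputable def incl : V.carrier →ₗ[k] (C.toTwistedEnv.induced V.left).carrier :=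
  C.toTwistedEnv.ofDiam V.left ∘ₗ V.coact

variable {V}

theorem incl_left (b : C.B') (v : V.carrier) : C.incl V (V.left b v)
    = C.toTwistedEnv.left (C.toTwistedEnv.induced V.left) b (C.incl V v) :=
  (congrArg (C.toTwistedEnv.ofDiam V.left) (V.coact_left b v)).trans
    (C.toTwistedEnv.ofDiam_diamSL V.left b _)

theorem incl_right (b : C.B') (v : V.carrier) : C.incl V (V.right (op b) v)
    = C.toTwistedEnv.right (C.toTwistedEnv.induced V.left) (op b) (C.incl V v) :=
  (congrArg (C.toTwistedEnv.ofDiam V.left) (V.coact_right b v)).trans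
    (C.toTwistedEnv.ofDiam_diamSR V.left b _)

theorem coact_incl (v : V.carrier) :
    C.toTwistedEnv.coact hΓ (C.toTwistedEnv.induced V.left) (C.incl V v)
      = C.hopf.diamMap (C.incl V) C.incl_left (V.coact v) := by
  refine (C.toTwistedEnv.coact_ofDiam V.left hΓ (V.coact v)).trans ?_
  refine (congrArg (C.hopf.diamMap (C.toTwistedEnv.ofDiam V.left)
    (C.toTwistedEnv.ofDiam_diamSL V.left)) ((C.hopf.comulDiam_congr
      (C.toTwistedEnv.comul_target hΓ) C.hopf.comul_target (fun x => (C.comul_eq hΓ x).symm)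
        V.left (V.coact v)).trans (V.coassoc v).symm)).trans ?_
  exact C.hopf.diamMap_diamMap _ _ _ _ _ _ (fun _ => rfl) _

theorem inducedCounit_incl (v : V.carrier) :
    C.toTwistedEnv.inducedCounit V.left (C.incl V v) = v :=
  (C.toTwistedEnv.inducedCounit_ofDiam V.left (V.coact v)).trans
    ((C.hopf.counitDiam_congr C.toTwistedEnv.counit_target C.hopf.counit_target
      (fun x => (C.counit_eq x).symm) V.left _).trans (V.counit_coact v))

theorem incl_twL (b : B) (v : V.carrier) : C.incl V (V.left (C.eB b) v)
    = Γ.twL (C.toTwistedEnv.induced V.left) b (C.incl V v) :=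
  (C.incl_left (C.eB b) v).trans (C.toTwistedEnv.left_eB b _)

variable (V) in
/-- `X ⋄ v ↦ X ⋄ δ(v)`. -/
noncomputable def inclMap : (C.toTwistedEnv.induced V.left).carrier →ₗ[k]
    (Γ.twCofree hH (C.toTwistedEnv.induced V.left)).carrier :=
  BalTensor.map (f := Γ.twR (dual hH)) (g := fun b => V.left (C.eB b)) (f' := Γ.twR (dual hH))
    (g' := Γ.twL (C.toTwistedEnv.induced V.left)) LinearMap.id (C.incl V) (fun _ _ => rfl)
    C.incl_twL

theorem isMor_inclMap : IsMor (C.toTwistedEnv.induced V.left)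
    (Γ.twCofree hH (C.toTwistedEnv.induced V.left)) (C.inclMap V) :=
  (regular H).isMor_btMap (Γ.twR (dual hH)) (Γ.isMor_twR_dual hH) (fun b => V.left (C.eB b))
    (Γ.twL (C.toTwistedEnv.induced V.left)) (C.incl V) C.incl_twL

theorem inclMap_imul (X : L) (v : V.carrier) : C.inclMap V (C.toTwistedEnv.imul V.left X v)
    = Γ.gmul hH (C.toTwistedEnv.induced V.left) X (C.incl V v) :=
  BalTensor.map_tmul (f := Γ.twR (dual hH)) (g := fun b => V.left (C.eB b))
    (f' := Γ.twR (dual hH)) (g' := Γ.twL (C.toTwistedEnv.induced V.left)) LinearMap.id (C.incl V)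
    (fun _ _ => rfl) C.incl_twL X v

theorem toDiam_inclMap (w : C.hopf.Diam V.left) :
    C.toTwistedEnv.toDiam (C.toTwistedEnv.induced V.left)
        (C.inclMap V (C.toTwistedEnv.ofDiam V.left w))
      = C.hopf.diamMap (C.incl V) C.incl_left w := by
  induction w using C.toTwistedEnv.diam_ind with
  | dmul X v =>
    refine (congrArg (fun z => C.toTwistedEnv.toDiam (C.toTwistedEnv.induced V.left)
      (C.inclMap V z)) (C.toTwistedEnv.ofDiam_dmul V.left X v)).trans ?_
    rw [inclMap_imul, TwistedEnv.toDiam_gmul]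
    exact (C.hopf.diamMap_dmul (C.incl V) C.incl_left (C.eL X) v).symm
  | add x y hx hy => simp only [map_add, hx, hy]

/-- The twisted coaction of the induced comodule and `inclMap` agree on the image of `V`. -/
theorem twCoact_incl (v : V.carrier) :
    Γ.twCoact hH hΓ (C.toTwistedEnv.induced V.left) (C.incl V v) = C.inclMap V (C.incl V v) :=
  C.toTwistedEnv.toDiam_injective hΓ _ ((C.coact_incl hΓ v).trans
    (C.toDiam_inclMap (V.coact v)).symm)

theorem twCounitDiam_inclMap (x : (C.toTwistedEnv.induced V.left).carrier) :
    Γ.twCounitDiam hH (C.toTwistedEnv.induced V.left) (C.inclMap V x)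
      = C.incl V (C.toTwistedEnv.inducedCounit V.left x) := by
  induction x using C.toTwistedEnv.imul_ind with
  | imul X v =>
    rw [inclMap_imul, twCounitDiam_gmul, TwistedEnv.inducedCounit_imul, incl_twL]
  | add x y hx hy => simp only [map_add, hx, hy]

/-- Conversely, an element on which the two maps agree is in the image of `V`. -/
theorem eq_incl {x : (C.toTwistedEnv.induced V.left).carrier}
    (hx : Γ.twCoact hH hΓ (C.toTwistedEnv.induced V.left) x = C.inclMap V x) :
    C.incl V (C.toTwistedEnv.inducedCounit V.left x) = x := by
  rw [← twCounitDiam_inclMap, ← hx, twCounitDiam_twCoact]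

/-- The condition for `sharpCounit` to split the pair formed by the twisted coaction and `inclMap`;
by naturality it reduces to `twCoact_incl`. -/
theorem sharpCounit_inclMap (x : (C.toTwistedEnv.induced V.left).carrier) :
    Γ.twCoact hH hΓ (C.toTwistedEnv.induced V.left)
        (Γ.sharpCounit hH (C.toTwistedEnv.induced V.left) (C.inclMap V x))
      = C.inclMap V (Γ.sharpCounit hH (C.toTwistedEnv.induced V.left) (C.inclMap V x)) := by
  induction x using C.toTwistedEnv.imul_ind with
  | imul X v =>
    rw [inclMap_imul, Γ.sharpCounit_natural hH (isMor_twCoact Γ hH hΓ _), twCoact_incl]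
    exact (Γ.sharpCounit_natural hH C.isMor_inclMap X (C.incl V v)).symm
  | add x y hx hy => simp only [map_add, hx, hy]

/-- The comodule `V` is isomorphic to the twist of the equalizer of the twisted coaction of the
induced comodule and `inclMap`. The isomorphism is the restriction of `ε^Γ ⋄ id`. -/
theorem exists_iso (V : C.hopf.Comodule) : ∃ M : H.Comodule, Nonempty (C.twist hΓ M ≅ V) := by
  let P := C.toTwistedEnv.induced V.left
  obtain ⟨I, j, hj, hj₁, hj₂⟩ := exists_equalizer (isMor_twCoact Γ hH hΓ P) C.isMor_inclMap
    (Γ.sharpCounit hH P) (Γ.sharpCounit_left hH) (Γ.sharpCounit_twCoact hH hΓ)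
    (C.sharpCounit_inclMap hΓ)
  let ε : P.carrier →ₗ[k] V.carrier := C.toTwistedEnv.inducedCounit V.left
  have hε : ∀ v, ε (C.incl V v) = v := C.inducedCounit_incl
  have hεj : ∀ x, C.incl V (ε (lin j x)) = lin j x := fun x => C.eq_incl hΓ (hj₁ x)
  have inj : Function.Injective (C.incl V) := Function.LeftInverse.injective hε
  have hl : ∀ b x, (ε ∘ₗ lin j) (C.toTwistedEnv.left I b x) = V.left b ((ε ∘ₗ lin j) x) :=
    fun b x => (congrArg ε (C.toTwistedEnv.left_natural (isMor_lin j) b x)).trans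
      (C.toTwistedEnv.inducedCounit_left V.left b _)
  have hr : ∀ b x, (ε ∘ₗ lin j) (C.toTwistedEnv.right I (op b) x)
      = V.right (op b) ((ε ∘ₗ lin j) x) := fun b x => inj <| by
    refine (hεj _).trans ((C.toTwistedEnv.right_natural (isMor_lin j) (op b) x).trans ?_)
    refine Eq.trans ?_ (C.incl_right b _).symm
    exact congrArg (C.toTwistedEnv.right P (op b)) (hεj x).symm
  have hc : ∀ x, V.coact ((ε ∘ₗ lin j) x)
      = C.hopf.diamMap (ε ∘ₗ lin j) hl (C.toTwistedEnv.coact hΓ I x) := fun x => by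
    refine Function.LeftInverse.injective (f := C.hopf.diamMap (C.incl V) C.incl_left)
      (g := C.hopf.diamMap ε (C.toTwistedEnv.inducedCounit_left V.left))
      (fun u => C.hopf.diamMap_leftInverse hε u) ?_
    refine (C.coact_incl hΓ _).symm.trans ?_
    refine (congrArg (C.toTwistedEnv.coact hΓ P) (hεj x)).trans ?_
    refine (C.toTwistedEnv.coact_natural hΓ (isMor_lin j) x).trans ?_
    exact (C.hopf.diamMap_diamMap (ε ∘ₗ lin j) hl (C.incl V) C.incl_left (lin j) _ hεj _).symm
  let f : C.twist hΓ I ⟶ V :=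
    (⟨ε ∘ₗ lin j, hl, fun b => hr (unop b), hc⟩ : Hom (C.twist hΓ I) V)
  refine ⟨I, ⟨isoOfBijective f ⟨fun x y h => hj ?_, fun v => ?_⟩⟩⟩
  · have h' : ε (lin j x) = ε (lin j y) := h
    rw [← hεj x, ← hεj y, h']
  · obtain ⟨x, hx⟩ := hj₂ (C.incl V v) (C.twCoact_incl hΓ v)
    exact ⟨x, (congrArg ε hx).trans (hε v)⟩

instance : (C.twistFunctor hΓ).EssSurj where
  mem_essImage V := C.exists_iso hΓ V

theorem isEquivalence_twistFunctor : (C.twistFunctor hΓ).IsEquivalence where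

end Cotwist

end LeftCocycle

end LeftBialgebroid

theorem mainTheorem4 {k : Type v} [Field k] {B L : Type u} [Ring B] [Algebra k B] [Ring L]
    [Algebra k L] (H : LeftBialgebroid k B L) (hH : H.IsLeftHopf) (Γ : H.LeftCocycle)
    (hΓ : Γ.IsInvertible) :
    Nonempty (Γ.Cotwist hH) ∧
    ∀ T : Γ.Cotwist hH,
      ∃ (F : H.Comodule ⥤ T.hopf.Comodule) (_ : F.Monoidal)
        (φ : ∀ M : H.Comodule, M.carrier ≃ₗ[k] (F.obj M).carrier),
        F.IsEquivalence ∧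
        (∀ (M N : H.Comodule) (f : M ⟶ N) (m : M.carrier),
          LeftBialgebroid.Comodule.lin (F.map f) (φ M m)
            = φ N (LeftBialgebroid.Comodule.lin f m)) ∧
        (∀ (M : H.Comodule) (b : B) (m : M.carrier),
          (F.obj M).left (T.eB b) (φ M m) = φ M (Γ.twL M b m)) ∧
        (∀ (M : H.Comodule) (b : B) (m : M.carrier),
          (F.obj M).right (MulOpposite.op (T.eB b)) (φ M m) = φ M (Γ.twR M b m)) ∧
        (∀ (M : H.Comodule) (m : M.carrier) (w : L ⊗[k] M.carrier),
          BalTensor.proj T.hopf.tL (F.obj M).left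
              (TensorProduct.map T.eL.toLinearMap (φ M).toLinearMap w)
            = (F.obj M).coact (φ M m) →
          Γ.sharpDiam hH M w = M.coact m) ∧
        (∀ b : B,
          LeftBialgebroid.Comodule.lin (Functor.LaxMonoidal.ε F)
              (LeftBialgebroid.Comodule.ofB T.hopf (T.eB b))
            = φ (MonoidalCategoryStruct.tensorUnit H.Comodule) (LeftBialgebroid.Comodule.ofB H b)) ∧
        (∀ (M N : H.Comodule) (m : M.carrier) (n : N.carrier),
          LeftBialgebroid.Comodule.lin (Functor.LaxMonoidal.μ F M N)
              ((F.obj M).ten (F.obj N) (φ M m) (φ N n))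
            = φ (MonoidalCategory.tensorObj M N)
                (Γ.sharp M N (BalTensor.tmul (Γ.twR M) (Γ.twL N) m n))) := by
  refine ⟨LeftBialgebroid.LeftCocycle.nonempty_cotwist hΓ, fun C => ?_⟩
  let T := C.toTwistedEnv
  refine ⟨C.twistFunctor hΓ, (C.coreMonoidal hΓ).toMonoidal, fun M => LinearEquiv.refl k M.carrier,
    C.isEquivalence_twistFunctor hΓ, fun M N f m => rfl, fun M b m => C.toTwistedEnv.left_eB b m,
    fun M b m => C.toTwistedEnv.right_eB b m, fun M m w hw => ?_, fun b => C.lin_epsilon hΓ b,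
    fun M N m n => ?_⟩
  · refine (C.toTwistedEnv.sh_proj w).symm.trans
      ((congrArg (C.toTwistedEnv.sh M) hw).trans (C.toTwistedEnv.sh_coact hΓ m))
  · refine (C.lin_mu hΓ m n).trans ?_
    exact (BalTensor.lift_tmul (f := Γ.twR M) (g := Γ.twL N)
        (Γ.sharp₀ M N) (Γ.sharp₀_bal M N) m n).symm
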